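/- Lemma. Let $M$ be a smooth connected manifold (Hausdorff, second countable, without boundary) and let $S\subset M$ be a compact smooth hypersurface without boundary, with a collar neighbourhood $C=S\times[-\varepsilon,\varepsilon]\subseteq M$, $\varepsilon>0$; that is, $C$ is the image of a smooth embedding $S\times[-\varepsilon,\varepsilon]\to M$ restricting to the inclusion of $S$ on $S\times\{0\}$, and we identify $C$ with $S\times[-\varepsilon,\varepsilon]$. Let $\delta>0$, and suppose that a smooth family of Riemannian metrics $h_t$ on $M$ (smooth jointly in the point of $M$ and in $t$) is given for $t\in[-\delta,0]\cup[1,1+\delta]$. Let $V_0$ be the $h_0$-unit normal field to $S\times\{-\varepsilon\}$ pointing into $C$, and let $V_1$ be the $h_1$-unit normal field to $S\times\{\varepsilon\}$ pointing out of $C$. Then there exist a diffeomorphism $\Phi:S\times[0,1]\to C$ and an extension of $\{h_t\}$ to a smooth family of Riemannian metrics on $M$, $t\in[-\delta,1+\delta]$, such that 1. $\Phi(p,0)=(p,-\varepsilon)$ and $\Phi(p,1)=(p,\varepsilon)$ for every $p\in S$; 2. for every $p\in S$, the curve $\gamma_p(t)=(\Phi(p,t),t)$, $t\in[0,1]$,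 is a null pregeodesic of the Lorentzian metric $g=h_t-dt^2$; that is, $\gamma_p$ is smooth, $\gamma_p'\neq 0$, $g(\gamma_p',\gamma_p')=0$, and $\nabla_{\gamma_p'}\gamma_p'=f\,\gamma_p'$ for some function $f$ on $[0,1]$, where $\nabla$ is the Levi-Civita connection of $g$; 3. $\frac{d}{dt}\big|_{t=0}\Phi(p,t)=V_0(p)$ and $\frac{d}{dt}\big|_{t=1}\Phi(p,t)=V_1(p)$ for every $p\in S$. -/

import Mathlib

open Set Bundle Manifold
open scoped ContDiff

noncomputable section

namespace NullScattering

section PseudoRiemannian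

variable {E : Type*} [NormedAddCommGroup E] [NormedSpace ℝ E]
  {H : Type*} [TopologicalSpace H] (I : ModelWithCorners ℝ E H)
  {X : Type*} [TopologicalSpace X] [ChartedSpace H X]

/-- The coefficients, at the coordinate point `y`, of the bilinear form field `g` in the preferred
chart around `x₀`: the value of `g` on the coordinate vector fields of `v` and `w`. -/
def chartForm (g : ∀ x : X, TangentSpace I x → TangentSpace I x → ℝ) (x₀ : X) (y v w : E) : ℝ :=
  g ((extChartAt I x₀).symm y)
    (mfderiv 𝓘(ℝ, E) I (extChartAt I x₀).symm y v)
    (mfderiv 𝓘(ℝ, E) I (extChartAt I x₀).symm y w)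

/-- `Γ` is the Christoffel vector `Γ(u, v)` (components `Γᵏᵢⱼ uⁱ vʲ`) of `g` at the point `y` of the
preferred chart around `x₀`. It is characterized by
`g(Γ(u, v), w) = (∂ᵤ g(v, w) + ∂ᵥ g(u, w) - ∂_w g(u, v)) / 2` for all coordinate vectors `w`;
when `g` is nondegenerate there is exactly one such vector. -/
def IsChristoffel (g : ∀ x : X, TangentSpace I x → TangentSpace I x → ℝ) (x₀ : X)
    (y u v Γ : E) : Prop :=
  ∀ w : E, chartForm I g x₀ y Γ w =
    (fderiv ℝ (fun z => chartForm I g x₀ z v w) y u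
      + fderiv ℝ (fun z => chartForm I g x₀ z u w) y v
      - fderiv ℝ (fun z => chartForm I g x₀ z u v) y w) / 2

/-- The velocity at time `t` of a curve defined on the set `s` of times (one-sided at an
endpoint), as a point of the tangent bundle. -/
def velocity (γ : ℝ → X) (s : Set ℝ) (t : ℝ) : TangentBundle I X :=
  ⟨γ t, mfderivWithin 𝓘(ℝ, ℝ) I γ s t (1 : ℝ)⟩

/-- `A` is the covariant acceleration `∇_{γ'} γ'` at time `t` of the curve `γ` on `s`, for the
Levi-Civita connection of `g`: in the preferred chart around `γ t` it is `u'' + Γ(u', u')`,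
where `u` is the coordinate expression of `γ`. -/
def IsCovariantAcceleration (g : ∀ x : X, TangentSpace I x → TangentSpace I x → ℝ)
    (γ : ℝ → X) (s : Set ℝ) (t : ℝ) (A : TangentSpace I (γ t)) : Prop :=
  let u : ℝ → E := fun r => extChartAt I (γ t) (γ r)
  ∃ Γ : E, IsChristoffel I g (γ t) (u t) (derivWithin u s t) (derivWithin u s t) Γ ∧
    A = derivWithin (derivWithin u s) s t + Γ

/-- `γ` is a pregeodesic of `g` on the interval `s`: a smooth regular curve with
`∇_{γ'} γ' = f γ'` for some function `f`; equivalently, a smooth regular curve that becomes a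
geodesic after a change of parameter (`f` is automatically smooth, because `γ'` does not vanish). -/
def IsPregeodesicOn (g : ∀ x : X, TangentSpace I x → TangentSpace I x → ℝ)
    (γ : ℝ → X) (s : Set ℝ) : Prop :=
  ContMDiffOn 𝓘(ℝ, ℝ) I ∞ γ s ∧
  (∀ t ∈ s, (velocity I γ s t).2 ≠ 0) ∧
  ∃ f : ℝ → ℝ, ∀ t ∈ s, IsCovariantAcceleration I g γ s t (f t • (velocity I γ s t).2)

/-- A pregeodesic whose velocity is everywhere a null vector. -/
def IsNullPregeodesicOn (g : ∀ x : X, TangentSpace I x → TangentSpace I x → ℝ)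
    (γ : ℝ → X) (s : Set ℝ) : Prop :=
  IsPregeodesicOn I g γ s ∧
  ∀ t ∈ s, g (γ t) (velocity I γ s t).2 (velocity I γ s t).2 = 0

end PseudoRiemannian

section Families

variable {n : ℕ} {M : Type*} [TopologicalSpace M] [ChartedSpace (EuclideanSpace ℝ (Fin n)) M]
  [IsManifold (𝓡 n) ∞ M]

/-- `h t`, for `t ∈ T`, is a family of Riemannian metrics on `M` that is smooth jointly in the
point and in `t`. The values `h t` for `t ∉ T` are irrelevant. -/
structure IsSmoothMetricFamily (T : Set ℝ)
    (h : ℝ → ∀ x : M, TangentSpace (𝓡 n) x →L[ℝ] TangentSpace (𝓡 n) x →L[ℝ] ℝ) : Prop where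
  symm : ∀ t ∈ T, ∀ (x : M) (v w : TangentSpace (𝓡 n) x), h t x v w = h t x w v
  pos : ∀ t ∈ T, ∀ (x : M) (v : TangentSpace (𝓡 n) x), v ≠ 0 → 0 < h t x v v
  smooth : ContMDiffOn ((𝓡 n).prod 𝓘(ℝ, ℝ))
    ((𝓡 n).prod 𝓘(ℝ, EuclideanSpace ℝ (Fin n) →L[ℝ] EuclideanSpace ℝ (Fin n) →L[ℝ] ℝ)) ∞
    (fun q : M × ℝ =>
      (TotalSpace.mk' (EuclideanSpace ℝ (Fin n) →L[ℝ] EuclideanSpace ℝ (Fin n) →L[ℝ] ℝ)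
        q.1 (h q.2 q.1) :
        TotalSpace (EuclideanSpace ℝ (Fin n) →L[ℝ] EuclideanSpace ℝ (Fin n) →L[ℝ] ℝ)
          (fun x : M => TangentSpace (𝓡 n) x →L[ℝ] TangentSpace (𝓡 n) x →L[ℝ] ℝ)))
    (univ ×ˢ T)

/-- The Lorentzian metric `h_t - dt²` on `M × ℝ`. -/
def lorentzForm (h : ℝ → ∀ x : M, TangentSpace (𝓡 n) x →L[ℝ] TangentSpace (𝓡 n) x →L[ℝ] ℝ)
    (q : M × ℝ) (v w : TangentSpace ((𝓡 n).prod 𝓘(ℝ, ℝ)) q) : ℝ :=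
  h q.2 q.1 v.1 w.1 - v.2 * w.2

end Families

section Collar

variable {d : ℕ} {M : Type*} [TopologicalSpace M] [ChartedSpace (EuclideanSpace ℝ (Fin (d + 1))) M]
  {S : Type*} [TopologicalSpace S] [ChartedSpace (EuclideanSpace ℝ (Fin d)) S]
  {a b : ℝ} [Fact (a < b)]

/-- `V` is the unit normal, for the Riemannian metric `h`, at the point `c (p, s)` to the slice
`S × {s}` of the cylinder `c : S × [a, b] → M`, on the side on which the `[a, b]`-coordinate
increases. For `s = a` this is the side pointing into the cylinder, for `s = b` the side
pointing out of it. -/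
def IsPositiveUnitNormal
    (h : ∀ x : M, TangentSpace (𝓡 (d + 1)) x →L[ℝ] TangentSpace (𝓡 (d + 1)) x →L[ℝ] ℝ)
    (c : S × Icc a b → M) (p : S) (s : Icc a b) (V : TangentSpace (𝓡 (d + 1)) (c (p, s))) :
    Prop :=
  h (c (p, s)) V V = 1 ∧
  (∀ w : TangentSpace (𝓡 d) p,
    h (c (p, s)) V (mfderiv (𝓡 d) (𝓡 (d + 1)) (fun p' : S => c (p', s)) p w) = 0) ∧
  ∃ ξ : TangentSpace ((𝓡 d).prod (𝓡∂ 1)) ((p, s) : S × Icc a b),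
    mfderiv ((𝓡 d).prod (𝓡∂ 1)) (𝓡 (d + 1)) c (p, s) ξ = V ∧
    (0 : ℝ) < mfderiv ((𝓡 d).prod (𝓡∂ 1)) 𝓘(ℝ, ℝ)
      (fun q : S × Icc a b => (q.2 : ℝ)) (p, s) ξ

/-- The curve `t ↦ Φ(p, t)` in `M`, for a map `Φ` from `S × [0, 1]` to the cylinder
`c : S × [a, b] → M`; outside `[0, 1]` it is continued by constants. -/
def trace (c : S × Icc a b → M) (Φ : S × Icc (0 : ℝ) 1 → S × Icc a b) (p : S) (t : ℝ) : M :=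
  c (Φ (p, projIcc 0 1 zero_le_one t))

end Collar

end NullScattering

end

/-!
# Null scattering across a collar

Curves of the form `t ↦ (X (p, t), t)` in `M × ℝ` are studied through the map `X : S × ℝ → M`.
The hypersurface that they sweep out is null for `h_t - dt²`, with these curves as its generators,
exactly if the *eikonal condition* `h_t (∂ₜX, dX z) = dt z` holds for all tangent vectors `z` of
`S × ℝ` (`EikonalAt`). Differentiating this condition gives the pregeodesic equation of the
generators (`accel_eq_of_chartEikonal`, `isNullPregeodesicOn_of_isNullGermAt`). It therefore
suffices to find a diffeomorphism `Φ` and metrics `h_t` satisfying the eikonal condition.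

Near the two ends the metrics are given and `Φ` is constructed from them. Metrics and collar are
first extended smoothly beyond the closed sets on which they are given, by Borel's lemma
(`exists_contDiff_extension`, `exists_symm_extension`). Starting with the unit normal velocity,
the pregeodesic equation is an ordinary differential equation with smooth local flow, and along its
solutions the eikonal condition propagates from the initial hypersurface
(`chartEikonal_of_accel_eq`). The local solutions are unique, so that they fit together along the
compact hypersurface `S` (`exists_nullGerm`); the far end of the collar is treated by reversing the
time. For short times, the resulting hypersurfaces of `M` are graphs over `S` in the collar
(`exists_splitting`), and graphs that move monotonically from each end can be joined by a
diffeomorphism of cylinders (`exists_interpolating_diffeo`, `exists_diffeo_isNullGermAt`).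

In between, `Φ` is given and the metrics are constructed from it. For fixed `X`, the eikonal
condition is affine in the metric, and positive definiteness, symmetry, and agreement with the given
metrics are convex conditions. Solutions of all of them exist locally: the given metrics at the
given times and, on the graph of `Φ` at times strictly between, the metric for which `X` is an
isometry from a flat cylinder (`exists_local_eikonal_metric`); off the graph, any metric will do.
A partition of unity glues these local solutions (`exists_metricFamily_of_eikonalAt`).
-/

open Filter Topology

noncomputable section

set_option maxSynthPendingDepth 3

namespace NullScattering

/-! ### Functions on the half-space -/

section HalfSpace

variable {E F : Type*} [NormedAddCommGroup E] [NormedSpace ℝ E]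
  [NormedAddCommGroup F] [NormedSpace ℝ F]

variable (E) in
/-- The closed half-space `{(x, t) | 0 ≤ t}` of `E × ℝ`. -/
def upperHalf : Set (E × ℝ) := {z | 0 ≤ z.2}

omit [NormedAddCommGroup E] [NormedSpace ℝ E] in
lemma upperHalf_eq : upperHalf E = univ ×ˢ Ici (0 : ℝ) := by
  ext z; simp [upperHalf]

lemma uniqueDiffOn_upperHalf : UniqueDiffOn ℝ (upperHalf E) := by
  rw [upperHalf_eq]
  exact uniqueDiffOn_univ.prod (uniqueDiffOn_Ici 0)

omit [NormedSpace ℝ E] in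
lemma upperHalf_subset_closure_interior :
    upperHalf E ⊆ closure (interior (upperHalf E)) := by
  rw [upperHalf_eq, interior_prod_eq, closure_prod_eq]
  simp

/-- The derivative in the direction of the last coordinate, for functions on the half-space. -/
def normalDeriv (w : E × ℝ → F) (z : E × ℝ) : F :=
  fderivWithin ℝ w (upperHalf E) z (0, 1)

lemma contDiffOn_fderivWithin_apply {w : E × ℝ → F} (hw : ContDiffOn ℝ ∞ w (upperHalf E))
    (y : E × ℝ) :
    ContDiffOn ℝ ∞ (fun z => fderivWithin ℝ w (upperHalf E) z y) (upperHalf E) :=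
  (hw.fderivWithin uniqueDiffOn_upperHalf (m := ∞) le_rfl).clm_apply contDiffOn_const

lemma contDiffOn_iterate_normalDeriv {w : E × ℝ → F} (hw : ContDiffOn ℝ ∞ w (upperHalf E))
    (k : ℕ) : ContDiffOn ℝ ∞ (normalDeriv^[k] w) (upperHalf E) := by
  induction k with
  | zero => exact hw
  | succ k ih =>
    rw [Function.iterate_succ_apply']
    exact contDiffOn_fderivWithin_apply ih _

lemma normalDeriv_congr {v w : E × ℝ → F} (h : EqOn v w (upperHalf E)) :
    EqOn (normalDeriv v) (normalDeriv w) (upperHalf E) := fun z hz => by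
  simp only [normalDeriv]
  rw [fderivWithin_congr h (h hz)]

/-- The normal derivative commutes with the other partial derivatives. -/
lemma fderivWithin_normalDeriv {w : E × ℝ → F} (hw : ContDiffOn ℝ ∞ w (upperHalf E))
    (y : E × ℝ) : EqOn (normalDeriv (fun z => fderivWithin ℝ w (upperHalf E) z y))
      (fun z => fderivWithin ℝ (normalDeriv w) (upperHalf E) z y) (upperHalf E) := by
  intro z hz
  have hs := (hw z hz).isSymmSndFDerivWithinAt
    (by rw [minSmoothness_of_isRCLikeNormedField]; exact WithTop.coe_le_coe.2 le_top)
    uniqueDiffOn_upperHalf (upperHalf_subset_closure_interior hz) hz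
  have hd : DifferentiableWithinAt ℝ (fderivWithin ℝ w (upperHalf E)) (upperHalf E) z :=
    ((hw.fderivWithin uniqueDiffOn_upperHalf (m := ∞) le_rfl) z hz).differentiableWithinAt
      (by simp)
  have hu := uniqueDiffOn_upperHalf (E := E) z hz
  have key : ∀ a b : E × ℝ, fderivWithin ℝ (fun z => fderivWithin ℝ w (upperHalf E) z a)
      (upperHalf E) z b = fderivWithin ℝ (fderivWithin ℝ w (upperHalf E)) (upperHalf E) z b a := by
    intro a b
    rw [fderivWithin_clm_apply hu hd (by fun_prop)]
    simp
  simp only [normalDeriv]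
  rw [key]
  exact (hs.eq _ _).trans (key _ _).symm

lemma fderivWithin_iterate_normalDeriv {w : E × ℝ → F} (hw : ContDiffOn ℝ ∞ w (upperHalf E))
    (y : E × ℝ) (k : ℕ) : EqOn (normalDeriv^[k] (fun z => fderivWithin ℝ w (upperHalf E) z y))
      (fun z => fderivWithin ℝ (normalDeriv^[k] w) (upperHalf E) z y) (upperHalf E) := by
  induction k with
  | zero => exact fun z _ => rfl
  | succ k ih =>
    simp only [Function.iterate_succ_apply']
    exact (normalDeriv_congr ih).trans
      (fderivWithin_normalDeriv (contDiffOn_iterate_normalDeriv hw k) y)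

/-- A function vanishing on the boundary has only a normal derivative there. -/
lemma fderivWithin_eq_of_boundary_eq_zero {w : E × ℝ → F} (hw : ContDiffOn ℝ ∞ w (upperHalf E))
    (h0 : ∀ x, w (x, 0) = 0) (x : E) (y : E × ℝ) :
    fderivWithin ℝ w (upperHalf E) (x, 0) y = y.2 • normalDeriv w (x, 0) := by
  have hmem : ∀ x : E, (x, (0 : ℝ)) ∈ upperHalf E := fun x => by simp [upperHalf]
  have hd : HasFDerivWithinAt w (fderivWithin ℝ w (upperHalf E) (x, 0)) (upperHalf E) (x, 0) :=
    ((hw _ (hmem x)).differentiableWithinAt (by simp)).hasFDerivWithinAt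
  have h1 : HasFDerivAt (fun x' : E => w (x', 0))
      ((fderivWithin ℝ w (upperHalf E) (x, 0)).comp (ContinuousLinearMap.inl ℝ E ℝ)) x := by
    have := hd.comp x (f := fun x' : E => (x', (0 : ℝ)))
      ((hasFDerivAt_prodMk_left x (0 : ℝ)).hasFDerivWithinAt (s := univ)) (fun x' _ => hmem x')
    simpa using! this
  have h2 : HasFDerivAt (fun x' : E => w (x', 0)) (0 : E →L[ℝ] F) x := by
    simp only [h0]; exact hasFDerivAt_const _ _
  have h3 := h1.unique h2
  have h4 : fderivWithin ℝ w (upperHalf E) (x, 0) (y.1, 0) = 0 := by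
    simpa using! DFunLike.congr_fun h3 y.1
  have h5 : y = (y.1, (0 : ℝ)) + y.2 • ((0 : E), (1 : ℝ)) := by ext <;> simp
  conv_lhs => rw [h5]
  rw [map_add, h4, map_smul, zero_add, normalDeriv]

/-- Extension by zero commutes with differentiation if the function and its normal derivative vanish
on the boundary. -/
lemma hasFDerivAt_indicator_upperHalf {w : E × ℝ → F} (hw : ContDiffOn ℝ ∞ w (upperHalf E))
    (h0 : ∀ x, w (x, 0) = 0) (h1 : ∀ x, normalDeriv w (x, 0) = 0) (z : E × ℝ) :
    HasFDerivAt ((upperHalf E).indicator w)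
      ((upperHalf E).indicator (fderivWithin ℝ w (upperHalf E)) z) z := by
  rcases lt_trichotomy z.2 0 with hz | hz | hz
  · have hmem : (upperHalf E)ᶜ ∈ 𝓝 z := by
      have : IsOpen {z : E × ℝ | z.2 < 0} := isOpen_lt (by fun_prop) (by fun_prop)
      filter_upwards [this.mem_nhds hz] with y hy
      simpa [upperHalf] using! hy
    have hz' : z ∉ upperHalf E := by simpa [upperHalf] using hz
    rw [indicator_of_notMem hz']
    refine (hasFDerivAt_const (0 : F) z).congr_of_eventuallyEq ?_
    filter_upwards [hmem] with y hy
    exact indicator_of_notMem hy _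
  · obtain ⟨x, t⟩ := z
    obtain rfl : t = 0 := hz
    have hmem : (x, (0 : ℝ)) ∈ upperHalf E := by simp [upperHalf]
    have hzero : fderivWithin ℝ w (upperHalf E) (x, 0) = 0 := by
      refine ContinuousLinearMap.ext fun y => ?_
      rw [fderivWithin_eq_of_boundary_eq_zero hw h0, h1]; simp
    rw [indicator_of_mem hmem, hzero, ← hasFDerivWithinAt_univ,
      ← union_compl_self (upperHalf E)]
    refine HasFDerivWithinAt.union ?_ ?_
    · have := ((hw _ hmem).differentiableWithinAt (by simp)).hasFDerivWithinAt
      rw [hzero] at this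
      exact this.congr (fun y hy => indicator_of_mem hy _) (indicator_of_mem hmem _)
    · refine (hasFDerivWithinAt_const (0 : F) _ _).congr
        (fun y hy => indicator_of_notMem hy _) ?_
      rw [indicator_of_mem hmem, h0]
  · have ho : IsOpen {z : E × ℝ | 0 < z.2} := isOpen_lt (by fun_prop) (by fun_prop)
    have hmem : upperHalf E ∈ 𝓝 z := by
      filter_upwards [ho.mem_nhds hz] with y hy
      exact le_of_lt hy
    have hz' : z ∈ upperHalf E := le_of_lt hz
    rw [indicator_of_mem hz']
    refine (((hw z hz').differentiableWithinAt (by simp)).hasFDerivWithinAt.hasFDerivAt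
      hmem).congr_of_eventuallyEq ?_
    filter_upwards [hmem] with y hy
    exact indicator_of_mem hy _

/-- Extension by zero of a function all of whose normal derivatives vanish on the boundary. -/
lemma contDiff_indicator_upperHalf [FiniteDimensional ℝ E] {w : E × ℝ → F}
    (hw : ContDiffOn ℝ ∞ w (upperHalf E))
    (h0 : ∀ k x, (normalDeriv^[k] w) (x, 0) = 0) : ContDiff ℝ ∞ ((upperHalf E).indicator w) := by
  rw [contDiff_infty]
  intro n
  induction n generalizing w with
  | zero =>
    refine contDiff_zero.2 ?_
    exact continuous_iff_continuousAt.2 fun z =>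
      (hasFDerivAt_indicator_upperHalf hw (h0 0) (h0 1) z).continuousAt
  | succ n ih =>
    have hF := hasFDerivAt_indicator_upperHalf hw (h0 0) (h0 1)
    rw [show ((n + 1 : ℕ) : WithTop ℕ∞) = (n : WithTop ℕ∞) + 1 by push_cast; rfl,
      contDiff_succ_iff_fderiv_apply]
    refine ⟨fun z => (hF z).differentiableAt, by simp, fun y => ?_⟩
    have heq : (fun z => fderiv ℝ ((upperHalf E).indicator w) z y)
        = (upperHalf E).indicator (fun z => fderivWithin ℝ w (upperHalf E) z y) := by
      ext1 z
      rw [(hF z).fderiv]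
      by_cases hz : z ∈ upperHalf E <;> simp [hz]
    rw [heq]
    refine ih (contDiffOn_fderivWithin_apply hw y) fun k x => ?_
    rw [fderivWithin_iterate_normalDeriv hw y k (by simp [upperHalf])]
    simp only
    rw [fderivWithin_eq_of_boundary_eq_zero (contDiffOn_iterate_normalDeriv hw k) (h0 k),
      ← Function.iterate_succ_apply' normalDeriv k w, h0, smul_zero]

lemma normalDeriv_eq_fderiv {w : E × ℝ → F} (hw : ContDiff ℝ ∞ w) :
    EqOn (normalDeriv w) (fun z => fderiv ℝ w z (0, 1)) (upperHalf E) := fun z hz => by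
  simp only [normalDeriv]
  rw [((hw.differentiable (by simp)) z).fderivWithin (uniqueDiffOn_upperHalf z hz)]

lemma iterate_normalDeriv_eq_iteratedFDeriv {w : E × ℝ → F} (hw : ContDiff ℝ ∞ w) (k : ℕ) :
    EqOn (normalDeriv^[k] w) (fun z => iteratedFDeriv ℝ k w z (fun _ => (0, 1)))
      (upperHalf E) := by
  induction k with
  | zero => exact fun z _ => (iteratedFDeriv_zero_apply _).symm
  | succ k ih =>
    rw [Function.iterate_succ_apply']
    have hk : ContDiff ℝ ∞ (iteratedFDeriv ℝ k w) :=
      hw.iteratedFDeriv_right (m := ∞) (i := k) (by exact_mod_cast le_rfl)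
    refine (normalDeriv_congr ih).trans ((normalDeriv_eq_fderiv ?_).trans ?_)
    · exact (ContinuousMultilinearMap.apply ℝ (fun _ : Fin k => E × ℝ) F
        (fun _ => (0, 1))).contDiff.comp hk
    · intro z _
      have h1 : HasFDerivAt (fun z => iteratedFDeriv ℝ k w z (fun _ => ((0 : E), (1 : ℝ)))) _ z :=
        (ContinuousMultilinearMap.apply ℝ (fun _ : Fin k => E × ℝ) F
          (fun _ => ((0 : E), (1 : ℝ)))).hasFDerivAt.comp z
          ((hk.differentiable (by simp)) z).hasFDerivAt
      simp only [h1.fderiv]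
      rw [iteratedFDeriv_succ_apply_left]
      rfl

lemma iterate_normalDeriv_smul {b : ℝ → ℝ} (hb : ContDiff ℝ ∞ b) {a : E → F}
    (ha : ContDiff ℝ ∞ a) (k : ℕ) :
    EqOn (normalDeriv^[k] (fun z : E × ℝ => b z.2 • a z.1))
      (fun z => iteratedDeriv k b z.2 • a z.1) (upperHalf E) := by
  induction k with
  | zero => intro z _; simp
  | succ k ih =>
    rw [Function.iterate_succ_apply']
    have hk : ContDiff ℝ ∞ (iteratedDeriv k b) := by
      rw [iteratedDeriv_eq_iterate]; exact hb.iterate_deriv k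
    have hsm : ContDiff ℝ ∞ (fun z : E × ℝ => iteratedDeriv k b z.2 • a z.1) := by fun_prop
    refine (normalDeriv_congr ih).trans ((normalDeriv_eq_fderiv hsm).trans ?_)
    intro z _
    have h1 : HasFDerivAt (fun z : E × ℝ => iteratedDeriv k b z.2) _ z :=
      ((hk.differentiable (by simp)) z.2).hasDerivAt.hasFDerivAt.comp z hasFDerivAt_snd
    have h2 : HasFDerivAt (fun z : E × ℝ => a z.1) _ z :=
      ((ha.differentiable (by simp)) z.1).hasFDerivAt.comp z hasFDerivAt_fst
    have h3 : fderiv ℝ (fun z : E × ℝ => iteratedDeriv k b z.2 • a z.1) z = _ :=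
      (h1.smul h2).fderiv
    simp [h3, iteratedDeriv_succ]

end HalfSpace

/-! ### Borel's lemma and extension from the half-space -/

section Borel

variable {E F : Type*} [NormedAddCommGroup E] [NormedSpace ℝ E] [FiniteDimensional ℝ E]
  [NormedAddCommGroup F] [NormedSpace ℝ F] [CompleteSpace F]

omit [FiniteDimensional ℝ E] [CompleteSpace F] in
/-- One term of a Borel sum: a smooth function on `E × ℝ` whose only nonzero normal derivative
on the boundary is the `i`-th one, equal to `a`, and whose derivatives of order less than `i` are
as small as desired. -/
lemma exists_borel_term {a : E → F} (ha : ContDiff ℝ ∞ a) (hac : HasCompactSupport a) (i : ℕ)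
    {e : ℝ} (he : 0 < e) :
    ∃ u : E × ℝ → F, ContDiff ℝ ∞ u ∧ HasCompactSupport u ∧
      (∀ k < i, ∀ z, ‖iteratedFDeriv ℝ k u z‖ ≤ e) ∧
      ∀ k x, (normalDeriv^[k] u) (x, 0) = if k = i then a x else 0 := by
  let χ : ContDiffBump (0 : ℝ) := ⟨1, 2, one_pos, one_lt_two⟩
  have hχ : ContDiff ℝ ∞ χ := χ.contDiff
  -- the Taylor monomial `t ^ i / i! • a x`, cut off away from `t = 0`
  let b : ℝ → ℝ := fun t => (i.factorial : ℝ)⁻¹ * t ^ i * χ t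
  have hb : ContDiff ℝ ∞ b := by fun_prop
  let v : E × ℝ → F := fun z => b z.2 • a z.1
  have hv : ContDiff ℝ ∞ v := by fun_prop
  have hvc : HasCompactSupport v := by
    have hK : IsCompact (tsupport a ×ˢ tsupport χ) :=
      IsCompact.prod hac χ.hasCompactSupport
    refine HasCompactSupport.intro hK fun z hz => ?_
    simp only [v, b]
    by_cases h1 : z.1 ∈ tsupport a
    · have h2 : z.2 ∉ tsupport χ := fun h => hz ⟨h1, h⟩
      rw [image_eq_zero_of_notMem_tsupport h2]; simp
    · rw [image_eq_zero_of_notMem_tsupport h1]; simp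
  have hbd : ∀ k : ℕ, ∃ C : ℝ, ∀ z, ‖iteratedFDeriv ℝ k v z‖ ≤ C := fun k =>
    (hvc.iteratedFDeriv k).exists_bound_of_continuous
      (hv.continuous_iteratedFDeriv (mod_cast le_top))
  choose C hC using hbd
  have hC0 : ∀ k, 0 ≤ C k := fun k => (norm_nonneg _).trans (hC k 0)
  -- Compressing the variable `t` by `l` and dividing by `l ^ i` preserves the `i`-th normal
  -- derivative and divides the lower derivatives by `l` at least.
  obtain ⟨l, hl⟩ : ∃ l : ℝ, 1 ≤ l ∧ ∀ k < i, C k ≤ l * e := by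
    refine ⟨max 1 ((∑ k ∈ Finset.range i, C k) / e), le_max_left _ _, fun k hk => ?_⟩
    have h1 : C k ≤ ∑ k ∈ Finset.range i, C k :=
      Finset.single_le_sum (fun j _ => hC0 j) (Finset.mem_range.2 hk)
    refine h1.trans ?_
    rw [← div_le_iff₀ he]
    exact le_max_right _ _
  have hl0 : (0 : ℝ) < l := lt_of_lt_of_le one_pos hl.1
  let L : E × ℝ →L[ℝ] E × ℝ :=
    (ContinuousLinearMap.fst ℝ E ℝ).prod (l • ContinuousLinearMap.snd ℝ E ℝ)
  have hL : ∀ z, L z = (z.1, l * z.2) := fun z => by simp [L]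
  have hLn : ‖L‖ ≤ l := by
    refine L.opNorm_le_bound hl0.le fun z => ?_
    rw [hL, Prod.norm_def]
    refine max_le ?_ ?_
    · calc ‖z.1‖ ≤ 1 * ‖z‖ := by rw [one_mul]; exact norm_fst_le z
        _ ≤ l * ‖z‖ := by gcongr; exact hl.1
    · simp only [norm_mul, Real.norm_eq_abs, abs_of_pos hl0]
      gcongr
      exact norm_snd_le z
  let u : E × ℝ → F := (l ^ i)⁻¹ • (v ∘ L)
  have hu : ContDiff ℝ ∞ u := (hv.comp L.contDiff).const_smul _
  have hueq : u = fun z : E × ℝ => ((l ^ i)⁻¹ * b (l * z.2)) • a z.1 := by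
    ext z; simp [u, v, hL, smul_smul]
  refine ⟨u, hu, ?_, ?_, ?_⟩
  · have hK : IsCompact (tsupport a ×ˢ Icc (-2 : ℝ) 2) := IsCompact.prod hac isCompact_Icc
    refine HasCompactSupport.intro hK fun z hz => ?_
    rw [hueq]
    by_cases h1 : z.1 ∈ tsupport a
    · have h2 : z.2 ∉ Icc (-2 : ℝ) 2 := fun h => hz ⟨h1, h⟩
      have h3 : χ (l * z.2) = 0 := by
        apply χ.zero_of_le_dist
        rw [Real.dist_eq, sub_zero, abs_mul, abs_of_pos hl0]
        have : 2 < |z.2| := by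
          rwa [mem_Icc, ← abs_le, not_le] at h2
        change (2 : ℝ) ≤ _
        nlinarith [hl.1]
      simp [b, h3]
    · simp [image_eq_zero_of_notMem_tsupport h1]
  · intro k hk z
    have h1 : iteratedFDeriv ℝ k u z
        = (l ^ i)⁻¹ • (iteratedFDeriv ℝ k v (L z)).compContinuousLinearMap fun _ => L := by
      rw [iteratedFDeriv_const_smul_apply
        (((hv.comp L.contDiff).of_le (mod_cast le_top)).contDiffAt),
        L.iteratedFDeriv_comp_right hv z (mod_cast le_top)]
    rw [h1, norm_smul, norm_inv, norm_pow, Real.norm_eq_abs, abs_of_pos hl0]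
    have h2 : ‖(iteratedFDeriv ℝ k v (L z)).compContinuousLinearMap fun _ => L‖
        ≤ C k * l ^ k := by
      refine (ContinuousMultilinearMap.norm_compContinuousLinearMap_le _ _).trans ?_
      simp only [Finset.prod_const, Finset.card_univ, Fintype.card_fin]
      gcongr
      · exact hC0 k
      · exact hC k _
    have h3 : l ^ k * l ≤ l ^ i := by
      rw [← pow_succ]; exact pow_le_pow_right₀ hl.1 hk
    rw [inv_mul_le_iff₀ (pow_pos hl0 i)]
    calc _ ≤ C k * l ^ k := h2
      _ ≤ l * e * l ^ k := by gcongr; exact hl.2 k hk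
      _ = l ^ k * l * e := by ring
      _ ≤ l ^ i * e := by gcongr
  · intro k x
    have hb' : ContDiff ℝ ∞ (fun t => (l ^ i)⁻¹ * b (l * t)) := by fun_prop
    rw [hueq, iterate_normalDeriv_smul hb' ha k (by simp [upperHalf])]
    -- near `0` the cut-off is `1`, and the factor is the monomial `t ^ i / i!`
    have h1 : (fun t => (l ^ i)⁻¹ * b (l * t)) =ᶠ[𝓝 0] fun t => (i.factorial : ℝ)⁻¹ * t ^ i := by
      have hc : Tendsto (fun t : ℝ => l * t) (𝓝 0) (𝓝 0) := by
        have : Continuous (fun t : ℝ => l * t) := by fun_prop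
        simpa using this.tendsto 0
      filter_upwards [hc.eventually χ.eventuallyEq_one] with t ht
      have ht' : χ (l * t) = 1 := ht
      simp only [b, ht', mul_pow]
      field_simp
    simp only
    rw [h1.iteratedDeriv_eq, iteratedDeriv_const_mul_field, iteratedDeriv_pow]
    split_ifs with hki
    · subst hki
      simp [Nat.descFactorial_self, Nat.factorial_ne_zero]
    · rcases lt_or_gt_of_ne hki with h | h
      · simp [Nat.sub_ne_zero_of_lt h]
      · simp [Nat.descFactorial_of_lt h]

omit [FiniteDimensional ℝ E] in
/-- **Borel's lemma** with parameters: the normal derivatives on the boundary of the half-space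
may be prescribed arbitrarily. -/
theorem exists_contDiff_normalDeriv_eq {a : ℕ → E → F} (ha : ∀ i, ContDiff ℝ ∞ (a i))
    (hac : ∀ i, HasCompactSupport (a i)) :
    ∃ g : E × ℝ → F, ContDiff ℝ ∞ g ∧ ∀ k x, (normalDeriv^[k] g) (x, 0) = a k x := by
  have hex := fun i => exists_borel_term (ha i) (hac i) i (e := (1 / 2) ^ i) (by positivity)
  choose u hu huc hule hun using hex
  have hbd : ∀ k i : ℕ, ∃ C : ℝ, ∀ z, ‖iteratedFDeriv ℝ k (u i) z‖ ≤ C := fun k i =>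
    ((huc i).iteratedFDeriv k).exists_bound_of_continuous
      ((hu i).continuous_iteratedFDeriv (mod_cast le_top))
  choose C hC using hbd
  -- a summable bound for the `k`-th derivatives, all but finitely many of which are small
  let v : ℕ → ℕ → ℝ := fun k i => if k < i then (1 / 2) ^ i else C k i
  have hv : ∀ k, Summable (v k) := fun k => by
    refine (summable_congr_cofinite ?_).1 summable_geometric_two
    rw [Nat.cofinite_eq_atTop]
    filter_upwards [eventually_gt_atTop k] with i hi
    simp [v, hi]
  have hle : ∀ k i z, ‖iteratedFDeriv ℝ k (u i) z‖ ≤ v k i := fun k i z => by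
    simp only [v]
    split_ifs with h
    · exact hule i k h z
    · exact hC k i z
  have hg : ContDiff ℝ ∞ fun z => ∑' i, u i z :=
    contDiff_tsum (N := ⊤) hu (fun k _ => hv k) (fun k i z _ => hle k i z)
  refine ⟨_, hg, fun k x => ?_⟩
  have hmem : (x, (0 : ℝ)) ∈ upperHalf E := by simp [upperHalf]
  rw [iterate_normalDeriv_eq_iteratedFDeriv hg k hmem]
  simp only
  rw [iteratedFDeriv_tsum_apply (N := ⊤) hu (fun k _ => hv k) (fun k i z _ => hle k i z) le_top]
  have hs : Summable fun i => iteratedFDeriv ℝ k (u i) (x, 0) :=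
    .of_norm_bounded (hv k) fun i => hle k i _
  have h1 : (∑' i, iteratedFDeriv ℝ k (u i) (x, 0)) (fun _ => ((0 : E), (1 : ℝ)))
      = ∑' i, iteratedFDeriv ℝ k (u i) (x, 0) (fun _ => ((0 : E), (1 : ℝ))) :=
    (ContinuousMultilinearMap.apply ℝ (fun _ : Fin k => E × ℝ) F
      (fun _ => ((0 : E), (1 : ℝ)))).map_tsum hs
  rw [h1, tsum_eq_single k]
  · refine (iterate_normalDeriv_eq_iteratedFDeriv (hu k) k hmem).symm.trans ?_
    rw [hun]; simp
  · intro i hi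
    refine (iterate_normalDeriv_eq_iteratedFDeriv (hu i) k hmem).symm.trans ?_
    rw [hun, if_neg hi.symm]

/-- A function that is smooth on the half-space near a boundary point extends to a smooth function
across the boundary. -/
theorem exists_contDiff_extension {f : E × ℝ → F} {x₀ : E}
    (hf : ∀ᶠ z in 𝓝[upperHalf E] (x₀, 0), ContDiffWithinAt ℝ ∞ f (upperHalf E) z) :
    ∃ g : E × ℝ → F, ContDiff ℝ ∞ g ∧ ∀ᶠ z in 𝓝 (x₀, (0 : ℝ)), z ∈ upperHalf E → g z = f z := by
  obtain ⟨r, hr, hrf⟩ := Metric.eventually_nhds_iff_ball.1 (eventually_nhdsWithin_iff.1 hf)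
  obtain ⟨χ, hχ1, hχ⟩ : ∃ χ : ContDiffBump (x₀, (0 : ℝ)), χ.rIn = r / 4 ∧ χ.rOut = r / 2 :=
    ⟨⟨r / 4, r / 2, by positivity, by linarith⟩, rfl, rfl⟩
  have hts : tsupport χ ⊆ Metric.ball (x₀, (0 : ℝ)) r := by
    rw [χ.tsupport_eq, hχ]
    exact Metric.closedBall_subset_ball (by linarith)
  let w : E × ℝ → F := fun z => χ z • f z
  have hw : ContDiffOn ℝ ∞ w (upperHalf E) := by
    intro z hz
    by_cases h : z ∈ tsupport χ
    · exact χ.contDiff.contDiffWithinAt.smul (hrf z (hts h) hz)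
    · refine (contDiffWithinAt_const (c := (0 : F))).congr_of_eventuallyEq ?_ ?_
      · refine mem_nhdsWithin_of_mem_nhds ?_
        filter_upwards [(isClosed_tsupport χ).isOpen_compl.mem_nhds h] with y hy
        simp [w, image_eq_zero_of_notMem_tsupport hy]
      · simp [w, image_eq_zero_of_notMem_tsupport h]
  have hwk := contDiffOn_iterate_normalDeriv hw
  have hwz : ∀ k z, z ∈ upperHalf E → z ∉ tsupport χ → (normalDeriv^[k] w) z = 0 := by
    intro k
    induction k with
    | zero => intro z _ hz; simp [w, image_eq_zero_of_notMem_tsupport hz]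
    | succ k ih =>
      intro z hz hzs
      rw [Function.iterate_succ_apply', normalDeriv]
      have h0 : normalDeriv^[k] w =ᶠ[𝓝[upperHalf E] z] fun _ => 0 := by
        filter_upwards [self_mem_nhdsWithin,
          mem_nhdsWithin_of_mem_nhds ((isClosed_tsupport χ).isOpen_compl.mem_nhds hzs)] with y hy
            hy'
        exact ih y hy hy'
      rw [h0.fderivWithin_eq (ih z hz hzs)]
      simp
  have hmem : ∀ x : E, (x, (0 : ℝ)) ∈ upperHalf E := fun x => by simp [upperHalf]
  obtain ⟨g, hg, hgk⟩ := exists_contDiff_normalDeriv_eq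
    (a := fun k x => (normalDeriv^[k] w) (x, 0))
    (fun k => (hwk k).comp_contDiff (by fun_prop) hmem)
    (fun k => by
      have hK : IsCompact (Prod.fst '' tsupport χ) := χ.hasCompactSupport.image continuous_fst
      refine HasCompactSupport.intro hK fun x hx => hwz k _ (hmem x) fun h => hx ⟨_, h, rfl⟩)
  -- The difference of `w` and the Borel sum `g` of its normal derivatives is flat on the boundary,
  -- so that its extension by zero is smooth.
  have hsub : ∀ k, EqOn (normalDeriv^[k] (w - g)) (normalDeriv^[k] w - normalDeriv^[k] g)
      (upperHalf E) := by
    intro k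
    induction k with
    | zero => exact fun z _ => rfl
    | succ k ih =>
      simp only [Function.iterate_succ_apply']
      refine (normalDeriv_congr ih).trans fun z hz => ?_
      simp only [normalDeriv, Pi.sub_apply]
      rw [fderivWithin_sub (uniqueDiffOn_upperHalf z hz)
        (((hwk k) z hz).differentiableWithinAt (by simp))
        ((contDiffOn_iterate_normalDeriv hg.contDiffOn k z hz).differentiableWithinAt (by simp))]
      rfl
  have hflat := contDiff_indicator_upperHalf (hw.sub hg.contDiffOn) fun k x => by
    have := hsub k (hmem x)
    simp only [Pi.sub_apply, hgk, sub_self] at this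
    exact this
  refine ⟨_, hg.add hflat, ?_⟩
  filter_upwards [χ.eventuallyEq_one] with z hz hzu
  have : χ z = 1 := hz
  simp [indicator_of_mem hzu, w, this]

end Borel

/-! ### Smooth dependence of ordinary differential equations on initial values -/

section Flow

universe u

variable {G G' : Type u} [NormedAddCommGroup G] [NormedSpace ℝ G]
  [NormedAddCommGroup G'] [NormedSpace ℝ G']

/-- A bilinear map, applied pointwise to continuous curves. -/
def bilinCurve {L : Type u} [NormedAddCommGroup L] [NormedSpace ℝ L] (B : L →L[ℝ] G →L[ℝ] G') :
    C(Icc (0 : ℝ) 1, L) →L[ℝ] C(Icc (0 : ℝ) 1, G) →L[ℝ] C(Icc (0 : ℝ) 1, G') :=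
  LinearMap.mkContinuous₂
    (LinearMap.mk₂ ℝ (fun A α => ⟨fun s => B (A s) (α s), by fun_prop⟩)
      (fun _ _ _ => by ext; simp) (fun _ _ _ => by ext; simp) (fun _ _ _ => by ext; simp)
      (fun _ _ _ => by ext; simp)) ‖B‖
    (fun A α => by
      rw [ContinuousMap.norm_le _ (by positivity)]
      intro s
      refine (B.le_opNorm₂ (A s) (α s)).trans ?_
      have h1 := A.norm_coe_le_norm s
      have h2 := α.norm_coe_le_norm s
      gcongr)

/-- Pointwise application of a continuous family of operators to a continuous curve. -/
def clmApplyCurve : C(Icc (0 : ℝ) 1, G →L[ℝ] G') →L[ℝ] C(Icc (0 : ℝ) 1, G) →L[ℝ]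
    C(Icc (0 : ℝ) 1, G') :=
  bilinCurve (.id ℝ (G →L[ℝ] G'))

/-- The substitution operator `α ↦ F ∘ α` on continuous curves. -/
def substCurve (F : C(G, G')) (α : C(Icc (0 : ℝ) 1, G)) : C(Icc (0 : ℝ) 1, G') := F.comp α

lemma hasFDerivAt_substCurve {F : C(G, G')} (hF : ContDiff ℝ ∞ F) (hFc : HasCompactSupport F)
    (DF : C(G, G →L[ℝ] G')) (hDF : ∀ x, DF x = fderiv ℝ F x) (α : C(Icc (0 : ℝ) 1, G)) :
    HasFDerivAt (substCurve F) (clmApplyCurve (substCurve DF α)) α := by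
  have hDFs : ContDiff ℝ ∞ DF := by
    have : (DF : G → G →L[ℝ] G') = fderiv ℝ F := funext hDF
    rw [this]; exact hF.fderiv_right (m := ∞) le_rfl
  have hDFc : HasCompactSupport DF := by
    have : (DF : G → G →L[ℝ] G') = fderiv ℝ F := funext hDF
    rw [this]; exact hFc.fderiv (𝕜 := ℝ)
  obtain ⟨C, hC⟩ := ContDiff.lipschitzWith_of_hasCompactSupport hDFc hDFs (by simp)
  have hpt : ∀ y h : G, ‖F (y + h) - F y - DF y h‖ ≤ C * ‖h‖ * ‖h‖ := by
    intro y h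
    have := (convex_closedBall y ‖h‖).norm_image_sub_le_of_norm_hasFDerivWithin_le'
      (f := F) (f' := DF) (φ := DF y) (C := C * ‖h‖) (x := y) (y := y + h)
      (fun x _ => by
        rw [hDF]; exact ((hF.differentiable (by simp)) x).hasFDerivAt.hasFDerivWithinAt)
      (fun x hx => by
        refine (hC.norm_sub_le x y).trans ?_
        gcongr
        simpa [dist_eq_norm] using hx)
      (by simp) (by simp)
    simpa using this
  rw [hasFDerivAt_iff_isLittleO_nhds_zero]
  refine Asymptotics.IsBigO.trans_isLittleO (g := fun h : C(Icc (0 : ℝ) 1, G) => ‖h‖ ^ 2) ?_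
    (Asymptotics.isLittleO_norm_pow_id one_lt_two)
  refine Asymptotics.IsBigO.of_bound C (Eventually.of_forall fun h => ?_)
  rw [ContinuousMap.norm_le _ (by positivity)]
  intro s
  refine (hpt (α s) (h s)).trans ?_
  rw [Real.norm_of_nonneg (by positivity), sq, mul_assoc]
  have := h.norm_coe_le_norm s
  gcongr

lemma contDiff_substCurve {F : C(G, G')} (hF : ContDiff ℝ ∞ F) (hFc : HasCompactSupport F) :
    ContDiff ℝ ∞ (substCurve F) := by
  rw [contDiff_infty]
  intro n
  induction n generalizing G' with
  | zero =>
    rw [Nat.cast_zero, contDiff_zero]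
    exact ContinuousMap.continuous_postcomp F
  | succ n ih =>
    have hDFs : ContDiff ℝ ∞ (fderiv ℝ F) := hF.fderiv_right (m := ∞) le_rfl
    let DF : C(G, G →L[ℝ] G') := ⟨fderiv ℝ F, hDFs.continuous⟩
    have hd := hasFDerivAt_substCurve hF hFc DF (fun _ => rfl)
    rw [show ((n + 1 : ℕ) : WithTop ℕ∞) = (n : WithTop ℕ∞) + 1 by push_cast; rfl,
      contDiff_succ_iff_fderiv]
    refine ⟨fun α => (hd α).differentiableAt, by simp, ?_⟩
    have : fderiv ℝ (substCurve F) = fun α => clmApplyCurve (substCurve DF α) :=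
      funext fun α => (hd α).fderiv
    rw [this]
    have h1 : ContDiff ℝ n (substCurve DF) := ih (F := DF) hDFs (hFc.fderiv (𝕜 := ℝ))
    exact ContDiff.comp (g := (clmApplyCurve (G := G) (G' := G')))
      (ContinuousLinearMap.contDiff _) h1

/-- The primitive vanishing at `0`, as an operator on continuous curves. -/
def primitiveCurve [CompleteSpace G] : C(Icc (0 : ℝ) 1, G) →L[ℝ] C(Icc (0 : ℝ) 1, G) :=
  LinearMap.mkContinuous
    { toFun := fun β =>
        ⟨fun s => ∫ r in (0 : ℝ)..s, β (projIcc 0 1 zero_le_one r), by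
          have : Continuous fun s : ℝ => ∫ r in (0 : ℝ)..s, β (projIcc 0 1 zero_le_one r) :=
            intervalIntegral.continuous_primitive
              (fun a b => (β.continuous.comp continuous_projIcc).intervalIntegrable a b) 0
          exact this.comp continuous_subtype_val⟩
      map_add' := fun β γ => by
        ext s
        simp only [ContinuousMap.coe_mk, ContinuousMap.add_apply]
        exact intervalIntegral.integral_add
          ((β.continuous.comp continuous_projIcc).intervalIntegrable _ _)
          ((γ.continuous.comp continuous_projIcc).intervalIntegrable _ _)
      map_smul' := fun c β => by
        ext s
        simp only [ContinuousMap.coe_mk, ContinuousMap.smul_apply, RingHom.id_apply]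
        exact intervalIntegral.integral_smul _ _ } 1
    (fun β => by
      rw [one_mul, ContinuousMap.norm_le _ (norm_nonneg _)]
      intro s
      refine (intervalIntegral.norm_integral_le_of_norm_le_const
        (fun r _ => β.norm_coe_le_norm _)).trans ?_
      rw [sub_zero, abs_of_nonneg s.2.1]
      exact mul_le_of_le_one_right (norm_nonneg _) s.2.2)

/-- Smooth dependence on the initial value: the rescaled solutions `s ↦ x (t s)`, `s ∈ [0, 1]`, form
an implicit function of the initial value and `t`, with values in the space of continuous curves. -/
lemma exists_smooth_flow_of_hasCompactSupport [CompleteSpace G] {F : G → G}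
    (hF : ContDiff ℝ ∞ F) (hFc : HasCompactSupport F) (g₀ : G) :
    ∃ φ : G × ℝ → G, (∀ᶠ z in 𝓝 (g₀, (0 : ℝ)), ContDiffAt ℝ ∞ φ z) ∧
      (∀ᶠ g in 𝓝 g₀, φ (g, 0) = g) ∧
      ∀ᶠ z in 𝓝 (g₀, (0 : ℝ)), HasDerivAt (fun t => φ (z.1, t)) (F (φ z)) z.2 := by
  let cst : G →L[ℝ] C(Icc (0 : ℝ) 1, G) := LinearMap.mkContinuous
    { toFun := fun x => ContinuousMap.const _ x
      map_add' := fun _ _ => rfl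
      map_smul' := fun _ _ => rfl } 1
    (fun x => by
      rw [one_mul, ContinuousMap.norm_le _ (norm_nonneg _)]
      exact fun s => le_rfl)
  have hcst : ∀ x s, cst x s = x := fun _ _ => rfl
  let FC : C(G, G) := ⟨F, hF.continuous⟩
  have hN : ContDiff ℝ ∞ (substCurve FC) := contDiff_substCurve hF hFc
  -- The curve `s ↦ x(ts)`, `s ∈ [0, 1]`, is a zero of `Ψ (x, t)`.
  let Ψ : (G × ℝ) × C(Icc (0 : ℝ) 1, G) → C(Icc (0 : ℝ) 1, G) :=
    fun w => w.2 - cst w.1.1 - w.1.2 • primitiveCurve (substCurve FC w.2)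
  let w₀ : (G × ℝ) × C(Icc (0 : ℝ) 1, G) := ((g₀, 0), cst g₀)
  have hΨs : ContDiff ℝ ∞ Ψ := by
    have h1 : ContDiff ℝ ∞ fun w : (G × ℝ) × C(Icc (0 : ℝ) 1, G) => substCurve FC w.2 :=
      hN.comp contDiff_snd
    fun_prop
  have hΨ : ContDiffAt ℝ ∞ Ψ w₀ := hΨs.contDiffAt
  have hΨ0 : Ψ w₀ = 0 := by simp [Ψ, w₀]
  have hinv : (fderiv ℝ Ψ w₀ ∘L .inr ℝ (G × ℝ) C(Icc (0 : ℝ) 1, G)).IsInvertible := by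
    have h1 : HasFDerivAt (fun α => Ψ ((g₀, 0), α))
        (fderiv ℝ Ψ w₀ ∘L .inr ℝ (G × ℝ) C(Icc (0 : ℝ) 1, G)) (cst g₀) :=
      HasFDerivAt.comp (cst g₀) ((hΨ.differentiableAt (by simp)).hasFDerivAt (x := w₀))
        (hasFDerivAt_prodMk_right (g₀, (0 : ℝ)) (cst g₀))
    have h2 : HasFDerivAt (fun α => Ψ ((g₀, 0), α)) (.id ℝ _) (cst g₀) := by
      have : (fun α => Ψ ((g₀, 0), α)) = fun α => α - cst g₀ := by
        ext α; simp [Ψ]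
      rw [this]
      exact (hasFDerivAt_id _).sub_const _
    rw [h1.unique h2]
    exact ⟨.refl ℝ _, rfl⟩
  let ψ := hΨ.implicitFunction (by simp) hinv
  have hψ0 : ContDiffAt ℝ ∞ ψ (g₀, 0) := hΨ.contDiffAt_implicitFunction (by simp) hinv
  have hψe : ∀ᶠ z in 𝓝 (g₀, (0 : ℝ)), Ψ (z, ψ z) = 0 := by
    have := hΨ.eventually_apply_implicitFunction (by simp) hinv
    rwa [hΨ0] at this
  -- Near `(g₀, 0)` the function `ψ` coincides with the implicit functions at nearby base points,
  -- so that it is smooth in a neighbourhood and not only at the point.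
  have hψ : ∀ᶠ z in 𝓝 (g₀, (0 : ℝ)), ContDiffAt ℝ ∞ ψ z := by
    have hiff : ∀ᶠ v in 𝓝 w₀, Ψ v = 0 → ψ v.1 = v.2 := by
      filter_upwards [hΨ.eventually_apply_eq_iff_implicitFunction (by simp) hinv] with v hv h
      exact hv.1 (h.trans hΨ0.symm)
    have hinv' : ∀ᶠ v in 𝓝 w₀,
        (fderiv ℝ Ψ v ∘L .inr ℝ (G × ℝ) C(Icc (0 : ℝ) 1, G)).IsInvertible := by
      have hcont : Continuous fun v => fderiv ℝ Ψ v ∘L .inr ℝ (G × ℝ) C(Icc (0 : ℝ) 1, G) :=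
        (hΨs.continuous_fderiv (by simp)).clm_comp continuous_const
      have ho : IsOpen {A : C(Icc (0 : ℝ) 1, G) →L[ℝ] C(Icc (0 : ℝ) 1, G) | A.IsInvertible} :=
        ContinuousLinearEquiv.isOpen
      exact hcont.continuousAt.eventually (ho.mem_nhds hinv)
    have hw : Tendsto (fun z => (z, ψ z)) (𝓝 (g₀, (0 : ℝ))) (𝓝 w₀) := by
      have h1 : ψ (g₀, 0) = cst g₀ := hΨ.implicitFunction_apply_self (by simp) hinv
      have h2 := (continuousAt_id.prodMk hψ0.continuousAt).tendsto
      simpa [h1] using! h2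
    filter_upwards [hw.eventually (eventually_eventually_nhds.2 hiff), hw.eventually hinv',
      hψe] with z hz1 hz2 hz3
    have hz : ContDiffAt ℝ ∞ Ψ (z, ψ z) := hΨs.contDiffAt
    have h1 := hz.contDiffAt_implicitFunction (by simp) hz2
    refine h1.congr_of_eventuallyEq ?_
    have h2 : Tendsto (fun y => (y, hz.implicitFunction (by simp) hz2 y)) (𝓝 z)
        (𝓝 (z, ψ z)) := by
      have h3 : hz.implicitFunction (by simp) hz2 z = ψ z :=
        hz.implicitFunction_apply_self (by simp) hz2
      have h4 := (continuousAt_id.prodMk h1.continuousAt).tendsto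
      simpa [h3] using! h4
    filter_upwards [h2.eventually hz1, hz.eventually_apply_implicitFunction (by simp) hz2]
      with y hy1 hy2
    exact hy1 (hy2.trans hz3)
  let one : Icc (0 : ℝ) 1 := ⟨1, by simp⟩
  refine ⟨fun z => ψ z one, ?_, ?_, ?_⟩
  · filter_upwards [hψ] with z hz
    exact (ContinuousMap.evalCLM ℝ one).contDiff.contDiffAt.comp _ hz
  · have h1 : Tendsto (fun g : G => (g, (0 : ℝ))) (𝓝 g₀) (𝓝 (g₀, 0)) :=
      Continuous.tendsto (by fun_prop) g₀
    filter_upwards [h1.eventually hψe] with g hg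
    have : ψ (g, 0) = cst g := by
      simpa [Ψ, sub_eq_zero] using hg
    rw [this, hcst]
  · obtain ⟨K, hK⟩ := ContDiff.lipschitzWith_of_hasCompactSupport hFc hF (by simp)
    obtain ⟨r, hr, e, he, hsol⟩ :=
      (hF.contDiffAt.of_le (by simp) : ContDiffAt ℝ 1 F
        g₀).exists_forall_mem_closedBall_exists_eq_forall_mem_Ioo_hasDerivAt 0
    -- `ψ (x, t) 1` is the value at time `t` of the solution with initial value `x`.
    have key : ∀ z : G × ℝ, Ψ (z, ψ z) = 0 → z.2 ∈ Ioo (-e) e → ∀ y : ℝ → G, y 0 = z.1 →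
        (∀ t ∈ Ioo (0 - e) (0 + e), HasDerivAt y (F (y t)) t) → ψ z one = y z.2 := by
      intro z hz hze y hy0 hy
      set α := ψ z
      have hα : ∀ s : Icc (0 : ℝ) 1, α s
          = z.1 + z.2 • ∫ r in (0 : ℝ)..s, F (α (projIcc 0 1 zero_le_one r)) := by
        intro s
        have := DFunLike.congr_fun hz s
        simp only [Ψ, ContinuousMap.sub_apply, ContinuousMap.zero_apply, sub_sub,
          sub_eq_zero] at this
        exact this
      let c : ℝ → G := fun s => z.1 + z.2 • ∫ r in (0 : ℝ)..s, F (α (projIcc 0 1 zero_le_one r))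
      have hcα : ∀ s (hs : s ∈ Icc (0 : ℝ) 1), c s = α (projIcc 0 1 zero_le_one s) := by
        intro s hs
        rw [projIcc_of_mem _ hs, hα]
      have hcont : Continuous fun r => F (α (projIcc 0 1 zero_le_one r)) :=
        hF.continuous.comp (α.continuous.comp continuous_projIcc)
      have hc : ∀ s, HasDerivAt c (z.2 • F (α (projIcc 0 1 zero_le_one s))) s := by
        intro s
        exact ((intervalIntegral.integral_hasDerivAt_right (hcont.intervalIntegrable _ _)
          (hcont.stronglyMeasurableAtFilter _ _) hcont.continuousAt).const_smul z.2).const_add z.1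
      have hle : ∀ s ∈ Icc (0 : ℝ) 1, s * z.2 ∈ Ioo (0 - e) (0 + e) := by
        intro s hs
        have : |s * z.2| < e := by
          rw [abs_mul, abs_of_nonneg hs.1]
          exact lt_of_le_of_lt (mul_le_of_le_one_left (abs_nonneg _) hs.2) (abs_lt.2 hze)
        simpa using abs_lt.1 this
      have hy' : ∀ s ∈ Icc (0 : ℝ) 1,
          HasDerivAt (fun s => y (s * z.2)) (z.2 • F (y (s * z.2))) s := by
        intro s hs
        exact (hy _ (hle s hs)).scomp s (hasDerivAt_mul_const z.2)
      have hK' : ∀ t : ℝ, LipschitzWith (‖z.2‖₊ * K) fun x => z.2 • F x :=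
        fun t => (lipschitzWith_smul z.2).comp hK
      have hEq := ODE_solution_unique (v := fun _ x => z.2 • F x) (a := 0) (b := 1) hK'
        (f := c) (g := fun s => y (s * z.2))
        (fun s _ => (hc s).continuousAt.continuousWithinAt)
        (fun s hs => by
          rw [hcα s (Ico_subset_Icc_self hs)]
          exact (hc s).hasDerivWithinAt)
        (fun s hs => (hy' s hs).continuousAt.continuousWithinAt)
        (fun s hs => (hy' s (Ico_subset_Icc_self hs)).hasDerivWithinAt)
        (by simp [c, hy0])
      have h1 := hEq (right_mem_Icc.2 zero_le_one)
      simp only [one_mul] at h1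
      rw [← h1, hcα 1 (by simp), projIcc_of_mem _ (by simp : (1 : ℝ) ∈ Icc (0 : ℝ) 1)]
    have h2 : ∀ᶠ z in 𝓝 (g₀, (0 : ℝ)), z.1 ∈ Metric.closedBall g₀ r ∧ z.2 ∈ Ioo (-e) e := by
      rw [nhds_prod_eq]
      exact Eventually.prod_mk (Metric.closedBall_mem_nhds g₀ hr)
        (Ioo_mem_nhds (neg_lt_zero.2 he) he)
    filter_upwards [eventually_eventually_nhds.2 (hψe.and h2)] with z hz
    obtain ⟨y, hy0, hy⟩ := hsol z.1 hz.self_of_nhds.2.1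
    have h3 : Tendsto (fun t : ℝ => (z.1, t)) (𝓝 z.2) (𝓝 z) :=
      Continuous.tendsto (by fun_prop) z.2
    have h4 : (fun t => ψ (z.1, t) one) =ᶠ[𝓝 z.2] y := by
      filter_upwards [h3.eventually hz] with t ht
      exact key (z.1, t) ht.1 ht.2.2 y hy0 hy
    rw [key z hz.self_of_nhds.1 hz.self_of_nhds.2.2 y hy0 hy]
    exact (hy z.2 (by simpa using hz.self_of_nhds.2.2)).congr_of_eventuallyEq h4

/-- A vector field that is smooth near a point has a smooth local flow there. -/
theorem exists_smooth_flow [FiniteDimensional ℝ G] {F : G → G} {g₀ : G}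
    (hF : ∀ᶠ g in 𝓝 g₀, ContDiffAt ℝ ∞ F g) :
    ∃ φ : G × ℝ → G, (∀ᶠ z in 𝓝 (g₀, (0 : ℝ)), ContDiffAt ℝ ∞ φ z) ∧
      (∀ᶠ g in 𝓝 g₀, φ (g, 0) = g) ∧
      ∀ᶠ z in 𝓝 (g₀, (0 : ℝ)), HasDerivAt (fun t => φ (z.1, t)) (F (φ z)) z.2 := by
  have : CompleteSpace G := FiniteDimensional.complete ℝ G
  obtain ⟨r, hr, hrF⟩ := Metric.eventually_nhds_iff_ball.1 hF
  obtain ⟨χ, hχ⟩ : ∃ χ : ContDiffBump g₀, χ.rOut = r / 2 :=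
    ⟨⟨r / 4, r / 2, by positivity, by linarith⟩, rfl⟩
  have hts : tsupport χ ⊆ Metric.ball g₀ r := by
    rw [χ.tsupport_eq, hχ]
    exact Metric.closedBall_subset_ball (by linarith)
  have hs : ContDiff ℝ ∞ fun g => χ g • F g := by
    refine contDiff_iff_contDiffAt.2 fun g => ?_
    by_cases h : g ∈ tsupport χ
    · exact χ.contDiff.contDiffAt.smul (hrF g (hts h))
    · refine (contDiffAt_const (c := (0 : G))).congr_of_eventuallyEq ?_
      filter_upwards [(isClosed_tsupport χ).isOpen_compl.mem_nhds h] with y hy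
      simp [image_eq_zero_of_notMem_tsupport hy]
  obtain ⟨φ, hφ, hφ0, hφ'⟩ := exists_smooth_flow_of_hasCompactSupport hs
    (χ.hasCompactSupport.smul_right) g₀
  refine ⟨φ, hφ, hφ0, ?_⟩
  have hφc : Tendsto φ (𝓝 (g₀, (0 : ℝ))) (𝓝 g₀) := by
    have := hφ.self_of_nhds.continuousAt.tendsto
    rwa [hφ0.self_of_nhds] at this
  filter_upwards [hφ', hφc.eventually χ.eventuallyEq_one] with z hz hz1
  have h1 : χ (φ z) = 1 := hz1
  simpa [h1] using hz

end Flow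

/-! ### The eikonal condition and the equation of null pregeodesics in coordinates -/

section EikonalChart

variable {P E : Type*} [NormedAddCommGroup P] [NormedSpace ℝ P]
  [NormedAddCommGroup E] [NormedSpace ℝ E]

/-- The eikonal condition `K (∂ₜX, dX z) = dt (z)` in coordinates, for a map `X` of the variables
`(y, t)` and a family `K` of bilinear forms depending on the point and on `t`. -/
def ChartEikonalAt (K : E × ℝ → E →L[ℝ] E →L[ℝ] ℝ) (X : P × ℝ → E) (q : P × ℝ) : Prop :=
  ∀ z : P × ℝ, K (X q, q.2) (fderiv ℝ X q (0, 1)) (fderiv ℝ X q z) = z.2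

/-- The covector `K (x'', ·)` prescribed by the equation of null pregeodesics of `K - dt²`
parametrized by `t`, at the point `y = (x, t)` and the velocity `v = x'`. -/
def eikonalForce (K : E × ℝ → E →L[ℝ] E →L[ℝ] ℝ) (y : E × ℝ) (v : E) : E →L[ℝ] ℝ :=
  (1 / 2 : ℝ) • ((ContinuousLinearMap.apply ℝ ℝ v).comp
      ((ContinuousLinearMap.apply ℝ (E →L[ℝ] ℝ) v).comp
        ((fderiv ℝ K y).comp (ContinuousLinearMap.inl ℝ E ℝ))))
    + (1 / 2 * fderiv ℝ K y (0, 1) v v) • K y v - fderiv ℝ K y (v, 1) v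

lemma eikonalForce_apply (K : E × ℝ → E →L[ℝ] E →L[ℝ] ℝ) (y : E × ℝ) (v w : E) :
    eikonalForce K y v w = 1 / 2 * fderiv ℝ K y (w, 0) v v
      + 1 / 2 * fderiv ℝ K y (0, 1) v v * K y v w - fderiv ℝ K y (v, 1) v w := by
  simp [eikonalForce]

variable {K : E × ℝ → E →L[ℝ] E →L[ℝ] ℝ} {X : P × ℝ → E} {q : P × ℝ}

lemma differentiableAt_pairing (hK : DifferentiableAt ℝ K (X q, q.2)) (hX : ContDiffAt ℝ 2 X q)
    (a b : P × ℝ) :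
    DifferentiableAt ℝ (fun q => K (X q, q.2) (fderiv ℝ X q a) (fderiv ℝ X q b)) q ∧
    ∀ ζ, fderiv ℝ (fun q => K (X q, q.2) (fderiv ℝ X q a) (fderiv ℝ X q b)) q ζ
      = fderiv ℝ K (X q, q.2) (fderiv ℝ X q ζ, ζ.2) (fderiv ℝ X q a) (fderiv ℝ X q b)
        + K (X q, q.2) (fderiv ℝ (fderiv ℝ X) q ζ a) (fderiv ℝ X q b)
        + K (X q, q.2) (fderiv ℝ X q a) (fderiv ℝ (fderiv ℝ X) q ζ b) := by
  have hX1 : HasFDerivAt X (fderiv ℝ X q) q := (hX.differentiableAt (by simp)).hasFDerivAt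
  have hX2 : HasFDerivAt (fderiv ℝ X) (fderiv ℝ (fderiv ℝ X) q) q :=
    ((hX.fderiv_right (m := 1) (by norm_num)).differentiableAt (by simp)).hasFDerivAt
  have h1 : HasFDerivAt (fun q : P × ℝ => K (X q, q.2))
      ((fderiv ℝ K (X q, q.2)).comp ((fderiv ℝ X q).prod (ContinuousLinearMap.snd ℝ P ℝ))) q :=
    HasFDerivAt.comp q (f := fun q : P × ℝ => (X q, q.2)) hK.hasFDerivAt
      (hX1.prodMk hasFDerivAt_snd)
  have h2 := (h1.clm_apply (hX2.clm_apply (hasFDerivAt_const a q))).clm_apply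
    (hX2.clm_apply (hasFDerivAt_const b q))
  refine ⟨h2.differentiableAt, fun ζ => ?_⟩
  rw [h2.fderiv]
  simp
  ring

/-- The eikonal condition implies the equation of null pregeodesics: differentiate
`K (∂ₜX, dX z) = dt (z)` in `t` and `K (∂ₜX, ∂ₜX) = 1` in the direction `z`. -/
lemma accel_eq_of_chartEikonal (hK : DifferentiableAt ℝ K (X q, q.2))
    (hsymm : ∀ v w, K (X q, q.2) v w = K (X q, q.2) w v)
    (hX : ContDiffAt ℝ 2 X q) (he : ∀ᶠ q' in 𝓝 q, ChartEikonalAt K X q') (z : P × ℝ) :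
    K (X q, q.2) (fderiv ℝ (fderiv ℝ X) q (0, 1) (0, 1)) (fderiv ℝ X q z)
      = eikonalForce K (X q, q.2) (fderiv ℝ X q (0, 1)) (fderiv ℝ X q z) := by
  have hs : IsSymmSndFDerivAt ℝ X q :=
    hX.isSymmSndFDerivAt (by rw [minSmoothness_of_isRCLikeNormedField])
  have h1 := (differentiableAt_pairing hK hX (0, 1) z).2 (0, 1)
  have h2 := (differentiableAt_pairing hK hX (0, 1) (0, 1)).2 z
  have e1 : (fun q : P × ℝ => K (X q, q.2) (fderiv ℝ X q (0, 1)) (fderiv ℝ X q z))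
      =ᶠ[𝓝 q] fun _ => z.2 := by
    filter_upwards [he] with q' hq' using hq' z
  have e2 : (fun q : P × ℝ => K (X q, q.2) (fderiv ℝ X q (0, 1)) (fderiv ℝ X q (0, 1)))
      =ᶠ[𝓝 q] fun _ => 1 := by
    filter_upwards [he] with q' hq' using hq' (0, 1)
  rw [e1.fderiv_eq] at h1
  rw [e2.fderiv_eq] at h2
  simp only [fderiv_fun_const, Pi.zero_apply, _root_.zero_apply] at h1 h2
  rw [hs.eq z (0, 1), hsymm (fderiv ℝ (fderiv ℝ X) q (0, 1) z)] at h2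
  have h3 : (fderiv ℝ X q z, z.2) = (fderiv ℝ X q z, (0 : ℝ)) + z.2 • ((0 : E), (1 : ℝ)) := by
    ext <;> simp
  rw [h3, map_add, map_smul] at h2
  have h4 := he.self_of_nhds z
  rw [eikonalForce_apply, h4]
  simp only [_root_.add_apply, _root_.smul_apply, smul_eq_mul] at h1 h2
  linarith

/-- A solution of a linear homogeneous scalar equation vanishing at `0` is zero. -/
lemma eq_zero_of_hasDerivAt_mul {u c : ℝ → ℝ} {r : ℝ} (hc : ContinuousOn c (Ioo (-r) r))
    (hu : ∀ t ∈ Ioo (-r) r, HasDerivAt u (c t * u t) t) (h0 : u 0 = 0) :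
    ∀ t ∈ Ioo (-r) r, u t = 0 := by
  intro t ht
  obtain ⟨s, hs1, hs2⟩ := exists_between (abs_lt.2 ht)
  have hs0 : 0 < s := (abs_nonneg t).trans_lt hs1
  have hsub : Icc (-s) s ⊆ Ioo (-r) r := fun x hx => ⟨by linarith [hx.1], by linarith [hx.2]⟩
  obtain ⟨C, hC⟩ := isCompact_Icc.exists_bound_of_continuousOn (hc.mono hsub)
  have hL : ∀ x ∈ Ioo (-s) s, LipschitzOnWith C.toNNReal (fun y => c x * y) univ := by
    intro x hx
    refine LipschitzOnWith.of_dist_le_mul fun y _ y' _ => ?_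
    rw [Real.dist_eq, Real.dist_eq, ← mul_sub, abs_mul]
    gcongr
    exact (hC x (Ioo_subset_Icc_self hx)).trans (Real.le_coe_toNNReal C)
  exact ODE_solution_unique_of_mem_Ioo (v := fun x y => c x * y) (s := fun _ => univ) hL
    (t₀ := 0) (f := u) (g := fun _ => 0) ⟨by linarith, hs0⟩
    (fun x hx => ⟨hu x (hsub (Ioo_subset_Icc_self hx)), mem_univ _⟩)
    (fun x _ => ⟨by simpa using hasDerivAt_const x (0 : ℝ), mem_univ _⟩) h0
    (abs_lt.1 hs1)

/-- Conversely, for solutions of the equation of null pregeodesics the eikonal condition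
propagates from `t = 0`. -/
lemma chartEikonal_of_accel_eq {y₀ : P}
    (hX : ∀ᶠ q in 𝓝 (y₀, (0 : ℝ)), ContDiffAt ℝ 2 X q)
    (hK : ∀ᶠ q in 𝓝 (y₀, (0 : ℝ)), ContDiffAt ℝ 1 K (X q, q.2))
    (hsymm : ∀ᶠ q in 𝓝 (y₀, (0 : ℝ)), ∀ v w, K (X q, q.2) v w = K (X q, q.2) w v)
    (hacc : ∀ᶠ q in 𝓝 (y₀, (0 : ℝ)), ∀ w,
      K (X q, q.2) (fderiv ℝ (fderiv ℝ X) q (0, 1) (0, 1)) w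
        = eikonalForce K (X q, q.2) (fderiv ℝ X q (0, 1)) w)
    (h0 : ∀ᶠ y in 𝓝 y₀, ChartEikonalAt K X (y, 0)) :
    ∀ᶠ q in 𝓝 (y₀, (0 : ℝ)), ChartEikonalAt K X q := by
  have hall := (hX.and (hK.and (hsymm.and hacc))).and ((continuous_fst.tendsto _).eventually h0)
  obtain ⟨r, hr, hball⟩ := Metric.eventually_nhds_iff_ball.1 hall
  rw [← ball_prod_same] at hball
  have hbox : ∀ y ∈ Metric.ball y₀ r, ∀ t ∈ Ioo (-r) r, _ :=
    fun y hy t ht => hball (y, t) ⟨hy, by simpa [Real.dist_eq] using abs_lt.2 ht⟩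
  -- the coefficient of the scalar equations
  have hcont : ∀ y ∈ Metric.ball y₀ r, ContinuousOn (fun t : ℝ =>
      fderiv ℝ K (X (y, t), t) (0, 1) (fderiv ℝ X (y, t) (0, 1)) (fderiv ℝ X (y, t) (0, 1)))
      (Ioo (-r) r) := by
    intro y hy t ht
    obtain ⟨⟨hX, hK, -⟩, -⟩ := hbox y hy t ht
    have c0 : ContinuousAt (fun t : ℝ => (y, t)) t := by fun_prop
    have c1 : ContinuousAt (fun t : ℝ => fderiv ℝ X (y, t)) t :=
      ContinuousAt.comp (f := fun t : ℝ => (y, t))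
        (hX.fderiv_right (m := 1) (by norm_num)).continuousAt c0
    have c2 : ContinuousAt (fun t : ℝ => fderiv ℝ K (X (y, t), t)) t := by
      refine ContinuousAt.comp (f := fun t : ℝ => (X (y, t), t)) (g := fderiv ℝ K) ?_ ?_
      · exact (hK.fderiv_right (m := 0) (by norm_num)).continuousAt
      · exact (ContinuousAt.comp (f := fun t : ℝ => (y, t)) hX.continuousAt c0).prodMk
          continuousAt_id
    exact (((c2.clm_apply continuousAt_const).clm_apply (c1.clm_apply continuousAt_const)).clm_apply
      (c1.clm_apply continuousAt_const)).continuousWithinAt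
  have hder : ∀ y ∈ Metric.ball y₀ r, ∀ t ∈ Ioo (-r) r, ∀ z : P × ℝ,
      HasDerivAt (fun t : ℝ => K (X (y, t), t) (fderiv ℝ X (y, t) (0, 1)) (fderiv ℝ X (y, t) z))
        (fderiv ℝ K (X (y, t), t) (fderiv ℝ X (y, t) (0, 1), 1)
            (fderiv ℝ X (y, t) (0, 1)) (fderiv ℝ X (y, t) z)
          + eikonalForce K (X (y, t), t) (fderiv ℝ X (y, t) (0, 1)) (fderiv ℝ X (y, t) z)
          + K (X (y, t), t) (fderiv ℝ X (y, t) (0, 1))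
            (fderiv ℝ (fderiv ℝ X) (y, t) (0, 1) z)) t := by
    intro y hy t ht z
    obtain ⟨⟨hX, hK, -, hacc⟩, -⟩ := hbox y hy t ht
    obtain ⟨hd, hd'⟩ := differentiableAt_pairing (q := (y, t)) (hK.differentiableAt (by simp)) hX
      (0, 1) z
    have h1 := hd.hasFDerivAt.comp_hasDerivAt t
      ((hasDerivAt_const t y).prodMk (hasDerivAt_id t))
    rw [hd' (0, 1)] at h1
    rw [← hacc]
    exact h1
  -- `K (∂ₜX, ∂ₜX) - 1` solves a homogeneous linear equation in `t`
  have hspeed : ∀ y ∈ Metric.ball y₀ r, ∀ t ∈ Ioo (-r) r,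
      K (X (y, t), t) (fderiv ℝ X (y, t) (0, 1)) (fderiv ℝ X (y, t) (0, 1)) = 1 := by
    intro y hy t ht
    rw [← sub_eq_zero]
    refine eq_zero_of_hasDerivAt_mul (r := r) (u := fun t => K (X (y, t), t)
      (fderiv ℝ X (y, t) (0, 1)) (fderiv ℝ X (y, t) (0, 1)) - 1) (hcont y hy)
      (fun t ht => ?_) ?_ t ht
    · obtain ⟨⟨-, -, hsymm, hacc⟩, -⟩ := hbox y hy t ht
      convert! (hder y hy t ht (0, 1)).sub_const 1 using 1
      rw [hsymm (fderiv ℝ X (y, t) (0, 1)) (fderiv ℝ (fderiv ℝ X) (y, t) (0, 1) (0, 1)), hacc,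
        eikonalForce_apply]
      have h3 : (fderiv ℝ X (y, t) (0, 1), (1 : ℝ))
          = (fderiv ℝ X (y, t) (0, 1), (0 : ℝ)) + ((0 : E), (1 : ℝ)) := by
        ext <;> simp
      rw [h3, map_add]
      simp only [_root_.add_apply]
      ring
    · have := (hbox y hy t ht).2 (0, 1)
      simpa [sub_eq_zero] using this
  have hopen : ∀ᶠ q in 𝓝 (y₀, (0 : ℝ)), q ∈ Metric.ball y₀ r ×ˢ Ioo (-r) r :=
    (Metric.isOpen_ball.prod isOpen_Ioo).mem_nhds ⟨Metric.mem_ball_self hr, by simp [hr]⟩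
  filter_upwards [hopen]
  rintro ⟨y, t⟩ ⟨hy, ht⟩ z
  rw [← sub_eq_zero]
  -- Since the speed is `1`, so does `K (∂ₜX, dX z) - dt (z)`, with half the coefficient.
  refine eq_zero_of_hasDerivAt_mul (r := r) (u := fun t => K (X (y, t), t)
    (fderiv ℝ X (y, t) (0, 1)) (fderiv ℝ X (y, t) z) - z.2)
    (c := fun t => 1 / 2 * fderiv ℝ K (X (y, t), t) (0, 1) (fderiv ℝ X (y, t) (0, 1))
      (fderiv ℝ X (y, t) (0, 1)))
    (continuousOn_const.mul (hcont y hy)) (fun t ht => ?_) ?_ t ht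
  · obtain ⟨⟨hX, hK, hsymm, hacc⟩, -⟩ := hbox y hy t ht
    convert! (hder y hy t ht z).sub_const z.2 using 1
    have hs : IsSymmSndFDerivAt ℝ X (y, t) :=
      hX.isSymmSndFDerivAt (by rw [minSmoothness_of_isRCLikeNormedField])
    have h2 := (differentiableAt_pairing (q := (y, t)) (hK.differentiableAt (by simp)) hX
      (0, 1) (0, 1)).2 z
    have e2 : (fun q : P × ℝ => K (X q, q.2) (fderiv ℝ X q (0, 1)) (fderiv ℝ X q (0, 1)))
        =ᶠ[𝓝 (y, t)] fun _ => 1 := by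
      filter_upwards [(Metric.isOpen_ball.prod isOpen_Ioo).mem_nhds
        (⟨hy, ht⟩ : (y, t) ∈ Metric.ball y₀ r ×ˢ Ioo (-r) r)] with q' hq'
      exact hspeed q'.1 hq'.1 q'.2 hq'.2
    rw [e2.fderiv_eq] at h2
    simp only [fderiv_fun_const, Pi.zero_apply, _root_.zero_apply] at h2
    rw [hs.eq z (0, 1), hsymm (fderiv ℝ (fderiv ℝ X) (y, t) (0, 1) z)] at h2
    have h3 : (fderiv ℝ X (y, t) z, z.2)
        = (fderiv ℝ X (y, t) z, (0 : ℝ)) + z.2 • ((0 : E), (1 : ℝ)) := by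
      ext <;> simp
    rw [h3, map_add, map_smul] at h2
    rw [eikonalForce_apply]
    simp only [_root_.add_apply, _root_.smul_apply, smul_eq_mul] at h2
    linarith
  · have := (hbox y hy t ht).2 z
    simpa [sub_eq_zero] using this

end EikonalChart

/-! ### Solutions of the equation of null pregeodesics: existence -/

section PregeodesicODE

universe u

variable {P : Type*} {E : Type u} [NormedAddCommGroup P] [NormedSpace ℝ P]
  [NormedAddCommGroup E] [NormedSpace ℝ E] [FiniteDimensional ℝ E]

omit [FiniteDimensional ℝ E] in
lemma contDiffAt_eikonalForce {K : E × ℝ → E →L[ℝ] E →L[ℝ] ℝ} {y : E × ℝ}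
    (hK : ContDiffAt ℝ ∞ K y) (v : E) :
    ContDiffAt ℝ ∞ (fun p : (E × ℝ) × E => eikonalForce K p.1 p.2) (y, v) := by
  have h1 : ContDiffAt ℝ ∞ (fun p : (E × ℝ) × E => fderiv ℝ K p.1) (y, v) :=
    (hK.fderiv_right (m := ∞) le_rfl).comp (y, v) contDiffAt_fst
  have h2 : ContDiffAt ℝ ∞ (fun p : (E × ℝ) × E => K p.1) (y, v) :=
    hK.comp (y, v) contDiffAt_fst
  have h3 : ContDiffAt ℝ ∞ (fun p : (E × ℝ) × E =>
      (ContinuousLinearMap.apply ℝ ℝ : E →L[ℝ] (E →L[ℝ] ℝ) →L[ℝ] ℝ) p.2) (y, v) :=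
    (ContinuousLinearMap.contDiff _).contDiffAt.comp (y, v) contDiffAt_snd
  have h4 : ContDiffAt ℝ ∞ (fun p : (E × ℝ) × E =>
      (ContinuousLinearMap.apply ℝ (E →L[ℝ] ℝ) :
        E →L[ℝ] (E →L[ℝ] E →L[ℝ] ℝ) →L[ℝ] E →L[ℝ] ℝ) p.2) (y, v) :=
    (ContinuousLinearMap.contDiff _).contDiffAt.comp (y, v) contDiffAt_snd
  have hsnd : ContDiffAt ℝ ∞ (fun p : (E × ℝ) × E => p.2) (y, v) := contDiffAt_snd
  have h5 := h3.clm_comp (h4.clm_comp (h1.clm_comp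
    (contDiffAt_const (c := ContinuousLinearMap.inl ℝ E ℝ))))
  have h6 := ((h1.clm_apply (contDiffAt_const (c := ((0 : E), (1 : ℝ))))).clm_apply
    hsnd).clm_apply hsnd
  have h7 := h2.clm_apply hsnd
  have h8 := (h1.clm_apply (hsnd.prodMk (contDiffAt_const (c := (1 : ℝ))))).clm_apply hsnd
  have h9 := contDiffAt_const (c := (1 / 2 : ℝ)).smul h5
  have h10 := (contDiffAt_const (c := (1 / 2 : ℝ)).mul h6).smul h7
  unfold eikonalForce
  exact (h9.add h10).sub h8

/-- The equation of null pregeodesics as an autonomous first order system in the variables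
`((x, t), v)`. -/
def eikonalField (K : E × ℝ → E →L[ℝ] E →L[ℝ] ℝ) (p : (E × ℝ) × E) : (E × ℝ) × E :=
  ((p.2, 1), (K p.1).inverse (eikonalForce K p.1 p.2))

lemma contDiffAt_eikonalField {K : E × ℝ → E →L[ℝ] E →L[ℝ] ℝ} {y : E × ℝ}
    (hK : ContDiffAt ℝ ∞ K y) (hi : (K y).IsInvertible) (v : E) :
    ContDiffAt ℝ ∞ (eikonalField K) (y, v) := by
  have := FiniteDimensional.complete ℝ E
  have h1 : ContDiffAt ℝ ∞ (fun p : (E × ℝ) × E => (K p.1).inverse) (y, v) := by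
    obtain ⟨e, he⟩ := hi
    have h2 : ContDiffAt ℝ ∞ (ContinuousLinearMap.inverse) (K y) := by
      rw [← he]; exact contDiffAt_map_inverse e
    exact h2.comp (y, v) (hK.comp (y, v) contDiffAt_fst)
  exact (contDiffAt_snd.prodMk contDiffAt_const).prodMk
    (h1.clm_apply (contDiffAt_eikonalForce hK v))

lemma eventually_isInvertible {K : E × ℝ → E →L[ℝ] E →L[ℝ] ℝ} {y : E × ℝ}
    (hK : ContinuousAt K y) (hi : (K y).IsInvertible) : ∀ᶠ y' in 𝓝 y, (K y').IsInvertible := by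
  have := FiniteDimensional.complete ℝ E
  have ho : IsOpen {A : E →L[ℝ] E →L[ℝ] ℝ | A.IsInvertible} := ContinuousLinearEquiv.isOpen
  exact hK.eventually (ho.mem_nhds hi)

/-- Solutions of the equation of null pregeodesics with smooth initial position and velocity. -/
lemma exists_accel_eq {K : E × ℝ → E →L[ℝ] E →L[ℝ] ℝ} {x V : P → E} {y₀ : P}
    (hK : ∀ᶠ y in 𝓝 (x y₀, (0 : ℝ)), ContDiffAt ℝ ∞ K y) (hi : (K (x y₀, 0)).IsInvertible)
    (hx : ∀ᶠ y in 𝓝 y₀, ContDiffAt ℝ ∞ x y) (hV : ∀ᶠ y in 𝓝 y₀, ContDiffAt ℝ ∞ V y) :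
    ∃ X : P × ℝ → E, (∀ᶠ q in 𝓝 (y₀, (0 : ℝ)), ContDiffAt ℝ ∞ X q) ∧
      (∀ᶠ y in 𝓝 y₀, X (y, 0) = x y ∧ fderiv ℝ X (y, 0) (0, 1) = V y) ∧
      ∀ᶠ q in 𝓝 (y₀, (0 : ℝ)), ∀ w,
        K (X q, q.2) (fderiv ℝ (fderiv ℝ X) q (0, 1) (0, 1)) w
          = eikonalForce K (X q, q.2) (fderiv ℝ X q (0, 1)) w := by
  have := FiniteDimensional.complete ℝ E
  let g₀ : (E × ℝ) × E := ((x y₀, 0), V y₀)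
  have hinv := eventually_isInvertible hK.self_of_nhds.continuousAt hi
  have hF : ∀ᶠ g in 𝓝 g₀, ContDiffAt ℝ ∞ (eikonalField K) g := by
    filter_upwards [(continuous_fst.tendsto g₀).eventually (hK.and hinv)] with g hg
    exact contDiffAt_eikonalField hg.1 hg.2 g.2
  obtain ⟨φ, hφ, hφ0, hφ'⟩ := exists_smooth_flow hF
  -- `Y` is the flow of `eikonalField` from the initial data; `X` is its first component.
  let i : P × ℝ → ((E × ℝ) × E) × ℝ := fun q => (((x q.1, 0), V q.1), q.2)
  have hi : ∀ᶠ q in 𝓝 (y₀, (0 : ℝ)), ContDiffAt ℝ ∞ i q := by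
    filter_upwards [(continuous_fst.tendsto (y₀, (0 : ℝ))).eventually (hx.and hV)] with q hq
    have h1 := hq.1.comp q contDiffAt_fst
    have h2 := hq.2.comp q contDiffAt_fst
    exact ((h1.prodMk contDiffAt_const).prodMk h2).prodMk contDiffAt_snd
  have hit : Tendsto i (𝓝 (y₀, 0)) (𝓝 (g₀, 0)) := hi.self_of_nhds.continuousAt
  let Y : P × ℝ → (E × ℝ) × E := fun q => φ (i q)
  have hY : ∀ᶠ q in 𝓝 (y₀, (0 : ℝ)), ContDiffAt ℝ ∞ Y q := by
    filter_upwards [hi, hit.eventually hφ] with q h1 h2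
    exact h2.comp q h1
  have hYt : Tendsto Y (𝓝 (y₀, 0)) (𝓝 g₀) := by
    have := hY.self_of_nhds.continuousAt.tendsto
    have h1 : Y (y₀, 0) = g₀ := hφ0.self_of_nhds
    rwa [h1] at this
  have h0t : Tendsto (fun y : P => (y, (0 : ℝ))) (𝓝 y₀) (𝓝 (y₀, 0)) :=
    Continuous.tendsto (by fun_prop) y₀
  have hY0 : ∀ᶠ y in 𝓝 y₀, Y (y, 0) = ((x y, 0), V y) := by
    have : Tendsto (fun y => (i (y, 0)).1) (𝓝 y₀) (𝓝 g₀) :=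
      (continuous_fst.tendsto _).comp (hit.comp h0t)
    exact this.eventually hφ0
  have hYd : ∀ᶠ q in 𝓝 (y₀, (0 : ℝ)), fderiv ℝ Y q (0, 1) = eikonalField K (Y q) := by
    filter_upwards [hY, hit.eventually hφ'] with q h1 h2
    have h3 := (h1.differentiableAt (by simp)).hasFDerivAt.comp_hasDerivAt q.2
      ((hasDerivAt_const q.2 q.1).prodMk (hasDerivAt_id q.2))
    exact h3.unique h2
  have hYd' : ∀ᶠ q in 𝓝 (y₀, (0 : ℝ)), ∀ z, fderiv ℝ Y q z
      = ((fderiv ℝ (fun q => (Y q).1.1) q z, fderiv ℝ (fun q => (Y q).1.2) q z),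
          fderiv ℝ (fun q => (Y q).2) q z) := by
    filter_upwards [hY] with q hq z
    have h := (hq.differentiableAt (by simp)).hasFDerivAt
    have h11 := h.fst.fst.fderiv
    have h12 := h.fst.snd.fderiv
    have h2 := h.snd.fderiv
    rw [h11, h12, h2]
    rfl
  -- The time component of the flow is `t`.
  have htime : ∀ᶠ q in 𝓝 (y₀, (0 : ℝ)), (Y q).1.2 = q.2 := by
    obtain ⟨r, hr, hball⟩ := Metric.eventually_nhds_iff_ball.1
      (hY.and (hYd.and ((continuous_fst.tendsto (y₀, (0 : ℝ))).eventually hY0)))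
    rw [← ball_prod_same, Real.ball_eq_Ioo, zero_sub, zero_add] at hball
    have hopen : ∀ᶠ q in 𝓝 (y₀, (0 : ℝ)), q ∈ Metric.ball y₀ r ×ˢ Ioo (-r) r :=
      (Metric.isOpen_ball.prod isOpen_Ioo).mem_nhds ⟨Metric.mem_ball_self hr, by simp [hr]⟩
    filter_upwards [hopen]
    rintro ⟨y, t⟩ ⟨hy, ht⟩
    rw [← sub_eq_zero]
    refine eq_zero_of_hasDerivAt_mul (r := r) (c := fun _ => 0) (u := fun t => (Y (y, t)).1.2 - t)
      continuousOn_const (fun t ht => ?_) ?_ t ht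
    · obtain ⟨h1, h2, -⟩ := hball (y, t) ⟨hy, ht⟩
      have h3 := (h1.differentiableAt (by simp)).hasFDerivAt.comp_hasDerivAt t
        ((hasDerivAt_const t y).prodMk (hasDerivAt_id t))
      rw [h2] at h3
      have h4 : HasDerivAt (fun t => (Y (y, t)).1.2) 1 t := by
        simpa [eikonalField] using! ((ContinuousLinearMap.snd ℝ E ℝ).comp
          (ContinuousLinearMap.fst ℝ (E × ℝ) E)).hasFDerivAt.comp_hasDerivAt t h3
      simpa using! h4.sub (hasDerivAt_id' t)
    · have := (hball (y, t) ⟨hy, ht⟩).2.2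
      simp only at this
      simp [this]
  refine ⟨fun q => (Y q).1.1, ?_, ?_, ?_⟩
  · filter_upwards [hY] with q hq using hq.fst.fst
  · filter_upwards [hY0, h0t.eventually hYd, h0t.eventually hYd'] with y h1 h2 h3
    refine ⟨by rw [h1], ?_⟩
    rw [h3, h1] at h2
    exact congrArg (fun a : (E × ℝ) × E => a.1.1) h2
  · filter_upwards [hYd.eventually_nhds, hYd'.eventually_nhds, htime,
      hYt.eventually ((continuous_fst.tendsto g₀).eventually hinv), hY] with q h1 h2 h3 h4 h5 w
    have hv : (fun q => fderiv ℝ (fun q => (Y q).1.1) q (0, 1)) =ᶠ[𝓝 q] fun q => (Y q).2 := by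
      filter_upwards [h1, h2] with q' h1 h2
      rw [h2] at h1
      exact congrArg (fun a : (E × ℝ) × E => a.1.1) h1
    have hX2 : ContDiffAt ℝ 2 (fun q => (Y q).1.1) q := h5.fst.fst.of_le
      (WithTop.coe_le_coe.2 le_top)
    have hd := ((hX2.fderiv_right (m := 1) (by norm_num)).differentiableAt
      (by simp)).hasFDerivAt.clm_apply (hasFDerivAt_const ((0 : P), (1 : ℝ)) q)
    have h6 : fderiv ℝ (fderiv ℝ fun q => (Y q).1.1) q (0, 1) (0, 1)
        = fderiv ℝ (fun q => (Y q).2) q (0, 1) := by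
      rw [← hv.fderiv_eq, hd.fderiv]
      simp
    have h7 := h1.self_of_nhds
    rw [h2.self_of_nhds] at h7
    have h8 : fderiv ℝ (fun q => (Y q).2) q (0, 1) = _ :=
      congrArg (fun a : (E × ℝ) × E => a.2) h7
    have h9 : (Y q).1 = ((Y q).1.1, q.2) := by rw [← h3]
    have h10 : ∀ f, K (Y q).1 ((K (Y q).1).inverse f) = f := by
      obtain ⟨e, he⟩ := h4
      intro f
      rw [← he, ContinuousLinearMap.inverse_equiv]
      exact e.apply_symm_apply f
    have h11 : fderiv ℝ (fun q => (Y q).1.1) q (0, 1) = (Y q).2 := hv.self_of_nhds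
    rw [h6, h8, h11, ← h9, eikonalField]
    simp only [h10]

end PregeodesicODE

/-! ### Solutions of the equation of null pregeodesics: uniqueness -/

section PregeodesicODE

universe u

variable {E : Type u} [NormedAddCommGroup E] [NormedSpace ℝ E] [FiniteDimensional ℝ E]

/-- Solutions of the equation of null pregeodesics are determined by position and velocity at one
time. -/
lemma eventuallyEq_of_accel_eq {K : E × ℝ → E →L[ℝ] E →L[ℝ] ℝ} {u u' v v' a a' : ℝ → E} {t₀ : ℝ}
    (hK : ContDiffAt ℝ ∞ K (u t₀, t₀)) (hi : (K (u t₀, t₀)).IsInvertible)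
    (hu : ∀ᶠ t in 𝓝 t₀, HasDerivAt u (v t) t ∧ HasDerivAt v (a t) t ∧
      ∀ w, K (u t, t) (a t) w = eikonalForce K (u t, t) (v t) w)
    (hu' : ∀ᶠ t in 𝓝 t₀, HasDerivAt u' (v' t) t ∧ HasDerivAt v' (a' t) t ∧
      ∀ w, K (u' t, t) (a' t) w = eikonalForce K (u' t, t) (v' t) w)
    (h0 : u t₀ = u' t₀) (h1 : v t₀ = v' t₀) : u =ᶠ[𝓝 t₀] u' := by
  obtain ⟨L, s, hs, hL⟩ := ((contDiffAt_eikonalField hK hi (v t₀)).of_le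
    (m := 1) (by simp)).exists_lipschitzOnWith
  -- Both curves lift to integral curves of `eikonalField`.
  have key : ∀ {u v a : ℝ → E}, (K (u t₀, t₀)).IsInvertible → ContDiffAt ℝ ∞ K (u t₀, t₀) →
      s ∈ 𝓝 ((u t₀, t₀), v t₀) →
      (∀ᶠ t in 𝓝 t₀, HasDerivAt u (v t) t ∧ HasDerivAt v (a t) t ∧
        ∀ w, K (u t, t) (a t) w = eikonalForce K (u t, t) (v t) w) →
      ∀ᶠ t in 𝓝 t₀, HasDerivAt (fun t => ((u t, t), v t)) (eikonalField K ((u t, t), v t)) t ∧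
        ((u t, t), v t) ∈ s := by
    intro u v a hi hK hs hu
    have hc : Tendsto (fun t => (u t, t)) (𝓝 t₀) (𝓝 (u t₀, t₀)) :=
      hu.self_of_nhds.1.continuousAt.prodMk continuousAt_id
    have hc' : Tendsto (fun t => ((u t, t), v t)) (𝓝 t₀) (𝓝 ((u t₀, t₀), v t₀)) :=
      hc.prodMk_nhds hu.self_of_nhds.2.1.continuousAt
    filter_upwards [hu, hc.eventually (eventually_isInvertible hK.continuousAt hi), hc' hs]
      with t ht hit hst
    refine ⟨?_, hst⟩
    have hd := (ht.1.prodMk (hasDerivAt_id t)).prodMk ht.2.1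
    have : eikonalField K ((u t, t), v t) = ((v t, 1), a t) := by
      obtain ⟨e, he⟩ := hit
      have h2 : K (u t, t) (a t) = eikonalForce K (u t, t) (v t) :=
        ContinuousLinearMap.ext ht.2.2
      rw [eikonalField, ← h2]
      simp only [Prod.mk.injEq, true_and]
      rw [← he, ContinuousLinearMap.inverse_equiv]
      exact e.symm_apply_apply _
    rw [this]
    exact hd
  have := ODE_solution_unique_of_eventually (v := fun _ => eikonalField K) (s := fun _ => s)
    (.of_forall fun _ => hL) (key hi hK hs hu)
    (key (h0 ▸ hi) (h0 ▸ hK) (h0 ▸ h1 ▸ hs) hu') (by simp [h0, h1])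
  filter_upwards [this] with t ht
  exact congrArg (fun p : (E × ℝ) × E => p.1.1) ht

end PregeodesicODE

/-! ### The inverse function theorem on manifolds -/

section InverseFunction

variable {F F' H H' : Type*} [NormedAddCommGroup F] [NormedSpace ℝ F] [FiniteDimensional ℝ F]
  [NormedAddCommGroup F'] [NormedSpace ℝ F'] [FiniteDimensional ℝ F']
  [TopologicalSpace H] [TopologicalSpace H']
  {I : ModelWithCorners ℝ F H} {J : ModelWithCorners ℝ F' H'} [I.Boundaryless]
  {N N' : Type*} [TopologicalSpace N] [ChartedSpace H N] [IsManifold I ∞ N]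
  [TopologicalSpace N'] [ChartedSpace H' N'] [IsManifold J ∞ N']

/-- The inverse function theorem on manifolds without boundary. -/
lemma exists_local_inverse {f : N → N'} {x₀ : N} (hf : ∀ᶠ x in 𝓝 x₀, ContMDiffAt I J ∞ f x)
    (hb : Function.Bijective (mfderiv I J f x₀)) :
    ∃ g : N' → N, (∀ᶠ y in 𝓝 (f x₀), ContMDiffAt J I ∞ g y ∧ f (g y) = y) ∧
      ∀ᶠ x in 𝓝 x₀, g (f x) = x := by
  have := FiniteDimensional.complete ℝ F
  have := FiniteDimensional.complete ℝ F'
  set φ := extChartAt I x₀ with hφ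
  set φ' := extChartAt J (f x₀) with hφ'
  set f' : F → F' := φ' ∘ f ∘ φ.symm with hf'
  have hfc : ContinuousAt f x₀ := hf.self_of_nhds.continuousAt
  have hsymm : Tendsto φ.symm (𝓝 (φ x₀)) (𝓝 x₀) := by
    simpa [hφ] using (continuousAt_extChartAt_symm (I := I) x₀).tendsto
  have hsymm' : Tendsto φ'.symm (𝓝 (φ' (f x₀))) (𝓝 (f x₀)) := by
    simpa [hφ'] using (continuousAt_extChartAt_symm (I := J) (f x₀)).tendsto
  have htgt : ∀ᶠ z in 𝓝 (φ x₀), z ∈ φ.target := by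
    have := extChartAt_target_mem_nhdsWithin (I := I) x₀
    rwa [I.range_eq_univ, nhdsWithin_univ] at this
  have hsmooth : ∀ᶠ z in 𝓝 (φ x₀), ContDiffAt ℝ ∞ f' z := by
    have h1 : ∀ᶠ x in 𝓝 x₀, f x ∈ (chartAt H' (f x₀)).source :=
      hfc.eventually (chart_source_mem_nhds H' (f x₀))
    filter_upwards [hsymm.eventually (hf.and h1), htgt] with z hz hzt
    have h2 : φ.symm z ∈ (chartAt H x₀).source := by
      rw [← extChartAt_source I]; exact φ.map_target hzt
    have h3 := ((contMDiffAt_iff_of_mem_source (I := I) (I' := J) h2 hz.2).1 hz.1).2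
    rw [φ.right_inv hzt, I.range_eq_univ, contDiffWithinAt_univ] at h3
    exact h3
  have hd0 : fderiv ℝ f' (φ x₀) = mfderiv I J f x₀ := by
    have h1 : fderivWithin ℝ f' (range I) (φ x₀) = fderiv ℝ f' (φ x₀) := by
      rw [I.range_eq_univ, fderivWithin_univ]
    exact h1.symm.trans (hf.self_of_nhds.mdifferentiableAt (by simp)).mfderiv.symm
  -- the inverse function theorem, for the expression `f'` of `f` in charts
  let A : F ≃L[ℝ] F' := ContinuousLinearEquiv.ofBijective (fderiv ℝ f' (φ x₀))
    (by rw [hd0, LinearMap.ker_eq_bot]; exact hb.1)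
      (by rw [hd0, LinearMap.range_eq_top]; exact hb.2)
  have hA : HasFDerivAt f' (A : F →L[ℝ] F') (φ x₀) :=
    (hsmooth.self_of_nhds.differentiableAt (by simp)).hasFDerivAt
  set e := hsmooth.self_of_nhds.toOpenPartialHomeomorph f' hA (by simp) with he
  have hes : φ x₀ ∈ e.source := hsmooth.self_of_nhds.mem_toOpenPartialHomeomorph_source hA _
  have hecoe : (e : F → F') = f' := rfl
  have hf0 : f' (φ x₀) = φ' (f x₀) := by simp [hf', hφ]
  have het : φ' (f x₀) ∈ e.target := by rw [← hf0, ← hecoe]; exact e.map_source hes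
  have hes0 : e.symm (φ' (f x₀)) = φ x₀ := by
    rw [← hf0, ← hecoe]; exact e.left_inv hes
  have hec : Tendsto e.symm (𝓝 (φ' (f x₀))) (𝓝 (φ x₀)) := by
    have := (e.symm.continuousAt het).tendsto
    rwa [hes0] at this
  have hinv : ∀ᶠ z in 𝓝 (φ x₀), (fderiv ℝ f' z).IsInvertible := by
    have ho : IsOpen {B : F →L[ℝ] F' | B.IsInvertible} := ContinuousLinearEquiv.isOpen
    have hc : ContinuousAt (fderiv ℝ f') (φ x₀) :=
      (hsmooth.self_of_nhds.fderiv_right (m := 0) (by simp)).continuousAt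
    exact hc.eventually (ho.mem_nhds ⟨A, rfl⟩)
  have hφc : Tendsto φ (𝓝 x₀) (𝓝 (φ x₀)) := (continuousAt_extChartAt (I := I) x₀).tendsto
  have hφ'c : Tendsto φ' (𝓝 (f x₀)) (𝓝 (φ' (f x₀))) :=
    (continuousAt_extChartAt (I := J) (f x₀)).tendsto
  refine ⟨φ.symm ∘ e.symm ∘ φ', ?_, ?_⟩
  · have h1 : Tendsto (φ.symm ∘ e.symm ∘ φ') (𝓝 (f x₀)) (𝓝 x₀) := hsymm.comp (hec.comp hφ'c)
    filter_upwards [(hec.comp hφ'c).eventually (hsmooth.and (hinv.and htgt)),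
      hφ'c.eventually (e.open_target.mem_nhds het), chart_source_mem_nhds H' (f x₀),
      h1.eventually (hfc.eventually (chart_source_mem_nhds H' (f x₀)))] with y hy1 hy2 hy3 hy4
    have hy5 : y ∈ φ'.source := by rwa [hφ', extChartAt_source]
    constructor
    · obtain ⟨B, hB⟩ := hy1.2.1
      have h3 : ContDiffAt ℝ ∞ e.symm (φ' y) :=
        e.contDiffAt_symm hy2 (f₀' := B) (by
          rw [hB]; exact (hy1.1.differentiableAt (by simp)).hasFDerivAt) hy1.1
      have h4 : ContMDiffAt J 𝓘(ℝ, F') ∞ φ' y := contMDiffAt_extChartAt' hy3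
      have h5 : ContMDiffAt 𝓘(ℝ, F) I ∞ φ.symm (e.symm (φ' y)) :=
        (contMDiffOn_extChartAt_symm x₀).contMDiffAt ((isOpen_extChartAt_target (I := I)
          x₀).mem_nhds hy1.2.2)
      exact h5.comp y (h3.contMDiffAt.comp y h4)
    · have h6 : f' (e.symm (φ' y)) = φ' y := by rw [← hecoe]; exact e.right_inv hy2
      exact φ'.injOn (by rwa [hφ', extChartAt_source]) hy5 h6
  · filter_upwards [hφc.eventually (e.open_source.mem_nhds hes), chart_source_mem_nhds H x₀]
      with x hx1 hx2
    have hx3 : x ∈ φ.source := by rwa [hφ, extChartAt_source]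
    have h1 : φ' (f x) = e (φ x) := by
      rw [hecoe, hf']; simp only [Function.comp_apply]; rw [φ.left_inv hx3]
    simp only [Function.comp_apply]
    rw [h1, e.left_inv hx1, φ.left_inv hx3]

end InverseFunction

/-! ### Tubes around a compact slice -/

section Tube

variable {S : Type*} [TopologicalSpace S] [CompactSpace S]

/-- The tube lemma for neighbourhoods of `S × {0}` in `S × ℝ`, with `S` compact. -/
lemma exists_forall_abs_lt_of_eventually {R : S × ℝ → Prop}
    (hR : ∀ p, ∀ᶠ q in 𝓝 (p, (0 : ℝ)), R q) : ∃ η > 0, ∀ p t, |t| < η → R (p, t) := by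
  have h1 : ∀ᶠ t in 𝓝 (0 : ℝ), ∀ p ∈ (univ : Set S), R (p, t) := by
    refine isCompact_univ.eventually_forall_of_forall_eventually (P := fun t p => R (p, t))
      fun p _ => ?_
    have : Tendsto (Prod.swap : ℝ × S → S × ℝ) (𝓝 (0, p)) (𝓝 (p, 0)) :=
      (continuous_swap.tendsto _)
    exact this.eventually (hR p)
  obtain ⟨η, hη, h⟩ := Metric.eventually_nhds_iff.1 h1
  exact ⟨η, hη, fun p t ht => h (by simpa [Real.dist_eq] using ht) p (mem_univ p)⟩

end Tube

/-! ### The product of a vector space with the time axis -/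

section ProdSelf

variable {E F : Type*} [NormedAddCommGroup E] [NormedSpace ℝ E]
  [NormedAddCommGroup F] [NormedSpace ℝ F] {f : E × ℝ → F} {s : Set (E × ℝ)} {z : E × ℝ}
  {n : WithTop ℕ∞}

lemma contMDiffWithinAt_prod_self_iff :
    ContMDiffWithinAt (𝓘(ℝ, E).prod 𝓘(ℝ, ℝ)) 𝓘(ℝ, F) n f s z ↔ ContDiffWithinAt ℝ n f s z := by
  rw [← contMDiffWithinAt_iff_contDiffWithinAt, modelWithCornersSelf_prod, ← chartedSpaceSelf_prod]

lemma contMDiffAt_prod_self_iff :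
    ContMDiffAt (𝓘(ℝ, E).prod 𝓘(ℝ, ℝ)) 𝓘(ℝ, F) n f z ↔ ContDiffAt ℝ n f z := by
  rw [← contMDiffAt_iff_contDiffAt, modelWithCornersSelf_prod, ← chartedSpaceSelf_prod]

lemma hasFDerivAt_of_hasMFDerivAt_prod {A : E × ℝ →L[ℝ] F}
    (h : HasMFDerivAt (𝓘(ℝ, E).prod 𝓘(ℝ, ℝ)) 𝓘(ℝ, F) f z A) : HasFDerivAt f A z := by
  have := h.2
  rw [ModelWithCorners.range_eq_univ] at this
  exact hasFDerivWithinAt_univ.1 this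

end ProdSelf

/-! ### Families of bilinear forms in charts -/

section MetricFamilies

variable {E : Type*} [NormedAddCommGroup E] [NormedSpace ℝ E]
  {M : Type*} [TopologicalSpace M] [ChartedSpace E M] [IsManifold 𝓘(ℝ, E) ∞ M]

/-- A family of bilinear forms as a map into the bundle of bilinear forms. -/
def formSection (k : ℝ → ∀ x : M, TangentSpace 𝓘(ℝ, E) x →L[ℝ] TangentSpace 𝓘(ℝ, E) x →L[ℝ] ℝ)
    (q : M × ℝ) : TotalSpace (E →L[ℝ] E →L[ℝ] ℝ)
      (fun x : M => TangentSpace 𝓘(ℝ, E) x →L[ℝ] TangentSpace 𝓘(ℝ, E) x →L[ℝ] ℝ) :=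
  TotalSpace.mk' (E →L[ℝ] E →L[ℝ] ℝ) q.1 (k q.2 q.1)

/-- The family of bilinear forms `k` in the chart at `x₀`, as a function of the coordinates and of
the time. -/
def coordForm (k : ℝ → ∀ x : M, TangentSpace 𝓘(ℝ, E) x →L[ℝ] TangentSpace 𝓘(ℝ, E) x →L[ℝ] ℝ)
    (x₀ : M) (y : E × ℝ) : E →L[ℝ] E →L[ℝ] ℝ :=
  ContinuousLinearMap.inCoordinates E (TangentSpace 𝓘(ℝ, E) : M → Type _) (E →L[ℝ] ℝ)
    (fun x => TangentSpace 𝓘(ℝ, E) x →L[ℝ] ℝ) x₀ ((extChartAt 𝓘(ℝ, E) x₀).symm y.1)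
    x₀ ((extChartAt 𝓘(ℝ, E) x₀).symm y.1) (k y.2 ((extChartAt 𝓘(ℝ, E) x₀).symm y.1))

variable {k : ℝ → ∀ x : M, TangentSpace 𝓘(ℝ, E) x →L[ℝ] TangentSpace 𝓘(ℝ, E) x →L[ℝ] ℝ}

lemma coordForm_apply {x₀ : M} {y : E × ℝ} (hy : y.1 ∈ (extChartAt 𝓘(ℝ, E) x₀).target) (v w : E) :
    coordForm k x₀ y v w = k y.2 ((extChartAt 𝓘(ℝ, E) x₀).symm y.1)
      (mfderiv 𝓘(ℝ, E) 𝓘(ℝ, E) (extChartAt 𝓘(ℝ, E) x₀).symm y.1 v)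
      (mfderiv 𝓘(ℝ, E) 𝓘(ℝ, E) (extChartAt 𝓘(ℝ, E) x₀).symm y.1 w) := by
  have : IsManifold 𝓘(ℝ, E) 1 M := IsManifold.of_le (n := ∞) (by simp)
  set x := (extChartAt 𝓘(ℝ, E) x₀).symm y.1 with hx
  have hxs : x ∈ (chartAt E x₀).source := by
    rw [← extChartAt_source 𝓘(ℝ, E)]; exact (extChartAt 𝓘(ℝ, E) x₀).map_target hy
  have hxy : extChartAt 𝓘(ℝ, E) x₀ x = y.1 := (extChartAt 𝓘(ℝ, E) x₀).right_inv hy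
  have h1 := TangentBundle.symmL_trivializationAt (I := 𝓘(ℝ, E)) hxs
  rw [hxy, ModelWithCorners.range_eq_univ, mfderivWithin_univ] at h1
  unfold coordForm
  rw [← hx, inCoordinates_apply_eq₂ (by simpa using hxs) (by simpa using hxs) (by simp)]
  have h2 : ∀ v : E, (trivializationAt E (TangentSpace 𝓘(ℝ, E)) x₀).symm x v
      = mfderiv 𝓘(ℝ, E) 𝓘(ℝ, E) (extChartAt 𝓘(ℝ, E) x₀).symm y.1 v := by
    intro v
    refine (Trivialization.symmL_apply (R := ℝ) (F := E) _ (by simpa using hxs) v).symm.trans ?_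
    exact congrArg (fun A : E →L[ℝ] E => A v) h1
  rw [h2, h2]
  simp
  rfl

lemma contMDiffWithinAt_formSection_iff {x₀ : M} {q : M × ℝ} {T : Set ℝ}
    (hq : q.1 ∈ (chartAt E x₀).source) :
    ContMDiffWithinAt (𝓘(ℝ, E).prod 𝓘(ℝ, ℝ)) (𝓘(ℝ, E).prod 𝓘(ℝ, E →L[ℝ] E →L[ℝ] ℝ)) ∞
      (formSection k) (univ ×ˢ T) q ↔
    ContDiffWithinAt ℝ ∞ (coordForm k x₀) (univ ×ˢ T) (extChartAt 𝓘(ℝ, E) x₀ q.1, q.2) := by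
  set e := trivializationAt (E →L[ℝ] E →L[ℝ] ℝ)
    (fun x : M => TangentSpace 𝓘(ℝ, E) x →L[ℝ] TangentSpace 𝓘(ℝ, E) x →L[ℝ] ℝ) x₀ with he
  set φ := extChartAt 𝓘(ℝ, E) x₀ with hφ
  have hqs : q.1 ∈ φ.source := by rwa [hφ, extChartAt_source]
  rw [e.contMDiffWithinAt_iff (by rw [e.mem_source]; simpa [he, formSection] using hq),
    ← contMDiffWithinAt_prod_self_iff]
  have h0 : ContMDiffWithinAt (𝓘(ℝ, E).prod 𝓘(ℝ, ℝ)) 𝓘(ℝ, E) ∞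
      (fun q : M × ℝ => (formSection k q).proj) (univ ×ˢ T) q := contMDiffWithinAt_fst
  have h1 : ∀ y : E × ℝ, coordForm k x₀ y = (e (formSection k (φ.symm y.1, y.2))).2 := fun _ => rfl
  have h2 : ContMDiffAt (𝓘(ℝ, E).prod 𝓘(ℝ, ℝ)) (𝓘(ℝ, E).prod 𝓘(ℝ, ℝ)) ∞
      (fun y : E × ℝ => (φ.symm y.1, y.2)) (φ q.1, q.2) := by
    refine ContMDiffAt.prodMk ?_ contMDiffAt_snd
    have h3 : ContMDiffAt 𝓘(ℝ, E) 𝓘(ℝ, E) ∞ φ.symm (φ q.1) :=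
      (contMDiffOn_extChartAt_symm x₀).contMDiffAt
        ((isOpen_extChartAt_target (I := 𝓘(ℝ, E)) x₀).mem_nhds (φ.map_source hqs))
    exact ContMDiffAt.comp (x := (φ q.1, q.2)) (g := φ.symm) (f := Prod.fst) h3 contMDiffAt_fst
  have h3 : ContMDiffAt (𝓘(ℝ, E).prod 𝓘(ℝ, ℝ)) (𝓘(ℝ, E).prod 𝓘(ℝ, ℝ)) ∞
      (fun q : M × ℝ => (φ q.1, q.2)) q := by
    refine ContMDiffAt.prodMk ?_ contMDiffAt_snd
    have h3 : ContMDiffAt 𝓘(ℝ, E) 𝓘(ℝ, E) ∞ φ q.1 := contMDiffAt_extChartAt' hq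
    exact ContMDiffAt.comp (x := q) (g := φ) (f := Prod.fst) h3 contMDiffAt_fst
  have hl : φ.symm (φ q.1) = q.1 := φ.left_inv hqs
  constructor
  · rintro ⟨-, h⟩
    have h4 : ContMDiffWithinAt (𝓘(ℝ, E).prod 𝓘(ℝ, ℝ)) 𝓘(ℝ, E →L[ℝ] E →L[ℝ] ℝ) ∞
        ((fun q => (e (formSection k q)).2) ∘ fun y : E × ℝ => (φ.symm y.1, y.2)) (univ ×ˢ T)
        (φ q.1, q.2) := by
      refine ContMDiffWithinAt.comp (t := univ ×ˢ T) (φ q.1, q.2) ?_ h2.contMDiffWithinAt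
        (fun y hy => ⟨mem_univ _, hy.2⟩)
      rw [hl]; exact h
    exact h4
  · intro h
    refine ⟨h0, ?_⟩
    have h4 : ContMDiffWithinAt (𝓘(ℝ, E).prod 𝓘(ℝ, ℝ)) 𝓘(ℝ, E →L[ℝ] E →L[ℝ] ℝ) ∞
        (coordForm k x₀ ∘ fun q : M × ℝ => (φ q.1, q.2)) (univ ×ˢ T) q :=
      ContMDiffWithinAt.comp (t := univ ×ˢ T) q h h3.contMDiffWithinAt
        (fun y hy => ⟨mem_univ _, hy.2⟩)
    refine h4.congr_of_eventuallyEq ?_ ?_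
    · have : ∀ᶠ q' in 𝓝[univ ×ˢ T] q, q'.1 ∈ φ.source := by
        refine nhdsWithin_le_nhds ((continuous_fst.tendsto q).eventually ?_)
        rw [hφ, extChartAt_source]
        exact (chartAt E x₀).open_source.mem_nhds hq
      filter_upwards [this] with q' hq'
      simp only [Function.comp_apply, h1, φ.left_inv hq']
    · simp only [Function.comp_apply, h1, hl]

lemma contMDiffAt_formSection_iff {x₀ : M} {q : M × ℝ} (hq : q.1 ∈ (chartAt E x₀).source) :
    ContMDiffAt (𝓘(ℝ, E).prod 𝓘(ℝ, ℝ)) (𝓘(ℝ, E).prod 𝓘(ℝ, E →L[ℝ] E →L[ℝ] ℝ)) ∞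
      (formSection k) q ↔
    ContDiffAt ℝ ∞ (coordForm k x₀) (extChartAt 𝓘(ℝ, E) x₀ q.1, q.2) := by
  have := contMDiffWithinAt_formSection_iff (k := k) (T := univ) hq
  rw [univ_prod_univ, contMDiffWithinAt_univ] at this
  rw [this, univ_prod_univ, contDiffWithinAt_univ]

lemma coordForm_apply_mfderiv {x₀ x : M} {t : ℝ} (hx : x ∈ (chartAt E x₀).source)
    (v w : TangentSpace 𝓘(ℝ, E) x) :
    coordForm k x₀ (extChartAt 𝓘(ℝ, E) x₀ x, t)
      (mfderiv 𝓘(ℝ, E) 𝓘(ℝ, E) (extChartAt 𝓘(ℝ, E) x₀) x v)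
      (mfderiv 𝓘(ℝ, E) 𝓘(ℝ, E) (extChartAt 𝓘(ℝ, E) x₀) x w) = k t x v w := by
  have : IsManifold 𝓘(ℝ, E) 1 M := IsManifold.of_le (n := ∞) (by simp)
  have hx' : x ∈ (extChartAt 𝓘(ℝ, E) x₀).source := by rwa [extChartAt_source]
  have h1 : (mfderiv 𝓘(ℝ, E) 𝓘(ℝ, E) (extChartAt 𝓘(ℝ, E) x₀).symm (extChartAt 𝓘(ℝ, E) x₀ x)).comp
      (mfderiv 𝓘(ℝ, E) 𝓘(ℝ, E) (extChartAt 𝓘(ℝ, E) x₀) x) = ContinuousLinearMap.id ℝ E := by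
    have := mfderivWithin_extChartAt_symm_comp_mfderiv_extChartAt' (I := 𝓘(ℝ, E)) hx'
    rw [ModelWithCorners.range_eq_univ, mfderivWithin_univ] at this
    exact this
  have h2 : ∀ v : E, mfderiv 𝓘(ℝ, E) 𝓘(ℝ, E) (extChartAt 𝓘(ℝ, E) x₀).symm
      (extChartAt 𝓘(ℝ, E) x₀ x) (mfderiv 𝓘(ℝ, E) 𝓘(ℝ, E) (extChartAt 𝓘(ℝ, E) x₀) x v) = v :=
    fun v => congrArg (fun A : E →L[ℝ] E => A v) h1
  refine (coordForm_apply ((extChartAt 𝓘(ℝ, E) x₀).map_source hx') _ _).trans ?_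
  have key : ∀ (x' : M) (hx' : x' = x) (a b : E), a = v → b = w →
      k t x' a b = k t x v w := by
    rintro _ rfl a b rfl rfl; rfl
  exact key _ ((extChartAt 𝓘(ℝ, E) x₀).left_inv hx') _ _ (h2 v) (h2 w)

end MetricFamilies

/-! ### Gluing families of bilinear forms -/

section Gluing

variable {E : Type*} [NormedAddCommGroup E] [NormedSpace ℝ E] [FiniteDimensional ℝ E]
  {M : Type*} [TopologicalSpace M] [T2Space M] [SigmaCompactSpace M] [ChartedSpace E M]
  [IsManifold 𝓘(ℝ, E) ∞ M]

/-- Families of sections of a vector bundle over `M`, parametrized by `ℝ` and subject to a pointwise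
convex condition, can be glued by a partition of unity on `M × ℝ`. -/
lemma exists_sectionFamily_of_local {F : Type*} [NormedAddCommGroup F] [NormedSpace ℝ F]
    (V : M → Type*) [∀ x, AddCommGroup (V x)] [∀ x, Module ℝ (V x)] [∀ x, TopologicalSpace (V x)]
    [TopologicalSpace (TotalSpace F V)] [FiberBundle F V] [VectorBundle ℝ F V]
    [ContMDiffVectorBundle ∞ F V 𝓘(ℝ, E)]
    (C : ∀ q : M × ℝ, Set (V q.1)) (hC : ∀ q, Convex ℝ (C q))
    (hloc : ∀ q₀ : M × ℝ, ∃ k : ℝ → ∀ x : M, V x,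
      ∀ᶠ q in 𝓝 q₀, ContMDiffAt (𝓘(ℝ, E).prod 𝓘(ℝ, ℝ)) (𝓘(ℝ, E).prod 𝓘(ℝ, F)) ∞
        (fun q : M × ℝ => TotalSpace.mk' F q.1 (k q.2 q.1)) q ∧ k q.2 q.1 ∈ C q) :
    ∃ k : ℝ → ∀ x : M, V x,
      ContMDiff (𝓘(ℝ, E).prod 𝓘(ℝ, ℝ)) (𝓘(ℝ, E).prod 𝓘(ℝ, F)) ∞
        (fun q : M × ℝ => TotalSpace.mk' F q.1 (k q.2 q.1)) ∧ ∀ q : M × ℝ, k q.2 q.1 ∈ C q := by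
  let f : C^∞⟮𝓘(ℝ, E).prod 𝓘(ℝ, ℝ), M × ℝ; 𝓘(ℝ, E), M⟯ := ContMDiffMap.fst
  have key : ∀ (k : ℝ → ∀ x : M, V x) (q : M × ℝ),
      ContMDiffAt (𝓘(ℝ, E).prod 𝓘(ℝ, ℝ)) (𝓘(ℝ, E).prod 𝓘(ℝ, F)) ∞
        (fun q : M × ℝ => TotalSpace.mk' F q.1 (k q.2 q.1)) q ↔
      ContMDiffAt (𝓘(ℝ, E).prod 𝓘(ℝ, ℝ)) ((𝓘(ℝ, E).prod 𝓘(ℝ, ℝ)).prod 𝓘(ℝ, F)) ∞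
        (fun q => TotalSpace.mk' F (E := (f *ᵖ V)) q (k q.2 q.1)) q := by
    intro k q
    refine contMDiffAt_totalSpace.trans (Iff.trans ?_ (Bundle.contMDiffAt_section q).symm)
    exact ⟨fun h => h.2, fun h => ⟨contMDiffAt_fst, h⟩⟩
  let W : M × ℝ → Type _ := fun q => V q.1
  let i1 : ∀ q, AddCommGroup (W q) := fun q => (inferInstance : AddCommGroup (V q.1))
  let i2 : ∀ q, Module ℝ (W q) := fun q => (inferInstance : Module ℝ (V q.1))
  let i3 : ∀ q, TopologicalSpace (W q) := fun q => (inferInstance : TopologicalSpace (V q.1))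
  let i4 : TopologicalSpace (TotalSpace F W) :=
    (inferInstance : TopologicalSpace (TotalSpace F (f *ᵖ V)))
  let i5 : FiberBundle F W := (inferInstance : FiberBundle F (f *ᵖ V))
  have i6 : VectorBundle ℝ F W := (inferInstance : VectorBundle ℝ F (f *ᵖ V))
  have i7 : ContMDiffVectorBundle ∞ F W (𝓘(ℝ, E).prod 𝓘(ℝ, ℝ)) :=
    (inferInstance : ContMDiffVectorBundle ∞ F (f *ᵖ V) (𝓘(ℝ, E).prod 𝓘(ℝ, ℝ)))
  obtain ⟨s, hs⟩ := exists_contMDiffSection_forall_mem_convex_of_local (n := ⊤)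
    (F_fiber := F) (𝓘(ℝ, E).prod 𝓘(ℝ, ℝ)) W C hC (by
      intro q₀
      obtain ⟨k, hk⟩ := hloc q₀
      exact ⟨_, hk, fun q => k q.2 q.1,
        fun q hq => ((key k q).1 hq.1).contMDiffWithinAt, fun q hq => hq.2⟩)
  exact ⟨fun t x => s (x, t), fun q => (key (fun t x => s (x, t)) q).2 (s.contMDiff q), hs⟩

/-- The case of families of bilinear forms. -/
lemma exists_formFamily_of_local
    (C : ∀ q : M × ℝ, Set (TangentSpace 𝓘(ℝ, E) q.1 →L[ℝ] TangentSpace 𝓘(ℝ, E) q.1 →L[ℝ] ℝ))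
    (hC : ∀ q, Convex ℝ (C q))
    (hloc : ∀ q₀ : M × ℝ, ∃ k : ℝ → ∀ x : M,
      TangentSpace 𝓘(ℝ, E) x →L[ℝ] TangentSpace 𝓘(ℝ, E) x →L[ℝ] ℝ,
      ∀ᶠ q in 𝓝 q₀, ContMDiffAt (𝓘(ℝ, E).prod 𝓘(ℝ, ℝ))
        (𝓘(ℝ, E).prod 𝓘(ℝ, E →L[ℝ] E →L[ℝ] ℝ)) ∞ (formSection k) q ∧ k q.2 q.1 ∈ C q) :
    ∃ k : ℝ → ∀ x : M, TangentSpace 𝓘(ℝ, E) x →L[ℝ] TangentSpace 𝓘(ℝ, E) x →L[ℝ] ℝ,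
      ContMDiff (𝓘(ℝ, E).prod 𝓘(ℝ, ℝ)) (𝓘(ℝ, E).prod 𝓘(ℝ, E →L[ℝ] E →L[ℝ] ℝ)) ∞
        (formSection k) ∧ ∀ q : M × ℝ, k q.2 q.1 ∈ C q :=
  exists_sectionFamily_of_local (F := E →L[ℝ] E →L[ℝ] ℝ)
    (fun x : M => TangentSpace 𝓘(ℝ, E) x →L[ℝ] TangentSpace 𝓘(ℝ, E) x →L[ℝ] ℝ) C hC hloc

end Gluing

/-! ### The eikonal condition on manifolds -/

section Eikonal

variable {P E : Type*} [NormedAddCommGroup P] [NormedSpace ℝ P]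
  [NormedAddCommGroup E] [NormedSpace ℝ E]
  {S M : Type*} [TopologicalSpace S] [ChartedSpace P S] [IsManifold 𝓘(ℝ, P) ∞ S]
  [TopologicalSpace M] [ChartedSpace E M] [IsManifold 𝓘(ℝ, E) ∞ M]

/-- The eikonal condition for a map `X : S × ℝ → M`: the velocity of `t ↦ (X (p, t), t)` is null,
and orthogonal to the images of the tangent vectors of `S × ℝ`, for `k - dt²`. The curves
`t ↦ (X (p, t), t)` are then the null generators of a null hypersurface. -/
def EikonalAt (k : ℝ → ∀ x : M, TangentSpace 𝓘(ℝ, E) x →L[ℝ] TangentSpace 𝓘(ℝ, E) x →L[ℝ] ℝ)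
    (X : S × ℝ → M) (q : S × ℝ) : Prop :=
  ∀ z : P × ℝ, k q.2 (X q) (mfderiv (𝓘(ℝ, P).prod 𝓘(ℝ, ℝ)) 𝓘(ℝ, E) X q ((0 : P), (1 : ℝ)))
    (mfderiv (𝓘(ℝ, P).prod 𝓘(ℝ, ℝ)) 𝓘(ℝ, E) X q z) = z.2

/-- The expression of `X : S × ℝ → M` in the charts at `p₀` and `x₀`. -/
def chartMap (X : S × ℝ → M) (p₀ : S) (x₀ : M) (z : P × ℝ) : E :=
  extChartAt 𝓘(ℝ, E) x₀ (X ((extChartAt 𝓘(ℝ, P) p₀).symm z.1, z.2))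

/-- The map `S × ℝ → M` with a given expression in the charts at `p₀` and `x₀`. -/
def ofChartMap (Y : P × ℝ → E) (p₀ : S) (x₀ : M) (q : S × ℝ) : M :=
  (extChartAt 𝓘(ℝ, E) x₀).symm (Y (extChartAt 𝓘(ℝ, P) p₀ q.1, q.2))

variable {k : ℝ → ∀ x : M, TangentSpace 𝓘(ℝ, E) x →L[ℝ] TangentSpace 𝓘(ℝ, E) x →L[ℝ] ℝ}
  {X : S × ℝ → M} {p₀ : S} {x₀ : M} {q : S × ℝ}

lemma contMDiffAt_prod_chart_symm (hq : q.1 ∈ (chartAt P p₀).source) :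
    ContMDiffAt (𝓘(ℝ, P).prod 𝓘(ℝ, ℝ)) (𝓘(ℝ, P).prod 𝓘(ℝ, ℝ)) ∞
      (fun z : P × ℝ => ((extChartAt 𝓘(ℝ, P) p₀).symm z.1, z.2))
      (extChartAt 𝓘(ℝ, P) p₀ q.1, q.2) := by
  refine ContMDiffAt.prodMk ?_ contMDiffAt_snd
  have h3 : ContMDiffAt 𝓘(ℝ, P) 𝓘(ℝ, P) ∞ (extChartAt 𝓘(ℝ, P) p₀).symm
      (extChartAt 𝓘(ℝ, P) p₀ q.1) :=
    (contMDiffOn_extChartAt_symm p₀).contMDiffAt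
      ((isOpen_extChartAt_target (I := 𝓘(ℝ, P)) p₀).mem_nhds
        ((extChartAt 𝓘(ℝ, P) p₀).map_source (by rwa [extChartAt_source])))
  exact ContMDiffAt.comp (x := (extChartAt 𝓘(ℝ, P) p₀ q.1, q.2)) (f := Prod.fst) h3
    contMDiffAt_fst

lemma contMDiffAt_prod_chart (hq : q.1 ∈ (chartAt P p₀).source) :
    ContMDiffAt (𝓘(ℝ, P).prod 𝓘(ℝ, ℝ)) (𝓘(ℝ, P).prod 𝓘(ℝ, ℝ)) ∞
      (fun q : S × ℝ => (extChartAt 𝓘(ℝ, P) p₀ q.1, q.2)) q := by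
  refine ContMDiffAt.prodMk ?_ contMDiffAt_snd
  have h3 : ContMDiffAt 𝓘(ℝ, P) 𝓘(ℝ, P) ∞ (extChartAt 𝓘(ℝ, P) p₀) q.1 :=
    contMDiffAt_extChartAt' hq
  exact ContMDiffAt.comp (x := q) (f := Prod.fst) h3 contMDiffAt_fst

lemma contDiffWithinAt_chartMap {T : Set ℝ} (hq : q.1 ∈ (chartAt P p₀).source)
    (hXq : X q ∈ (chartAt E x₀).source)
    (hX : ContMDiffWithinAt (𝓘(ℝ, P).prod 𝓘(ℝ, ℝ)) 𝓘(ℝ, E) ∞ X (univ ×ˢ T) q) :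
    ContDiffWithinAt ℝ ∞ (chartMap X p₀ x₀ : P × ℝ → E) (univ ×ˢ T)
      (extChartAt 𝓘(ℝ, P) p₀ q.1, q.2) := by
  have hl : (extChartAt 𝓘(ℝ, P) p₀).symm (extChartAt 𝓘(ℝ, P) p₀ q.1) = q.1 :=
    (extChartAt 𝓘(ℝ, P) p₀).left_inv (by rwa [extChartAt_source])
  rw [← contMDiffWithinAt_prod_self_iff]
  have h1 : ContMDiffWithinAt (𝓘(ℝ, P).prod 𝓘(ℝ, ℝ)) 𝓘(ℝ, E) ∞
      (extChartAt 𝓘(ℝ, E) x₀ ∘ X) (univ ×ˢ T) q :=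
    ContMDiffAt.comp_contMDiffWithinAt q (contMDiffAt_extChartAt' hXq) hX
  refine ContMDiffWithinAt.comp (t := univ ×ˢ T) (g := extChartAt 𝓘(ℝ, E) x₀ ∘ X) _ ?_
    (contMDiffAt_prod_chart_symm hq).contMDiffWithinAt (fun y hy => ⟨mem_univ _, hy.2⟩)
  rw [hl]
  exact h1

lemma contDiffAt_chartMap (hq : q.1 ∈ (chartAt P p₀).source)
    (hXq : X q ∈ (chartAt E x₀).source)
    (hX : ContMDiffAt (𝓘(ℝ, P).prod 𝓘(ℝ, ℝ)) 𝓘(ℝ, E) ∞ X q) :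
    ContDiffAt ℝ ∞ (chartMap X p₀ x₀ : P × ℝ → E) (extChartAt 𝓘(ℝ, P) p₀ q.1, q.2) := by
  have := contDiffWithinAt_chartMap (T := univ) hq hXq (by rwa [univ_prod_univ])
  rwa [univ_prod_univ] at this

lemma contMDiffAt_ofChartMap {Y : P × ℝ → E} (hq : q.1 ∈ (chartAt P p₀).source)
    (hYq : Y (extChartAt 𝓘(ℝ, P) p₀ q.1, q.2) ∈ (extChartAt 𝓘(ℝ, E) x₀).target)
    (hY : ContDiffAt ℝ ∞ Y (extChartAt 𝓘(ℝ, P) p₀ q.1, q.2)) :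
    ContMDiffAt (𝓘(ℝ, P).prod 𝓘(ℝ, ℝ)) 𝓘(ℝ, E) ∞ (ofChartMap Y p₀ x₀ : S × ℝ → M) q := by
  have h1 : ContMDiffAt 𝓘(ℝ, E) 𝓘(ℝ, E) ∞ (extChartAt 𝓘(ℝ, E) x₀).symm
      (Y (extChartAt 𝓘(ℝ, P) p₀ q.1, q.2)) :=
    (contMDiffOn_extChartAt_symm x₀).contMDiffAt
      ((isOpen_extChartAt_target (I := 𝓘(ℝ, E)) x₀).mem_nhds hYq)
  have h2 := contMDiffAt_prod_self_iff.2 hY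
  exact ContMDiffAt.comp q h1 (ContMDiffAt.comp q h2 (contMDiffAt_prod_chart hq))

omit [IsManifold 𝓘(ℝ, P) ∞ S] [IsManifold 𝓘(ℝ, E) ∞ M] in
/-- Near a point whose chart value is that of `Y`, the chart expression of `ofChartMap Y` is `Y`. -/
lemma chartMap_ofChartMap {Y : P × ℝ → E} {z : P × ℝ}
    (hz : z.1 ∈ (extChartAt 𝓘(ℝ, P) p₀).target) (hY : Y z ∈ (extChartAt 𝓘(ℝ, E) x₀).target) :
    chartMap (ofChartMap Y p₀ x₀ : S × ℝ → M) p₀ x₀ z = Y z := by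
  unfold chartMap ofChartMap
  rw [(extChartAt 𝓘(ℝ, P) p₀).right_inv hz, (extChartAt 𝓘(ℝ, E) x₀).right_inv hY]

/-- The differential of the chart expression. -/
lemma fderiv_chartMap (hq : q.1 ∈ (chartAt P p₀).source) (hXq : X q ∈ (chartAt E x₀).source)
    (hX : MDifferentiableAt (𝓘(ℝ, P).prod 𝓘(ℝ, ℝ)) 𝓘(ℝ, E) X q) (z : P × ℝ) :
    fderiv ℝ (chartMap X p₀ x₀ : P × ℝ → E) (extChartAt 𝓘(ℝ, P) p₀ q.1, q.2)
        (mfderiv 𝓘(ℝ, P) 𝓘(ℝ, P) (extChartAt 𝓘(ℝ, P) p₀) q.1 z.1, z.2)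
      = mfderiv 𝓘(ℝ, E) 𝓘(ℝ, E) (extChartAt 𝓘(ℝ, E) x₀) (X q)
        (mfderiv (𝓘(ℝ, P).prod 𝓘(ℝ, ℝ)) 𝓘(ℝ, E) X q z) := by
  have : IsManifold 𝓘(ℝ, P) 1 S := IsManifold.of_le (n := ∞) (by simp)
  have hq' : q.1 ∈ (extChartAt 𝓘(ℝ, P) p₀).source := by rwa [extChartAt_source]
  set ψ := extChartAt 𝓘(ℝ, P) p₀ with hψ
  have hl : ψ.symm (ψ q.1) = q.1 := ψ.left_inv hq'
  have h1 : HasMFDerivAt 𝓘(ℝ, P) 𝓘(ℝ, P) ψ q.1 (mfderiv 𝓘(ℝ, P) 𝓘(ℝ, P) ψ q.1) :=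
    (mdifferentiableAt_extChartAt hq).hasMFDerivAt
  have hΨ : HasMFDerivAt (𝓘(ℝ, P).prod 𝓘(ℝ, ℝ)) (𝓘(ℝ, P).prod 𝓘(ℝ, ℝ))
      (fun q : S × ℝ => (ψ q.1, q.2)) q
      (((mfderiv 𝓘(ℝ, P) 𝓘(ℝ, P) ψ q.1).comp (ContinuousLinearMap.fst ℝ P ℝ)).prod
        (ContinuousLinearMap.snd ℝ P ℝ)) :=
    HasMFDerivAt.prodMk (HasMFDerivAt.comp q (g := ψ) (f := Prod.fst) h1 (hasMFDerivAt_fst _))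
      (hasMFDerivAt_snd _)
  have hφ : HasMFDerivAt 𝓘(ℝ, E) 𝓘(ℝ, E) (extChartAt 𝓘(ℝ, E) x₀) (X q)
      (mfderiv 𝓘(ℝ, E) 𝓘(ℝ, E) (extChartAt 𝓘(ℝ, E) x₀) (X q)) :=
    have : IsManifold 𝓘(ℝ, E) 1 M := IsManifold.of_le (n := ∞) (by simp)
    (mdifferentiableAt_extChartAt hXq).hasMFDerivAt
  -- Differentiate `chartMap X ∘ (ψ, id) = φ ∘ X`.
  have hY : MDifferentiableAt (𝓘(ℝ, P).prod 𝓘(ℝ, ℝ)) 𝓘(ℝ, E) (chartMap X p₀ x₀ : P × ℝ → E)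
      (ψ q.1, q.2) := by
    have h2 := (contMDiffAt_prod_chart_symm (q := q) hq).mdifferentiableAt (by simp)
    have h3 : MDifferentiableAt (𝓘(ℝ, P).prod 𝓘(ℝ, ℝ)) 𝓘(ℝ, E) (extChartAt 𝓘(ℝ, E) x₀ ∘ X)
      (ψ.symm (ψ q.1), q.2) := by
      rw [hl]; exact (hφ.comp q hX.hasMFDerivAt).mdifferentiableAt
    exact MDifferentiableAt.comp (g := extChartAt 𝓘(ℝ, E) x₀ ∘ X) (ψ q.1, q.2) h3 h2
  have hY' := hasFDerivAt_of_hasMFDerivAt_prod hY.hasMFDerivAt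
  have e1 := (hY.hasMFDerivAt.comp q hΨ).congr_of_eventuallyEq (f₁ := extChartAt 𝓘(ℝ, E) x₀ ∘ X) (by
    have : ∀ᶠ q' in 𝓝 q, q'.1 ∈ ψ.source := by
      refine (continuous_fst.tendsto q).eventually ?_
      rw [hψ, extChartAt_source]
      exact (chartAt P p₀).open_source.mem_nhds hq
    filter_upwards [this] with q' hq'
    simp only [Function.comp_apply, chartMap, ← hψ, ψ.left_inv hq'])
  have e2 := hasMFDerivAt_unique e1 (hφ.comp q hX.hasMFDerivAt)
  have e3 := congrArg (fun A : P × ℝ →L[ℝ] E => A z) e2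
  rw [hY'.fderiv]
  exact e3

lemma bijective_mfderiv_extChartAt {x : M} (hx : x ∈ (chartAt E x₀).source) :
    Function.Bijective (mfderiv 𝓘(ℝ, E) 𝓘(ℝ, E) (extChartAt 𝓘(ℝ, E) x₀) x) := by
  have : IsManifold 𝓘(ℝ, E) 1 M := IsManifold.of_le (n := ∞) (by simp)
  exact (isInvertible_mfderiv_extChartAt (by rwa [extChartAt_source])).bijective

lemma surjective_prod_mfderiv_extChartAt {p : S} (hp : p ∈ (chartAt P p₀).source) (ζ : P × ℝ) :
    ∃ z : P × ℝ, ((mfderiv 𝓘(ℝ, P) 𝓘(ℝ, P) (extChartAt 𝓘(ℝ, P) p₀) p z.1, z.2) : P × ℝ) = ζ := by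
  obtain ⟨a, ha⟩ := (bijective_mfderiv_extChartAt (E := P) hp).2 ζ.1
  exact ⟨(a, ζ.2), Prod.ext ha rfl⟩

lemma chartEikonalAt_chartMap_iff (hq : q.1 ∈ (chartAt P p₀).source)
    (hXq : X q ∈ (chartAt E x₀).source)
    (hX : MDifferentiableAt (𝓘(ℝ, P).prod 𝓘(ℝ, ℝ)) 𝓘(ℝ, E) X q) :
    ChartEikonalAt (coordForm k x₀) (chartMap X p₀ x₀) (extChartAt 𝓘(ℝ, P) p₀ q.1, q.2)
      ↔ EikonalAt (P := P) k X q := by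
  have hl : (extChartAt 𝓘(ℝ, P) p₀).symm (extChartAt 𝓘(ℝ, P) p₀ q.1) = q.1 :=
    (extChartAt 𝓘(ℝ, P) p₀).left_inv (by rwa [extChartAt_source])
  have h0 : chartMap X p₀ x₀ (extChartAt 𝓘(ℝ, P) p₀ q.1, q.2) = extChartAt 𝓘(ℝ, E) x₀ (X q) := by
    unfold chartMap; rw [hl]
  have h1 := fderiv_chartMap hq hXq hX ((0 : P), (1 : ℝ))
  have h2 : ((mfderiv 𝓘(ℝ, P) 𝓘(ℝ, P) (extChartAt 𝓘(ℝ, P) p₀) q.1 (0 : P) : P), (1 : ℝ))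
      = ((0 : P), (1 : ℝ)) := Prod.ext (map_zero (mfderiv 𝓘(ℝ, P) 𝓘(ℝ, P) _ q.1)) rfl
  have h3 : fderiv ℝ (chartMap X p₀ x₀ : P × ℝ → E) (extChartAt 𝓘(ℝ, P) p₀ q.1, q.2)
    ((0 : P), (1 : ℝ))
    = mfderiv 𝓘(ℝ, E) 𝓘(ℝ, E) (extChartAt 𝓘(ℝ, E) x₀) (X q)
        (mfderiv (𝓘(ℝ, P).prod 𝓘(ℝ, ℝ)) 𝓘(ℝ, E) X q ((0 : P), (1 : ℝ))) := by
    rw [← h1]; exact congrArg _ h2.symm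
  have key : ∀ z : P × ℝ, coordForm k x₀
      (chartMap X p₀ x₀ (extChartAt 𝓘(ℝ, P) p₀ q.1, q.2), q.2)
      (fderiv ℝ (chartMap X p₀ x₀ : P × ℝ → E) (extChartAt 𝓘(ℝ, P) p₀ q.1, q.2)
        ((0 : P), (1 : ℝ)))
      (fderiv ℝ (chartMap X p₀ x₀ : P × ℝ → E) (extChartAt 𝓘(ℝ, P) p₀ q.1, q.2)
        (mfderiv 𝓘(ℝ, P) 𝓘(ℝ, P) (extChartAt 𝓘(ℝ, P) p₀) q.1 z.1, z.2))
      = k q.2 (X q) (mfderiv (𝓘(ℝ, P).prod 𝓘(ℝ, ℝ)) 𝓘(ℝ, E) X q ((0 : P), (1 : ℝ)))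
        (mfderiv (𝓘(ℝ, P).prod 𝓘(ℝ, ℝ)) 𝓘(ℝ, E) X q z) := by
    intro z
    rw [h0, h3, fderiv_chartMap hq hXq hX z]
    exact coordForm_apply_mfderiv hXq _ _
  constructor
  · intro h z
    rw [← key z]
    exact h _
  · intro h ζ
    obtain ⟨z, hz⟩ := surjective_prod_mfderiv_extChartAt hq ζ
    have := (key z).trans (h z)
    rw [hz] at this
    rw [this, ← hz]

lemma bijective_fderiv_chartMap_iff (hq : q.1 ∈ (chartAt P p₀).source)
    (hXq : X q ∈ (chartAt E x₀).source)
    (hX : MDifferentiableAt (𝓘(ℝ, P).prod 𝓘(ℝ, ℝ)) 𝓘(ℝ, E) X q) :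
    Function.Bijective (fderiv ℝ (chartMap X p₀ x₀ : P × ℝ → E) (extChartAt 𝓘(ℝ, P) p₀ q.1, q.2))
      ↔ Function.Bijective (mfderiv (𝓘(ℝ, P).prod 𝓘(ℝ, ℝ)) 𝓘(ℝ, E) X q) := by
  let a : P × ℝ → P × ℝ := fun z =>
    (mfderiv 𝓘(ℝ, P) 𝓘(ℝ, P) (extChartAt 𝓘(ℝ, P) p₀) q.1 z.1, z.2)
  have hb := bijective_mfderiv_extChartAt (E := P) hq
  have ha : Function.Bijective a :=
    ⟨fun z w h => Prod.ext (hb.1 (Prod.ext_iff.1 h).1) (Prod.ext_iff.1 h).2,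
      fun ζ => surjective_prod_mfderiv_extChartAt hq ζ⟩
  have h1 : (fderiv ℝ (chartMap X p₀ x₀ : P × ℝ → E) (extChartAt 𝓘(ℝ, P) p₀ q.1, q.2)) ∘ a
      = (mfderiv 𝓘(ℝ, E) 𝓘(ℝ, E) (extChartAt 𝓘(ℝ, E) x₀) (X q)) ∘
        (mfderiv (𝓘(ℝ, P).prod 𝓘(ℝ, ℝ)) 𝓘(ℝ, E) X q) :=
    funext fun z => fderiv_chartMap hq hXq hX z
  rw [← Function.Bijective.of_comp_iff _ ha]
  erw [h1]
  exact Function.Bijective.of_comp_iff' (bijective_mfderiv_extChartAt hXq) _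

end Eikonal

/-! ### Positive definite forms -/

section PosDef

variable {E : Type*} [NormedAddCommGroup E] [NormedSpace ℝ E] [FiniteDimensional ℝ E]

lemma isInvertible_of_pos {b : E →L[ℝ] E →L[ℝ] ℝ} (hb : ∀ v ≠ 0, 0 < b v v) : b.IsInvertible := by
  have := FiniteDimensional.complete ℝ E
  have hinj : Function.Injective b := by
    rw [injective_iff_map_eq_zero]
    intro v hv
    by_contra hne
    have := hb v hne
    simp [hv] at this
  have hfr : Module.finrank ℝ E = Module.finrank ℝ (E →L[ℝ] ℝ) := by
    rw [← (LinearMap.toContinuousLinearMap : (E →ₗ[ℝ] ℝ) ≃ₗ[ℝ] E →L[ℝ] ℝ).finrank_eq]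
    exact (Subspace.dual_finrank_eq).symm
  have hsurj : Function.Surjective b :=
    (LinearMap.injective_iff_surjective_of_finrank_eq_finrank (f := b.toLinearMap) hfr).1 hinj
  exact ⟨ContinuousLinearEquiv.ofBijective b (LinearMap.ker_eq_bot.2 hinj)
    (LinearMap.range_eq_top.2 hsurj), by ext; simp⟩

/-- Positive definiteness is an open condition. -/
lemma eventually_pos_of_continuousAt {Z : Type*} [TopologicalSpace Z] {K : Z → E →L[ℝ] E →L[ℝ] ℝ}
    {z : Z} (hK : ContinuousAt K z) (hpos : ∀ v ≠ 0, 0 < K z v v) :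
    ∀ᶠ z' in 𝓝 z, ∀ v ≠ 0, 0 < K z' v v := by
  have hcomp : IsCompact (Metric.sphere (0 : E) 1) := isCompact_sphere 0 1
  have h1 : ∀ᶠ z' in 𝓝 z, ∀ v ∈ Metric.sphere (0 : E) 1, 0 < K z' v v := by
    refine hcomp.eventually_forall_of_forall_eventually (P := fun z' v => 0 < K z' v v)
      fun v hv => ?_
    have hv0 : v ≠ 0 := by
      rintro rfl; simp at hv
    have hc : ContinuousAt (fun p : Z × E => K p.1 p.2 p.2) (z, v) := by
      have h2 : ContinuousAt (fun p : Z × E => K p.1) (z, v) :=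
        ContinuousAt.comp (x := (z, v)) (g := K) hK continuousAt_fst
      exact (h2.clm_apply continuousAt_snd).clm_apply continuousAt_snd
    exact hc.eventually (lt_mem_nhds (hpos v hv0))
  filter_upwards [h1] with z' hz' v hv
  have hn : 0 < ‖v‖ := norm_pos_iff.2 hv
  have h2 := hz' (‖v‖⁻¹ • v) (by simp [norm_smul, hn.ne'])
  simp only [map_smul, _root_.smul_apply, smul_eq_mul] at h2
  have h3 : 0 < ‖v‖⁻¹ * ‖v‖⁻¹ := by positivity
  rw [← mul_assoc] at h2
  exact (mul_pos_iff_of_pos_left h3).1 h2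

end PosDef

/-! ### Extension from one side of a given time -/

section Extension

variable {E F : Type*} [NormedAddCommGroup E] [NormedSpace ℝ E] [FiniteDimensional ℝ E]
  [NormedAddCommGroup F] [NormedSpace ℝ F] [CompleteSpace F]

/-- Two-sided local extension of a map that is smooth on one side of `t₀`; the sign `σ = ± 1` is
that of the side. -/
lemma exists_contDiff_extension_of_side {f : E × ℝ → F} {T : Set ℝ} {y₀ : E} {t₀ σ : ℝ}
    (hσ : σ * σ = 1) (hT : ∀ᶠ t in 𝓝 t₀, t ∈ T ↔ 0 ≤ σ * (t - t₀))
    (hf : ∀ᶠ z in 𝓝[univ ×ˢ T] (y₀, t₀), ContDiffWithinAt ℝ ∞ f (univ ×ˢ T) z) :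
    ∃ g : E × ℝ → F, ContDiff ℝ ∞ g ∧ ∀ᶠ z in 𝓝 (y₀, t₀), z.2 ∈ T → g z = f z := by
  -- `i` maps the half-space to the side on which `f` is given, and `j` is its inverse.
  let i : E × ℝ → E × ℝ := fun z => (z.1, t₀ + σ * z.2)
  let j : E × ℝ → E × ℝ := fun z => (z.1, σ * (z.2 - t₀))
  have hi : ContDiff ℝ ∞ i := by fun_prop
  have hj : ContDiff ℝ ∞ j := by fun_prop
  have hij : ∀ z, i (j z) = z := by
    intro z
    refine Prod.ext rfl ?_
    simp only [i, j]
    rw [← mul_assoc, hσ]; ring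
  have hi0 : i (y₀, 0) = (y₀, t₀) := by simp [i]
  have hj0 : j (y₀, t₀) = (y₀, 0) := by simp [j]
  have hit : Tendsto i (𝓝 (y₀, 0)) (𝓝 (y₀, t₀)) := by
    have := hi.continuous.tendsto (y₀, 0); rwa [hi0] at this
  have hjt : Tendsto j (𝓝 (y₀, t₀)) (𝓝 (y₀, 0)) := by
    have := hj.continuous.tendsto (y₀, t₀); rwa [hj0] at this
  have hT' : ∀ᶠ z in 𝓝 (y₀, (0 : ℝ)), (i z).2 ∈ T ↔ 0 ≤ z.2 := by
    have := hit.eventually ((continuous_snd.tendsto (y₀, t₀)).eventually hT)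
    filter_upwards [this] with z hz
    rw [hz]
    simp only [i]
    rw [add_sub_cancel_left, ← mul_assoc, hσ, one_mul]
  have hf' : ∀ᶠ z in 𝓝[upperHalf E] (y₀, 0), ContDiffWithinAt ℝ ∞ (f ∘ i) (upperHalf E) z := by
    rw [eventually_nhdsWithin_iff] at hf ⊢
    filter_upwards [hit.eventually hf, hT'.eventually_nhds] with z hz hz' hzu
    have h1 := hz ⟨mem_univ _, hz'.self_of_nhds.2 hzu⟩
    have h2 : ContDiffWithinAt ℝ ∞ (f ∘ i) (i ⁻¹' (univ ×ˢ T)) z :=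
      ContDiffWithinAt.comp z h1 hi.contDiffAt.contDiffWithinAt fun _ h => h
    refine h2.congr_set ?_
    filter_upwards [hz'] with z' hz'
    refine propext ?_
    change (i z' ∈ univ ×ˢ T) ↔ z' ∈ upperHalf E
    simp only [mem_prod, mem_univ, true_and, hz']
    rfl
  obtain ⟨g, hg, hgf⟩ := exists_contDiff_extension hf'
  refine ⟨g ∘ j, hg.comp hj, ?_⟩
  filter_upwards [hjt.eventually hgf, hjt.eventually hT'] with z hz hz' hzT
  rw [hij] at hz'
  have := hz (hz'.1 hzT)
  simpa [hij] using this

end Extension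

/-! ### Extension of families of symmetric forms in time -/

section FormExtension

variable {E : Type*} [NormedAddCommGroup E] [NormedSpace ℝ E]
  {M : Type*} [TopologicalSpace M] [ChartedSpace E M] [IsManifold 𝓘(ℝ, E) ∞ M]

/-- The family of bilinear forms whose expression in the chart at `x₀` is `G`; it is used on the
chart domain only. -/
def ofCoordForm (G : E × ℝ → E →L[ℝ] E →L[ℝ] ℝ) (x₀ : M) (t : ℝ) (x : M) :
    TangentSpace 𝓘(ℝ, E) x →L[ℝ] TangentSpace 𝓘(ℝ, E) x →L[ℝ] ℝ :=
  (trivializationAt (E →L[ℝ] E →L[ℝ] ℝ)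
    (fun x : M => TangentSpace 𝓘(ℝ, E) x →L[ℝ] TangentSpace 𝓘(ℝ, E) x →L[ℝ] ℝ) x₀).symm x
    (G (extChartAt 𝓘(ℝ, E) x₀ x, t))

lemma coordForm_ofCoordForm {G : E × ℝ → E →L[ℝ] E →L[ℝ] ℝ} {x₀ : M} {y : E × ℝ}
    (hy : y.1 ∈ (extChartAt 𝓘(ℝ, E) x₀).target) : coordForm (ofCoordForm G x₀) x₀ y = G y := by
  have hx : (extChartAt 𝓘(ℝ, E) x₀).symm y.1 ∈ (chartAt E x₀).source := by
    rw [← extChartAt_source 𝓘(ℝ, E)]; exact (extChartAt 𝓘(ℝ, E) x₀).map_target hy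
  have := Trivialization.apply_mk_symm (trivializationAt (E →L[ℝ] E →L[ℝ] ℝ)
    (fun x : M => TangentSpace 𝓘(ℝ, E) x →L[ℝ] TangentSpace 𝓘(ℝ, E) x →L[ℝ] ℝ) x₀)
    (b := (extChartAt 𝓘(ℝ, E) x₀).symm y.1) (by simpa using hx)
    (G (extChartAt 𝓘(ℝ, E) x₀ ((extChartAt 𝓘(ℝ, E) x₀).symm y.1), y.2))
  rw [(extChartAt 𝓘(ℝ, E) x₀).right_inv hy] at this
  have h2 := congrArg Prod.snd this
  refine Eq.trans ?_ h2
  unfold ofCoordForm coordForm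
  dsimp only
  rw [(extChartAt 𝓘(ℝ, E) x₀).right_inv hy]
  rfl

lemma contMDiffAt_ofCoordForm {G : E × ℝ → E →L[ℝ] E →L[ℝ] ℝ} {x₀ : M} {q : M × ℝ}
    (hq : q.1 ∈ (chartAt E x₀).source)
    (hG : ContDiffAt ℝ ∞ G (extChartAt 𝓘(ℝ, E) x₀ q.1, q.2)) :
    ContMDiffAt (𝓘(ℝ, E).prod 𝓘(ℝ, ℝ)) (𝓘(ℝ, E).prod 𝓘(ℝ, E →L[ℝ] E →L[ℝ] ℝ)) ∞
      (formSection (ofCoordForm G x₀)) q := by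
  rw [contMDiffAt_formSection_iff hq]
  refine hG.congr_of_eventuallyEq ?_
  have h1 : ∀ᶠ y in 𝓝 (extChartAt 𝓘(ℝ, E) x₀ q.1, q.2), y.1 ∈ (extChartAt 𝓘(ℝ, E) x₀).target :=
    (continuous_fst.tendsto (extChartAt 𝓘(ℝ, E) x₀ q.1, q.2)).eventually
      ((isOpen_extChartAt_target (I := 𝓘(ℝ, E)) x₀).mem_nhds
        ((extChartAt 𝓘(ℝ, E) x₀).map_source (by rwa [extChartAt_source])))
  filter_upwards [h1] with y hy using coordForm_ofCoordForm hy

lemma ofCoordForm_apply {G : E × ℝ → E →L[ℝ] E →L[ℝ] ℝ} {x₀ x : M} {t : ℝ}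
    (hx : x ∈ (chartAt E x₀).source) (v w : TangentSpace 𝓘(ℝ, E) x) :
    ofCoordForm G x₀ t x v w = G (extChartAt 𝓘(ℝ, E) x₀ x, t)
      (mfderiv 𝓘(ℝ, E) 𝓘(ℝ, E) (extChartAt 𝓘(ℝ, E) x₀) x v)
      (mfderiv 𝓘(ℝ, E) 𝓘(ℝ, E) (extChartAt 𝓘(ℝ, E) x₀) x w) := by
  refine (coordForm_apply_mfderiv hx v w).symm.trans ?_
  rw [coordForm_ofCoordForm]
  exact (extChartAt 𝓘(ℝ, E) x₀).map_source (by rwa [extChartAt_source])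

/-- A family of symmetric forms that is smooth over a set `T` of times extends smoothly, as a family
of symmetric forms, to all times, if each point of `T` is interior to `T` or an endpoint. -/
lemma exists_symm_extension [FiniteDimensional ℝ E] [T2Space M] [SigmaCompactSpace M] {T : Set ℝ}
    (hTc : IsClosed T)
    (hT : ∀ t₀ ∈ T, T ∈ 𝓝 t₀ ∨ ∃ σ : ℝ, σ * σ = 1 ∧ ∀ᶠ t in 𝓝 t₀, t ∈ T ↔ 0 ≤ σ * (t - t₀))
    {h : ℝ → ∀ x : M, TangentSpace 𝓘(ℝ, E) x →L[ℝ] TangentSpace 𝓘(ℝ, E) x →L[ℝ] ℝ}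
    (hsymm : ∀ t ∈ T, ∀ (x : M) (v w : TangentSpace 𝓘(ℝ, E) x), h t x v w = h t x w v)
    (hh : ContMDiffOn (𝓘(ℝ, E).prod 𝓘(ℝ, ℝ)) (𝓘(ℝ, E).prod 𝓘(ℝ, E →L[ℝ] E →L[ℝ] ℝ)) ∞
      (formSection h) (univ ×ˢ T)) :
    ∃ k : ℝ → ∀ x : M, TangentSpace 𝓘(ℝ, E) x →L[ℝ] TangentSpace 𝓘(ℝ, E) x →L[ℝ] ℝ,
      ContMDiff (𝓘(ℝ, E).prod 𝓘(ℝ, ℝ)) (𝓘(ℝ, E).prod 𝓘(ℝ, E →L[ℝ] E →L[ℝ] ℝ)) ∞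
        (formSection k) ∧
      (∀ (t : ℝ) (x : M) (v w : TangentSpace 𝓘(ℝ, E) x), k t x v w = k t x w v) ∧
      ∀ t ∈ T, k t = h t := by
  let C : ∀ q : M × ℝ, Set (TangentSpace 𝓘(ℝ, E) q.1 →L[ℝ] TangentSpace 𝓘(ℝ, E) q.1 →L[ℝ] ℝ) :=
    fun q => {b | (∀ v w, b v w = b w v) ∧ (q.2 ∈ T → b = h q.2 q.1)}
  have hconv : ∀ q, Convex ℝ (C q) := by
    rintro q b ⟨hb, hb'⟩ b' ⟨hc, hc'⟩ α β hα hβ hαβ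
    refine ⟨fun v w => ?_, fun hq => ?_⟩
    · simp only [_root_.add_apply, _root_.smul_apply, hb v w, hc v w]
    · rw [hb' hq, hc' hq, ← add_smul, hαβ, one_smul]
  have hloc : ∀ q₀ : M × ℝ, ∃ k : ℝ → ∀ x : M,
      TangentSpace 𝓘(ℝ, E) x →L[ℝ] TangentSpace 𝓘(ℝ, E) x →L[ℝ] ℝ,
      ∀ᶠ q in 𝓝 q₀, ContMDiffAt (𝓘(ℝ, E).prod 𝓘(ℝ, ℝ))
        (𝓘(ℝ, E).prod 𝓘(ℝ, E →L[ℝ] E →L[ℝ] ℝ)) ∞ (formSection k) q ∧ k q.2 q.1 ∈ C q := by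
    rintro ⟨x₀, t₀⟩
    set φ := extChartAt 𝓘(ℝ, E) x₀ with hφ
    by_cases ht₀ : t₀ ∈ T
    · have hsrc : ∀ᶠ q : M × ℝ in 𝓝 (x₀, t₀), q.1 ∈ (chartAt E x₀).source :=
        (continuous_fst.tendsto (x₀, t₀)).eventually (chart_source_mem_nhds E x₀)
      have htgt : ∀ᶠ z : E × ℝ in 𝓝 (φ x₀, t₀), z.1 ∈ φ.target :=
        (continuous_fst.tendsto (φ x₀, t₀)).eventually
          ((isOpen_extChartAt_target (I := 𝓘(ℝ, E)) x₀).mem_nhds (mem_extChartAt_target x₀))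
      have hcd : ∀ᶠ z in 𝓝[univ ×ˢ T] (φ x₀, t₀),
          ContDiffWithinAt ℝ ∞ (coordForm h x₀) (univ ×ˢ T) z := by
        rw [eventually_nhdsWithin_iff]
        filter_upwards [htgt] with z hz hzT
        have hs : φ.symm z.1 ∈ (chartAt E x₀).source := by
          rw [← extChartAt_source 𝓘(ℝ, E)]; exact φ.map_target hz
        have h1 := (contMDiffWithinAt_formSection_iff (q := (φ.symm z.1, z.2)) hs).1
          (hh (φ.symm z.1, z.2) ⟨mem_univ _, hzT.2⟩)
        rw [← hφ] at h1
        dsimp only at h1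
        rwa [φ.right_inv hz] at h1
      -- extend the coefficients, then symmetrize
      obtain ⟨g, hg, hgh⟩ : ∃ g : E × ℝ → E →L[ℝ] E →L[ℝ] ℝ,
          (∀ᶠ z in 𝓝 (φ x₀, t₀), ContDiffAt ℝ ∞ g z) ∧
          ∀ᶠ z in 𝓝 (φ x₀, t₀), z.2 ∈ T → g z = coordForm h x₀ z := by
        rcases hT t₀ ht₀ with hn | ⟨σ, hσ, hs⟩
        · refine ⟨coordForm h x₀, ?_, .of_forall fun _ _ => rfl⟩
          have hT1 : ∀ᶠ z : E × ℝ in 𝓝 (φ x₀, t₀), univ ×ˢ T ∈ 𝓝 z := by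
            have : ∀ᶠ t in 𝓝 t₀, T ∈ 𝓝 t := eventually_mem_nhds_iff.2 hn
            filter_upwards [(continuous_snd.tendsto (φ x₀, t₀)).eventually this] with z hz
            exact prod_mem_nhds univ_mem hz
          have hT0 := hT1.self_of_nhds
          rw [nhdsWithin_eq_nhds.2 hT0] at hcd
          filter_upwards [hcd, hT1] with z hz hz1 using hz.contDiffAt hz1
        · obtain ⟨g, hg, hgf⟩ := exists_contDiff_extension_of_side hσ hs hcd
          exact ⟨g, .of_forall fun z => hg.contDiffAt, hgf⟩
      -- The extension `g` need not be symmetric outside of `T`, so it is averaged with its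
      -- transpose.
      let L := (ContinuousLinearMap.flipₗᵢ ℝ E E ℝ).toContinuousLinearEquiv.toContinuousLinearMap
      let G : E × ℝ → E →L[ℝ] E →L[ℝ] ℝ := fun z => (1 / 2 : ℝ) • (g z + L (g z))
      have hGapp : ∀ z v w, G z v w = 1 / 2 * (g z v w + g z w v) := fun _ _ _ => rfl
      have hφt : Tendsto (fun q : M × ℝ => (φ q.1, q.2)) (𝓝 (x₀, t₀)) (𝓝 (φ x₀, t₀)) :=
        ((continuousAt_extChartAt (I := 𝓘(ℝ, E)) x₀).comp_of_eq continuousAt_fst rfl).prodMk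
          continuousAt_snd
      refine ⟨ofCoordForm G x₀, ?_⟩
      filter_upwards [hsrc, hφt.eventually hg, hφt.eventually hgh] with q hq hqg hqh
      refine ⟨contMDiffAt_ofCoordForm hq ?_, fun v w => ?_, fun hqT => ?_⟩
      · exact (contDiffAt_const (c := (1 / 2 : ℝ))).smul
          (hqg.add (L.contDiff.contDiffAt.comp _ hqg))
      · rw [ofCoordForm_apply hq, ofCoordForm_apply hq]
        exact (hGapp _ _ _).trans ((by ring : _ = _).trans (hGapp _ _ _).symm)
      · refine ContinuousLinearMap.ext fun v => ContinuousLinearMap.ext fun w => ?_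
        rw [ofCoordForm_apply hq]
        refine (hGapp _ _ _).trans ?_
        rw [hqh hqT]
        have e1 := coordForm_apply_mfderiv (k := h) (t := q.2) hq v w
        have e2 := coordForm_apply_mfderiv (k := h) (t := q.2) hq w v
        rw [hsymm q.2 hqT q.1 w v] at e2
        refine (congrArg₂ (fun a b : ℝ => 1 / 2 * (a + b)) e1 e2).trans ?_
        ring
    -- Away from the closed set `T`, only symmetry is required.
    · refine ⟨fun _ _ => 0, ?_⟩
      have h1 : ∀ᶠ q : M × ℝ in 𝓝 (x₀, t₀), q.2 ∉ T :=
        (continuous_snd.tendsto (x₀, t₀)).eventually (hTc.isOpen_compl.mem_nhds ht₀)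
      filter_upwards [h1] with q hq
      refine ⟨?_, fun v w => rfl, fun hqT => absurd hqT hq⟩
      rw [contMDiffAt_formSection_iff (mem_chart_source E q.1)]
      refine contDiffAt_const (c := (0 : E →L[ℝ] E →L[ℝ] ℝ)) |>.congr_of_eventuallyEq ?_
      have h2 : ∀ᶠ y : E × ℝ in 𝓝 (extChartAt 𝓘(ℝ, E) q.1 q.1, q.2),
          y.1 ∈ (extChartAt 𝓘(ℝ, E) q.1).target :=
        (continuous_fst.tendsto (extChartAt 𝓘(ℝ, E) q.1 q.1, q.2)).eventually
          ((isOpen_extChartAt_target (I := 𝓘(ℝ, E)) q.1).mem_nhds (mem_extChartAt_target q.1))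
      filter_upwards [h2] with y hy
      ext v w
      rw [coordForm_apply hy]
      rfl
  obtain ⟨k, hk, hkC⟩ := exists_formFamily_of_local C hconv hloc
  exact ⟨k, hk, fun t x => (hkC (x, t)).1, fun t ht => funext fun x => (hkC (x, t)).2 ht⟩

end FormExtension

/-! ### Null hypersurfaces in a chart -/

section ChartGerm

universe u

variable {P : Type*} {E : Type u} [NormedAddCommGroup P] [NormedSpace ℝ P]
  [NormedAddCommGroup E] [NormedSpace ℝ E] [FiniteDimensional ℝ E]

lemma isInvertible_of_bijective {F F' : Type*} [NormedAddCommGroup F] [NormedSpace ℝ F]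
    [CompleteSpace F] [NormedAddCommGroup F'] [NormedSpace ℝ F'] [CompleteSpace F'] {A : F →L[ℝ] F'}
    (hA : Function.Bijective A) : A.IsInvertible :=
  ⟨ContinuousLinearEquiv.ofBijective A (LinearMap.ker_eq_bot.2 hA.1)
    (LinearMap.range_eq_top.2 hA.2), ContinuousLinearMap.ext fun _ => rfl⟩

/-- The unit normal `V` of a hypersurface with conormal `n` is `b⁻¹ n / √(n (b⁻¹ n))`. -/
lemma unitNormal_eq {b : E →L[ℝ] E →L[ℝ] ℝ} (hb : ∀ v ≠ 0, 0 < b v v)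
    {A : P × ℝ →L[ℝ] E} (hA : A.IsInvertible) {V : E} {ξ : P × ℝ} (hξ : 0 < ξ.2) (hV : A ξ = V)
    (h1 : b V V = 1) (h0 : ∀ w, b V (A (w, 0)) = 0) :
    V = (Real.sqrt (((ContinuousLinearMap.snd ℝ P ℝ).comp A.inverse)
        (b.inverse ((ContinuousLinearMap.snd ℝ P ℝ).comp A.inverse))))⁻¹ •
      b.inverse ((ContinuousLinearMap.snd ℝ P ℝ).comp A.inverse) := by
  obtain ⟨e, he⟩ := isInvertible_of_pos hb
  obtain ⟨a, ha⟩ := hA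
  set n := (ContinuousLinearMap.snd ℝ P ℝ).comp A.inverse with hn
  have hnA : ∀ z, n (A z) = z.2 := by
    intro z
    rw [hn, ← ha, ContinuousLinearMap.inverse_equiv]
    simp
  -- `b V` is a positive multiple of the conormal
  set l := b V (A (0, 1)) with hl
  have hbV : b V = l • n := by
    ext w
    obtain ⟨z, rfl⟩ : ∃ z, A z = w := ⟨a.symm w, by rw [← ha]; simp⟩
    have hz : z = (z.1, (0 : ℝ)) + z.2 • ((0 : P), (1 : ℝ)) := by ext <;> simp
    rw [_root_.smul_apply, hnA]
    conv_lhs => rw [hz, map_add, map_add, map_smul, map_smul, h0]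
    simp [hl, mul_comm]
  set u := b.inverse n with hu
  have hVu : V = l • u := by
    have : b.inverse (b V) = V := by
      rw [← he, ContinuousLinearMap.inverse_equiv]; exact e.symm_apply_apply V
    rw [← this, hbV, map_smul]
  have hlV : l * n V = 1 := by
    rw [← h1, hbV]; rfl
  have hnV : n V = ξ.2 := by rw [← hV, hnA]
  have hlpos : 0 < l := by
    rw [hnV] at hlV
    by_contra hneg
    nlinarith
  have hnu : l * (l * n u) = 1 := by
    rw [← hlV, hVu, map_smul, smul_eq_mul]
  have hsq : Real.sqrt (n u) = l⁻¹ := by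
    have : n u = l⁻¹ ^ 2 := by
      field_simp
      linarith
    rw [this, Real.sqrt_sq (by positivity)]
  rw [hsq, inv_inv]
  exact hVu

/-- A null hypersurface of `K - dt²`, in a chart, through a hypersurface with given unit normal. -/
lemma exists_chart_germ [FiniteDimensional ℝ P] {K : E × ℝ → E →L[ℝ] E →L[ℝ] ℝ} {C : P × ℝ → E}
    {V : P → E} {y₀ : P}
    (hK : ∀ᶠ y in 𝓝 (C (y₀, 0), (0 : ℝ)), ContDiffAt ℝ ∞ K y)
    (hsymm : ∀ᶠ y in 𝓝 (C (y₀, 0), (0 : ℝ)), ∀ v w, K y v w = K y w v)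
    (hpos : ∀ v ≠ 0, 0 < K (C (y₀, 0), 0) v v)
    (hC : ∀ᶠ z in 𝓝 (y₀, (0 : ℝ)), ContDiffAt ℝ ∞ C z)
    (hCb : Function.Bijective (fderiv ℝ C (y₀, 0)))
    (hV : ∀ᶠ y in 𝓝 y₀, (∃ ξ : P × ℝ, 0 < ξ.2 ∧ fderiv ℝ C (y, 0) ξ = V y) ∧
      K (C (y, 0), 0) (V y) (V y) = 1 ∧
      ∀ w, K (C (y, 0), 0) (V y) (fderiv ℝ C (y, 0) (w, 0)) = 0) :
    ∃ X : P × ℝ → E, (∀ᶠ q in 𝓝 (y₀, (0 : ℝ)), ContDiffAt ℝ ∞ X q ∧ ChartEikonalAt K X q ∧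
        Function.Bijective (fderiv ℝ X q)) ∧
      ∀ᶠ y in 𝓝 y₀, X (y, 0) = C (y, 0) ∧ fderiv ℝ X (y, 0) (0, 1) = V y := by
  have := FiniteDimensional.complete ℝ E
  have := FiniteDimensional.complete ℝ P
  have h0t : Tendsto (fun y : P => (y, (0 : ℝ))) (𝓝 y₀) (𝓝 (y₀, 0)) :=
    Continuous.tendsto (by fun_prop) y₀
  have hCinv : (fderiv ℝ C (y₀, 0)).IsInvertible := isInvertible_of_bijective hCb
  have hopen : IsOpen {A : P × ℝ →L[ℝ] E | A.IsInvertible} := ContinuousLinearEquiv.isOpen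
  have hx : ∀ᶠ y in 𝓝 y₀, ContDiffAt ℝ ∞ (fun y => C (y, 0)) y := by
    filter_upwards [h0t.eventually hC] with y hy
    exact ContDiffAt.comp y (f := fun y : P => (y, (0 : ℝ))) hy
      (contDiffAt_id.prodMk contDiffAt_const)
  have hxt : Tendsto (fun y => (C (y, 0), (0 : ℝ))) (𝓝 y₀) (𝓝 (C (y₀, 0), 0)) :=
    hx.self_of_nhds.continuousAt.prodMk continuousAt_const
  have hD : ∀ᶠ y in 𝓝 y₀, ContDiffAt ℝ ∞ (fun y => fderiv ℝ C (y, 0)) y := by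
    filter_upwards [h0t.eventually hC] with y hy
    exact ContDiffAt.comp y (f := fun y : P => (y, (0 : ℝ))) (g := fderiv ℝ C)
      (hy.fderiv_right (m := ∞) le_rfl) (contDiffAt_id.prodMk contDiffAt_const)
  have hDinv : ∀ᶠ y in 𝓝 y₀, (fderiv ℝ C (y, 0)).IsInvertible :=
    hD.self_of_nhds.continuousAt.eventually (hopen.mem_nhds hCinv)
  have hKpos := eventually_pos_of_continuousAt hK.self_of_nhds.continuousAt hpos
  -- the unit normal is smooth
  have hVs : ∀ᶠ y in 𝓝 y₀, ContDiffAt ℝ ∞ V y := by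
    have hall := hV.and (hDinv.and (hxt.eventually hKpos))
    filter_upwards [hall.eventually_nhds, hall, hD, hx, hxt.eventually hK]
      with y hall hy hD hx hK
    obtain ⟨⟨⟨ξ, hξ, hξV⟩, hV1, hV0⟩, hDi, hKp⟩ := hy
    have hn : ContDiffAt ℝ ∞ (fun y => (ContinuousLinearMap.snd ℝ P ℝ).comp
        (fderiv ℝ C (y, 0)).inverse) y := by
      obtain ⟨a, ha⟩ := hDi
      have h1 : ContDiffAt ℝ ∞ ContinuousLinearMap.inverse (fderiv ℝ C (y, 0)) := by
        rw [← ha]; exact contDiffAt_map_inverse a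
      exact (contDiffAt_const (c := ContinuousLinearMap.snd ℝ P ℝ)).clm_comp
        (ContDiffAt.comp y (f := fun y => fderiv ℝ C (y, 0)) h1 hD)
    have hKx : ContDiffAt ℝ ∞ (fun y => (K (C (y, 0), 0)).inverse) y := by
      obtain ⟨a, ha⟩ := isInvertible_of_pos hKp
      have h1 : ContDiffAt ℝ ∞ ContinuousLinearMap.inverse (K (C (y, 0), 0)) := by
        rw [← ha]; exact contDiffAt_map_inverse a
      exact h1.comp y (ContDiffAt.comp y (f := fun y => (C (y, 0), (0 : ℝ))) hK
        (hx.prodMk contDiffAt_const))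
    have hu := hKx.clm_apply hn
    have hq := hn.clm_apply hu
    have hVy := unitNormal_eq hKp hDi hξ hξV hV1 hV0
    have hVne : V y ≠ 0 := by
      intro h
      rw [h] at hV1
      simp at hV1
    have hne : ((ContinuousLinearMap.snd ℝ P ℝ).comp (fderiv ℝ C (y, 0)).inverse)
        ((K (C (y, 0), 0)).inverse ((ContinuousLinearMap.snd ℝ P ℝ).comp
          (fderiv ℝ C (y, 0)).inverse)) ≠ 0 := by
      intro h
      rw [h] at hVy
      simp at hVy
      exact hVne hVy
    have hsq : Real.sqrt (((ContinuousLinearMap.snd ℝ P ℝ).comp (fderiv ℝ C (y, 0)).inverse)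
        ((K (C (y, 0), 0)).inverse ((ContinuousLinearMap.snd ℝ P ℝ).comp
          (fderiv ℝ C (y, 0)).inverse))) ≠ 0 := by
      intro h
      rw [h] at hVy
      simp at hVy
      exact hVne hVy
    refine (((hq.sqrt hne).inv hsq).smul hu).congr_of_eventuallyEq ?_
    filter_upwards [hall] with y' hy'
    obtain ⟨⟨⟨ξ, hξ, hξV⟩, hV1, hV0⟩, hDi, hKp⟩ := hy'
    exact unitNormal_eq hKp hDi hξ hξV hV1 hV0
  -- the pregeodesics leaving the hypersurface with velocity `V`
  obtain ⟨X, hX, hX0, hacc⟩ := exists_accel_eq (x := fun y => C (y, 0)) hK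
    (isInvertible_of_pos hpos) hx hVs
  have hXt : Tendsto (fun q => (X q, q.2)) (𝓝 (y₀, 0)) (𝓝 (C (y₀, 0), 0)) := by
    have := hX.self_of_nhds.continuousAt.tendsto
    rw [hX0.self_of_nhds.1] at this
    exact this.prodMk_nhds (continuous_snd.tendsto (y₀, (0 : ℝ)))
  have hXw : ∀ᶠ y in 𝓝 y₀, ∀ z : P × ℝ, fderiv ℝ X (y, 0) z
      = fderiv ℝ C (y, 0) (z.1, 0) + z.2 • V y := by
    filter_upwards [hX0.eventually_nhds, h0t.eventually hX, h0t.eventually hC] with y hy hX hC z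
    have hz : z = (z.1, (0 : ℝ)) + z.2 • ((0 : P), (1 : ℝ)) := by ext <;> simp
    have e : fderiv ℝ X (y, 0) (z.1, 0) = fderiv ℝ C (y, 0) (z.1, 0) := by
      have hi : HasFDerivAt (fun y : P => (y, (0 : ℝ))) (ContinuousLinearMap.inl ℝ P ℝ) y :=
        (ContinuousLinearMap.inl ℝ P ℝ).hasFDerivAt
      have h1 := HasFDerivAt.comp y (hX.differentiableAt (by simp)).hasFDerivAt hi
      have h2 := HasFDerivAt.comp y (hC.differentiableAt (by simp)).hasFDerivAt hi
      have h3 := h2.congr_of_eventuallyEq (f₁ := X ∘ fun y : P => (y, (0 : ℝ)))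
        (by filter_upwards [hy] with y' hy' using hy'.1)
      have h4 := h1.unique h3
      simpa using congrArg (fun A : P →L[ℝ] E => A z.1) h4
    conv_lhs => rw [hz, map_add, map_smul, e, hy.self_of_nhds.2]
  have heik : ∀ᶠ q in 𝓝 (y₀, (0 : ℝ)), ChartEikonalAt K X q := by
    refine chartEikonal_of_accel_eq ?_ ?_ (hXt.eventually hsymm) hacc ?_
    · filter_upwards [hX] with q hq using hq.of_le (WithTop.coe_le_coe.2 le_top)
    · filter_upwards [hXt.eventually hK] with q hq using hq.of_le (by simp)
    -- Initially, the eikonal condition says that `V` is a unit normal.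
    · filter_upwards [hXw, hX0, hV] with y h1 h2 h3 z
      obtain ⟨-, h4, h5⟩ := h3
      rw [h1 z, h2.2, h2.1, map_add, map_smul, h5, h4]
      simp
  refine ⟨X, ?_, hX0⟩
  -- The velocity `V` is transversal to the hypersurface.
  have hbij : (fderiv ℝ X (y₀, 0)).IsInvertible := by
    obtain ⟨a, ha⟩ := hCinv
    obtain ⟨⟨ξ, hξ, hξV⟩, -, -⟩ := hV.self_of_nhds
    have hinj : Function.Injective (fderiv ℝ X (y₀, 0)) := by
      rw [injective_iff_map_eq_zero]
      intro z hz
      rw [hXw.self_of_nhds, ← hξV, ← map_smul, ← map_add, map_eq_zero_iff _ hCb.1,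
        Prod.ext_iff] at hz
      obtain ⟨hz1, hz2⟩ := hz
      simp only [Prod.fst_add, Prod.smul_fst, Prod.fst_zero, Prod.snd_add, Prod.smul_snd,
        smul_eq_mul, zero_add, Prod.snd_zero, mul_eq_zero, hξ.ne', or_false] at hz1 hz2
      rw [hz2, zero_smul, add_zero] at hz1
      exact Prod.ext hz1 hz2
    have hsurj : Function.Surjective (fderiv ℝ X (y₀, 0)) :=
      (LinearMap.injective_iff_surjective_of_finrank_eq_finrank
        (f := (fderiv ℝ X (y₀, 0)).toLinearMap) a.toLinearEquiv.finrank_eq).1 hinj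
    exact isInvertible_of_bijective ⟨hinj, hsurj⟩
  have hXb : ∀ᶠ q in 𝓝 (y₀, (0 : ℝ)), (fderiv ℝ X q).IsInvertible :=
    (hX.self_of_nhds.fderiv_right (m := 0) (by simp)).continuousAt.eventually
      (hopen.mem_nhds hbij)
  filter_upwards [hX, heik, hXb] with q h1 h2 h3 using ⟨h1, h2, h3.bijective⟩

end ChartGerm

/-! ### Local null hypersurfaces -/

section NullGerm

universe u

variable {P : Type*} {E : Type u} [NormedAddCommGroup P] [NormedSpace ℝ P]
  [NormedAddCommGroup E] [NormedSpace ℝ E]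
  {S M : Type*} [TopologicalSpace S] [ChartedSpace P S] [IsManifold 𝓘(ℝ, P) ∞ S]
  [TopologicalSpace M] [ChartedSpace E M] [IsManifold 𝓘(ℝ, E) ∞ M]

/-- `C` is a smooth extension, near `(p₀, 0)`, of the one-sided collar `c₀` to both sides. -/
structure IsCollarExtension (c₀ C : S × ℝ → M) (p₀ : S) : Prop where
  smooth : ∀ᶠ z in 𝓝 (p₀, (0 : ℝ)), ContMDiffAt (𝓘(ℝ, P).prod 𝓘(ℝ, ℝ)) 𝓘(ℝ, E) ∞ C z
  bijective : Function.Bijective (mfderiv (𝓘(ℝ, P).prod 𝓘(ℝ, ℝ)) 𝓘(ℝ, E) C (p₀, 0))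
  eq : ∀ᶠ z in 𝓝 (p₀, (0 : ℝ)), 0 ≤ z.2 → C z = c₀ z

/-- `V p` is the `k₀`-unit normal to `S × {0}` in the collar `C`, at `p`, pointing to the side on
which the collar coordinate increases. All tangent spaces of `M` are identified with `E`. -/
def IsCollarNormal (k : ℝ → ∀ x : M, TangentSpace 𝓘(ℝ, E) x →L[ℝ] TangentSpace 𝓘(ℝ, E) x →L[ℝ] ℝ)
    (C : S × ℝ → M) (V : S → E) (p : S) : Prop :=
  (∃ ξ : P × ℝ, 0 < ξ.2 ∧ mfderiv (𝓘(ℝ, P).prod 𝓘(ℝ, ℝ)) 𝓘(ℝ, E) C (p, 0) ξ = V p) ∧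
  k 0 (C (p, 0)) (V p) (V p) = 1 ∧
  ∀ w : P, k 0 (C (p, 0)) (V p) (mfderiv (𝓘(ℝ, P).prod 𝓘(ℝ, ℝ)) 𝓘(ℝ, E) C (p, 0) (w, (0 : ℝ))) = 0

/-- Near `q`, the map `X` is a smooth local diffeomorphism satisfying the eikonal condition. -/
def IsNullGermAt (P : Type*) [NormedAddCommGroup P] [NormedSpace ℝ P]
    {S : Type*} [TopologicalSpace S] [ChartedSpace P S]
    (k : ℝ → ∀ x : M, TangentSpace 𝓘(ℝ, E) x →L[ℝ] TangentSpace 𝓘(ℝ, E) x →L[ℝ] ℝ)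
    (X : S × ℝ → M) (q : S × ℝ) : Prop :=
  ∀ᶠ q' in 𝓝 q, ContMDiffAt (𝓘(ℝ, P).prod 𝓘(ℝ, ℝ)) 𝓘(ℝ, E) ∞ X q' ∧
    EikonalAt (P := P) k X q' ∧
    Function.Bijective (mfderiv (𝓘(ℝ, P).prod 𝓘(ℝ, ℝ)) 𝓘(ℝ, E) X q')

variable {k : ℝ → ∀ x : M, TangentSpace 𝓘(ℝ, E) x →L[ℝ] TangentSpace 𝓘(ℝ, E) x →L[ℝ] ℝ}

lemma tendsto_prod_extChartAt_symm (p : S) (t : ℝ) :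
    Tendsto (fun z : P × ℝ => ((extChartAt 𝓘(ℝ, P) p).symm z.1, z.2))
      (𝓝 (extChartAt 𝓘(ℝ, P) p p, t)) (𝓝 (p, t)) := by
  have h := (contMDiffAt_prod_chart_symm (P := P) (q := (p, t)) (mem_chart_source P p)).continuousAt
  have h' := h.tendsto
  simpa using h'

lemma tendsto_prod_extChartAt (p : S) (t : ℝ) :
    Tendsto (fun q : S × ℝ => (extChartAt 𝓘(ℝ, P) p q.1, q.2)) (𝓝 (p, t))
      (𝓝 (extChartAt 𝓘(ℝ, P) p p, t)) :=
  (contMDiffAt_prod_chart (P := P) (q := (p, t)) (mem_chart_source P p)).continuousAt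

omit [IsManifold 𝓘(ℝ, P) ∞ S] in
lemma eventually_mem_prod_target (p : S) (t : ℝ) :
    ∀ᶠ z : P × ℝ in 𝓝 (extChartAt 𝓘(ℝ, P) p p, t), z.1 ∈ (extChartAt 𝓘(ℝ, P) p).target :=
  (continuous_fst.tendsto (extChartAt 𝓘(ℝ, P) p p, t)).eventually
    ((isOpen_extChartAt_target (I := 𝓘(ℝ, P)) p).mem_nhds (mem_extChartAt_target p))

omit [NormedSpace ℝ P] [IsManifold 𝓘(ℝ, P) ∞ S] in
lemma eventually_mem_prod_source (p : S) (t : ℝ) :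
    ∀ᶠ q : S × ℝ in 𝓝 (p, t), q.1 ∈ (chartAt P p).source :=
  (continuous_fst.tendsto (p, t)).eventually (chart_source_mem_nhds P p)

/-- A null hypersurface near a point of a hypersurface with given unit normal. -/
lemma exists_local_nullGerm [FiniteDimensional ℝ P] [FiniteDimensional ℝ E] {c₀ C : S × ℝ → M}
    {V : S → E} {p₀ : S}
    (hk : ContMDiff (𝓘(ℝ, E).prod 𝓘(ℝ, ℝ)) (𝓘(ℝ, E).prod 𝓘(ℝ, E →L[ℝ] E →L[ℝ] ℝ)) ∞
      (formSection k))
    (hsymm : ∀ (t : ℝ) (x : M) (v w : TangentSpace 𝓘(ℝ, E) x), k t x v w = k t x w v)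
    (hpos : ∀ (x : M) (v : TangentSpace 𝓘(ℝ, E) x), v ≠ 0 → 0 < k 0 x v v)
    (hC : IsCollarExtension (P := P) (E := E) c₀ C p₀)
    (hV : ∀ᶠ p in 𝓝 p₀, IsCollarNormal (P := P) k C V p) :
    ∃ X : S × ℝ → M, IsNullGermAt P k X (p₀, 0) ∧ ∀ᶠ p in 𝓝 p₀, X (p, 0) = c₀ (p, 0) ∧
      mfderiv (𝓘(ℝ, P).prod 𝓘(ℝ, ℝ)) 𝓘(ℝ, E) X (p, 0) ((0 : P), (1 : ℝ)) = V p := by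
  set x₀ := C (p₀, 0) with hx₀
  set φ := extChartAt 𝓘(ℝ, E) x₀ with hφ
  set ψ := extChartAt 𝓘(ℝ, P) p₀ with hψ
  set Ĉ : P × ℝ → E := chartMap C p₀ x₀ with hĈ
  have hCc : ContinuousAt C (p₀, 0) := hC.smooth.self_of_nhds.continuousAt
  have hl : ψ.symm (ψ p₀) = p₀ := ψ.left_inv (mem_extChartAt_source p₀)
  have h0t : Tendsto (fun y : P => (y, (0 : ℝ))) (𝓝 (ψ p₀)) (𝓝 (ψ p₀, 0)) :=
    Continuous.tendsto (by fun_prop) _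
  have h0S : Tendsto (fun p : S => (p, (0 : ℝ))) (𝓝 p₀) (𝓝 (p₀, 0)) :=
    Continuous.tendsto (by fun_prop) _
  have hψs : Tendsto ψ.symm (𝓝 (ψ p₀)) (𝓝 p₀) := by
    have := (continuousAt_extChartAt_symm (I := 𝓘(ℝ, P)) p₀).tendsto
    rwa [← hψ, hl] at this
  have hĈ0 : Ĉ (ψ p₀, 0) = φ x₀ := by
    simp only [hĈ, chartMap, ← hψ, hl]; rfl
  -- everything known near `(p₀, 0)`
  have hCs : ∀ᶠ q in 𝓝 (p₀, (0 : ℝ)), C q ∈ (chartAt E x₀).source :=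
    hCc.eventually (chart_source_mem_nhds E x₀)
  have hgood := (tendsto_prod_extChartAt_symm (P := P) p₀ 0).eventually
    (hC.smooth.and (hCs.and (eventually_mem_prod_source (P := P) p₀ 0)))
  have hCsm : ∀ᶠ z in 𝓝 (ψ p₀, (0 : ℝ)), ContDiffAt ℝ ∞ Ĉ z := by
    filter_upwards [hgood, eventually_mem_prod_target (P := P) p₀ 0] with z hz hzt
    have := contDiffAt_chartMap hz.2.2 hz.2.1 hz.1
    rw [← hψ] at this
    dsimp only at this
    rwa [ψ.right_inv hzt] at this
  have hCb : Function.Bijective (fderiv ℝ Ĉ (ψ p₀, 0)) :=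
    (bijective_fderiv_chartMap_iff (q := (p₀, (0 : ℝ))) (mem_chart_source P p₀)
      (mem_chart_source E x₀) (hC.smooth.self_of_nhds.mdifferentiableAt (by simp))).2 hC.bijective
  -- the normal field in the charts
  let V' : P → E := fun y => mfderiv 𝓘(ℝ, E) 𝓘(ℝ, E) φ (C (ψ.symm y, 0)) (V (ψ.symm y))
  have hKsm : ∀ᶠ y in 𝓝 (Ĉ (ψ p₀, 0), (0 : ℝ)), ContDiffAt ℝ ∞ (coordForm k x₀) y := by
    rw [hĈ0]
    filter_upwards [eventually_mem_prod_target (P := E) x₀ 0] with y hy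
    have hs : φ.symm y.1 ∈ (chartAt E x₀).source := by
      rw [← extChartAt_source 𝓘(ℝ, E)]; exact φ.map_target hy
    have := (contMDiffAt_formSection_iff (q := (φ.symm y.1, y.2)) hs).1 (hk _)
    rw [← hφ] at this
    dsimp only at this
    rwa [φ.right_inv hy] at this
  have hKsy : ∀ᶠ y in 𝓝 (Ĉ (ψ p₀, 0), (0 : ℝ)), ∀ v w,
      coordForm k x₀ y v w = coordForm k x₀ y w v := by
    rw [hĈ0]
    filter_upwards [eventually_mem_prod_target (P := E) x₀ 0] with y hy v w
    rw [coordForm_apply hy, coordForm_apply hy]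
    exact hsymm _ _ _ _
  have hKpos : ∀ v ≠ 0, 0 < coordForm k x₀ (Ĉ (ψ p₀, 0), 0) v v := by
    intro v hv
    rw [hĈ0]
    obtain ⟨a, rfl⟩ := (bijective_mfderiv_extChartAt (mem_chart_source E x₀)).2 v
    rw [show coordForm k x₀ (φ x₀, 0) _ _ = _ from
      coordForm_apply_mfderiv (mem_chart_source E x₀) a a]
    refine hpos x₀ a fun h => hv ?_
    rw [h]
    exact map_zero (mfderiv 𝓘(ℝ, E) 𝓘(ℝ, E) φ x₀)
  have hVchart : ∀ᶠ y in 𝓝 (ψ p₀), (∃ ξ : P × ℝ, 0 < ξ.2 ∧ fderiv ℝ Ĉ (y, 0) ξ = V' y) ∧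
      coordForm k x₀ (Ĉ (y, 0), 0) (V' y) (V' y) = 1 ∧
      ∀ w, coordForm k x₀ (Ĉ (y, 0), 0) (V' y) (fderiv ℝ Ĉ (y, 0) (w, 0)) = 0 := by
    filter_upwards [h0t.eventually hgood, hψs.eventually hV,
      h0t.eventually (eventually_mem_prod_target (P := P) p₀ 0)] with y hz hVy hy
    obtain ⟨⟨ξ, hξ, hξV⟩, hV1, hV0⟩ := hVy
    have hr : ψ (ψ.symm y) = y := ψ.right_inv hy
    have hd : ∀ z : P × ℝ, fderiv ℝ Ĉ (y, 0)
        (mfderiv 𝓘(ℝ, P) 𝓘(ℝ, P) ψ (ψ.symm y) z.1, z.2)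
        = mfderiv 𝓘(ℝ, E) 𝓘(ℝ, E) φ (C (ψ.symm y, 0))
          (mfderiv (𝓘(ℝ, P).prod 𝓘(ℝ, ℝ)) 𝓘(ℝ, E) C (ψ.symm y, 0) z) := by
      intro z
      have := fderiv_chartMap (q := (ψ.symm y, (0 : ℝ))) hz.2.2 hz.2.1
        (hz.1.mdifferentiableAt (by simp)) z
      rw [← hψ] at this
      dsimp only at this
      rwa [hr] at this
    have hval : Ĉ (y, 0) = φ (C (ψ.symm y, 0)) := rfl
    refine ⟨⟨_, ?_, (hd ξ).trans ?_⟩, ?_, fun w => ?_⟩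
    · exact hξ
    · exact congrArg (mfderiv 𝓘(ℝ, E) 𝓘(ℝ, E) φ (C (ψ.symm y, 0))) hξV
    · rw [hval]
      exact (coordForm_apply_mfderiv hz.2.1 _ _).trans hV1
    · obtain ⟨z, hz'⟩ := surjective_prod_mfderiv_extChartAt hz.2.2 (w, (0 : ℝ))
      have h2 : z.2 = 0 := congrArg Prod.snd hz'
      rw [hval, ← hz']
      rw [show fderiv ℝ Ĉ (y, 0) _ = _ from hd z]
      refine (coordForm_apply_mfderiv hz.2.1 _ _).trans ?_
      have h3 : z = (z.1, (0 : ℝ)) := Prod.ext rfl h2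
      rw [h3]
      exact hV0 z.1
  -- The solution in the charts is transported back to the manifolds.
  obtain ⟨Y, hY, hY0⟩ := exists_chart_germ hKsm hKsy hKpos hCsm hCb hVchart
  have hYv : Y (ψ p₀, 0) = φ x₀ := by rw [hY0.self_of_nhds.1, hĈ0]
  have hYt : ∀ᶠ z in 𝓝 (ψ p₀, (0 : ℝ)), Y z ∈ φ.target := by
    refine hY.self_of_nhds.1.continuousAt.eventually ?_
    rw [hYv]
    exact (isOpen_extChartAt_target (I := 𝓘(ℝ, E)) x₀).mem_nhds (mem_extChartAt_target x₀)
  have hXY : (chartMap (ofChartMap Y p₀ x₀ : S × ℝ → M) p₀ x₀ : P × ℝ → E)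
      =ᶠ[𝓝 (ψ p₀, (0 : ℝ))] Y := by
    filter_upwards [hYt, eventually_mem_prod_target (P := P) p₀ 0] with z h1 h2
      using chartMap_ofChartMap h2 h1
  have hmain : ∀ᶠ q in 𝓝 (p₀, (0 : ℝ)),
      ContMDiffAt (𝓘(ℝ, P).prod 𝓘(ℝ, ℝ)) 𝓘(ℝ, E) ∞ (ofChartMap Y p₀ x₀ : S × ℝ → M) q ∧
      (ofChartMap Y p₀ x₀ : S × ℝ → M) q ∈ (chartAt E x₀).source := by
    filter_upwards [(tendsto_prod_extChartAt (P := P) p₀ 0).eventually (hY.and hYt),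
      eventually_mem_prod_source (P := P) p₀ 0] with q hq hqs
    refine ⟨contMDiffAt_ofChartMap hqs hq.2 hq.1.1, ?_⟩
    rw [← extChartAt_source 𝓘(ℝ, E)]
    exact φ.map_target hq.2
  refine ⟨ofChartMap Y p₀ x₀, ?_, ?_⟩
  · filter_upwards [hmain, eventually_mem_prod_source (P := P) p₀ 0,
      (tendsto_prod_extChartAt (P := P) p₀ 0).eventually (hY.and hXY.eventuallyEq_nhds)] with q h1
        h2 h3
    obtain ⟨⟨-, hYe, hYb⟩, hXY⟩ := h3
    have hmd := h1.1.mdifferentiableAt (n := ∞) (by simp)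
    have hfd := hXY.fderiv_eq (𝕜 := ℝ)
    refine ⟨h1.1, (chartEikonalAt_chartMap_iff h2 h1.2 hmd).1 ?_,
      (bijective_fderiv_chartMap_iff h2 h1.2 hmd).1 ?_⟩
    · intro z
      have e := hYe z
      rw [hfd, hXY.eq_of_nhds]
      exact e
    · rw [hfd]; exact hYb
  · have hψt : Tendsto ψ (𝓝 p₀) (𝓝 (ψ p₀)) :=
      (continuousAt_extChartAt (I := 𝓘(ℝ, P)) p₀).tendsto
    filter_upwards [hψt.eventually hY0, h0S.eventually hmain,
      h0S.eventually (eventually_mem_prod_source (P := P) p₀ 0), h0S.eventually hCs,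
      h0S.eventually hC.eq,
      h0S.eventually ((tendsto_prod_extChartAt (P := P) p₀ 0).eventually hXY.eventuallyEq_nhds)]
      with p h1 h2 h3 h4 h5 h6
    have hlp : ψ.symm (ψ p) = p := ψ.left_inv (by rwa [hψ, extChartAt_source])
    have hXC : (ofChartMap Y p₀ x₀ : S × ℝ → M) (p, 0) = C (p, 0) := by
      simp only [ofChartMap, ← hψ, ← hφ]
      rw [h1.1]
      simp only [hĈ, chartMap, ← hψ, ← hφ, hlp]
      exact φ.left_inv (by rwa [hφ, extChartAt_source])
    refine ⟨hXC.trans (h5 le_rfl), ?_⟩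
    have e := fderiv_chartMap (q := (p, (0 : ℝ))) h3 h2.2
      (h2.1.mdifferentiableAt (by simp)) ((0 : P), (1 : ℝ))
    have e2 : ((mfderiv 𝓘(ℝ, P) 𝓘(ℝ, P) ψ p (0 : P) : P), (1 : ℝ)) = ((0 : P), (1 : ℝ)) :=
      Prod.ext (map_zero (mfderiv 𝓘(ℝ, P) 𝓘(ℝ, P) _ p)) rfl
    have e3 : fderiv ℝ (chartMap (ofChartMap Y p₀ x₀ : S × ℝ → M) p₀ x₀ : P × ℝ → E) (ψ p, 0)
        ((0 : P), (1 : ℝ)) = V' (ψ p) := by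
      rw [h6.fderiv_eq]; exact h1.2
    have e4 := (congrArg (fderiv ℝ (chartMap (ofChartMap Y p₀ x₀ : S × ℝ → M) p₀ x₀ : P × ℝ → E)
      (ψ p, 0)) e2).symm.trans e
    have e5 : V' (ψ p) = mfderiv 𝓘(ℝ, E) 𝓘(ℝ, E) φ ((ofChartMap Y p₀ x₀ : S × ℝ → M) (p, 0))
        (V p) := by
      simp only [V']
      rw [hlp, hXC]
    exact (bijective_mfderiv_extChartAt h2.2).1 (e4.symm.trans (e3.trans e5))

end NullGerm

/-! ### Null hypersurfaces along a compact hypersurface -/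

section NullCurves

universe u

variable {P : Type*} {E : Type u} [NormedAddCommGroup P] [NormedSpace ℝ P]
  [NormedAddCommGroup E] [NormedSpace ℝ E]
  {S M : Type*} [TopologicalSpace S] [ChartedSpace P S] [IsManifold 𝓘(ℝ, P) ∞ S]
  [TopologicalSpace M] [ChartedSpace E M] [IsManifold 𝓘(ℝ, E) ∞ M]
  {k : ℝ → ∀ x : M, TangentSpace 𝓘(ℝ, E) x →L[ℝ] TangentSpace 𝓘(ℝ, E) x →L[ℝ] ℝ}

lemma IsNullGermAt.eventually_chart {X : S × ℝ → M} {p : S} {t : ℝ} {x₀ : M}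
    (hX : IsNullGermAt P k X (p, t)) (hx : X (p, t) ∈ (chartAt E x₀).source) :
    ∀ᶠ z in 𝓝 (extChartAt 𝓘(ℝ, P) p p, t),
      ContDiffAt ℝ ∞ (chartMap X p x₀ : P × ℝ → E) z ∧
      ChartEikonalAt (coordForm k x₀) (chartMap X p x₀ : P × ℝ → E) z ∧
      Function.Bijective (fderiv ℝ (chartMap X p x₀ : P × ℝ → E) z) := by
  have hXc : ContinuousAt X (p, t) := hX.self_of_nhds.1.continuousAt
  have h1 := hX.and ((hXc.eventually ((chartAt E x₀).open_source.mem_nhds hx)).and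
    (eventually_mem_prod_source (P := P) p t))
  filter_upwards [(tendsto_prod_extChartAt_symm (P := P) p t).eventually h1,
    eventually_mem_prod_target (P := P) p t] with z hz hzt
  obtain ⟨⟨hs, he, hb⟩, hz1, hz2⟩ := hz
  have hr : extChartAt 𝓘(ℝ, P) p ((extChartAt 𝓘(ℝ, P) p).symm z.1) = z.1 :=
    (extChartAt 𝓘(ℝ, P) p).right_inv hzt
  have hmd := hs.mdifferentiableAt (n := ∞) (by simp)
  have e1 := contDiffAt_chartMap hz2 hz1 hs
  have e2 := (chartEikonalAt_chartMap_iff hz2 hz1 hmd).2 he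
  have e3 := (bijective_fderiv_chartMap_iff hz2 hz1 hmd).2 hb
  dsimp only at e1 e2 e3
  rw [hr] at e1 e2 e3
  exact ⟨e1, e2, e3⟩

omit [IsManifold 𝓘(ℝ, P) ∞ S] [IsManifold 𝓘(ℝ, E) ∞ M] in
lemma chartMap_extChartAt (X : S × ℝ → M) (p : S) (x₀ : M) (s : ℝ) :
    chartMap X p x₀ (extChartAt 𝓘(ℝ, P) p p, s) = extChartAt 𝓘(ℝ, E) x₀ (X (p, s)) := by
  simp only [chartMap, extChartAt_to_inv]

lemma contDiffAt_coordForm {x₀ x : M} {t : ℝ} (hx : x ∈ (chartAt E x₀).source)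
    (hk : ContMDiff (𝓘(ℝ, E).prod 𝓘(ℝ, ℝ)) (𝓘(ℝ, E).prod 𝓘(ℝ, E →L[ℝ] E →L[ℝ] ℝ)) ∞
      (formSection k)) : ContDiffAt ℝ ∞ (coordForm k x₀) (extChartAt 𝓘(ℝ, E) x₀ x, t) :=
  (contMDiffAt_formSection_iff (q := (x, t)) hx).1 (hk _)

lemma coordForm_symm {x₀ x : M} {t : ℝ} (hx : x ∈ (chartAt E x₀).source)
    (hsymm : ∀ v w : TangentSpace 𝓘(ℝ, E) x, k t x v w = k t x w v) (v w : E) :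
    coordForm k x₀ (extChartAt 𝓘(ℝ, E) x₀ x, t) v w
      = coordForm k x₀ (extChartAt 𝓘(ℝ, E) x₀ x, t) w v := by
  obtain ⟨a, rfl⟩ := (bijective_mfderiv_extChartAt hx).2 v
  obtain ⟨b, rfl⟩ := (bijective_mfderiv_extChartAt hx).2 w
  exact (coordForm_apply_mfderiv hx a b).trans
    ((hsymm a b).trans (coordForm_apply_mfderiv hx b a).symm)

lemma coordForm_pos {x₀ x : M} {t : ℝ} (hx : x ∈ (chartAt E x₀).source)
    (hpos : ∀ v : TangentSpace 𝓘(ℝ, E) x, v ≠ 0 → 0 < k t x v v) (v : E) (hv : v ≠ 0) :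
    0 < coordForm k x₀ (extChartAt 𝓘(ℝ, E) x₀ x, t) v v := by
  obtain ⟨a, rfl⟩ := (bijective_mfderiv_extChartAt hx).2 v
  refine (hpos a fun h => hv ?_).trans_eq (coordForm_apply_mfderiv hx a a).symm
  rw [h]
  exact map_zero (mfderiv 𝓘(ℝ, E) 𝓘(ℝ, E) (extChartAt 𝓘(ℝ, E) x₀) x)

/-- In a chart, the generators `s ↦ X (p, s)` of a null germ solve the equation of null
pregeodesics. -/
lemma IsNullGermAt.exists_accel_eq {X : S × ℝ → M} {p : S} {t : ℝ} {x₀ : M}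
    (hk : ContMDiff (𝓘(ℝ, E).prod 𝓘(ℝ, ℝ)) (𝓘(ℝ, E).prod 𝓘(ℝ, E →L[ℝ] E →L[ℝ] ℝ)) ∞
      (formSection k))
    (hsymm : ∀ (t : ℝ) (x : M) (v w : TangentSpace 𝓘(ℝ, E) x), k t x v w = k t x w v)
    (hX : IsNullGermAt P k X (p, t)) (hx : X (p, t) ∈ (chartAt E x₀).source) :
    ∃ v a : ℝ → E, ∀ᶠ s in 𝓝 t,
      (HasDerivAt (fun s => extChartAt 𝓘(ℝ, E) x₀ (X (p, s))) (v s) s ∧ HasDerivAt v (a s) s ∧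
      ∀ w, coordForm k x₀ (extChartAt 𝓘(ℝ, E) x₀ (X (p, s)), s) (a s) w
        = eikonalForce (coordForm k x₀) (extChartAt 𝓘(ℝ, E) x₀ (X (p, s)), s) (v s) w) ∧
      v s = mfderiv 𝓘(ℝ, E) 𝓘(ℝ, E) (extChartAt 𝓘(ℝ, E) x₀) (X (p, s))
        (mfderiv (𝓘(ℝ, P).prod 𝓘(ℝ, ℝ)) 𝓘(ℝ, E) X (p, s) ((0 : P), (1 : ℝ))) := by
  set Y : P × ℝ → E := chartMap X p x₀ with hY
  set y : P := extChartAt 𝓘(ℝ, P) p p with hy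
  have ht : Tendsto (fun s : ℝ => (y, s)) (𝓝 t) (𝓝 (y, t)) := Continuous.tendsto (by fun_prop) _
  have htS : Tendsto (fun s : ℝ => (p, s)) (𝓝 t) (𝓝 (p, t)) := Continuous.tendsto (by fun_prop) _
  have hXc : ContinuousAt X (p, t) := hX.self_of_nhds.1.continuousAt
  have hev := (hX.eventually_chart hx).eventually_nhds
  refine ⟨fun s => fderiv ℝ Y (y, s) (0, 1), fun s => fderiv ℝ (fderiv ℝ Y) (y, s) (0, 1) (0, 1),
    ?_⟩
  filter_upwards [ht.eventually hev, htS.eventually hX,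
    htS.eventually (hXc.eventually ((chartAt E x₀).open_source.mem_nhds hx))] with s hs hXs hxs
  obtain ⟨hYs, -, hYb⟩ := hs.self_of_nhds
  have hline : HasDerivAt (fun s : ℝ => (y, s)) ((0 : P), (1 : ℝ)) s :=
    (hasDerivAt_const s y).prodMk (hasDerivAt_id s)
  have hval : ∀ s, Y (y, s) = extChartAt 𝓘(ℝ, E) x₀ (X (p, s)) :=
    fun s => chartMap_extChartAt X p x₀ s
  have hY2 : ContDiffAt ℝ 2 Y (y, s) := hYs.of_le (WithTop.coe_le_coe.2 le_top)
  refine ⟨⟨?_, ?_, fun w => ?_⟩, ?_⟩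
  · have := (hYs.differentiableAt (by simp)).hasFDerivAt.comp_hasDerivAt s hline
    rw [show (fun s => extChartAt 𝓘(ℝ, E) x₀ (X (p, s))) = fun s => Y (y, s) from
      funext fun s => (hval s).symm]
    exact this
  · have h1 : HasFDerivAt (fderiv ℝ Y) (fderiv ℝ (fderiv ℝ Y) (y, s)) (y, s) :=
      ((hY2.fderiv_right (m := 1) (by norm_num)).differentiableAt (by simp)).hasFDerivAt
    have h2 := h1.comp_hasDerivAt s hline
    simpa using! h2.clm_apply (hasDerivAt_const s ((0 : P), (1 : ℝ)))
  -- The equation is known on the vectors `dY z`, and all vectors are of this form.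
  · obtain ⟨z, rfl⟩ := hYb.2 w
    have h1 : ContDiffAt ℝ ∞ (coordForm k x₀) (Y (y, s), s) := by
      rw [hval]; exact contDiffAt_coordForm hxs hk
    have h2 : ∀ v w, coordForm k x₀ (Y (y, s), s) v w = coordForm k x₀ (Y (y, s), s) w v := by
      rw [hval]; exact coordForm_symm hxs (hsymm s _)
    have h3 := accel_eq_of_chartEikonal (q := (y, s)) (h1.differentiableAt (by simp)) h2 hY2
      (hs.mono fun z hz => hz.2.1) z
    rw [← hval]
    exact h3
  · have e := fderiv_chartMap (q := (p, s)) (mem_chart_source P p) hxs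
      (hXs.1.mdifferentiableAt (by simp)) ((0 : P), (1 : ℝ))
    have e2 : ((mfderiv 𝓘(ℝ, P) 𝓘(ℝ, P) (extChartAt 𝓘(ℝ, P) p) p (0 : P) : P), (1 : ℝ))
        = ((0 : P), (1 : ℝ)) :=
      Prod.ext (map_zero (mfderiv 𝓘(ℝ, P) 𝓘(ℝ, P) _ p)) rfl
    exact (congrArg (fderiv ℝ Y (y, s)) e2).symm.trans e

variable [FiniteDimensional ℝ E]

/-- Positive definiteness of a family of bilinear forms is an open condition. -/
lemma eventually_pos_form {q₀ : M × ℝ}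
    (hk : ContMDiffAt (𝓘(ℝ, E).prod 𝓘(ℝ, ℝ)) (𝓘(ℝ, E).prod 𝓘(ℝ, E →L[ℝ] E →L[ℝ] ℝ)) ∞
      (formSection k) q₀)
    (hpos : ∀ v : TangentSpace 𝓘(ℝ, E) q₀.1, v ≠ 0 → 0 < k q₀.2 q₀.1 v v) :
    ∀ᶠ q in 𝓝 q₀, ∀ v : TangentSpace 𝓘(ℝ, E) q.1, v ≠ 0 → 0 < k q.2 q.1 v v := by
  obtain ⟨x₀, t₀⟩ := q₀
  have hsrc := mem_chart_source E x₀
  have h1 := eventually_pos_of_continuousAt ((contMDiffAt_formSection_iff hsrc).1 hk).continuousAt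
    (coordForm_pos hsrc hpos)
  filter_upwards [(tendsto_prod_extChartAt (P := E) x₀ t₀).eventually h1,
    eventually_mem_prod_source (P := E) x₀ t₀] with q hq hqs v hv
  refine (hq (mfderiv 𝓘(ℝ, E) 𝓘(ℝ, E) (extChartAt 𝓘(ℝ, E) x₀) q.1 v) fun h => hv ?_).trans_eq
    (coordForm_apply_mfderiv hqs v v)
  exact (bijective_mfderiv_extChartAt hqs).1
    (h.trans (map_zero (mfderiv 𝓘(ℝ, E) 𝓘(ℝ, E) (extChartAt 𝓘(ℝ, E) x₀) q.1)).symm)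

variable [T2Space M]

/-- The generators of a null germ are determined by their initial position and velocity. -/
lemma eqOn_of_isNullGermAt {X X' : S × ℝ → M} {p : S} {η : ℝ}
    (hk : ContMDiff (𝓘(ℝ, E).prod 𝓘(ℝ, ℝ)) (𝓘(ℝ, E).prod 𝓘(ℝ, E →L[ℝ] E →L[ℝ] ℝ)) ∞
      (formSection k))
    (hsymm : ∀ (t : ℝ) (x : M) (v w : TangentSpace 𝓘(ℝ, E) x), k t x v w = k t x w v)
    (hpos : ∀ t ∈ Ioo (-η) η, ∀ v : TangentSpace 𝓘(ℝ, E) (X (p, t)),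
      v ≠ 0 → 0 < k t (X (p, t)) v v)
    (hX : ∀ t ∈ Ioo (-η) η, IsNullGermAt P k X (p, t))
    (hX' : ∀ t ∈ Ioo (-η) η, IsNullGermAt P k X' (p, t))
    (h0 : X (p, 0) = X' (p, 0))
    (h1 : (mfderiv (𝓘(ℝ, P).prod 𝓘(ℝ, ℝ)) 𝓘(ℝ, E) X (p, 0) ((0 : P), (1 : ℝ)) : E)
      = mfderiv (𝓘(ℝ, P).prod 𝓘(ℝ, ℝ)) 𝓘(ℝ, E) X' (p, 0) ((0 : P), (1 : ℝ))) :
    ∀ t ∈ Ioo (-η) η, X (p, t) = X' (p, t) := by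
  rcases le_or_gt η 0 with hη | hη
  · intro t ht
    exact absurd (ht.1.trans ht.2) (by linarith)
  have hcurve : ∀ {X : S × ℝ → M} {t}, IsNullGermAt P k X (p, t) →
      ContinuousAt (fun s => X (p, s)) t := by
    intro X t hX
    have h2 : ContinuousAt X (p, t) := hX.self_of_nhds.1.continuousAt
    exact h2.comp (f := fun s : ℝ => (p, s)) (by fun_prop)
  -- local uniqueness
  have hloc : ∀ t ∈ Ioo (-η) η, ∀ v v' a a' : ℝ → E, X (p, t) = X' (p, t) →
      (∀ᶠ s in 𝓝 t, HasDerivAt (fun s => extChartAt 𝓘(ℝ, E) (X (p, t)) (X (p, s))) (v s) s ∧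
        HasDerivAt v (a s) s ∧
        ∀ w, coordForm k (X (p, t)) (extChartAt 𝓘(ℝ, E) (X (p, t)) (X (p, s)), s) (a s) w
          = eikonalForce (coordForm k (X (p, t)))
            (extChartAt 𝓘(ℝ, E) (X (p, t)) (X (p, s)), s) (v s) w) →
      (∀ᶠ s in 𝓝 t, HasDerivAt (fun s => extChartAt 𝓘(ℝ, E) (X (p, t)) (X' (p, s))) (v' s) s ∧
        HasDerivAt v' (a' s) s ∧
        ∀ w, coordForm k (X (p, t)) (extChartAt 𝓘(ℝ, E) (X (p, t)) (X' (p, s)), s) (a' s) w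
          = eikonalForce (coordForm k (X (p, t)))
            (extChartAt 𝓘(ℝ, E) (X (p, t)) (X' (p, s)), s) (v' s) w) → v t = v' t →
      ∀ᶠ s in 𝓝 t, X (p, s) = X' (p, s) := by
    intro t ht v v' a a' hXX hv hv' hvv
    have hsrc := mem_chart_source E (X (p, t))
    have e := eventuallyEq_of_accel_eq
      (u := fun s => extChartAt 𝓘(ℝ, E) (X (p, t)) (X (p, s)))
      (u' := fun s => extChartAt 𝓘(ℝ, E) (X (p, t)) (X' (p, s))) (contDiffAt_coordForm hsrc hk)
      (isInvertible_of_pos (coordForm_pos hsrc (hpos t ht))) hv hv'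
      (congrArg (extChartAt 𝓘(ℝ, E) (X (p, t))) hXX) hvv
    have hs' : X' (p, t) ∈ (chartAt E (X (p, t))).source := by rw [← hXX]; exact hsrc
    filter_upwards [e, (hcurve (hX t ht)).eventually ((chartAt E _).open_source.mem_nhds hsrc),
      (hcurve (hX' t ht)).eventually ((chartAt E _).open_source.mem_nhds hs')] with s h2 h3 h4
    rw [← extChartAt_source 𝓘(ℝ, E)] at h3 h4
    exact (extChartAt 𝓘(ℝ, E) _).injOn h3 h4 h2
  -- The set `U` of times near which the curves agree is open. It is closed in the interval, because
  -- at a limit point position and velocity agree by continuity.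
  let U : Set ℝ := {t | ∀ᶠ s in 𝓝 t, X (p, s) = X' (p, s)}
  have hUo : IsOpen U := isOpen_iff_mem_nhds.2 fun t ht => by
    have : ∀ᶠ s in 𝓝 t, s ∈ U := eventually_eventually_nhds.2 ht
    exact this
  have h0mem : (0 : ℝ) ∈ Ioo (-η) η := ⟨by linarith, hη⟩
  have h0U : (0 : ℝ) ∈ U := by
    have hsrc := mem_chart_source E (X (p, 0))
    have hs' : X' (p, 0) ∈ (chartAt E (X (p, 0))).source := by rw [← h0]; exact hsrc
    obtain ⟨v, a, hv⟩ := (hX 0 h0mem).exists_accel_eq hk hsymm hsrc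
    obtain ⟨v', a', hv'⟩ := (hX' 0 h0mem).exists_accel_eq hk hsymm hs'
    refine hloc 0 h0mem v v' a a' h0 (hv.mono fun s h => h.1) (hv'.mono fun s h => h.1) ?_
    have key : ∀ (x x' : M) (b b' : E), x = x' → b = b' →
        (mfderiv 𝓘(ℝ, E) 𝓘(ℝ, E) (extChartAt 𝓘(ℝ, E) (X (p, 0))) x b : E)
          = mfderiv 𝓘(ℝ, E) 𝓘(ℝ, E) (extChartAt 𝓘(ℝ, E) (X (p, 0))) x' b' := by
      rintro x _ b _ rfl rfl
      rfl
    obtain ⟨-, e1⟩ := hv.self_of_nhds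
    obtain ⟨-, e2⟩ := hv'.self_of_nhds
    refine e1.trans (Eq.trans ?_ e2.symm)
    exact key (X (p, 0)) (X' (p, 0)) _ _ h0 h1
  have hsub := isPreconnected_Ioo.subset_of_closure_inter_subset hUo ⟨0, h0mem, h0U⟩ (by
    rintro t ⟨htU, ht⟩
    have hfr : ∃ᶠ s in 𝓝 t, s ∈ U := mem_closure_iff_frequently.1 htU
    have hXX : X (p, t) = X' (p, t) :=
      tendsto_nhds_unique_of_frequently_eq (hcurve (hX t ht)) (hcurve (hX' t ht))
        (hfr.mono fun s hs => hs.self_of_nhds)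
    have hsrc := mem_chart_source E (X (p, t))
    have hs' : X' (p, t) ∈ (chartAt E (X (p, t))).source := by rw [← hXX]; exact hsrc
    obtain ⟨v, a, hv⟩ := (hX t ht).exists_accel_eq hk hsymm hsrc
    obtain ⟨v', a', hv'⟩ := (hX' t ht).exists_accel_eq hk hsymm hs'
    refine hloc t ht v v' a a' hXX (hv.mono fun s h => h.1) (hv'.mono fun s h => h.1) ?_
    refine tendsto_nhds_unique_of_frequently_eq hv.self_of_nhds.1.2.1.continuousAt
      hv'.self_of_nhds.1.2.1.continuousAt ?_
    refine (hfr.and_eventually (hv.and hv')).mono ?_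
    rintro s ⟨hsU, h2, h3⟩
    refine h2.1.1.unique (h3.1.1.congr_of_eventuallyEq ?_)
    filter_upwards [hsU] with r hr
    rw [hr])
  exact fun t ht => (hsub ht).self_of_nhds

omit [FiniteDimensional ℝ E] [T2Space M] [IsManifold 𝓘(ℝ, P) ∞ S] [IsManifold 𝓘(ℝ, E) ∞ M] in
lemma IsNullGermAt.congr {X X' : S × ℝ → M} {q : S × ℝ} (hX : IsNullGermAt P k X q)
    (h : X' =ᶠ[𝓝 q] X) : IsNullGermAt P k X' q := by
  filter_upwards [hX, h.eventuallyEq_nhds] with q' hq he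
  have hm := he.mfderiv_eq (I := 𝓘(ℝ, P).prod 𝓘(ℝ, ℝ)) (I' := 𝓘(ℝ, E))
  refine ⟨hq.1.congr_of_eventuallyEq he, fun z => ?_, ?_⟩
  · have e := hq.2.1 z
    have key : ∀ (x x' : M) (A A' : P × ℝ →L[ℝ] E), x' = x → A' = A →
        (k q'.2 x (A (0, 1)) (A z) = z.2) → (k q'.2 x' (A' (0, 1)) (A' z) = z.2) := by
      rintro x _ A _ rfl rfl h; exact h
    exact key _ _ _ _ he.eq_of_nhds hm e
  · have := hq.2.2
    have key : ∀ (A A' : P × ℝ →L[ℝ] E), A' = A → Function.Bijective A → Function.Bijective A' := by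
      rintro A _ rfl h; exact h
    exact key _ _ hm this

variable [CompactSpace S]

/-- A null germ along a compact hypersurface: local null hypersurfaces agree where they overlap,
because their generators have the same initial data. -/
lemma exists_nullGerm {c₀ : S × ℝ → M} {V : S → E} [FiniteDimensional ℝ P]
    (hk : ContMDiff (𝓘(ℝ, E).prod 𝓘(ℝ, ℝ)) (𝓘(ℝ, E).prod 𝓘(ℝ, E →L[ℝ] E →L[ℝ] ℝ)) ∞
      (formSection k))
    (hsymm : ∀ (t : ℝ) (x : M) (v w : TangentSpace 𝓘(ℝ, E) x), k t x v w = k t x w v)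
    (hpos : ∀ (x : M) (v : TangentSpace 𝓘(ℝ, E) x), v ≠ 0 → 0 < k 0 x v v)
    (hC : ∀ p₀, ∃ C, IsCollarExtension (P := P) (E := E) c₀ C p₀ ∧
      ∀ᶠ p in 𝓝 p₀, IsCollarNormal (P := P) k C V p) :
    ∃ η > 0, ∃ X : S × ℝ → M, (∀ p t, |t| < η → IsNullGermAt P k X (p, t)) ∧
      ∀ p, X (p, 0) = c₀ (p, 0) ∧
        mfderiv (𝓘(ℝ, P).prod 𝓘(ℝ, ℝ)) 𝓘(ℝ, E) X (p, 0) ((0 : P), (1 : ℝ)) = V p := by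
  have hloc : ∀ p₀, ∃ (X : S × ℝ → M) (U : Set S) (r : ℝ), IsOpen U ∧ p₀ ∈ U ∧ 0 < r ∧
      ∀ p ∈ U, (∀ t, |t| < r → IsNullGermAt P k X (p, t) ∧
        ∀ v : TangentSpace 𝓘(ℝ, E) (X (p, t)), v ≠ 0 → 0 < k t (X (p, t)) v v) ∧
      X (p, 0) = c₀ (p, 0) ∧
        mfderiv (𝓘(ℝ, P).prod 𝓘(ℝ, ℝ)) 𝓘(ℝ, E) X (p, 0) ((0 : P), (1 : ℝ)) = V p := by
    intro p₀
    obtain ⟨C, hC, hV⟩ := hC p₀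
    obtain ⟨X, hX, hX0⟩ := exists_local_nullGerm hk hsymm hpos hC hV
    have hXc : ContinuousAt X (p₀, 0) := hX.self_of_nhds.1.continuousAt
    have h1 : Tendsto (fun q : S × ℝ => (X q, q.2)) (𝓝 (p₀, 0)) (𝓝 (X (p₀, 0), 0)) :=
      hXc.prodMk continuousAt_snd
    have h2 := h1.eventually (eventually_pos_form (q₀ := (X (p₀, 0), 0)) (hk _) (hpos _))
    have h3 := (eventually_eventually_nhds.2 hX).and
      (h2.and ((continuous_fst.tendsto (p₀, (0 : ℝ))).eventually hX0))
    obtain ⟨U, W, hU, hpU, hW, h0W, hUW⟩ := mem_nhds_prod_iff'.1 h3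
    obtain ⟨r, hr, hrW⟩ := Metric.isOpen_iff.1 hW 0 h0W
    refine ⟨X, U, r, hU, hpU, hr, fun p hp => ⟨fun t ht => ?_, ?_⟩⟩
    · have := hUW (⟨hp, hrW (by simpa using ht)⟩ : (p, t) ∈ U ×ˢ W)
      exact ⟨this.1, this.2.1⟩
    · exact (hUW (⟨hp, h0W⟩ : (p, (0 : ℝ)) ∈ U ×ˢ W)).2.2
  -- By compactness, some local solution `X (i p)` is defined at `p` for the common time `η₁ / 2`.
  choose X U r hU hpU hr hX using hloc
  obtain ⟨η₁, hη₁, hR⟩ := exists_forall_abs_lt_of_eventually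
    (R := fun q : S × ℝ => ∃ p₀, q.1 ∈ U p₀ ∧ |q.2| < r p₀) (by
      intro p₀
      have h1 : ∀ᶠ q : S × ℝ in 𝓝 (p₀, 0), q.1 ∈ U p₀ :=
        (continuous_fst.tendsto (p₀, (0 : ℝ))).eventually ((hU p₀).mem_nhds (hpU p₀))
      have h2 : ∀ᶠ q : S × ℝ in 𝓝 (p₀, 0), |q.2| < r p₀ :=
        ((continuous_abs.comp continuous_snd).tendsto (p₀, (0 : ℝ))).eventually
          (gt_mem_nhds (by simpa using hr p₀))
      filter_upwards [h1, h2] with q h1 h2 using ⟨p₀, h1, h2⟩)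
  have hη : |η₁ / 2| < η₁ := by rw [abs_of_pos (by linarith)]; linarith
  choose i hi hir using fun p => hR p (η₁ / 2) hη
  dsimp only at hi hir
  rw [abs_of_pos (by linarith)] at hir
  have hagree : ∀ p₀, η₁ / 2 < r p₀ → ∀ p ∈ U p₀, ∀ t ∈ Ioo (-(η₁ / 2)) (η₁ / 2),
      X (i p) (p, t) = X p₀ (p, t) := by
    intro p₀ hp₀ p hp
    have hlt : ∀ t ∈ Ioo (-(η₁ / 2)) (η₁ / 2), |t| < η₁ / 2 := fun t ht => abs_lt.2 ht
    have hXi := hX (i p) p (hi p)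
    have hXp := hX p₀ p hp
    exact eqOn_of_isNullGermAt hk hsymm (fun t ht => (hXi.1 t ((hlt t ht).trans (hir p))).2)
      (fun t ht => (hXi.1 t ((hlt t ht).trans (hir p))).1)
      (fun t ht => (hXp.1 t ((hlt t ht).trans hp₀)).1)
      (hXi.2.1.trans hXp.2.1.symm) (hXi.2.2.trans hXp.2.2.symm)
  have heq : ∀ p t, |t| < η₁ / 2 → (fun q : S × ℝ => X (i q.1) q) =ᶠ[𝓝 (p, t)] X (i p) := by
    intro p t ht
    filter_upwards [((hU (i p)).prod isOpen_Ioo).mem_nhds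
      (⟨hi p, abs_lt.1 ht⟩ : (p, t) ∈ U (i p) ×ˢ Ioo (-(η₁ / 2)) (η₁ / 2))] with q hq
    exact hagree (i p) (hir p) q.1 hq.1 q.2 hq.2
  refine ⟨η₁ / 2, by linarith, fun q => X (i q.1) q, fun p t ht => ?_, fun p => ?_⟩
  · exact ((hX (i p) p (hi p)).1 t (ht.trans (hir p))).1.congr (heq p t ht)
  · have h0 := (hX (i p) p (hi p)).2
    refine ⟨h0.1, ?_⟩
    have hm := (heq p 0 (by simpa using by linarith)).mfderiv_eq
      (I := 𝓘(ℝ, P).prod 𝓘(ℝ, ℝ)) (I' := 𝓘(ℝ, E))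
    exact (congrArg (fun A : P × ℝ →L[ℝ] E => A (0, 1)) hm).trans h0.2

end NullCurves

/-! ### Derivatives along the slices of a cylinder -/

section Slices

variable {P : Type*} [NormedAddCommGroup P] [NormedSpace ℝ P]
  {S : Type*} [TopologicalSpace S] [ChartedSpace P S]
  {F : Type*} [NormedAddCommGroup F] [NormedSpace ℝ F]
  {N : Type*} [TopologicalSpace N] [ChartedSpace F N]

lemma hasMFDerivAt_prodMk_left (p : S) (t : ℝ) :
    HasMFDerivAt 𝓘(ℝ, P) (𝓘(ℝ, P).prod 𝓘(ℝ, ℝ)) (fun p : S => (p, t)) p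
      (ContinuousLinearMap.inl ℝ P ℝ) := by
  have := (hasMFDerivAt_id (I := 𝓘(ℝ, P)) p).prodMk
    (hasMFDerivAt_const (I := 𝓘(ℝ, P)) (I' := 𝓘(ℝ, ℝ)) t p)
  exact this

lemma hasMFDerivAt_prodMk_right (p : S) (t : ℝ) :
    HasMFDerivAt 𝓘(ℝ, ℝ) (𝓘(ℝ, P).prod 𝓘(ℝ, ℝ)) (fun t : ℝ => (p, t)) t
      (ContinuousLinearMap.inr ℝ P ℝ) := by
  have := (hasMFDerivAt_const (I := 𝓘(ℝ, ℝ)) (I' := 𝓘(ℝ, P)) p t).prodMk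
    (hasMFDerivAt_id (I := 𝓘(ℝ, ℝ)) t)
  exact this

lemma hasDerivAt_slice {f : S × ℝ → ℝ} {p : S} {t : ℝ}
    (hf : MDifferentiableAt (𝓘(ℝ, P).prod 𝓘(ℝ, ℝ)) 𝓘(ℝ, ℝ) f (p, t)) :
    HasDerivAt (fun s => f (p, s))
      (mfderiv (𝓘(ℝ, P).prod 𝓘(ℝ, ℝ)) 𝓘(ℝ, ℝ) f (p, t) ((0 : P), (1 : ℝ))) t := by
  obtain ⟨D, hD⟩ : ∃ D : P × ℝ →L[ℝ] ℝ,
      D = mfderiv (𝓘(ℝ, P).prod 𝓘(ℝ, ℝ)) 𝓘(ℝ, ℝ) f (p, t) := ⟨_, rfl⟩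
  have h : HasFDerivAt (fun s => f (p, s)) (D.comp (ContinuousLinearMap.inr ℝ P ℝ)) t := by
    rw [hD]
    exact (HasMFDerivAt.comp t (g := f) (f := fun s : ℝ => (p, s)) hf.hasMFDerivAt
      (hasMFDerivAt_prodMk_right (P := P) p t)).hasFDerivAt
  exact h.hasDerivAt.congr_deriv (congrArg (fun A : P × ℝ →L[ℝ] ℝ => A (0, 1)) hD)

variable [IsManifold 𝓘(ℝ, P) ∞ S]

/-- Positivity of the derivative in time is an open condition. -/
lemma eventually_pos_deriv_slice {f : S × ℝ → ℝ} {p₀ : S} {t₀ : ℝ}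
    (hf : ContMDiffAt (𝓘(ℝ, P).prod 𝓘(ℝ, ℝ)) 𝓘(ℝ, ℝ) ∞ f (p₀, t₀))
    (h : 0 < deriv (fun t => f (p₀, t)) t₀) :
    ∀ᶠ z in 𝓝 (p₀, t₀), 0 < deriv (fun t => f (z.1, t)) z.2 := by
  set G : P × ℝ → ℝ := chartMap f p₀ (0 : ℝ) with hG
  have hval : ∀ z : S × ℝ, z.1 ∈ (chartAt P p₀).source → ∀ t,
      f (z.1, t) = G (extChartAt 𝓘(ℝ, P) p₀ z.1, t) := by
    intro z hz t
    simp only [hG, chartMap]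
    rw [(extChartAt 𝓘(ℝ, P) p₀).left_inv (by rwa [extChartAt_source])]
    rfl
  have hG1 : ContDiffAt ℝ ∞ G (extChartAt 𝓘(ℝ, P) p₀ p₀, t₀) :=
    contDiffAt_chartMap (q := (p₀, t₀)) (mem_chart_source P p₀) (mem_univ _) hf
  have hG2 : ∀ᶠ y in 𝓝 (extChartAt 𝓘(ℝ, P) p₀ p₀, t₀), DifferentiableAt ℝ G y :=
    ((hG1.of_le (m := 1) (WithTop.coe_le_coe.2 le_top)).eventually (by decide)).mono
      fun y hy => hy.differentiableAt (by simp)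
  have hG3 : ContinuousAt (fun y => fderiv ℝ G y ((0 : P), (1 : ℝ)))
      (extChartAt 𝓘(ℝ, P) p₀ p₀, t₀) :=
    (((hG1.fderiv_right (m := 0) (by simp)).continuousAt).clm_apply continuousAt_const)
  have hder : ∀ y s, DifferentiableAt ℝ G (y, s) →
      HasDerivAt (fun t => G (y, t)) (fderiv ℝ G (y, s) ((0 : P), (1 : ℝ))) s := fun y s hy =>
    hy.hasFDerivAt.comp_hasDerivAt s ((hasDerivAt_const s y).prodMk (hasDerivAt_id s))
  have hpos : 0 < fderiv ℝ G (extChartAt 𝓘(ℝ, P) p₀ p₀, t₀) ((0 : P), (1 : ℝ)) := by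
    rw [← (hder _ _ hG2.self_of_nhds).deriv]
    refine h.trans_eq ?_
    congr 1
    exact funext (hval (p₀, t₀) (mem_chart_source P p₀))
  filter_upwards [(tendsto_prod_extChartAt (P := P) p₀ t₀).eventually
    (hG2.and (hG3.eventually (lt_mem_nhds hpos))),
    eventually_mem_prod_source (P := P) p₀ t₀] with z hz hzs
  rw [funext (hval z hzs), (hder _ _ hz.1).deriv]
  exact hz.2

end Slices

/-! ### Local splitting of moving hypersurfaces -/

section Splitting

universe u

variable {P : Type*} {E : Type*} [NormedAddCommGroup P] [NormedSpace ℝ P] [FiniteDimensional ℝ P]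
  [NormedAddCommGroup E] [NormedSpace ℝ E] [FiniteDimensional ℝ E]
  {S M : Type*} [TopologicalSpace S] [ChartedSpace P S] [IsManifold 𝓘(ℝ, P) ∞ S]
  [TopologicalSpace M] [ChartedSpace E M] [IsManifold 𝓘(ℝ, E) ∞ M]

/-- A family `X` of hypersurfaces starting at `S × {0}` and moving into the collar `c₀` is, near
`(p₀, 0)`, of the form `c₀ (A z, σ z)`, where `A` is a deformation of the identity of `S`, with
inverse `B`. -/
lemma exists_local_splitting {c₀ C X : S × ℝ → M} {p₀ : S} {ξ : P × ℝ}
    (hC : IsCollarExtension (P := P) (E := E) c₀ C p₀)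
    (hX : ∀ᶠ z in 𝓝 (p₀, (0 : ℝ)), ContMDiffAt (𝓘(ℝ, P).prod 𝓘(ℝ, ℝ)) 𝓘(ℝ, E) ∞ X z)
    (hX0 : ∀ p, X (p, 0) = c₀ (p, 0)) (hξ : 0 < ξ.2)
    (hXξ : (mfderiv (𝓘(ℝ, P).prod 𝓘(ℝ, ℝ)) 𝓘(ℝ, E) C (p₀, 0) ξ : E)
      = mfderiv (𝓘(ℝ, P).prod 𝓘(ℝ, ℝ)) 𝓘(ℝ, E) X (p₀, 0) ((0 : P), (1 : ℝ))) :
    ∃ (A B : S × ℝ → S) (σ : S × ℝ → ℝ),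
      (∀ᶠ z in 𝓝 (p₀, (0 : ℝ)), ContMDiffAt (𝓘(ℝ, P).prod 𝓘(ℝ, ℝ)) 𝓘(ℝ, P) ∞ A z ∧
        ContMDiffAt (𝓘(ℝ, P).prod 𝓘(ℝ, ℝ)) 𝓘(ℝ, P) ∞ B z ∧
        ContMDiffAt (𝓘(ℝ, P).prod 𝓘(ℝ, ℝ)) 𝓘(ℝ, ℝ) ∞ σ z) ∧
      (∀ᶠ z in 𝓝 (p₀, (0 : ℝ)), 0 ≤ z.2 → 0 ≤ σ z ∧ X z = c₀ (A z, σ z)) ∧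
      (∀ᶠ z in 𝓝 (p₀, (0 : ℝ)), A (B z, z.2) = z.1 ∧ B (A z, z.2) = z.1) ∧
      (∀ᶠ p in 𝓝 p₀, A (p, 0) = p ∧ σ (p, 0) = 0 ∧ B (p, 0) = p) ∧
      0 < deriv (fun t => σ (p₀, t)) 0 := by
  obtain ⟨g, hg, hgC⟩ := exists_local_inverse (I := 𝓘(ℝ, P).prod 𝓘(ℝ, ℝ)) (J := 𝓘(ℝ, E))
    hC.smooth hC.bijective
  have hCX : ∀ᶠ p in 𝓝 p₀, X (p, 0) = C (p, 0) := by
    have := (Continuous.tendsto (f := fun p : S => (p, (0 : ℝ))) (by fun_prop) p₀).eventually hC.eq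
    exact this.mono fun p hp => (hX0 p).trans (hp le_rfl).symm
  have hX0C : X (p₀, 0) = C (p₀, 0) := hCX.self_of_nhds
  have hXc : Tendsto X (𝓝 (p₀, 0)) (𝓝 (C (p₀, 0))) := by
    rw [← hX0C]; exact hX.self_of_nhds.continuousAt
  have hsl : Tendsto (fun p : S => (p, (0 : ℝ))) (𝓝 p₀) (𝓝 (p₀, 0)) :=
    Continuous.tendsto (by fun_prop) p₀
  -- `X` in the coordinates of the collar
  let G : S × ℝ → S × ℝ := fun z => g (X z)
  have hGs : ∀ᶠ z in 𝓝 (p₀, (0 : ℝ)),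
      ContMDiffAt (𝓘(ℝ, P).prod 𝓘(ℝ, ℝ)) (𝓘(ℝ, P).prod 𝓘(ℝ, ℝ)) ∞ G z ∧ C (G z) = X z := by
    filter_upwards [hX, hXc.eventually hg] with z h1 h2
    exact ⟨h2.1.comp z h1, h2.2⟩
  have hG0 : ∀ᶠ p in 𝓝 p₀, G (p, 0) = (p, 0) := by
    filter_upwards [hCX, hsl.eventually hgC] with p h1 h2
    exact (congrArg g h1).trans h2
  have hG00 : G (p₀, 0) = (p₀, 0) := hG0.self_of_nhds
  have hGt : Tendsto G (𝓝 (p₀, 0)) (𝓝 (p₀, 0)) := by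
    conv => enter [3]; rw [← hG00]
    exact hGs.self_of_nhds.1.continuousAt
  -- the differential of `G`
  obtain ⟨DG, hDG⟩ : ∃ D : P × ℝ →L[ℝ] P × ℝ,
      HasMFDerivAt (𝓘(ℝ, P).prod 𝓘(ℝ, ℝ)) (𝓘(ℝ, P).prod 𝓘(ℝ, ℝ)) G (p₀, 0) D :=
    ⟨_, (hGs.self_of_nhds.1.mdifferentiableAt (by simp)).hasMFDerivAt⟩
  have hDξ : DG (0, 1) = ξ := by
    have h1 : HasMFDerivAt (𝓘(ℝ, P).prod 𝓘(ℝ, ℝ)) 𝓘(ℝ, E) C (G (p₀, 0))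
        (mfderiv (𝓘(ℝ, P).prod 𝓘(ℝ, ℝ)) 𝓘(ℝ, E) C (p₀, 0) : P × ℝ →L[ℝ] E) := by
      rw [hG00]
      exact (hC.smooth.self_of_nhds.mdifferentiableAt (by simp)).hasMFDerivAt
    have h2 := (HasMFDerivAt.comp (p₀, (0 : ℝ)) h1 hDG).congr_of_eventuallyEq (f₁ := X)
      (hGs.mono fun z hz => hz.2.symm)
    have h3 := h2.mfderiv
    have h4 : (mfderiv (𝓘(ℝ, P).prod 𝓘(ℝ, ℝ)) 𝓘(ℝ, E) C (p₀, 0) (DG (0, 1)) : E)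
        = mfderiv (𝓘(ℝ, P).prod 𝓘(ℝ, ℝ)) 𝓘(ℝ, E) X (p₀, 0) ((0 : P), (1 : ℝ)) :=
      (congrArg (fun A : P × ℝ →L[ℝ] E => A (0, 1)) h3).symm
    exact hC.bijective.1 (h4.trans hXξ.symm)
  have hDw : ∀ w, DG (w, 0) = (w, 0) := by
    intro w
    have h1 := HasMFDerivAt.comp p₀ (g := G) (f := fun p : S => (p, (0 : ℝ))) hDG
      (hasMFDerivAt_prodMk_left (P := P) p₀ 0)
    have h2 := (hasMFDerivAt_prodMk_left (P := P) p₀ 0).congr_of_eventuallyEq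
      (f₁ := G ∘ fun p : S => (p, (0 : ℝ))) hG0
    have h3 := hasMFDerivAt_unique h1 h2
    exact congrArg (fun A : P →L[ℝ] P × ℝ => A w) h3
  let A : S × ℝ → S := fun z => (G z).1
  let σ : S × ℝ → ℝ := fun z => (G z).2
  have hAs : ∀ᶠ z in 𝓝 (p₀, (0 : ℝ)), ContMDiffAt (𝓘(ℝ, P).prod 𝓘(ℝ, ℝ)) 𝓘(ℝ, P) ∞ A z :=
    hGs.mono fun z hz => contMDiffAt_fst.comp z hz.1
  have hσs : ∀ᶠ z in 𝓝 (p₀, (0 : ℝ)), ContMDiffAt (𝓘(ℝ, P).prod 𝓘(ℝ, ℝ)) 𝓘(ℝ, ℝ) ∞ σ z :=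
    hGs.mono fun z hz => contMDiffAt_snd.comp z hz.1
  have hDA : HasMFDerivAt (𝓘(ℝ, P).prod 𝓘(ℝ, ℝ)) 𝓘(ℝ, P) A (p₀, 0)
      ((ContinuousLinearMap.fst ℝ P ℝ).comp DG) :=
    HasMFDerivAt.comp (p₀, (0 : ℝ)) (hasMFDerivAt_fst (G (p₀, 0))) hDG
  have hDσ : HasMFDerivAt (𝓘(ℝ, P).prod 𝓘(ℝ, ℝ)) 𝓘(ℝ, ℝ) σ (p₀, 0)
      ((ContinuousLinearMap.snd ℝ P ℝ).comp DG) :=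
    HasMFDerivAt.comp (p₀, (0 : ℝ)) (hasMFDerivAt_snd (G (p₀, 0))) hDG
  have hσ' : 0 < deriv (fun t => σ (p₀, t)) 0 := by
    have h1 : HasFDerivAt (fun t => σ (p₀, t)) (((ContinuousLinearMap.snd ℝ P ℝ).comp DG).comp
        (ContinuousLinearMap.inr ℝ P ℝ)) 0 :=
      (HasMFDerivAt.comp (0 : ℝ) (g := σ) (f := fun s : ℝ => (p₀, s)) hDσ
        (hasMFDerivAt_prodMk_right (P := P) p₀ 0)).hasFDerivAt
    have h2 : HasDerivAt (fun t => σ (p₀, t)) (DG (0, 1)).2 0 := h1.hasDerivAt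
    rw [h2.deriv, hDξ]
    exact hξ
  -- `σ` vanishes at time `0` and increases, so that `X` moves into the side `c₀` of the collar.
  have hσpos : ∀ᶠ z in 𝓝 (p₀, (0 : ℝ)), 0 ≤ z.2 → 0 ≤ σ z := by
    obtain ⟨U, W, hU, hpU, hW, h0W, hUW⟩ := mem_nhds_prod_iff'.1
      ((eventually_pos_deriv_slice (P := P) hσs.self_of_nhds hσ').and
        ((continuous_fst.tendsto (p₀, (0 : ℝ))).eventually hG0))
    obtain ⟨r, hr, hrW⟩ := Metric.isOpen_iff.1 hW 0 h0W
    filter_upwards [(hU.prod Metric.isOpen_ball).mem_nhds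
      (⟨hpU, Metric.mem_ball_self hr⟩ : (p₀, (0 : ℝ)) ∈ U ×ˢ Metric.ball (0 : ℝ) r)] with z hz h0
    have hd : ∀ t ∈ Icc 0 z.2, 0 < deriv (fun t => σ (z.1, t)) t := fun t ht =>
      (hUW (⟨hz.1, hrW (by
        have := hz.2
        rw [Metric.mem_ball, Real.dist_eq, sub_zero, abs_lt] at this ⊢
        exact ⟨by linarith [ht.1], ht.2.trans_lt this.2⟩)⟩ : (z.1, t) ∈ U ×ˢ W)).1
    have hmono : MonotoneOn (fun t => σ (z.1, t)) (Icc 0 z.2) := by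
      refine monotoneOn_of_deriv_nonneg (convex_Icc _ _) ?_ ?_ ?_
      · exact fun t ht => (differentiableAt_of_deriv_ne_zero
          (hd t ht).ne').continuousAt.continuousWithinAt
      · exact fun t ht => (differentiableAt_of_deriv_ne_zero
          (hd t (interior_subset ht)).ne').differentiableWithinAt
      · exact fun t ht => (hd t (interior_subset ht)).le
    have h1 := hmono (left_mem_Icc.2 h0) (right_mem_Icc.2 h0) h0
    have h2 : G (z.1, 0) = (z.1, 0) :=
      (hUW (⟨hz.1, h0W⟩ : (z.1, (0 : ℝ)) ∈ U ×ˢ W)).2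
    have h3 : σ (z.1, 0) = 0 := congrArg Prod.snd h2
    exact h3.symm.le.trans h1
  -- The maps `A (·, t)` are inverted together, by inverting `F (p, t) = (A (p, t), t)`.
  let F : S × ℝ → S × ℝ := fun z => (A z, z.2)
  have hFs : ∀ᶠ z in 𝓝 (p₀, (0 : ℝ)),
      ContMDiffAt (𝓘(ℝ, P).prod 𝓘(ℝ, ℝ)) (𝓘(ℝ, P).prod 𝓘(ℝ, ℝ)) ∞ F z :=
    hAs.mono fun z hz => hz.prodMk contMDiffAt_snd
  have hDF : HasMFDerivAt (𝓘(ℝ, P).prod 𝓘(ℝ, ℝ)) (𝓘(ℝ, P).prod 𝓘(ℝ, ℝ)) F (p₀, 0)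
      (((ContinuousLinearMap.fst ℝ P ℝ).comp DG).prod (ContinuousLinearMap.snd ℝ P ℝ)) :=
    hDA.prodMk (hasMFDerivAt_snd _)
  have hFb : Function.Bijective
      (mfderiv (𝓘(ℝ, P).prod 𝓘(ℝ, ℝ)) (𝓘(ℝ, P).prod 𝓘(ℝ, ℝ)) F (p₀, 0)) := by
    have h1 : Function.Injective
        (((ContinuousLinearMap.fst ℝ P ℝ).comp DG).prod (ContinuousLinearMap.snd ℝ P ℝ)) := by
      rw [injective_iff_map_eq_zero]
      rintro ⟨w, t⟩ h
      obtain ⟨h2, h3⟩ := Prod.ext_iff.1 h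
      have h3 : t = 0 := h3
      subst h3
      have h2 : (DG (w, 0)).1 = 0 := h2
      rw [hDw] at h2
      exact Prod.ext h2 rfl
    have h2 : Function.Bijective
        (((ContinuousLinearMap.fst ℝ P ℝ).comp DG).prod (ContinuousLinearMap.snd ℝ P ℝ)) :=
      ⟨h1, LinearMap.surjective_of_injective (f := ((((ContinuousLinearMap.fst ℝ P ℝ).comp
        DG).prod (ContinuousLinearMap.snd ℝ P ℝ) : P × ℝ →L[ℝ] P × ℝ) : P × ℝ →ₗ[ℝ] P × ℝ)) h1⟩
    rw [hDF.mfderiv]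
    exact h2
  obtain ⟨H, hH, hHF⟩ := exists_local_inverse hFs hFb
  have hA0 : ∀ᶠ p in 𝓝 p₀, A (p, 0) = p := hG0.mono fun p hp => congrArg Prod.fst hp
  have hF00 : F (p₀, 0) = (p₀, 0) := Prod.ext hA0.self_of_nhds rfl
  rw [hF00] at hH
  have hAB : ∀ᶠ z in 𝓝 (p₀, (0 : ℝ)), A ((H z).1, z.2) = z.1 ∧ (H (A z, z.2)).1 = z.1 := by
    filter_upwards [hH, hHF] with z h1 h2
    have h5 : F (H z) = z := h1.2
    have h3 : (H z).2 = z.2 := (Prod.ext_iff.1 h5).2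
    have h4 : A (H z) = z.1 := (Prod.ext_iff.1 h5).1
    exact ⟨by rw [← h3]; exact h4, congrArg Prod.fst h2⟩
  refine ⟨A, fun z => (H z).1, σ, ?_, ?_, hAB, ?_, hσ'⟩
  · filter_upwards [hAs, hσs, hH] with z h1 h2 h3
    exact ⟨h1, contMDiffAt_fst.comp z h3.1, h2⟩
  · filter_upwards [hσpos, hGs, hGt.eventually hC.eq] with z h1 h2 h3 h0
    exact ⟨h1 h0, h2.2.symm.trans (h3 (h1 h0))⟩
  · filter_upwards [hG0, hsl.eventually hAB] with p h1 h2
    have h3 : A (p, 0) = p := congrArg Prod.fst h1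
    refine ⟨h3, congrArg Prod.snd h1, ?_⟩
    have h4 := h2.2
    simp only [h3] at h4
    exact h4

end Splitting

/-! ### Moving hypersurfaces as graphs -/

section GlobalSplitting

variable {P : Type*} {E : Type*} [NormedAddCommGroup P] [NormedSpace ℝ P]
  [NormedAddCommGroup E] [NormedSpace ℝ E]
  {S M : Type*} [TopologicalSpace S] [ChartedSpace P S] [IsManifold 𝓘(ℝ, P) ∞ S]
  [TopologicalSpace M] [ChartedSpace E M] [IsManifold 𝓘(ℝ, E) ∞ M]

omit [IsManifold 𝓘(ℝ, P) ∞ S] in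
/-- If `ρ` is the height as a function of the point `A (p, t)` of the base, and `σ` the height as a
function of `p`, both have the same initial speed, as `ρ` is constant at time `0`. -/
lemma deriv_pos_of_comp_eq {A : S × ℝ → S} {ρ σ : S × ℝ → ℝ} {p₀ : S}
    (hA : MDifferentiableAt (𝓘(ℝ, P).prod 𝓘(ℝ, ℝ)) 𝓘(ℝ, P) A (p₀, 0)) (hA0 : A (p₀, 0) = p₀)
    (hρ : MDifferentiableAt (𝓘(ℝ, P).prod 𝓘(ℝ, ℝ)) 𝓘(ℝ, ℝ) ρ (p₀, 0)) (hρ0 : ∀ p, ρ (p, 0) = 0)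
    (h : ∀ᶠ t in 𝓝[≥] (0 : ℝ), ρ (A (p₀, t), t) = σ (p₀, t))
    (hσ : 0 < deriv (fun t => σ (p₀, t)) 0) : 0 < deriv (fun t => ρ (p₀, t)) 0 := by
  obtain ⟨DA, hDA⟩ : ∃ D : P × ℝ →L[ℝ] P,
      HasMFDerivAt (𝓘(ℝ, P).prod 𝓘(ℝ, ℝ)) 𝓘(ℝ, P) A (p₀, 0) D := ⟨_, hA.hasMFDerivAt⟩
  obtain ⟨Dρ, hDρ⟩ : ∃ D : P × ℝ →L[ℝ] ℝ,
      HasMFDerivAt (𝓘(ℝ, P).prod 𝓘(ℝ, ℝ)) 𝓘(ℝ, ℝ) ρ (p₀, 0) D := ⟨_, hρ.hasMFDerivAt⟩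
  have h1 : HasFDerivAt (fun t => ρ (p₀, t)) (Dρ.comp (ContinuousLinearMap.inr ℝ P ℝ)) 0 :=
    (HasMFDerivAt.comp (0 : ℝ) (g := ρ) (f := fun s : ℝ => (p₀, s)) hDρ
      (hasMFDerivAt_prodMk_right (P := P) p₀ 0)).hasFDerivAt
  have h2 : Dρ.comp (ContinuousLinearMap.inl ℝ P ℝ) = 0 := by
    have e1 := HasMFDerivAt.comp p₀ (g := ρ) (f := fun p : S => (p, (0 : ℝ))) hDρ
      (hasMFDerivAt_prodMk_left (P := P) p₀ 0)
    have e2 := (hasMFDerivAt_const (I := 𝓘(ℝ, P)) (I' := 𝓘(ℝ, ℝ)) (0 : ℝ)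
      p₀).congr_of_eventuallyEq (f₁ := ρ ∘ fun p : S => (p, (0 : ℝ)))
      (Eventually.of_forall fun p => hρ0 p)
    exact hasMFDerivAt_unique e1 e2
  have h3 : HasMFDerivAt 𝓘(ℝ, ℝ) (𝓘(ℝ, P).prod 𝓘(ℝ, ℝ)) (fun t : ℝ => (A (p₀, t), t)) 0
      ((DA.comp (ContinuousLinearMap.inr ℝ P ℝ)).prod (ContinuousLinearMap.id ℝ ℝ)) :=
    (HasMFDerivAt.comp (0 : ℝ) (g := A) (f := fun s : ℝ => (p₀, s)) hDA
      (hasMFDerivAt_prodMk_right (P := P) p₀ 0)).prodMk (hasMFDerivAt_id _)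
  have hDρ' : HasMFDerivAt (𝓘(ℝ, P).prod 𝓘(ℝ, ℝ)) 𝓘(ℝ, ℝ) ρ (A (p₀, 0), 0) Dρ := by
    rw [hA0]; exact hDρ
  have h4 : HasFDerivAt (fun t => ρ (A (p₀, t), t))
      (Dρ.comp ((DA.comp (ContinuousLinearMap.inr ℝ P ℝ)).prod (ContinuousLinearMap.id ℝ ℝ))) 0 :=
    (HasMFDerivAt.comp (0 : ℝ) (g := ρ) (f := fun t : ℝ => (A (p₀, t), t)) hDρ' h3).hasFDerivAt
  have h5 : HasDerivAt (fun t => ρ (A (p₀, t), t)) (Dρ (DA (0, 1), 1)) 0 := h4.hasDerivAt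
  have h6 : Dρ (DA (0, 1), 1) = Dρ (0, 1) := by
    have e1 : ((DA (0, 1), 1) : P × ℝ) = (DA (0, 1), 0) + (0, 1) := by simp
    have e2 : Dρ (DA (0, 1), 0) = 0 := congrArg (fun L : P →L[ℝ] ℝ => L (DA (0, 1))) h2
    rw [e1, map_add, e2, zero_add]
  have h7 : HasDerivWithinAt (fun t => σ (p₀, t)) (Dρ (0, 1)) (Ici 0) 0 := by
    rw [← h6]
    exact h5.hasDerivWithinAt.congr_of_eventuallyEq (h.mono fun t ht => ht.symm)
      (h.self_of_nhdsWithin self_mem_Ici).symm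
  have h8 := (differentiableAt_of_deriv_ne_zero hσ.ne').hasDerivAt.hasDerivWithinAt (s := Ici 0)
  have h9 := (uniqueDiffWithinAt_Ici (0 : ℝ)).eq_deriv _ h8 h7
  have h10 : HasDerivAt (fun t => ρ (p₀, t)) (Dρ (0, 1)) 0 := h1.hasDerivAt
  rw [h10.deriv, ← h9]
  exact hσ

variable (P) in
/-- A motion of hypersurfaces in a collar of `S`, for times in `[0, η)`: the point starting at `p`
is at time `t` over the point `A (p, t)` of `S`, at height `ρ (A (p, t), t) < r`. The map `B (·, t)`
is the inverse of `A (·, t)`. -/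
structure IsGraphMotion (η r : ℝ) (A B : S × ℝ → S) (ρ : S × ℝ → ℝ) : Prop where
  contMDiffOn_fst : ContMDiffOn (𝓘(ℝ, P).prod 𝓘(ℝ, ℝ)) 𝓘(ℝ, P) ∞ A (univ ×ˢ Ico 0 η)
  contMDiffOn_inv : ContMDiffOn (𝓘(ℝ, P).prod 𝓘(ℝ, ℝ)) 𝓘(ℝ, P) ∞ B (univ ×ˢ Ico 0 η)
  contMDiff_height : ContMDiff (𝓘(ℝ, P).prod 𝓘(ℝ, ℝ)) 𝓘(ℝ, ℝ) ∞ ρ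
  fst_zero : ∀ p, A (p, 0) = p
  height_zero : ∀ p, ρ (p, 0) = 0
  right_inv : ∀ p, ∀ t ∈ Ico 0 η, A (B (p, t), t) = p
  left_inv : ∀ p, ∀ t ∈ Ico 0 η, B (A (p, t), t) = p
  height_mem : ∀ p, ∀ t ∈ Ico 0 η, ρ (p, t) ∈ Ico 0 r
  deriv_pos : ∀ p, ∀ t ∈ Ico 0 η, 0 < deriv (fun t => ρ (p, t)) t

omit [IsManifold 𝓘(ℝ, P) ∞ S] in
lemma IsGraphMotion.mono {η η' r : ℝ} {A B : S × ℝ → S} {ρ : S × ℝ → ℝ}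
    (h : IsGraphMotion P η r A B ρ) (hη : η' ≤ η) : IsGraphMotion P η' r A B ρ where
  contMDiffOn_fst := h.contMDiffOn_fst.mono (prod_mono_right (Ico_subset_Ico_right hη))
  contMDiffOn_inv := h.contMDiffOn_inv.mono (prod_mono_right (Ico_subset_Ico_right hη))
  contMDiff_height := h.contMDiff_height
  fst_zero := h.fst_zero
  height_zero := h.height_zero
  right_inv p t ht := h.right_inv p t (Ico_subset_Ico_right hη ht)
  left_inv p t ht := h.left_inv p t (Ico_subset_Ico_right hη ht)
  height_mem p t ht := h.height_mem p t (Ico_subset_Ico_right hη ht)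
  deriv_pos p t ht := h.deriv_pos p t (Ico_subset_Ico_right hη ht)

variable [FiniteDimensional ℝ P] [FiniteDimensional ℝ E] [CompactSpace S] [T2Space S]

/-- A family of hypersurfaces starting at `S × {0}` and moving into the collar `c₀` consists, for
small times, of graphs over `S`. -/
lemma exists_splitting {c₀ X : S × ℝ → M} {r : ℝ} (hr : 0 < r)
    (hinj : InjOn c₀ (univ ×ˢ Icc 0 r))
    (hC : ∀ p₀, ∃ (C : S × ℝ → M) (ξ : P × ℝ), IsCollarExtension (P := P) (E := E) c₀ C p₀ ∧
      0 < ξ.2 ∧ (mfderiv (𝓘(ℝ, P).prod 𝓘(ℝ, ℝ)) 𝓘(ℝ, E) C (p₀, 0) ξ : E)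
        = mfderiv (𝓘(ℝ, P).prod 𝓘(ℝ, ℝ)) 𝓘(ℝ, E) X (p₀, 0) ((0 : P), (1 : ℝ)))
    (hX : ∀ p, ∀ᶠ z in 𝓝 (p, (0 : ℝ)), ContMDiffAt (𝓘(ℝ, P).prod 𝓘(ℝ, ℝ)) 𝓘(ℝ, E) ∞ X z)
    (hX0 : ∀ p, X (p, 0) = c₀ (p, 0)) :
    ∃ η > 0, ∃ (A B : S × ℝ → S) (ρ : S × ℝ → ℝ),
      IsGraphMotion P η r A B ρ ∧
      ∀ p, ∀ t ∈ Ico 0 η, X (p, t) = c₀ (A (p, t), ρ (A (p, t), t)) := by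
  choose C ξ hC hξ hCξ using hC
  choose A B σ hsm hAσ hAB h0 hσ' using fun p₀ =>
    exists_local_splitting (hC p₀) (hX p₀) hX0 (hξ p₀) (hCξ p₀)
  -- `A i`, `B i`, `σ i` form a local splitting at `z`
  let Good : S → S × ℝ → Prop := fun i z =>
    (ContMDiffAt (𝓘(ℝ, P).prod 𝓘(ℝ, ℝ)) 𝓘(ℝ, P) ∞ (A i) z ∧
      ContMDiffAt (𝓘(ℝ, P).prod 𝓘(ℝ, ℝ)) 𝓘(ℝ, P) ∞ (B i) z ∧
      ContMDiffAt (𝓘(ℝ, P).prod 𝓘(ℝ, ℝ)) 𝓘(ℝ, ℝ) ∞ (fun z => σ i (B i z, z.2)) z) ∧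
    (0 ≤ z.2 → (σ i z ∈ Ico 0 r ∧ X z = c₀ (A i z, σ i z)) ∧
      σ i (B i z, z.2) ∈ Ico 0 r ∧ X (B i z, z.2) = c₀ (z.1, σ i (B i z, z.2))) ∧
    A i (B i z, z.2) = z.1 ∧ B i (A i z, z.2) = z.1
  have hGood : ∀ p, ∀ᶠ z in 𝓝 (p, (0 : ℝ)), Good p z := by
    intro p
    obtain ⟨hA, hB, hσ⟩ := (hsm p).self_of_nhds
    have hσr : ∀ᶠ z in 𝓝 (p, (0 : ℝ)), σ p z < r :=
      hσ.continuousAt.eventually (gt_mem_nhds (by rw [(h0 p).self_of_nhds.2.1]; exact hr))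
    have hBt : Tendsto (fun z : S × ℝ => (B p z, z.2)) (𝓝 (p, 0)) (𝓝 (p, 0)) := by
      have h1 : Tendsto (fun z : S × ℝ => (B p z, z.2)) (𝓝 (p, 0)) (𝓝 (B p (p, 0), 0)) :=
        hB.continuousAt.prodMk continuousAt_snd
      rwa [(h0 p).self_of_nhds.2.2] at h1
    filter_upwards [hsm p, hAσ p, hAB p, hσr, hBt.eventually (hsm p), hBt.eventually (hAσ p),
      hBt.eventually hσr] with z h1 h2 h3 h4 h5 h6 h7
    refine ⟨⟨h1.1, h1.2.1, ?_⟩, fun hz => ⟨⟨⟨(h2 hz).1, h4⟩, (h2 hz).2⟩,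
      ⟨(h6 hz).1, h7⟩, ?_⟩, h3⟩
    · exact ContMDiffAt.comp (g := σ p) (f := fun z : S × ℝ => (B p z, z.2)) z h5.2.2
        (h1.2.1.prodMk contMDiffAt_snd)
    · have := (h6 hz).2
      rwa [h3.1] at this
  obtain ⟨η₁, hη₁, hR⟩ := exists_forall_abs_lt_of_eventually
    (R := fun z : S × ℝ => ∃ i, ∀ᶠ z' in 𝓝 z, Good i z') fun p =>
      (eventually_eventually_nhds.2 (hGood p)).mono fun z hz => ⟨p, hz⟩
  choose i hi using fun (z : S × ℝ) (hz : |z.2| < η₁) => hR z.1 z.2 hz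
  -- A global splitting `(a, s)` of `X`; as `c₀` is injective, it agrees with the local ones.
  have hex : ∀ z : S × ℝ, ∃ (a : S) (s : ℝ), z.2 ∈ Ico 0 η₁ → s ∈ Ico 0 r ∧ X z = c₀ (a, s) := by
    intro z
    by_cases hz : z.2 ∈ Ico 0 η₁
    · have h1 := ((hi z (by rw [abs_of_nonneg hz.1]; exact hz.2)).self_of_nhds.2.1 hz.1).1
      exact ⟨_, _, fun _ => h1⟩
    · exact ⟨z.1, 0, fun h => absurd h hz⟩
  choose a s has using hex
  have huniq : ∀ z : S × ℝ, z.2 ∈ Ico 0 η₁ → ∀ a' s', s' ∈ Ico 0 r → X z = c₀ (a', s') →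
      a z = a' ∧ s z = s' := by
    intro z hz a' s' hs' h
    have h1 := hinj ⟨mem_univ _, Ico_subset_Icc_self (has z hz).1⟩
      ⟨mem_univ _, Ico_subset_Icc_self hs'⟩ ((has z hz).2.symm.trans h)
    exact Prod.ext_iff.1 h1
  have hloc : ∀ (j : S) (z : S × ℝ), z.2 ∈ Ico 0 η₁ → Good j z → a z = A j z ∧ s z = σ j z :=
    fun j z hz hg => huniq z hz _ _ (hg.2.1 hz.1).1.1 (hg.2.1 hz.1).1.2
  have hlocB : ∀ (j : S) (z : S × ℝ), z.2 ∈ Ico 0 η₁ → Good j z →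
      a (B j z, z.2) = z.1 ∧ s (B j z, z.2) = σ j (B j z, z.2) :=
    fun j z hz hg => huniq (B j z, z.2) hz _ _ (hg.2.1 hz.1).2.1 (hg.2.1 hz.1).2.2
  have ha0 : ∀ p, a (p, 0) = p ∧ s (p, 0) = 0 := fun p =>
    huniq (p, 0) ⟨le_rfl, hη₁⟩ p 0 ⟨le_rfl, hr⟩ (hX0 p)
  -- The maps `a (·, t)` are locally injective, and injective for `t = 0`; by compactness they are
  -- injective for small `t`. Negative times, where `a` has arbitrary values, are replaced by `0`.
  obtain ⟨η₂, hη₂, hinj₂⟩ : ∃ η₂ > 0, ∀ p p' t, t ∈ Ico 0 η₁ → t < η₂ → a (p, t) = a (p', t) →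
      p = p' := by
    let F : S × ℝ → S × ℝ := fun z => (a (z.1, max z.2 0), z.2)
    have hmax : ∀ p : S, Tendsto (fun z : S × ℝ => (z.1, max z.2 0)) (𝓝 (p, 0)) (𝓝 (p, 0)) := by
      intro p
      have : Continuous fun z : S × ℝ => (z.1, max z.2 0) := by fun_prop
      simpa using this.tendsto (p, 0)
    have hFloc : ∀ p, ∀ᶠ z in 𝓝 (p, (0 : ℝ)), a (z.1, max z.2 0) = A p (z.1, max z.2 0) ∧
        B p (a (z.1, max z.2 0), max z.2 0) = z.1 := by
      intro p
      have hlt : ∀ᶠ z in 𝓝 (p, (0 : ℝ)), z.2 < η₁ :=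
        (continuous_snd.tendsto (p, (0 : ℝ))).eventually (gt_mem_nhds hη₁)
      filter_upwards [(hmax p).eventually ((hGood p).and hlt)] with z hz
      have h1 := hloc p (z.1, max z.2 0) ⟨le_max_right _ _, hz.2⟩ hz.1
      exact ⟨h1.1, by rw [h1.1]; exact hz.1.2.2.2⟩
    obtain ⟨U, hU, hUF⟩ := Set.InjOn.exists_mem_nhdsSet (f := F) (s := univ ×ˢ {0}) (by
        rintro ⟨p, t⟩ ⟨-, ht⟩ ⟨p', t'⟩ ⟨-, ht'⟩ h
        obtain rfl : t = 0 := ht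
        obtain rfl : t' = 0 := ht'
        have h1 : a (p, max 0 0) = a (p', max 0 0) := congrArg Prod.fst h
        rw [max_self, (ha0 p).1, (ha0 p').1] at h1
        rw [h1])
      (isCompact_univ.prod isCompact_singleton) (by
        rintro ⟨p, t⟩ ⟨-, ht⟩
        obtain rfl : t = 0 := ht
        refine ContinuousAt.prodMk ?_ continuousAt_snd
        have h1 : ContinuousAt (fun z : S × ℝ => A p (z.1, max z.2 0)) (p, 0) := by
          refine Tendsto.comp (y := 𝓝 (p, 0)) ?_ (hmax p)
          have h2 := (hsm p).self_of_nhds.1.continuousAt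
          simpa using h2.tendsto
        exact h1.congr ((hFloc p).mono fun z hz => hz.1.symm)) (by
        rintro ⟨p, t⟩ ⟨-, ht⟩
        obtain rfl : t = 0 := ht
        refine ⟨_, hFloc p, fun z hz z' hz' h => ?_⟩
        obtain ⟨h1, h2⟩ := Prod.ext_iff.1 h
        have h1 : a (z.1, max z.2 0) = a (z'.1, max z'.2 0) := h1
        have h2 : z.2 = z'.2 := h2
        refine Prod.ext ?_ h2
        rw [← hz.2, ← hz'.2, h1, h2])
    obtain ⟨η₂, hη₂, h2⟩ := exists_forall_abs_lt_of_eventually (R := fun z => z ∈ U) fun p =>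
      mem_nhdsSet_iff_forall.1 hU (p, 0) ⟨mem_univ _, rfl⟩
    refine ⟨η₂, hη₂, fun p p' t ht htη h => ?_⟩
    have habs : |t| < η₂ := by rwa [abs_of_nonneg ht.1]
    have h3 := hUF (h2 p t habs) (h2 p' t habs) (by
      show (a (p, max t 0), t) = (a (p', max t 0), t)
      rw [max_eq_left ht.1, h])
    exact congrArg Prod.fst h3
  set η := min η₁ η₂ with hη
  have hηpos : 0 < η := lt_min hη₁ hη₂
  have hlt₁ : ∀ {t}, t ∈ Ico 0 η → t ∈ Ico 0 η₁ := fun ht =>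
    ⟨ht.1, ht.2.trans_le (min_le_left _ _)⟩
  have habs : ∀ {t}, t ∈ Ico 0 η → |t| < η₁ := fun ht => by
    rw [abs_of_nonneg ht.1]; exact (hlt₁ ht).2
  have hinj₃ : ∀ {p p' t}, t ∈ Ico 0 η → a (p, t) = a (p', t) → p = p' := fun ht h =>
    hinj₂ _ _ _ (hlt₁ ht) (ht.2.trans_le (min_le_right _ _)) h
  have hexB : ∀ z : S × ℝ, ∃ b, z.2 ∈ Ico 0 η → a (b, z.2) = z.1 := by
    intro z
    by_cases hz : z.2 ∈ Ico 0 η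
    · exact ⟨_, fun _ => (hlocB _ z (hlt₁ hz) (hi z (habs hz)).self_of_nhds).1⟩
    · exact ⟨z.1, fun h => absurd h hz⟩
  choose b hb using hexB
  have hbloc : ∀ (j : S) (z : S × ℝ), z.2 ∈ Ico 0 η → Good j z → b z = B j z := fun j z hz hg =>
    hinj₃ hz ((hb z hz).trans (hlocB j z (hlt₁ hz) hg).1.symm)
  -- The height over the base point `a (p, t)` is extended smoothly from small nonnegative times to
  -- all times.
  obtain ⟨ρ, hρ⟩ := exists_contMDiffMap_forall_mem_convex_of_local (𝓘(ℝ, P).prod 𝓘(ℝ, ℝ))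
    (n := ⊤) (t := fun z : S × ℝ => {y : ℝ | z.2 ∈ Icc 0 (η / 2) → y = s (b z, z.2)})
    (fun z => by
      intro x hx y hy α β _ _ hαβ h
      have hx' : x = s (b z, z.2) := hx h
      have hy' : y = s (b z, z.2) := hy h
      rw [hx', hy', ← add_smul, hαβ, one_smul])
    (fun z => by
      by_cases hz : z.2 ∈ Icc 0 (η / 2)
      · have hz' : z.2 ∈ Ico 0 η := ⟨hz.1, by linarith [hz.2]⟩
        have hlt : ∀ᶠ z' in 𝓝 z, z'.2 < η :=
          (continuous_snd.tendsto z).eventually (gt_mem_nhds hz'.2)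
        refine ⟨_, (hi z (habs hz')).and hlt,
          fun z' => σ (i z (habs hz')) (B (i z (habs hz')) z', z'.2),
          fun z' h => h.1.1.2.2.contMDiffWithinAt, fun z' h h' => ?_⟩
        have hz1 : z'.2 ∈ Ico 0 η := ⟨h'.1, h.2⟩
        rw [hbloc _ z' hz1 h.1]
        exact (hlocB _ z' (hlt₁ hz1) h.1).2.symm
      · refine ⟨{z' | z'.2 ∉ Icc 0 (η / 2)}, ?_, fun _ => 0, contMDiffOn_const,
          fun z' h h' => absurd h' h⟩
        exact (isClosed_Icc.preimage continuous_snd).isOpen_compl.mem_nhds hz)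
  have hρs : ContMDiff (𝓘(ℝ, P).prod 𝓘(ℝ, ℝ)) 𝓘(ℝ, ℝ) ∞ ρ := ρ.contMDiff
  have hρ' : ∀ z : S × ℝ, z.2 ∈ Ico 0 (η / 2) → ρ z = s (b z, z.2) := fun z hz =>
    hρ z (Ico_subset_Icc_self hz)
  have hsub : ∀ {t}, t ∈ Ico 0 (η / 2) → t ∈ Ico 0 η := fun ht => ⟨ht.1, by linarith [ht.2]⟩
  have hba : ∀ z : S × ℝ, z.2 ∈ Ico 0 η → b (a z, z.2) = z.1 := fun z hz =>
    hinj₃ hz (hb (a z, z.2) hz)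
  have hρa : ∀ z : S × ℝ, z.2 ∈ Ico 0 (η / 2) → ρ (a z, z.2) = s z := fun z hz =>
    (hρ' (a z, z.2) hz).trans (by rw [hba z (hsub hz)])
  have hρ0 : ∀ p, ρ (p, 0) = 0 := fun p => by
    have h1 := hρa (p, 0) ⟨le_rfl, by dsimp only; linarith⟩
    rwa [(ha0 p).1, (ha0 p).2] at h1
  obtain ⟨η₃, hη₃, hder⟩ := exists_forall_abs_lt_of_eventually
    (R := fun z : S × ℝ => 0 < deriv (fun t => ρ (z.1, t)) z.2) fun p => by
      refine eventually_pos_deriv_slice (P := P) (hρs _) ?_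
      refine deriv_pos_of_comp_eq (σ := σ p)
        ((hsm p).self_of_nhds.1.mdifferentiableAt (by simp)) (h0 p).self_of_nhds.1
        ((hρs _).mdifferentiableAt (by simp)) hρ0 ?_ (hσ' p)
      have h1 : Tendsto (fun t : ℝ => (p, t)) (𝓝 0) (𝓝 (p, 0)) :=
        Continuous.tendsto (by fun_prop) 0
      filter_upwards [nhdsWithin_le_nhds (h1.eventually (hGood p)), self_mem_nhdsWithin,
        nhdsWithin_le_nhds (gt_mem_nhds (show (0 : ℝ) < η / 2 by linarith))] with t h2 h3 h4
      have h5 := hloc p (p, t) (hlt₁ (hsub ⟨h3, h4⟩)) h2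
      rw [← h5.1, ← h5.2]
      exact hρa (p, t) ⟨h3, h4⟩
  have ht1 : ∀ {t}, t ∈ Ico 0 (min (η / 2) η₃) → t ∈ Ico 0 (η / 2) := fun ht =>
    ⟨ht.1, ht.2.trans_le (min_le_left _ _)⟩
  refine ⟨min (η / 2) η₃, lt_min (by linarith) hη₃, a, b, ρ, ⟨?_, ?_, hρs, fun p => (ha0 p).1,
    hρ0, fun p t ht => hb (p, t) (hsub (ht1 ht)), fun p t ht => hba (p, t) (hsub (ht1 ht)),
    fun p t ht => ?_, fun p t ht => ?_⟩, fun p t ht => ?_⟩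
  · rintro z ⟨-, hz⟩
    have hz' : z.2 ∈ Ico 0 η := hsub ⟨hz.1, hz.2.trans_le (min_le_left _ _)⟩
    have hg := hi z (habs hz')
    refine hg.self_of_nhds.1.1.contMDiffWithinAt.congr_of_eventuallyEq_of_mem ?_ ⟨mem_univ _, hz⟩
    filter_upwards [nhdsWithin_le_nhds hg, self_mem_nhdsWithin] with z' h1 h2
    exact (hloc _ z' (hlt₁ (hsub ⟨h2.2.1, h2.2.2.trans_le (min_le_left _ _)⟩)) h1).1
  · rintro z ⟨-, hz⟩
    have hz' : z.2 ∈ Ico 0 η := hsub ⟨hz.1, hz.2.trans_le (min_le_left _ _)⟩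
    have hg := hi z (habs hz')
    refine hg.self_of_nhds.1.2.1.contMDiffWithinAt.congr_of_eventuallyEq_of_mem ?_
      ⟨mem_univ _, hz⟩
    filter_upwards [nhdsWithin_le_nhds hg, self_mem_nhdsWithin] with z' h1 h2
    exact hbloc _ z' (hsub ⟨h2.2.1, h2.2.2.trans_le (min_le_left _ _)⟩) h1
  · rw [hρ' (p, t) (ht1 ht)]
    exact (has (b (p, t), t) (hlt₁ (hsub (ht1 ht)))).1
  · exact hder p t (by rw [abs_of_nonneg ht.1]; exact ht.2.trans_le (min_le_right _ _))
  · rw [hρa (p, t) (ht1 ht)]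
    exact (has (p, t) (hlt₁ (hsub (ht1 ht)))).2

end GlobalSplitting

/-! ### Differentials of immersions -/

section Immersion

variable {E F H G : Type*} [NormedAddCommGroup E] [NormedSpace ℝ E]
  [NormedAddCommGroup F] [NormedSpace ℝ F] [TopologicalSpace H] [TopologicalSpace G]
  {I : ModelWithCorners ℝ E H} {J : ModelWithCorners ℝ F G}
  {M N : Type*} [TopologicalSpace M] [ChartedSpace H M] [TopologicalSpace N] [ChartedSpace G N]

lemma injective_mfderiv_extend [IsManifold I ∞ M] {e : OpenPartialHomeomorph M H} {x : M}
    (he : e ∈ IsManifold.maximalAtlas I ∞ M) (hx : x ∈ e.source) :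
    Function.Injective (mfderiv I 𝓘(ℝ, E) (e.extend I) x) := by
  have h1 : HasMFDerivAt I 𝓘(ℝ, E) (e.extend I) x (mfderiv I 𝓘(ℝ, E) (e.extend I) x) :=
    ((e.contMDiffAt_extend he hx).mdifferentiableAt (by simp)).hasMFDerivAt
  have hx' : e.extend I x ∈ I '' e.target := ⟨e x, e.map_source hx, rfl⟩
  have h2 := (((contMDiffOn_extend_symm he) _ hx').mdifferentiableWithinAt
    (by simp)).hasMFDerivWithinAt
  have hev : ∀ᶠ y in 𝓝 x, y ∈ e.source := e.open_source.mem_nhds hx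
  have h3 := (h2.comp x h1.hasMFDerivWithinAt (s := e.source)
    (fun y hy => ⟨e y, e.map_source hy, rfl⟩)).hasMFDerivAt hev
  have h4 := h3.congr_of_eventuallyEq (f₁ := id) (by
    filter_upwards [hev] with y hy
    exact (e.extend_left_inv hy).symm)
  have h5 := hasMFDerivAt_unique h4 (hasMFDerivAt_id x)
  intro v w hvw
  have h6 : ∀ u : E, mfderivWithin 𝓘(ℝ, E) I (e.extend I).symm (I '' e.target) (e.extend I x)
      (mfderiv I 𝓘(ℝ, E) (e.extend I) x u) = u := fun u =>
    congrArg (fun A : E →L[ℝ] E => A u) h5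
  exact (h6 v).symm.trans ((congrArg _ hvw).trans (h6 w))

/-- In suitable charts an immersion is a linear embedding, so that a chart of its source factors
through it. -/
lemma injective_mfderiv_of_isImmersionAt [IsManifold I ∞ M] {f : M → N} {x : M}
    (h : IsImmersionAt I J ∞ f x) : Function.Injective (mfderiv I J f x) := by
  have h1 : HasMFDerivAt I J f x (mfderiv I J f x) :=
    (h.contMDiffAt.mdifferentiableAt (by simp)).hasMFDerivAt
  have h2 : HasMFDerivAt J 𝓘(ℝ, F) (h.codChart.extend J) (f x)
      (mfderiv J 𝓘(ℝ, F) (h.codChart.extend J) (f x)) :=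
    ((h.codChart.contMDiffAt_extend h.codChart_mem_maximalAtlas
      h.mem_codChart_source).mdifferentiableAt (by simp)).hasMFDerivAt
  let pr : F →L[ℝ] E := (ContinuousLinearMap.fst ℝ E h.complement).comp
    (h.equiv.symm : F →L[ℝ] E × h.complement)
  have h3 : HasMFDerivAt 𝓘(ℝ, F) 𝓘(ℝ, E) pr (h.codChart.extend J (f x)) pr :=
    pr.hasMFDerivAt
  have h4 := (h3.comp x (h2.comp x h1)).congr_of_eventuallyEq (f₁ := h.domChart.extend I) (by
    filter_upwards [h.domChart.open_source.mem_nhds h.mem_domChart_source] with y hy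
    have hy' : y ∈ (h.domChart.extend I).source := by
      rwa [OpenPartialHomeomorph.extend_source]
    have h5 := h.writtenInCharts ((h.domChart.extend I).map_source hy')
    simp only [Function.comp_apply] at h5
    rw [(h.domChart.extend I).left_inv hy'] at h5
    show _ = pr (h.codChart.extend J (f y))
    rw [h5]
    simp [pr])
  intro v w hvw
  refine injective_mfderiv_extend h.domChart_mem_maximalAtlas h.mem_domChart_source ?_
  rw [h4.mfderiv]
  exact congrArg (fun u => pr (mfderiv J 𝓘(ℝ, F) (h.codChart.extend J) (f x) u)) hvw

end Immersion

/-! ### The ends of the collar -/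

section CollarInput

variable {d : ℕ} {M : Type*} [TopologicalSpace M] [ChartedSpace (EuclideanSpace ℝ (Fin (d + 1))) M]
  [IsManifold (𝓡 (d + 1)) ∞ M]
  {S : Type*} [TopologicalSpace S] [ChartedSpace (EuclideanSpace ℝ (Fin d)) S]
  [IsManifold (𝓡 d) ∞ S] {ε : ℝ} [hε : Fact (-ε < ε)] {c : S × Icc (-ε) ε → M} {σ : ℝ}

/-- The parameter of the cylinder at distance `s` from the end `-ε` (for `σ = 1`) or from the end
`ε` (for `σ = -1`). -/
def collarParam (ε : ℝ) [hε : Fact (-ε < ε)] (σ s : ℝ) : Icc (-ε) ε :=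
  projIcc (-ε) ε hε.out.le (σ * (s - ε))

/-- The cylinder `c`, parametrized by the distance to one of its ends. -/
def collarMap (c : S × Icc (-ε) ε → M) (σ : ℝ) (z : S × ℝ) : M :=
  c (z.1, collarParam ε σ z.2)

omit hε in
lemma eps_pos_of_fact (hε : Fact (-ε < ε)) : 0 < ε := by linarith [hε.out]

lemma coe_collarParam (hσ : σ = 1 ∨ σ = -1) {s : ℝ} (hs : s ∈ Icc 0 (2 * ε)) :
    (collarParam ε σ s : ℝ) = σ * (s - ε) := by
  have : σ * (s - ε) ∈ Icc (-ε) ε := by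
    rcases hσ with rfl | rfl <;> constructor <;> linarith [hs.1, hs.2]
  rw [collarParam, projIcc_of_mem _ this]

lemma contMDiffOn_collarParam (hσ : σ = 1 ∨ σ = -1) :
    ContMDiffOn 𝓘(ℝ, ℝ) (𝓡∂ 1) ∞ (collarParam ε σ) (Icc 0 (2 * ε)) := by
  refine ContMDiffOn.comp (t := Icc (-ε) ε) (f := fun s => σ * (s - ε)) contMDiffOn_projIcc ?_ ?_
  · have : ContDiff ℝ ∞ fun s => σ * (s - ε) := by fun_prop
    exact this.contMDiff.contMDiffOn
  · intro s hs
    rw [mem_preimage, ← coe_collarParam hσ hs]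
    exact (collarParam ε σ s).2

lemma continuous_collarParam : Continuous (collarParam ε σ) :=
  continuous_projIcc.comp (by fun_prop)

/-- The derivative `L` of `collarParam` at an end of the cylinder, and its inverse `σ • D`, where
`D` is the differential of the coordinate of the interval. -/
lemma exists_hasMFDerivWithinAt_collarParam (hσ : σ = 1 ∨ σ = -1) :
    ∃ (L : ℝ →L[ℝ] EuclideanSpace ℝ (Fin 1)) (D : EuclideanSpace ℝ (Fin 1) →L[ℝ] ℝ),
      HasMFDerivWithinAt 𝓘(ℝ, ℝ) (𝓡∂ 1) (collarParam ε σ) (Icc 0 (2 * ε)) 0 L ∧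
      HasMFDerivAt (𝓡∂ 1) 𝓘(ℝ, ℝ) (Subtype.val : Icc (-ε) ε → ℝ) (collarParam ε σ 0) D ∧
      Function.Bijective L ∧ ∀ ξ, L (σ * D ξ) = ξ := by
  have hε' := eps_pos_of_fact hε
  have h0 : (0 : ℝ) ∈ Icc 0 (2 * ε) := ⟨le_rfl, by linarith⟩
  have hσσ : σ * σ = 1 := by rcases hσ with rfl | rfl <;> norm_num
  have h1 := ((contMDiffOn_collarParam (ε := ε) hσ 0 h0).mdifferentiableWithinAt
    (by simp)).hasMFDerivWithinAt
  obtain ⟨L, hL⟩ : ∃ L : ℝ →L[ℝ] EuclideanSpace ℝ (Fin 1),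
      HasMFDerivWithinAt 𝓘(ℝ, ℝ) (𝓡∂ 1) (collarParam ε σ) (Icc 0 (2 * ε)) 0 L := ⟨_, h1⟩
  obtain ⟨D, hD⟩ : ∃ D : EuclideanSpace ℝ (Fin 1) →L[ℝ] ℝ,
      HasMFDerivAt (𝓡∂ 1) 𝓘(ℝ, ℝ) (Subtype.val : Icc (-ε) ε → ℝ) (collarParam ε σ 0) D :=
    ⟨_, ((contMDiff_subtypeVal_Icc (n := ∞) _).mdifferentiableAt (by simp)).hasMFDerivAt⟩
  have h2 : HasFDerivWithinAt (Subtype.val ∘ collarParam ε σ) (D.comp L) (Icc 0 (2 * ε)) 0 :=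
    (hD.comp_hasMFDerivWithinAt (0 : ℝ) hL).hasFDerivWithinAt
  have h3 : HasDerivWithinAt (Subtype.val ∘ collarParam ε σ) (D (L 1)) (Icc 0 (2 * ε)) 0 :=
    h2.hasDerivWithinAt
  have h4 : HasDerivWithinAt (Subtype.val ∘ collarParam ε σ) σ (Icc 0 (2 * ε)) 0 := by
    have h5 : HasDerivAt (fun s => σ * (s - ε)) σ 0 := by
      simpa using ((hasDerivAt_id (0 : ℝ)).sub_const ε).const_mul σ
    exact h5.hasDerivWithinAt.congr (fun s hs => coe_collarParam hσ hs) (coe_collarParam hσ h0)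
  have h6 : D (L 1) = σ :=
    (uniqueDiffOn_Icc (by linarith : (0 : ℝ) < 2 * ε) 0 h0).eq_deriv _ h3 h4
  have h7 : ∀ τ, D (L τ) = τ * σ := fun τ => by
    have : L τ = τ • L 1 := by rw [← map_smul]; simp
    rw [this, map_smul, h6, smul_eq_mul]
  have hσ0 : σ ≠ 0 := by rcases hσ with rfl | rfl <;> norm_num
  have hinj : Function.Injective L := fun τ τ' h => by
    have := congrArg D h
    rw [h7, h7] at this
    exact mul_right_cancel₀ hσ0 this
  have hb : Function.Bijective L := by
    refine ⟨hinj, ?_⟩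
    exact (LinearMap.injective_iff_surjective_of_finrank_eq_finrank
      (f := (L : ℝ →ₗ[ℝ] EuclideanSpace ℝ (Fin 1))) (by simp)).1 hinj
  refine ⟨L, D, hL, hD, hb, fun ξ => ?_⟩
  obtain ⟨τ, rfl⟩ := hb.2 ξ
  have h9 : σ * (τ * σ) = τ := by linear_combination τ * hσσ
  rw [h7, h9]

variable (hc : IsSmoothEmbedding ((𝓡 d).prod (𝓡∂ 1)) (𝓡 (d + 1)) ∞ c)
include hc

omit [IsManifold (𝓡 (d + 1)) ∞ M] [IsManifold (𝓡 d) ∞ S] in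
lemma contMDiffOn_collarMap (hσ : σ = 1 ∨ σ = -1) :
    ContMDiffOn ((𝓡 d).prod 𝓘(ℝ, ℝ)) (𝓡 (d + 1)) ∞ (collarMap c σ) (univ ×ˢ Icc 0 (2 * ε)) := by
  refine hc.contMDiff.comp_contMDiffOn (f := fun z : S × ℝ => (z.1, collarParam ε σ z.2)) ?_
  exact contMDiffOn_fst.prodMk ((contMDiffOn_collarParam hσ).comp contMDiffOn_snd fun z hz => hz.2)

omit [IsManifold (𝓡 (d + 1)) ∞ M] [IsManifold (𝓡 d) ∞ S] in
lemma injOn_collarMap (hσ : σ = 1 ∨ σ = -1) :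
    InjOn (collarMap c σ) (univ ×ˢ Icc 0 (2 * ε)) := by
  rintro ⟨p, s⟩ ⟨-, hs⟩ ⟨p', s'⟩ ⟨-, hs'⟩ h
  obtain ⟨h1, h2⟩ := Prod.ext_iff.1 (hc.isEmbedding.injective h)
  have h1 : p = p' := h1
  have h2 : σ * (s - ε) = σ * (s' - ε) := by
    rw [← coe_collarParam hσ hs, ← coe_collarParam hσ hs']
    exact congrArg Subtype.val h2
  have hσ0 : σ ≠ 0 := by rcases hσ with rfl | rfl <;> norm_num
  have := mul_left_cancel₀ hσ0 h2
  exact Prod.ext h1 (by linarith : s = s')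

omit [IsManifold (𝓡 (d + 1)) ∞ M] in
/-- The cylinder has full dimension, also at its boundary points. -/
lemma bijective_mfderiv_cylinder (q : S × Icc (-ε) ε) :
    Function.Bijective (mfderiv ((𝓡 d).prod (𝓡∂ 1)) (𝓡 (d + 1)) c q) := by
  have hinj := injective_mfderiv_of_isImmersionAt (hc.isImmersion.isImmersionAt q)
  have key : ∀ A : EuclideanSpace ℝ (Fin d) × EuclideanSpace ℝ (Fin 1) →L[ℝ]
      EuclideanSpace ℝ (Fin (d + 1)), Function.Injective A → Function.Surjective A := fun A hA =>
    (LinearMap.injective_iff_surjective_of_finrank_eq_finrank (f := A.toLinearMap)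
      (by simp)).1 hA
  exact ⟨hinj, key _ hinj⟩

omit [IsManifold (𝓡 (d + 1)) ∞ M] [IsManifold (𝓡 d) ∞ S] in
/-- A two-sided extension of the collar has at the boundary the differential of the cylinder, as the
one-sided derivatives determine the differential. -/
lemma mfderiv_eq_of_eq_collarMap {C : S × ℝ → M} {p : S}
    {L : ℝ →L[ℝ] EuclideanSpace ℝ (Fin 1)}
    (hL : HasMFDerivWithinAt 𝓘(ℝ, ℝ) (𝓡∂ 1) (collarParam ε σ) (Icc 0 (2 * ε)) 0 L)
    (hC : MDifferentiableAt ((𝓡 d).prod 𝓘(ℝ, ℝ)) (𝓡 (d + 1)) C (p, 0))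
    (he : ∀ᶠ z in 𝓝 (p, (0 : ℝ)), 0 ≤ z.2 → C z = collarMap c σ z) :
    (mfderiv ((𝓡 d).prod 𝓘(ℝ, ℝ)) (𝓡 (d + 1)) C (p, 0) :
        EuclideanSpace ℝ (Fin d) × ℝ →L[ℝ] EuclideanSpace ℝ (Fin (d + 1)))
      = (mfderiv ((𝓡 d).prod (𝓡∂ 1)) (𝓡 (d + 1)) c (p, collarParam ε σ 0) :
        EuclideanSpace ℝ (Fin d) × EuclideanSpace ℝ (Fin 1) →L[ℝ]
          EuclideanSpace ℝ (Fin (d + 1))).comp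
        ((ContinuousLinearMap.id ℝ (EuclideanSpace ℝ (Fin d))).prodMap L) := by
  have hε' := eps_pos_of_fact hε
  have h0 : (0 : ℝ) ∈ Icc 0 (2 * ε) := ⟨le_rfl, by linarith⟩
  have h1 : HasMFDerivWithinAt ((𝓡 d).prod 𝓘(ℝ, ℝ)) ((𝓡 d).prod (𝓡∂ 1))
      (fun z : S × ℝ => (z.1, collarParam ε σ z.2)) (univ ×ˢ Icc 0 (2 * ε)) (p, 0)
      ((ContinuousLinearMap.id ℝ (EuclideanSpace ℝ (Fin d))).prodMap L) := by
    have h2 : HasMFDerivWithinAt ((𝓡 d).prod 𝓘(ℝ, ℝ)) (𝓡∂ 1)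
        (fun z : S × ℝ => collarParam ε σ z.2) (univ ×ˢ Icc 0 (2 * ε)) (p, 0)
        (L.comp (ContinuousLinearMap.snd ℝ (EuclideanSpace ℝ (Fin d)) ℝ)) :=
      HasMFDerivWithinAt.comp (p, (0 : ℝ)) (g := collarParam ε σ) (f := Prod.snd) hL
        (hasMFDerivWithinAt_snd _ _) (fun z hz => hz.2)
    exact (hasMFDerivWithinAt_fst _ _).prodMk h2
  have h2 := ((hc.contMDiff (p, collarParam ε σ 0)).mdifferentiableAt (by simp)).hasMFDerivAt
  have h3 := HasMFDerivAt.comp_hasMFDerivWithinAt (p, (0 : ℝ)) (g := c)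
    (f := fun z : S × ℝ => (z.1, collarParam ε σ z.2)) h2 h1
  have h4 := h3.congr_of_eventuallyEq (f₁ := C) (by
    filter_upwards [nhdsWithin_le_nhds he, self_mem_nhdsWithin] with z hz hz'
    exact hz hz'.2.1) (he.self_of_nhds le_rfl)
  have hU : UniqueMDiffWithinAt ((𝓡 d).prod 𝓘(ℝ, ℝ)) (univ ×ˢ Icc 0 (2 * ε)) (p, (0 : ℝ)) :=
    (uniqueMDiffWithinAt_univ (𝓡 d)).prod
      (uniqueDiffOn_Icc (by linarith : (0 : ℝ) < 2 * ε) 0 h0).uniqueMDiffWithinAt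
  exact hU.eq hC.hasMFDerivAt.hasMFDerivWithinAt h4

/-- By Borel's lemma, the collar extends smoothly across each end. -/
lemma exists_isCollarExtension (hσ : σ = 1 ∨ σ = -1) (p₀ : S) :
    ∃ C, IsCollarExtension (P := EuclideanSpace ℝ (Fin d)) (E := EuclideanSpace ℝ (Fin (d + 1)))
      (collarMap c σ) C p₀ := by
  have hε' := eps_pos_of_fact hε
  set x₀ := collarMap c σ (p₀, 0) with hx₀
  set ψ := extChartAt 𝓘(ℝ, EuclideanSpace ℝ (Fin d)) p₀ with hψ
  set φ := extChartAt 𝓘(ℝ, EuclideanSpace ℝ (Fin (d + 1))) x₀ with hφ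
  let f : EuclideanSpace ℝ (Fin d) × ℝ → EuclideanSpace ℝ (Fin (d + 1)) :=
    chartMap (collarMap c σ) p₀ x₀
  have hcont : Continuous (collarMap c σ) := by
    refine hc.contMDiff.continuous.comp ?_
    exact continuous_fst.prodMk (continuous_collarParam.comp continuous_snd)
  have hlt : ∀ᶠ z in 𝓝 (p₀, (0 : ℝ)), z.2 < 2 * ε :=
    (continuous_snd.tendsto (p₀, (0 : ℝ))).eventually (gt_mem_nhds (by linarith))
  have hsrc : ∀ᶠ z in 𝓝 (p₀, (0 : ℝ)),
      collarMap c σ z ∈ (chartAt (EuclideanSpace ℝ (Fin (d + 1))) x₀).source :=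
    hcont.continuousAt.eventually (chart_source_mem_nhds _ x₀)
  have hl : ψ.symm (ψ p₀) = p₀ := ψ.left_inv (mem_extChartAt_source p₀)
  have hf : ∀ᶠ z in 𝓝 (ψ p₀, (0 : ℝ)), 0 ≤ z.2 →
      ContDiffWithinAt ℝ ∞ f (upperHalf _) z := by
    filter_upwards [(tendsto_prod_extChartAt_symm (P := EuclideanSpace ℝ (Fin d)) p₀ 0).eventually
      (hlt.and (hsrc.and (eventually_mem_prod_source (P := EuclideanSpace ℝ (Fin d)) p₀ 0))),
      eventually_mem_prod_target (P := EuclideanSpace ℝ (Fin d)) p₀ 0] with z hz hzt h0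
    have h1 : ContMDiffWithinAt ((𝓡 d).prod 𝓘(ℝ, ℝ)) (𝓡 (d + 1)) ∞ (collarMap c σ)
        (univ ×ˢ Ici 0) (ψ.symm z.1, z.2) := by
      refine (contMDiffOn_collarMap hc hσ (ψ.symm z.1, z.2)
        ⟨mem_univ _, h0, hz.1.le⟩).mono_of_mem_nhdsWithin ?_
      filter_upwards [self_mem_nhdsWithin, nhdsWithin_le_nhds
        ((continuous_snd.tendsto (ψ.symm z.1, z.2)).eventually (gt_mem_nhds hz.1))] with y h1 h2
      exact ⟨mem_univ _, h1.2, h2.le⟩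
    have h2 := contDiffWithinAt_chartMap hz.2.2 hz.2.1 h1
    rw [← hψ] at h2
    dsimp only at h2
    rw [ψ.right_inv hzt] at h2
    rw [upperHalf_eq]
    exact h2
  -- the extension of the expression `f` of the collar in charts
  obtain ⟨Y, hY, hYf⟩ := exists_contDiff_extension (f := f) (x₀ := ψ p₀)
    (eventually_nhdsWithin_iff.2 (hf.mono fun z hz h => hz h))
  have hY0 : Y (ψ p₀, 0) = φ x₀ := by
    rw [hYf.self_of_nhds (le_refl (0 : ℝ))]
    show extChartAt _ x₀ (collarMap c σ (ψ.symm (ψ p₀), 0)) = _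
    rw [hl]
  have hYt : ∀ᶠ z in 𝓝 (ψ p₀, (0 : ℝ)), Y z ∈ φ.target := by
    refine hY.continuous.continuousAt.eventually ?_
    rw [hY0]
    exact (isOpen_extChartAt_target x₀).mem_nhds (mem_extChartAt_target x₀)
  let C : S × ℝ → M := ofChartMap Y p₀ x₀
  have hCs : ∀ᶠ z in 𝓝 (p₀, (0 : ℝ)),
      ContMDiffAt ((𝓡 d).prod 𝓘(ℝ, ℝ)) (𝓡 (d + 1)) ∞ C z := by
    filter_upwards [(tendsto_prod_extChartAt p₀ 0).eventually hYt,
      eventually_mem_prod_source (P := EuclideanSpace ℝ (Fin d)) p₀ 0] with z hz hzs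
    exact contMDiffAt_ofChartMap hzs hz hY.contDiffAt
  have hCe : ∀ᶠ z in 𝓝 (p₀, (0 : ℝ)), 0 ≤ z.2 → C z = collarMap c σ z := by
    filter_upwards [(tendsto_prod_extChartAt p₀ 0).eventually hYf, hsrc,
      eventually_mem_prod_source (P := EuclideanSpace ℝ (Fin d)) p₀ 0] with z hz h1 h2 h0
    have h3 : Y (ψ z.1, z.2) = φ (collarMap c σ z) := by
      rw [hz h0]
      show φ (collarMap c σ (ψ.symm (ψ z.1), z.2)) = _
      rw [ψ.left_inv (by rwa [hψ, extChartAt_source])]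
    show φ.symm (Y (ψ z.1, z.2)) = _
    rw [h3, φ.left_inv (by rwa [hφ, extChartAt_source])]
  obtain ⟨L, -, hL, -, hLb, -⟩ := exists_hasMFDerivWithinAt_collarParam (ε := ε) hσ
  refine ⟨C, hCs, ?_, hCe⟩
  have h1 := mfderiv_eq_of_eq_collarMap hc hL
    (hCs.self_of_nhds.mdifferentiableAt (by simp)) hCe
  have h2 : Function.Bijective ((ContinuousLinearMap.id ℝ (EuclideanSpace ℝ (Fin d))).prodMap L) :=
    Function.bijective_id.prodMap hLb
  have h3 := (bijective_mfderiv_cylinder hc (p₀, collarParam ε σ 0)).comp h2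
  have key : ∀ A B : EuclideanSpace ℝ (Fin d) × ℝ →L[ℝ] EuclideanSpace ℝ (Fin (d + 1)), A = B →
      Function.Bijective B → Function.Bijective A := by
    rintro A _ rfl h; exact h
  exact key _ _ h1 h3

omit [IsManifold (𝓡 (d + 1)) ∞ M] [IsManifold (𝓡 d) ∞ S] in
/-- The unit normal in the direction of increasing parameter of the cylinder is, up to the sign `σ`
of the end, the unit normal pointing into the collar at that end. -/
lemma isCollarNormal_of_isPositiveUnitNormal (hσ : σ = 1 ∨ σ = -1) {C : S × ℝ → M} {p : S}
    {k : ℝ → ∀ x : M, TangentSpace (𝓡 (d + 1)) x →L[ℝ] TangentSpace (𝓡 (d + 1)) x →L[ℝ] ℝ}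
    {s : Icc (-ε) ε} (hs : s = collarParam ε σ 0)
    {V : TangentSpace (𝓡 (d + 1)) (c (p, s))} (hV : IsPositiveUnitNormal (k 0) c p s V)
    {V' : S → EuclideanSpace ℝ (Fin (d + 1))}
    (hV' : V' p = σ • (V : EuclideanSpace ℝ (Fin (d + 1))))
    (hCs : ContMDiffAt ((𝓡 d).prod 𝓘(ℝ, ℝ)) (𝓡 (d + 1)) ∞ C (p, 0))
    (hCe : ∀ᶠ z in 𝓝 (p, (0 : ℝ)), 0 ≤ z.2 → C z = collarMap c σ z) :
    IsCollarNormal (P := EuclideanSpace ℝ (Fin d)) (E := EuclideanSpace ℝ (Fin (d + 1)))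
      k C V' p := by
  subst hs
  obtain ⟨hV1, hV2, ξ, hξ, hξpos⟩ := hV
  have hσσ : σ * σ = 1 := by rcases hσ with rfl | rfl <;> norm_num
  obtain ⟨L, Dv, hL, hDv, -, hLζ⟩ := exists_hasMFDerivWithinAt_collarParam (ε := ε) hσ
  have hD := mfderiv_eq_of_eq_collarMap hc hL (hCs.mdifferentiableAt (by simp)) hCe
  have hC0 : C (p, 0) = c (p, collarParam ε σ 0) := hCe.self_of_nhds le_rfl
  have hcd := (hc.contMDiff (p, collarParam ε σ 0)).mdifferentiableAt (by simp)
  obtain ⟨Dc, hDc⟩ : ∃ D : EuclideanSpace ℝ (Fin d) × EuclideanSpace ℝ (Fin 1) →L[ℝ]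
      EuclideanSpace ℝ (Fin (d + 1)),
      D = mfderiv ((𝓡 d).prod (𝓡∂ 1)) (𝓡 (d + 1)) c (p, collarParam ε σ 0) := ⟨_, rfl⟩
  obtain ⟨W, hW⟩ : ∃ W : EuclideanSpace ℝ (Fin (d + 1)), W = V := ⟨_, rfl⟩
  obtain ⟨ζ, hζ⟩ : ∃ ζ : EuclideanSpace ℝ (Fin d) × EuclideanSpace ℝ (Fin 1), ζ = ξ := ⟨_, rfl⟩
  have hDζ : Dc ζ = W := by
    rw [hDc, hζ, hW]; exact hξ
  have hDC : ∀ z : EuclideanSpace ℝ (Fin d) × ℝ,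
      mfderiv ((𝓡 d).prod 𝓘(ℝ, ℝ)) (𝓡 (d + 1)) C (p, 0) z = Dc (z.1, L z.2) := by
    intro z
    rw [hDc]
    exact congrArg (fun A : EuclideanSpace ℝ (Fin d) × ℝ →L[ℝ] EuclideanSpace ℝ (Fin (d + 1)) =>
      A z) hD
  have hpos : 0 < Dv ζ.2 := by
    have h1 : HasMFDerivAt ((𝓡 d).prod (𝓡∂ 1)) 𝓘(ℝ, ℝ) (fun q : S × Icc (-ε) ε => (q.2 : ℝ))
        (p, collarParam ε σ 0) (Dv.comp (ContinuousLinearMap.snd ℝ _ _)) :=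
      HasMFDerivAt.comp (p, collarParam ε σ 0) (g := Subtype.val) (f := Prod.snd) hDv
        (hasMFDerivAt_snd _)
    refine hξpos.trans_eq ?_
    rw [hζ]
    exact congrArg (fun A : EuclideanSpace ℝ (Fin d) × EuclideanSpace ℝ (Fin 1) →L[ℝ] ℝ => A ξ)
      h1.mfderiv
  obtain ⟨K, hK⟩ : ∃ K : EuclideanSpace ℝ (Fin (d + 1)) →L[ℝ] EuclideanSpace ℝ (Fin (d + 1)) →L[ℝ]
      ℝ, K = k 0 (c (p, collarParam ε σ 0)) := ⟨_, rfl⟩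
  have hk : ∀ u v : EuclideanSpace ℝ (Fin (d + 1)), k 0 (C (p, 0)) u v = K u v := by
    rw [hK]
    have key : ∀ (x x' : M) (u v : EuclideanSpace ℝ (Fin (d + 1))), x = x' →
        k 0 x u v = k 0 x' u v := by
      rintro x _ u v rfl; rfl
    exact fun u v => key _ _ u v hC0
  have hVW : V' p = σ • W := by rw [hW]; exact hV'
  refine ⟨⟨(σ • ζ.1, Dv ζ.2), hpos, ?_⟩, ?_, fun w => ?_⟩
  · refine (hDC _).trans ?_
    have h1 : L (Dv ζ.2) = σ • ζ.2 := by
      rw [← hLζ (σ • ζ.2), map_smul, smul_eq_mul, ← mul_assoc, hσσ, one_mul]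
    rw [hVW, ← hDζ]
    exact (congrArg (fun y => Dc (σ • ζ.1, y)) h1).trans (map_smul Dc σ ζ)
  · refine (hk _ _).trans ?_
    rw [hVW, map_smul, map_smul, smul_apply, smul_smul, hσσ, one_smul, hW, hK]
    exact hV1
  · refine (hk _ _).trans ?_
    have h2 : HasMFDerivAt (𝓡 d) (𝓡 (d + 1)) (fun p' : S => c (p', collarParam ε σ 0)) p
        (Dc.comp (ContinuousLinearMap.inl ℝ _ _)) := by
      rw [hDc]
      exact HasMFDerivAt.comp p (g := c) (f := fun p' : S => (p', collarParam ε σ 0))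
        hcd.hasMFDerivAt ((hasMFDerivAt_id (I := 𝓡 d) p).prodMk
          (hasMFDerivAt_const (I := 𝓡 d) (I' := 𝓡∂ 1) (collarParam ε σ 0) p))
    have h3 := hV2 w
    have h4 : (mfderiv (𝓡 d) (𝓡 (d + 1)) (fun p' : S => c (p', collarParam ε σ 0)) p w :
        EuclideanSpace ℝ (Fin (d + 1))) = Dc (w, 0) :=
      congrArg (fun A : EuclideanSpace ℝ (Fin d) →L[ℝ] EuclideanSpace ℝ (Fin (d + 1)) => A w)
        h2.mfderiv
    have h5 : (mfderiv ((𝓡 d).prod 𝓘(ℝ, ℝ)) (𝓡 (d + 1)) C (p, 0) (w, (0 : ℝ)) :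
        EuclideanSpace ℝ (Fin (d + 1))) = Dc (w, 0) := by
      refine (hDC (w, 0)).trans ?_
      rw [map_zero]
    have h6 : K W (Dc (w, 0)) = 0 := by
      rw [hW, ← h4, hK]; exact h3
    refine (congrArg (K (V' p)) h5).trans ?_
    rw [hVW, map_smul, smul_apply, h6, smul_zero]

end CollarInput

/-! ### Diffeomorphisms of cylinders -/

section CylinderDiffeo

variable {P : Type*} [NormedAddCommGroup P] [NormedSpace ℝ P]
  {S : Type*} [TopologicalSpace S] [CompactSpace S] [ChartedSpace P S] [IsManifold 𝓘(ℝ, P) ∞ S]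

/-- A function that increases in `t ∈ [0, 1]` still does so on a slightly larger interval, by
compactness of the base. -/
lemma exists_strictMonoOn_slices {s : S × ℝ → ℝ}
    (hs : ContMDiff (𝓘(ℝ, P).prod 𝓘(ℝ, ℝ)) 𝓘(ℝ, ℝ) ∞ s)
    (hs' : ∀ q, ∀ t ∈ Icc (0 : ℝ) 1, 0 < deriv (fun t => s (q, t)) t) :
    ∃ ζ > 0, ∀ q, StrictMonoOn (fun t => s (q, t)) (Ioo (-ζ) (1 + ζ)) := by
  obtain ⟨ζ₀, hζ₀, h0⟩ := exists_forall_abs_lt_of_eventually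
    (R := fun z : S × ℝ => 0 < deriv (fun t => s (z.1, t)) z.2) fun p =>
      eventually_pos_deriv_slice (P := P) (hs _) (hs' p 0 (by simp))
  obtain ⟨ζ₁, hζ₁, h1⟩ := exists_forall_abs_lt_of_eventually
    (R := fun z : S × ℝ => 0 < deriv (fun t => s (z.1, t)) (1 + z.2)) fun p => by
      have h2 : Tendsto (fun z : S × ℝ => (z.1, 1 + z.2)) (𝓝 (p, 0)) (𝓝 (p, 1)) := by
        have : Continuous fun z : S × ℝ => (z.1, 1 + z.2) := by fun_prop
        simpa using this.tendsto (p, 0)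
      exact h2.eventually (eventually_pos_deriv_slice (P := P) (hs _) (hs' p 1 (by simp)))
  refine ⟨min ζ₀ ζ₁, lt_min hζ₀ hζ₁, fun q => ?_⟩
  have hpos : ∀ t ∈ Ioo (-min ζ₀ ζ₁) (1 + min ζ₀ ζ₁), 0 < deriv (fun t => s (q, t)) t := by
    intro t ht
    have h2 := min_le_left ζ₀ ζ₁
    have h3 := min_le_right ζ₀ ζ₁
    rcases lt_or_ge t 0 with h | h
    · exact h0 q t (abs_lt.2 ⟨by linarith [ht.1], by linarith⟩)
    rcases le_or_gt t 1 with h' | h'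
    · exact hs' q t ⟨h, h'⟩
    · have := h1 q (t - 1) (abs_lt.2 ⟨by linarith, by linarith [ht.2]⟩)
      simpa using this
  refine strictMonoOn_of_deriv_pos (convex_Ioo _ _) (fun t ht => ?_) fun t ht => ?_
  · exact (differentiableAt_of_deriv_ne_zero (hpos t ht).ne').continuousAt.continuousWithinAt
  · exact hpos t (interior_subset ht)

variable [FiniteDimensional ℝ P] {ε : ℝ} [hε : Fact (-ε < ε)]

/-- A diffeomorphism of cylinders `(p, t) ↦ (A (p, t), s (A (p, t), t))`, where the `A (·, t)` are
diffeomorphisms of `S` and `s` is increasing in `t`. -/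
lemma exists_cylinder_diffeo {A B : S × ℝ → S} {s : S × ℝ → ℝ}
    (hA : ContMDiffOn (𝓘(ℝ, P).prod 𝓘(ℝ, ℝ)) 𝓘(ℝ, P) ∞ A (univ ×ˢ Icc 0 1))
    (hB : ContMDiffOn (𝓘(ℝ, P).prod 𝓘(ℝ, ℝ)) 𝓘(ℝ, P) ∞ B (univ ×ˢ Icc 0 1))
    (hAB : ∀ p, ∀ t ∈ Icc (0 : ℝ) 1, A (B (p, t), t) = p ∧ B (A (p, t), t) = p)
    (hs : ContMDiff (𝓘(ℝ, P).prod 𝓘(ℝ, ℝ)) 𝓘(ℝ, ℝ) ∞ s)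
    (hs0 : ∀ q, s (q, 0) = -ε) (hs1 : ∀ q, s (q, 1) = ε)
    (hs' : ∀ q, ∀ t ∈ Icc (0 : ℝ) 1, 0 < deriv (fun t => s (q, t)) t) :
    ∃ Φ : (S × Icc (0 : ℝ) 1) ≃ₘ^∞⟮𝓘(ℝ, P).prod (𝓡∂ 1), 𝓘(ℝ, P).prod (𝓡∂ 1)⟯
        (S × Icc (-ε) ε),
      ∀ p t, (Φ (p, t)).1 = A (p, t) ∧ ((Φ (p, t)).2 : ℝ) = s (A (p, t), t) := by
  obtain ⟨ζ, hζ, hmono⟩ := exists_strictMonoOn_slices hs hs'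
  have hIcc : ∀ {t : ℝ}, t ∈ Icc (0 : ℝ) 1 → t ∈ Ioo (-ζ) (1 + ζ) := fun ht =>
    ⟨by linarith [ht.1], by linarith [ht.2]⟩
  have hmem : ∀ q, ∀ t ∈ Icc (0 : ℝ) 1, s (q, t) ∈ Icc (-ε) ε := fun q t ht => by
    rw [← hs0 q, ← hs1 q]
    exact ⟨(hmono q).monotoneOn (hIcc (by simp)) (hIcc ht) ht.1,
      (hmono q).monotoneOn (hIcc ht) (hIcc (by simp)) ht.2⟩
  have hsurj : ∀ y : S × Icc (-ε) ε, ∃ t : Icc (0 : ℝ) 1, s (y.1, t) = y.2 := by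
    intro y
    have hc : ContinuousOn (fun t => s (y.1, t)) (Icc 0 1) :=
      (hs.continuous.comp (by fun_prop)).continuousOn
    have h1 : (y.2 : ℝ) ∈ Icc (s (y.1, 0)) (s (y.1, 1)) := by rw [hs0, hs1]; exact y.2.2
    obtain ⟨t, ht, h⟩ := intermediate_value_Icc zero_le_one hc h1
    exact ⟨⟨t, ht⟩, h⟩
  choose τ hτ using hsurj
  have hval : ContMDiff (𝓘(ℝ, P).prod (𝓡∂ 1)) (𝓘(ℝ, P).prod 𝓘(ℝ, ℝ)) ∞
      (fun z : S × Icc (0 : ℝ) 1 => (z.1, (z.2 : ℝ))) :=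
    contMDiff_fst.prodMk (contMDiff_subtypeVal_Icc.comp contMDiff_snd)
  have hvalε : ContMDiff (𝓘(ℝ, P).prod (𝓡∂ 1)) (𝓘(ℝ, P).prod 𝓘(ℝ, ℝ)) ∞
      (fun z : S × Icc (-ε) ε => (z.1, (z.2 : ℝ))) :=
    contMDiff_fst.prodMk (contMDiff_subtypeVal_Icc.comp contMDiff_snd)
  have hA' : ContMDiff (𝓘(ℝ, P).prod (𝓡∂ 1)) 𝓘(ℝ, P) ∞
      (fun z : S × Icc (0 : ℝ) 1 => A (z.1, z.2)) :=
    hA.comp_contMDiff hval fun z => ⟨mem_univ _, z.2.2⟩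
  -- The inverse `τ` of `s (q, ·)` is smooth: it is given by a local inverse of the map
  -- `(q, t) ↦ (q, s (q, t))` of `S × ℝ`, whose second component may leave `[0, 1]`, but not the
  -- interval on which `s (q, ·)` is injective.
  have hτs : ContMDiff (𝓘(ℝ, P).prod (𝓡∂ 1)) 𝓘(ℝ, ℝ) ∞ (fun y : S × Icc (-ε) ε => (τ y : ℝ)) := by
    intro y₀
    let f : S × ℝ → S × ℝ := fun z => (z.1, s z)
    have hf : ContMDiff (𝓘(ℝ, P).prod 𝓘(ℝ, ℝ)) (𝓘(ℝ, P).prod 𝓘(ℝ, ℝ)) ∞ f :=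
      contMDiff_fst.prodMk hs
    obtain ⟨Ds, hDs⟩ : ∃ D : P × ℝ →L[ℝ] ℝ, HasMFDerivAt (𝓘(ℝ, P).prod 𝓘(ℝ, ℝ)) 𝓘(ℝ, ℝ) s
        (y₀.1, (τ y₀ : ℝ)) D := ⟨_, ((hs _).mdifferentiableAt (by simp)).hasMFDerivAt⟩
    have hpos : 0 < Ds (0, 1) := by
      have h1 := hs' y₀.1 (τ y₀) (τ y₀).2
      rw [(hasDerivAt_slice (P := P) ((hs _).mdifferentiableAt (by simp))).deriv] at h1
      exact h1.trans_eq (congrArg (fun A : P × ℝ →L[ℝ] ℝ => A (0, 1)) hDs.mfderiv)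
    have hDf : HasMFDerivAt (𝓘(ℝ, P).prod 𝓘(ℝ, ℝ)) (𝓘(ℝ, P).prod 𝓘(ℝ, ℝ)) f
        (y₀.1, (τ y₀ : ℝ)) ((ContinuousLinearMap.fst ℝ P ℝ).prod Ds) :=
      (hasMFDerivAt_fst _).prodMk hDs
    have hb : Function.Bijective ((ContinuousLinearMap.fst ℝ P ℝ).prod Ds) := by
      have h1 : Function.Injective ((ContinuousLinearMap.fst ℝ P ℝ).prod Ds) := by
        rw [injective_iff_map_eq_zero]
        rintro ⟨w, t⟩ h
        obtain ⟨h2, h3⟩ := Prod.ext_iff.1 h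
        have h2 : w = 0 := h2
        subst h2
        have h3 : Ds (0, t) = 0 := h3
        have h4 : ((0 : P), t) = t • ((0 : P), (1 : ℝ)) := by simp
        rw [h4, map_smul, smul_eq_mul] at h3
        rw [(mul_eq_zero.1 h3).resolve_right hpos.ne']
        rfl
      exact ⟨h1, LinearMap.surjective_of_injective
        (f := ((ContinuousLinearMap.fst ℝ P ℝ).prod Ds).toLinearMap) h1⟩
    obtain ⟨g, hg, hgf⟩ := exists_local_inverse (f := f) (x₀ := (y₀.1, (τ y₀ : ℝ)))
      (Eventually.of_forall hf) (by rw [hDf.mfderiv]; exact hb)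
    have hfy : f (y₀.1, (τ y₀ : ℝ)) = (y₀.1, (y₀.2 : ℝ)) := by simp only [f, hτ]
    rw [hfy] at hg
    have hgy : g (y₀.1, (y₀.2 : ℝ)) = (y₀.1, (τ y₀ : ℝ)) := by
      rw [← hfy]; exact hgf.self_of_nhds
    have hgs : ContMDiffAt (𝓘(ℝ, P).prod (𝓡∂ 1)) 𝓘(ℝ, ℝ) ∞
        (fun y : S × Icc (-ε) ε => (g (y.1, (y.2 : ℝ))).2) y₀ :=
      contMDiffAt_snd.comp y₀ (ContMDiffAt.comp (g := g)
        (f := fun z : S × Icc (-ε) ε => (z.1, (z.2 : ℝ))) y₀ hg.self_of_nhds.1 (hvalε y₀))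
    refine hgs.congr_of_eventuallyEq ?_
    have hIoo : ∀ᶠ y in 𝓝 y₀, (g (y.1, (y.2 : ℝ))).2 ∈ Ioo (-ζ) (1 + ζ) := by
      refine hgs.continuousAt.eventually (isOpen_Ioo.mem_nhds ?_)
      show (g (y₀.1, (y₀.2 : ℝ))).2 ∈ _
      rw [hgy]
      exact hIcc (τ y₀).2
    filter_upwards [(hvalε y₀).continuousAt.eventually hg, hIoo] with y hy hyI
    have h1 : f (g (y.1, (y.2 : ℝ))) = (y.1, (y.2 : ℝ)) := hy.2
    obtain ⟨h2, h3⟩ := Prod.ext_iff.1 h1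
    have h2 : (g (y.1, (y.2 : ℝ))).1 = y.1 := h2
    have h3 : s (g (y.1, (y.2 : ℝ))) = y.2 := h3
    refine (hmono y.1).injOn (hIcc (τ y).2) hyI ?_
    show s (y.1, (τ y : ℝ)) = s (y.1, (g (y.1, (y.2 : ℝ))).2)
    exact (hτ y).trans (h3.symm.trans (congrArg s (Prod.ext h2 rfl)))
  have hτs' : ContMDiff (𝓘(ℝ, P).prod (𝓡∂ 1)) (𝓡∂ 1) ∞ τ := by
    rw [contMDiff_iff_comp_subtypeVal_Icc]
    exact ⟨continuous_induced_rng.2 hτs.continuous, hτs⟩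
  have hinj : ∀ q, ∀ t ∈ Icc (0 : ℝ) 1, ∀ t' ∈ Icc (0 : ℝ) 1, s (q, t) = s (q, t') → t = t' :=
    fun q t ht t' ht' h => (hmono q).injOn (hIcc ht) (hIcc ht') h
  let toF : S × Icc (0 : ℝ) 1 → S × Icc (-ε) ε := fun z =>
    (A (z.1, z.2), ⟨s (A (z.1, z.2), z.2), hmem _ _ z.2.2⟩)
  let invF : S × Icc (-ε) ε → S × Icc (0 : ℝ) 1 := fun y => (B (y.1, τ y), τ y)
  have hleft : Function.LeftInverse invF toF := by
    rintro ⟨p, t⟩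
    have h1 : τ (toF (p, t)) = t := Subtype.ext (hinj (A (p, t)) _ (τ (toF (p, t))).2 _ t.2
      (hτ (toF (p, t))))
    show (B (A (p, t), τ (toF (p, t))), τ (toF (p, t))) = (p, t)
    rw [h1, (hAB p t t.2).2]
  have hright : Function.RightInverse invF toF := by
    rintro ⟨q, y⟩
    have h1 := (hAB q (τ (q, y)) (τ (q, y)).2).1
    refine Prod.ext h1 (Subtype.ext ?_)
    show s (A (B (q, τ (q, y)), τ (q, y)), τ (q, y)) = y
    rw [h1]
    exact hτ (q, y)
  refine ⟨⟨⟨toF, invF, hleft, hright⟩, ?_, ?_⟩, fun p t => ⟨rfl, rfl⟩⟩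
  · refine hA'.prodMk ?_
    rw [contMDiff_iff_comp_subtypeVal_Icc]
    have h1 : ContMDiff (𝓘(ℝ, P).prod (𝓡∂ 1)) 𝓘(ℝ, ℝ) ∞
        (fun z : S × Icc (0 : ℝ) 1 => s (A (z.1, z.2), z.2)) :=
      hs.comp (hA'.prodMk (contMDiff_subtypeVal_Icc.comp contMDiff_snd))
    exact ⟨continuous_induced_rng.2 h1.continuous, h1⟩
  · refine ContMDiff.prodMk ?_ hτs'
    exact hB.comp_contMDiff (f := fun y : S × Icc (-ε) ε => (y.1, (τ y : ℝ)))
      (contMDiff_fst.prodMk hτs) fun y => ⟨mem_univ _, (τ y).2⟩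

end CylinderDiffeo

/-! ### Joining the motions from the two ends -/

section Interpolation

/-- A smooth cutoff function, equal to `1` on `(-∞, κ]` and to `0` on `[2κ, ∞)`. -/
def cutoff (κ t : ℝ) : ℝ := Real.smoothTransition (2 - t / κ)

variable {κ t : ℝ}

lemma contDiff_cutoff : ContDiff ℝ ∞ (cutoff κ) :=
  Real.smoothTransition.contDiff.comp (by fun_prop)

lemma cutoff_eq_one (hκ : 0 < κ) (ht : t ≤ κ) : cutoff κ t = 1 := by
  refine Real.smoothTransition.one_of_one_le ?_
  have : t / κ ≤ 1 := (div_le_one hκ).2 ht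
  linarith

lemma cutoff_eq_zero (hκ : 0 < κ) (ht : 2 * κ ≤ t) : cutoff κ t = 0 := by
  refine Real.smoothTransition.zero_of_nonpos ?_
  have : 2 ≤ t / κ := (le_div_iff₀ hκ).2 ht
  linarith

lemma cutoff_mem (κ t : ℝ) : cutoff κ t ∈ Icc 0 1 :=
  ⟨Real.smoothTransition.nonneg _, Real.smoothTransition.le_one _⟩

lemma hasDerivAt_cutoff : HasDerivAt (cutoff κ) (deriv (cutoff κ) t) t :=
  (contDiff_cutoff.differentiable (by simp) t).hasDerivAt

lemma deriv_cutoff_nonpos (hκ : 0 < κ) : deriv (cutoff κ) t ≤ 0 := by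
  refine Antitone.deriv_nonpos fun x y hxy => Real.smoothTransition.monotone ?_
  have : x / κ ≤ y / κ := div_le_div_of_nonneg_right hxy hκ.le
  linarith

lemma deriv_cutoff_eq_zero (hκ : 0 < κ) (ht : 2 * κ < t) : deriv (cutoff κ) t = 0 := by
  have : cutoff κ =ᶠ[𝓝 t] fun _ => 0 := by
    filter_upwards [lt_mem_nhds ht] with x hx using cutoff_eq_zero hκ hx.le
  rw [this.deriv_eq]
  simp

variable {P : Type*} [NormedAddCommGroup P] [NormedSpace ℝ P]
  {S : Type*} [TopologicalSpace S] [CompactSpace S] [ChartedSpace P S] [IsManifold 𝓘(ℝ, P) ∞ S]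
  [FiniteDimensional ℝ P] {ε : ℝ} [hε : Fact (-ε < ε)]

/-- A diffeomorphism of `S × [0, 1]` with the cylinder that follows given motions from each end of
the cylinder: the motion over `S` is stopped before the middle, and the heights are interpolated. -/
lemma exists_interpolating_diffeo {η : ℝ} (hη : 0 < η) {A₀ B₀ A₁ B₁ : S × ℝ → S}
    {ρ₀ ρ₁ : S × ℝ → ℝ} (h₀ : IsGraphMotion P η (ε / 2) A₀ B₀ ρ₀)
    (h₁ : IsGraphMotion P η (ε / 2) A₁ B₁ ρ₁) :
    ∃ (Φ : (S × Icc (0 : ℝ) 1) ≃ₘ^∞⟮𝓘(ℝ, P).prod (𝓡∂ 1), 𝓘(ℝ, P).prod (𝓡∂ 1)⟯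
        (S × Icc (-ε) ε)), ∃ κ > 0, κ < η ∧ 4 * κ < 1 ∧ ∀ (p : S) (t : Icc (0 : ℝ) 1),
      ((t : ℝ) ≤ κ → Φ (p, t) = (A₀ (p, t), collarParam ε 1 (ρ₀ (A₀ (p, t), t)))) ∧
      (1 - κ ≤ (t : ℝ) → Φ (p, t)
        = (A₁ (p, 1 - t), collarParam ε (-1) (ρ₁ (A₁ (p, 1 - t), 1 - t)))) := by
  have hε' := eps_pos_of_fact hε
  -- The motions are defined up to `2 * κ`, and the cutoffs at the two ends have disjoint supports.
  set κ := min η 1 / 8 with hκ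
  have hκpos : 0 < κ := by have := lt_min hη one_pos; positivity
  have hκη : 2 * κ < η := by
    have := min_le_left η 1
    have := lt_min hη one_pos
    rw [hκ]; linarith
  have hκ1 : 4 * κ < 1 := by have := min_le_right η 1; rw [hκ]; linarith
  let χ := cutoff κ
  -- The time change `β` is the identity up to `κ`; from `2 * κ` on it is `0`, where the motions
  -- over `S` are the identity.
  let β : ℝ → ℝ := fun t => t * χ t
  have hβs : ContDiff ℝ ∞ β := contDiff_id.mul contDiff_cutoff
  have hβ : ∀ {t}, t ∈ Icc (0 : ℝ) 1 → β t ∈ Ico 0 η := by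
    intro t ht
    have h1 := cutoff_mem κ t
    refine ⟨mul_nonneg ht.1 h1.1, ?_⟩
    rcases le_or_gt (2 * κ) t with h | h
    · have h2 : β t = 0 := by simp only [β, χ, cutoff_eq_zero hκpos h, mul_zero]
      rw [h2]; exact hη
    · exact (mul_le_of_le_one_right ht.1 h1.2).trans_lt (h.trans hκη)
  have hsymm : ∀ {t : ℝ}, t ∈ Icc (0 : ℝ) 1 → 1 - t ∈ Icc (0 : ℝ) 1 := fun ht =>
    ⟨by linarith [ht.2], by linarith [ht.1]⟩
  have hβ0 : ∀ {t}, 2 * κ ≤ t → β t = 0 := fun h => by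
    simp only [β, χ, cutoff_eq_zero hκpos h, mul_zero]
  have hβ1 : ∀ {t}, t ≤ κ → β t = t := fun h => by
    simp only [β, χ, cutoff_eq_one hκpos h, mul_one]
  have hsβ : ContMDiff (𝓘(ℝ, P).prod 𝓘(ℝ, ℝ)) 𝓘(ℝ, ℝ) ∞ (fun z : S × ℝ => β z.2) :=
    hβs.contMDiff.comp contMDiff_snd
  have hsβ' : ContMDiff (𝓘(ℝ, P).prod 𝓘(ℝ, ℝ)) 𝓘(ℝ, ℝ) ∞ (fun z : S × ℝ => β (1 - z.2)) :=
    (hβs.comp (contDiff_const.sub contDiff_id)).contMDiff.comp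
      (f := Prod.snd) (g := fun t : ℝ => β (1 - t)) contMDiff_snd
  let A : S × ℝ → S := fun z => A₁ (A₀ (z.1, β z.2), β (1 - z.2))
  let B : S × ℝ → S := fun z => B₀ (B₁ (z.1, β (1 - z.2)), β z.2)
  have hA : ContMDiffOn (𝓘(ℝ, P).prod 𝓘(ℝ, ℝ)) 𝓘(ℝ, P) ∞ A (univ ×ˢ Icc 0 1) := by
    refine h₁.contMDiffOn_fst.comp (f := fun z : S × ℝ => (A₀ (z.1, β z.2), β (1 - z.2)))
      (ContMDiffOn.prodMk ?_ hsβ'.contMDiffOn) fun z hz => ⟨mem_univ _, hβ (hsymm hz.2)⟩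
    exact h₀.contMDiffOn_fst.comp (f := fun z : S × ℝ => (z.1, β z.2))
      (contMDiff_fst.prodMk hsβ).contMDiffOn fun z hz => ⟨mem_univ _, hβ hz.2⟩
  have hB : ContMDiffOn (𝓘(ℝ, P).prod 𝓘(ℝ, ℝ)) 𝓘(ℝ, P) ∞ B (univ ×ˢ Icc 0 1) := by
    refine h₀.contMDiffOn_inv.comp (f := fun z : S × ℝ => (B₁ (z.1, β (1 - z.2)), β z.2))
      (ContMDiffOn.prodMk ?_ hsβ.contMDiffOn) fun z hz => ⟨mem_univ _, hβ hz.2⟩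
    exact h₁.contMDiffOn_inv.comp (f := fun z : S × ℝ => (z.1, β (1 - z.2)))
      (contMDiff_fst.prodMk hsβ').contMDiffOn fun z hz => ⟨mem_univ _, hβ (hsymm hz.2)⟩
  have hAB : ∀ p, ∀ t ∈ Icc (0 : ℝ) 1, A (B (p, t), t) = p ∧ B (A (p, t), t) = p := by
    intro p t ht
    simp only [A, B]
    rw [h₀.right_inv _ _ (hβ ht), h₁.right_inv _ _ (hβ (hsymm ht)),
      h₁.left_inv _ _ (hβ (hsymm ht)), h₀.left_inv _ _ (hβ ht)]
    exact ⟨rfl, rfl⟩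
  -- The heights of the two motions, with values in the lower and in the upper quarter of the
  -- cylinder, are interpolated with a linear function between them, which keeps `s` increasing.
  let s : S × ℝ → ℝ := fun z => χ z.2 * (-ε + ρ₀ z) + χ (1 - z.2) * (ε - ρ₁ (z.1, 1 - z.2))
    + (1 - χ z.2 - χ (1 - z.2)) * (ε * (z.2 - 1 / 2))
  have hs : ContMDiff (𝓘(ℝ, P).prod 𝓘(ℝ, ℝ)) 𝓘(ℝ, ℝ) ∞ s := by
    have e1 : ContMDiff (𝓘(ℝ, P).prod 𝓘(ℝ, ℝ)) 𝓘(ℝ, ℝ) ∞ (fun z : S × ℝ => χ z.2) :=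
      contDiff_cutoff.contMDiff.comp contMDiff_snd
    have e2 : ContMDiff (𝓘(ℝ, P).prod 𝓘(ℝ, ℝ)) 𝓘(ℝ, ℝ) ∞ (fun z : S × ℝ => 1 - z.2) :=
      contMDiff_const.sub contMDiff_snd
    have e3 : ContMDiff (𝓘(ℝ, P).prod 𝓘(ℝ, ℝ)) 𝓘(ℝ, ℝ) ∞ (fun z : S × ℝ => χ (1 - z.2)) :=
      contDiff_cutoff.contMDiff.comp e2
    have e4 : ContMDiff (𝓘(ℝ, P).prod 𝓘(ℝ, ℝ)) 𝓘(ℝ, ℝ) ∞ (fun z : S × ℝ => ρ₁ (z.1, 1 - z.2)) :=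
      h₁.contMDiff_height.comp (contMDiff_fst.prodMk e2)
    have e5 : ContMDiff (𝓘(ℝ, P).prod 𝓘(ℝ, ℝ)) 𝓘(ℝ, ℝ) ∞
        (fun z : S × ℝ => ε * (z.2 - 1 / 2)) :=
      contMDiff_const.mul (contMDiff_snd.sub contMDiff_const)
    exact ((e1.mul (contMDiff_const.add h₀.contMDiff_height)).add
      (e3.mul (contMDiff_const.sub e4))).add (((contMDiff_const.sub e1).sub e3).mul e5)
  have hs0 : ∀ q t, t ≤ κ → s (q, t) = -ε + ρ₀ (q, t) := by
    intro q t ht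
    simp only [s, χ, cutoff_eq_one hκpos ht, cutoff_eq_zero hκpos (by linarith : 2 * κ ≤ 1 - t)]
    ring
  have hs1 : ∀ q t, 1 - κ ≤ t → s (q, t) = ε - ρ₁ (q, 1 - t) := by
    intro q t ht
    simp only [s, χ, cutoff_eq_one hκpos (by linarith : 1 - t ≤ κ),
      cutoff_eq_zero hκpos (by linarith : 2 * κ ≤ t)]
    ring
  have hs' : ∀ q, ∀ t ∈ Icc (0 : ℝ) 1, 0 < deriv (fun t => s (q, t)) t := by
    intro q t ht
    have d0 : HasDerivAt (fun t => ρ₀ (q, t)) (deriv (fun t => ρ₀ (q, t)) t) t :=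
      (hasDerivAt_slice (P := P)
        ((h₀.contMDiff_height _).mdifferentiableAt (by simp))).differentiableAt.hasDerivAt
    have d1 : HasDerivAt (fun t => ρ₁ (q, t)) (deriv (fun t => ρ₁ (q, t)) (1 - t)) (1 - t) :=
      (hasDerivAt_slice (P := P)
        ((h₁.contMDiff_height _).mdifferentiableAt (by simp))).differentiableAt.hasDerivAt
    have dsub : HasDerivAt (fun t : ℝ => 1 - t) (-1) t := by
      simpa using (hasDerivAt_id t).const_sub 1
    have c0 : HasDerivAt χ (deriv χ t) t := hasDerivAt_cutoff
    have c1 : HasDerivAt (fun t => χ (1 - t)) (deriv χ (1 - t) * -1) t :=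
      HasDerivAt.comp (h₂ := χ) t hasDerivAt_cutoff dsub
    have d1' : HasDerivAt (fun t => ρ₁ (q, 1 - t)) (deriv (fun t => ρ₁ (q, t)) (1 - t) * -1) t :=
      HasDerivAt.comp (h₂ := fun t => ρ₁ (q, t)) t d1 dsub
    have dl : HasDerivAt (fun t : ℝ => ε * (t - 1 / 2)) (ε * 1) t :=
      ((hasDerivAt_id t).sub_const _).const_mul ε
    have hd := ((c0.mul (d0.const_add (-ε))).add (c1.mul (d1'.const_sub ε))).add
      (((c0.const_sub 1).sub c1).mul dl)
    have hd' : HasDerivAt (fun t => s (q, t)) _ t := hd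
    rw [hd'.deriv]
    simp only [Pi.sub_apply]
    have hχ := cutoff_mem κ t
    have hχ' := cutoff_mem κ (1 - t)
    -- Where two heights are interpolated, the cutoff decreases from the lower to the upper one.
    rcases le_or_gt t (2 * κ) with h | h
    · have h1 : χ (1 - t) = 0 := cutoff_eq_zero hκpos (by linarith)
      have h2 : deriv χ (1 - t) = 0 := deriv_cutoff_eq_zero hκpos (by linarith)
      have h3 : deriv χ t ≤ 0 := deriv_cutoff_nonpos hκpos
      have h4 := h₀.height_mem q t ⟨ht.1, by linarith⟩
      have h5 := h₀.deriv_pos q t ⟨ht.1, by linarith⟩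
      have h6 : 0 ≤ deriv χ t * (-ε + ρ₀ (q, t) - ε * (t - 1 / 2)) :=
        mul_nonneg_of_nonpos_of_nonpos h3 (by nlinarith [h4.2, ht.1])
      have h7 : 0 < χ t * deriv (fun t => ρ₀ (q, t)) t + (1 - χ t) * ε := by
        rcases hχ.1.eq_or_lt with h8 | h8
        · have h8 : χ t = 0 := h8.symm
          rw [h8]; linarith
        · exact add_pos_of_pos_of_nonneg (mul_pos h8 h5)
            (mul_nonneg (by linarith [hχ.2]) hε'.le)
      rw [h1, h2]
      linarith
    rcases le_or_gt (1 - 2 * κ) t with h' | h'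
    · have h1 : χ t = 0 := cutoff_eq_zero hκpos h.le
      have h2 : deriv χ t = 0 := deriv_cutoff_eq_zero hκpos h
      have h3 : deriv χ (1 - t) ≤ 0 := deriv_cutoff_nonpos hκpos
      have ht' : 1 - t ∈ Ico 0 η := ⟨by linarith [ht.2], by linarith⟩
      have h4 := h₁.height_mem q (1 - t) ht'
      have h5 := h₁.deriv_pos q (1 - t) ht'
      have h6 : 0 ≤ -deriv χ (1 - t) * (ε - ρ₁ (q, 1 - t) - ε * (t - 1 / 2)) :=
        mul_nonneg (by linarith) (by nlinarith [h4.2, ht.2])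
      have h7 : 0 < χ (1 - t) * deriv (fun t => ρ₁ (q, t)) (1 - t) + (1 - χ (1 - t)) * ε := by
        rcases hχ'.1.eq_or_lt with h8 | h8
        · have h8 : χ (1 - t) = 0 := h8.symm
          rw [h8]; linarith
        · exact add_pos_of_pos_of_nonneg (mul_pos h8 h5)
            (mul_nonneg (by linarith [hχ'.2]) hε'.le)
      rw [h1, h2]
      linarith
    · have h1 : χ t = 0 := cutoff_eq_zero hκpos h.le
      have h2 : deriv χ t = 0 := deriv_cutoff_eq_zero hκpos h
      have h3 : χ (1 - t) = 0 := cutoff_eq_zero hκpos (by linarith)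
      have h4 : deriv χ (1 - t) = 0 := deriv_cutoff_eq_zero hκpos (by linarith)
      rw [h1, h2, h3, h4]
      linarith
  obtain ⟨Φ, hΦ⟩ := exists_cylinder_diffeo (ε := ε) hA hB hAB hs
    (fun q => by rw [hs0 q 0 hκpos.le, h₀.height_zero, add_zero])
    (fun q => by rw [hs1 q 1 (by linarith), sub_self, h₁.height_zero, sub_zero]) hs'
  refine ⟨Φ, κ, hκpos, by linarith, hκ1, fun p t => ⟨fun ht => ?_, fun ht => ?_⟩⟩
  · have hA0 : A (p, t) = A₀ (p, t) := by
      simp only [A]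
      rw [hβ1 ht, hβ0 (by linarith), h₁.fst_zero]
    obtain ⟨h1, h2⟩ := hΦ p t
    rw [hA0] at h1 h2
    have hρ := h₀.height_mem (A₀ (p, t)) t ⟨t.2.1, by linarith⟩
    refine Prod.ext h1 (Subtype.ext ?_)
    rw [h2, hs0 _ _ ht, coe_collarParam (Or.inl rfl) ⟨hρ.1, by linarith [hρ.2]⟩]
    ring
  · have hA1 : A (p, t) = A₁ (p, 1 - t) := by
      simp only [A]
      rw [hβ1 (by linarith : 1 - (t : ℝ) ≤ κ), hβ0 (by linarith : 2 * κ ≤ (t : ℝ)), h₀.fst_zero]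
    obtain ⟨h1, h2⟩ := hΦ p t
    rw [hA1] at h1 h2
    have hρ := h₁.height_mem (A₁ (p, 1 - t)) (1 - t) ⟨by linarith [t.2.2], by linarith⟩
    refine Prod.ext h1 (Subtype.ext ?_)
    rw [h2, hs1 _ _ ht, coe_collarParam (Or.inr rfl) ⟨hρ.1, by linarith [hρ.2]⟩]
    ring

end Interpolation

/-! ### The null hypersurfaces at the ends of the collar -/

section Ends

variable {d : ℕ} {M : Type*} [TopologicalSpace M] [ChartedSpace (EuclideanSpace ℝ (Fin (d + 1))) M]
  [IsManifold (𝓡 (d + 1)) ∞ M] [T2Space M]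
  {S : Type*} [TopologicalSpace S] [CompactSpace S] [ChartedSpace (EuclideanSpace ℝ (Fin d)) S]
  [IsManifold (𝓡 d) ∞ S] {ε : ℝ} [hε : Fact (-ε < ε)] {c : S × Icc (-ε) ε → M} {σ : ℝ}

/-- The null hypersurface emanating from an end of the cylinder, with initial velocity pointing into
the cylinder; near that end it consists of graphs over `S`. -/
lemma exists_null_end (hc : IsSmoothEmbedding ((𝓡 d).prod (𝓡∂ 1)) (𝓡 (d + 1)) ∞ c)
    (hσ : σ = 1 ∨ σ = -1)
    {k : ℝ → ∀ x : M, TangentSpace (𝓡 (d + 1)) x →L[ℝ] TangentSpace (𝓡 (d + 1)) x →L[ℝ] ℝ}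
    (hk : ContMDiff ((𝓡 (d + 1)).prod 𝓘(ℝ, ℝ)) ((𝓡 (d + 1)).prod
      𝓘(ℝ, EuclideanSpace ℝ (Fin (d + 1)) →L[ℝ] EuclideanSpace ℝ (Fin (d + 1)) →L[ℝ] ℝ)) ∞
      (formSection k))
    (hsymm : ∀ (t : ℝ) (x : M) (v w : TangentSpace (𝓡 (d + 1)) x), k t x v w = k t x w v)
    (hpos : ∀ (x : M) (v : TangentSpace (𝓡 (d + 1)) x), v ≠ 0 → 0 < k 0 x v v)
    {s : Icc (-ε) ε} (hs : s = collarParam ε σ 0)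
    {V : ∀ p : S, TangentSpace (𝓡 (d + 1)) (c (p, s))}
    (hV : ∀ p, IsPositiveUnitNormal (k 0) c p s (V p)) :
    ∃ (X : S × ℝ → M) (η : ℝ) (A B : S × ℝ → S) (ρ : S × ℝ → ℝ), 0 < η ∧
      (∀ p t, |t| < η → IsNullGermAt (EuclideanSpace ℝ (Fin d)) k X (p, t)) ∧
      (∀ p, (mfderiv ((𝓡 d).prod 𝓘(ℝ, ℝ)) (𝓡 (d + 1)) X (p, 0)
        ((0 : EuclideanSpace ℝ (Fin d)), (1 : ℝ)) : EuclideanSpace ℝ (Fin (d + 1)))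
          = σ • (V p : EuclideanSpace ℝ (Fin (d + 1)))) ∧
      IsGraphMotion (EuclideanSpace ℝ (Fin d)) η (ε / 2) A B ρ ∧
      ∀ p, ∀ t ∈ Ico 0 η, X (p, t) = collarMap c σ (A (p, t), ρ (A (p, t), t)) := by
  have hε' := eps_pos_of_fact hε
  have hT2 : T2Space S := by
    have hcont : Continuous fun p : S => c (p, s) := hc.contMDiff.continuous.comp (by fun_prop)
    exact T2Space.of_injective_continuous (f := fun p : S => c (p, s))
      (fun p p' h => (Prod.ext_iff.1 (hc.isEmbedding.injective h)).1) hcont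
  let V' : S → EuclideanSpace ℝ (Fin (d + 1)) := fun p => σ • (V p : EuclideanSpace ℝ (Fin (d + 1)))
  have hC : ∀ p₀, ∃ C, IsCollarExtension (P := EuclideanSpace ℝ (Fin d))
      (E := EuclideanSpace ℝ (Fin (d + 1))) (collarMap c σ) C p₀ ∧
      ∀ᶠ p in 𝓝 p₀, IsCollarNormal (P := EuclideanSpace ℝ (Fin d)) k C V' p := by
    intro p₀
    obtain ⟨C, hC⟩ := exists_isCollarExtension hc hσ p₀
    refine ⟨C, hC, ?_⟩
    have hsl : Tendsto (fun p : S => (p, (0 : ℝ))) (𝓝 p₀) (𝓝 (p₀, 0)) :=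
      Continuous.tendsto (by fun_prop) p₀
    filter_upwards [hsl.eventually hC.smooth, hsl.eventually hC.eq.eventually_nhds] with p h1 h2
    exact isCollarNormal_of_isPositiveUnitNormal hc hσ hs (hV p) rfl h1 h2
  obtain ⟨η₁, hη₁, X, hX, hX0⟩ := exists_nullGerm hk hsymm hpos hC
  obtain ⟨η₂, hη₂, A, B, ρ, hAB, hXA⟩ := exists_splitting (P := EuclideanSpace ℝ (Fin d))
    (E := EuclideanSpace ℝ (Fin (d + 1))) (X := X) (c₀ := collarMap c σ)
    (show 0 < ε / 2 by linarith)
    ((injOn_collarMap hc hσ).mono (prod_mono_right (Icc_subset_Icc_right (by linarith))))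
    (fun p₀ => by
      obtain ⟨C, hC, hCV⟩ := hC p₀
      obtain ⟨⟨ξ, hξ, hξV⟩, -⟩ := hCV.self_of_nhds
      exact ⟨C, ξ, hC, hξ, hξV.trans (hX0 p₀).2.symm⟩)
    (fun p => (hX p 0 (by simpa using hη₁)).mono fun z hz => hz.1) (fun p => (hX0 p).1)
  refine ⟨X, min η₁ η₂, A, B, ρ, lt_min hη₁ hη₂,
    fun p t ht => hX p t (ht.trans_le (min_le_left _ _)), fun p => (hX0 p).2,
    hAB.mono (min_le_right _ _), fun p t ht => hXA p t ⟨ht.1, ht.2.trans_le (min_le_right _ _)⟩⟩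

end Ends

/-! ### Pullback of constant forms -/

section Pullback

universe u

variable {E : Type u} {F : Type*} [NormedAddCommGroup E] [NormedSpace ℝ E]
  [NormedAddCommGroup F] [NormedSpace ℝ F]
  {M : Type*} [TopologicalSpace M] [ChartedSpace E M]

/-- The pullback of a constant bilinear form by a map to a vector space, as a constant family of
bilinear forms. -/
def pullbackForm (B : F →L[ℝ] F →L[ℝ] ℝ) (ψ : M → F) (_t : ℝ) (x : M) :
    TangentSpace 𝓘(ℝ, E) x →L[ℝ] TangentSpace 𝓘(ℝ, E) x →L[ℝ] ℝ :=
  let L : E →L[ℝ] F := mfderiv 𝓘(ℝ, E) 𝓘(ℝ, F) ψ x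
  ((ContinuousLinearMap.compL ℝ E F ℝ).flip L).comp (B.comp L)

lemma pullbackForm_apply (B : F →L[ℝ] F →L[ℝ] ℝ) (ψ : M → F) (t : ℝ) (x : M)
    (v w : TangentSpace 𝓘(ℝ, E) x) : pullbackForm B ψ t x v w
      = B (mfderiv 𝓘(ℝ, E) 𝓘(ℝ, F) ψ x v) (mfderiv 𝓘(ℝ, E) 𝓘(ℝ, F) ψ x w) := rfl

variable [IsManifold 𝓘(ℝ, E) ∞ M]

/-- In a chart, `pullbackForm` is expressed by the Fréchet derivative. -/
lemma contMDiffAt_pullbackForm (B : F →L[ℝ] F →L[ℝ] ℝ) {ψ : M → F} {x₀ : M}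
    (hψ : ∀ᶠ x in 𝓝 x₀, ContMDiffAt 𝓘(ℝ, E) 𝓘(ℝ, F) ∞ ψ x) (t : ℝ) :
    ContMDiffAt (𝓘(ℝ, E).prod 𝓘(ℝ, ℝ)) (𝓘(ℝ, E).prod 𝓘(ℝ, E →L[ℝ] E →L[ℝ] ℝ)) ∞
      (formSection (pullbackForm (E := E) B ψ)) (x₀, t) := by
  set φ := extChartAt 𝓘(ℝ, E) x₀ with hφ
  rw [contMDiffAt_formSection_iff (mem_chart_source E x₀)]
  have hsymm : ∀ y ∈ φ.target, ContMDiffAt 𝓘(ℝ, E) 𝓘(ℝ, E) ∞ φ.symm y := fun y hy =>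
    (contMDiffOn_extChartAt_symm x₀).contMDiffAt
      ((isOpen_extChartAt_target (I := 𝓘(ℝ, E)) x₀).mem_nhds hy)
  have hl : φ.symm (φ x₀) = x₀ := φ.left_inv (mem_extChartAt_source x₀)
  have hsm : ContDiffAt ℝ ∞ (fun y => ψ (φ.symm y)) (φ x₀) := by
    rw [← contMDiffAt_iff_contDiffAt]
    refine ContMDiffAt.comp (g := ψ) (f := φ.symm) (φ x₀) ?_
      (hsymm _ (mem_extChartAt_target x₀))
    rw [hl]
    exact hψ.self_of_nhds
  have hL : ContDiffAt ℝ ∞ (fun y : E × ℝ => fderiv ℝ (fun y => ψ (φ.symm y)) y.1) (φ x₀, t) :=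
    ContDiffAt.comp (φ x₀, t) (g := fderiv ℝ fun y => ψ (φ.symm y)) (f := Prod.fst)
      (hsm.fderiv_right (by simp)) contDiffAt_fst
  have hG : ContDiffAt ℝ ∞ (fun y : E × ℝ => ((ContinuousLinearMap.compL ℝ E F ℝ).flip
      (fderiv ℝ (fun y => ψ (φ.symm y)) y.1)).comp
      (B.comp (fderiv ℝ (fun y => ψ (φ.symm y)) y.1))) (φ x₀, t) :=
    (((ContinuousLinearMap.compL ℝ E F ℝ).flip.contDiff.contDiffAt.comp (φ x₀, t) hL)).clm_comp
      (contDiffAt_const.clm_comp hL)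
  refine hG.congr_of_eventuallyEq ?_
  have h1 : Tendsto (fun y : E × ℝ => φ.symm y.1) (𝓝 (φ x₀, t)) (𝓝 x₀) := by
    have := (hsymm _ (mem_extChartAt_target x₀)).continuousAt.tendsto.comp
      (continuous_fst.tendsto (φ x₀, t))
    rwa [hl] at this
  filter_upwards [eventually_mem_prod_target (P := E) x₀ t, h1.eventually hψ] with y hy hψy
  ext v w
  rw [coordForm_apply hy]
  have h2 : HasFDerivAt (fun y => ψ (φ.symm y)) ((mfderiv 𝓘(ℝ, E) 𝓘(ℝ, F) ψ (φ.symm y.1) :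
      E →L[ℝ] F).comp (mfderiv 𝓘(ℝ, E) 𝓘(ℝ, E) φ.symm y.1 : E →L[ℝ] E)) y.1 :=
    (HasMFDerivAt.comp (g := ψ) (f := φ.symm) y.1 (hψy.mdifferentiableAt (by simp)).hasMFDerivAt
      ((hsymm _ hy).mdifferentiableAt (by simp)).hasMFDerivAt).hasFDerivAt
  have key : ∀ (f : E → F) (L : E →L[ℝ] F) (y : E), HasFDerivAt f L y → fderiv ℝ f y = L :=
    fun f L y h => h.fderiv
  exact (congrArg (fun L : E →L[ℝ] F => B (L v) (L w)) (key _ _ _ h2)).symm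

end Pullback

/-! ### Local metrics satisfying the eikonal condition -/

section MetricGluing

universe u

variable {P : Type*} {E : Type u} [NormedAddCommGroup P] [InnerProductSpace ℝ P]
  [FiniteDimensional ℝ P] [NormedAddCommGroup E] [InnerProductSpace ℝ E] [FiniteDimensional ℝ E]
  {S M : Type*} [TopologicalSpace S] [CompactSpace S] [ChartedSpace P S] [IsManifold 𝓘(ℝ, P) ∞ S]
  [TopologicalSpace M] [T2Space M] [ChartedSpace E M] [IsManifold 𝓘(ℝ, E) ∞ M]

variable (P) in
/-- The inner product of the flat cylinder `P × ℝ`. -/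
def cylinderForm : (P × ℝ) →L[ℝ] (P × ℝ) →L[ℝ] ℝ :=
  (innerSL ℝ).bilinearComp (ContinuousLinearMap.fst ℝ P ℝ) (ContinuousLinearMap.fst ℝ P ℝ)
    + (innerSL ℝ).bilinearComp (ContinuousLinearMap.snd ℝ P ℝ) (ContinuousLinearMap.snd ℝ P ℝ)

omit [FiniteDimensional ℝ P] in
lemma cylinderForm_apply (v w : P × ℝ) :
    cylinderForm P v w = inner ℝ v.1 w.1 + w.2 * v.2 := by
  simp [cylinderForm]

omit [FiniteDimensional ℝ P] in
lemma cylinderForm_pos {v : P × ℝ} (hv : v ≠ 0) : 0 < cylinderForm P v v := by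
  rw [cylinderForm_apply, real_inner_self_eq_norm_sq]
  by_contra! h
  have h1 : ‖v.1‖ = 0 := by nlinarith [sq_nonneg ‖v.1‖, mul_self_nonneg v.2]
  have h2 : v.2 = 0 := by nlinarith [sq_nonneg ‖v.1‖, mul_self_nonneg v.2]
  exact hv (Prod.ext (norm_eq_zero.1 h1) h2)

omit [CompactSpace S] [T2Space M] in
/-- Near a point of a local diffeomorphism `Y : S × ℝ → M`, the metric on `M` that makes `Y` an
isometry from a flat cylinder satisfies the eikonal condition. -/
lemma exists_local_eikonal_metric {Y : S × ℝ → M} {z₀ : S × ℝ}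
    (hY : ∀ᶠ z in 𝓝 z₀, ContMDiffAt (𝓘(ℝ, P).prod 𝓘(ℝ, ℝ)) 𝓘(ℝ, E) ∞ Y z)
    (hb : Function.Bijective (mfderiv (𝓘(ℝ, P).prod 𝓘(ℝ, ℝ)) 𝓘(ℝ, E) Y z₀)) :
    ∃ (k : ℝ → ∀ x : M, TangentSpace 𝓘(ℝ, E) x →L[ℝ] TangentSpace 𝓘(ℝ, E) x →L[ℝ] ℝ)
      (g : M → S × ℝ), (∀ᶠ x in 𝓝 (Y z₀), ∀ t, ContMDiffAt (𝓘(ℝ, E).prod 𝓘(ℝ, ℝ))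
        (𝓘(ℝ, E).prod 𝓘(ℝ, E →L[ℝ] E →L[ℝ] ℝ)) ∞ (formSection k) (x, t)) ∧
      (∀ t x (v w : TangentSpace 𝓘(ℝ, E) x), k t x v w = k t x w v) ∧
      (∀ t, ∀ v : TangentSpace 𝓘(ℝ, E) (Y z₀), v ≠ 0 → 0 < k t (Y z₀) v v) ∧
      (∀ᶠ x in 𝓝 (Y z₀), Y (g x) = x) ∧ Tendsto g (𝓝 (Y z₀)) (𝓝 z₀) ∧
      ∀ᶠ z in 𝓝 z₀, EikonalAt (P := P) k Y z := by
  obtain ⟨g, hg, hgY⟩ := exists_local_inverse hY hb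
  set φ := extChartAt 𝓘(ℝ, P) z₀.1 with hφ
  have hg0 : g (Y z₀) = z₀ := hgY.self_of_nhds
  have hgt : Tendsto g (𝓝 (Y z₀)) (𝓝 z₀) := by
    conv => enter [3]; rw [← hg0]
    exact hg.self_of_nhds.1.continuousAt
  have hYc : Tendsto Y (𝓝 z₀) (𝓝 (Y z₀)) := hY.self_of_nhds.continuousAt
  have hsrc : ∀ᶠ z in 𝓝 z₀, z.1 ∈ (chartAt P z₀.1).source :=
    eventually_mem_prod_source (P := P) z₀.1 z₀.2
  -- The metric is pulled back from `P × ℝ` by `ψ`, the inverse of `Y` followed by a chart of `S`.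
  let χ : S × ℝ → P × ℝ := fun z => (φ z.1, z.2)
  let ψ : M → P × ℝ := fun x => χ (g x)
  have hχ : ∀ z : S × ℝ, z.1 ∈ (chartAt P z₀.1).source →
      ContMDiffAt (𝓘(ℝ, P).prod 𝓘(ℝ, ℝ)) 𝓘(ℝ, P × ℝ) ∞ χ z := by
    intro z hz
    rw [modelWithCornersSelf_prod, ← chartedSpaceSelf_prod]
    exact contMDiffAt_prod_chart hz
  have hψ : ∀ᶠ x in 𝓝 (Y z₀), ContMDiffAt 𝓘(ℝ, E) 𝓘(ℝ, P × ℝ) ∞ ψ x := by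
    filter_upwards [hg, hgt.eventually hsrc] with x h1 h2
    exact (hχ _ h2).comp x h1.1
  have hsymmB : ∀ v w, cylinderForm P v w = cylinderForm P w v := fun v w => by
    rw [cylinderForm_apply, cylinderForm_apply, real_inner_comm, mul_comm]
  -- the differential of `ψ ∘ Y`
  have hψY : ∀ᶠ z in 𝓝 z₀, ∀ ζ : P × ℝ,
      (mfderiv 𝓘(ℝ, E) 𝓘(ℝ, P × ℝ) ψ (Y z)
        (mfderiv (𝓘(ℝ, P).prod 𝓘(ℝ, ℝ)) 𝓘(ℝ, E) Y z ζ) : P × ℝ)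
      = ((mfderiv 𝓘(ℝ, P) 𝓘(ℝ, P) φ z.1 ζ.1 : P), ζ.2) := by
    have : IsManifold 𝓘(ℝ, P) 1 S := IsManifold.of_le (n := ∞) (by simp)
    filter_upwards [hYc.eventually hψ, hY, hgY.eventually_nhds, hsrc] with z h1 h2 h3 h4 ζ
    have e1 : HasMFDerivAt (𝓘(ℝ, P).prod 𝓘(ℝ, ℝ)) 𝓘(ℝ, P × ℝ) χ z
        (((mfderiv 𝓘(ℝ, P) 𝓘(ℝ, P) φ z.1).comp (ContinuousLinearMap.fst ℝ P ℝ)).prod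
          (ContinuousLinearMap.snd ℝ P ℝ)) := by
      rw [modelWithCornersSelf_prod, ← chartedSpaceSelf_prod]
      exact HasMFDerivAt.prodMk (HasMFDerivAt.comp z (g := φ) (f := Prod.fst)
        (mdifferentiableAt_extChartAt h4).hasMFDerivAt (hasMFDerivAt_fst _)) (hasMFDerivAt_snd _)
    have e2 : HasMFDerivAt (𝓘(ℝ, P).prod 𝓘(ℝ, ℝ)) 𝓘(ℝ, P × ℝ) χ z
        ((mfderiv 𝓘(ℝ, E) 𝓘(ℝ, P × ℝ) ψ (Y z)).comp
          (mfderiv (𝓘(ℝ, P).prod 𝓘(ℝ, ℝ)) 𝓘(ℝ, E) Y z)) :=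
      (HasMFDerivAt.comp z (g := ψ) (f := Y) (h1.mdifferentiableAt (by simp)).hasMFDerivAt
        (h2.mdifferentiableAt (by simp)).hasMFDerivAt).congr_of_eventuallyEq
        (h3.mono fun z' hz' => by simp only [Function.comp_apply, ψ, hz'])
    exact congrArg (fun A : P × ℝ →L[ℝ] P × ℝ => A ζ) (hasMFDerivAt_unique e2 e1)
  refine ⟨pullbackForm (cylinderForm P) ψ, g, ?_, fun t x v w => hsymmB _ _, fun t v hv => ?_,
    hg.mono fun x hx => hx.2, hgt, ?_⟩
  · exact hψ.eventually_nhds.mono fun x hx t => contMDiffAt_pullbackForm _ hx t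
  · obtain ⟨ζ, rfl⟩ := hb.2 v
    refine cylinderForm_pos fun h => hv ?_
    have h1 := (hψY.self_of_nhds ζ).symm.trans h
    obtain ⟨h2, h3⟩ := Prod.ext_iff.1 h1
    have h4 : ζ.1 = 0 := (bijective_mfderiv_extChartAt (E := P) (mem_chart_source P z₀.1)).1
      (h2.trans (map_zero (mfderiv 𝓘(ℝ, P) 𝓘(ℝ, P) φ z₀.1)).symm)
    have h5 : ζ = 0 := Prod.ext h4 h3
    rw [h5]
    exact map_zero (mfderiv (𝓘(ℝ, P).prod 𝓘(ℝ, ℝ)) 𝓘(ℝ, E) Y z₀)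
  · filter_upwards [hψY] with z hz ζ
    refine (pullbackForm_apply _ _ _ _ _ _).trans ?_
    have e1 := hz ((0 : P), (1 : ℝ))
    have e2 := hz ζ
    have key : ∀ a b a' b' : P × ℝ, a = a' → b = b' →
        cylinderForm P a b = cylinderForm P a' b' := by
      rintro a b _ _ rfl rfl; rfl
    refine (key _ _ _ _ e1 e2).trans ?_
    refine (cylinderForm_apply (P := P) _ _).trans ?_
    have h0 : (mfderiv 𝓘(ℝ, P) 𝓘(ℝ, P) φ z.1 (0 : P) : P) = 0 :=
      map_zero (mfderiv 𝓘(ℝ, P) 𝓘(ℝ, P) φ z.1)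
    have h1 : inner ℝ (mfderiv 𝓘(ℝ, P) 𝓘(ℝ, P) φ z.1 (0 : P) : P)
        (mfderiv 𝓘(ℝ, P) 𝓘(ℝ, P) φ z.1 ζ.1 : P) = 0 := by
      rw [show (mfderiv 𝓘(ℝ, P) 𝓘(ℝ, P) φ z.1 (0 : P) : P) = 0 from h0, inner_zero_left]
    show inner ℝ (mfderiv 𝓘(ℝ, P) 𝓘(ℝ, P) φ z.1 (0 : P) : P)
        (mfderiv 𝓘(ℝ, P) 𝓘(ℝ, P) φ z.1 ζ.1 : P) + ζ.2 * 1 = ζ.2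
    rw [h1]
    ring

end MetricGluing

/-! ### The global family of metrics -/

section MetricGluing

universe u

variable {P : Type*} {E : Type u} [NormedAddCommGroup P] [InnerProductSpace ℝ P]
  [FiniteDimensional ℝ P] [NormedAddCommGroup E] [InnerProductSpace ℝ E] [FiniteDimensional ℝ E]
  {S M : Type*} [TopologicalSpace S] [CompactSpace S] [ChartedSpace P S] [IsManifold 𝓘(ℝ, P) ∞ S]
  [TopologicalSpace M] [T2Space M] [SigmaCompactSpace M] [ChartedSpace E M]
  [IsManifold 𝓘(ℝ, E) ∞ M]

/-- The conditions on the value `B` at `q : M × ℝ` of a family of metrics on `M` that extends the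
family `h`, given for the times in `T`, to the times in `J`, and for which the map
`Y : S × ℝ → M` satisfies the eikonal condition at the times in `[0, 1]`. -/
def extensionConstraint (P : Type*) [NormedAddCommGroup P] [NormedSpace ℝ P] [ChartedSpace P S]
    (T J : Set ℝ)
    (h : ℝ → ∀ x : M, TangentSpace 𝓘(ℝ, E) x →L[ℝ] TangentSpace 𝓘(ℝ, E) x →L[ℝ] ℝ)
    (Y : S × ℝ → M) (q : M × ℝ) :
    Set (TangentSpace 𝓘(ℝ, E) q.1 →L[ℝ] TangentSpace 𝓘(ℝ, E) q.1 →L[ℝ] ℝ) :=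
  {B | (∀ v w, B v w = B w v) ∧ (q.2 ∈ J → ∀ v, v ≠ 0 → 0 < B v v) ∧
    (q.2 ∈ T → B = h q.2 q.1) ∧
    (q.2 ∈ Icc (0 : ℝ) 1 → ∀ p : S, Y (p, q.2) = q.1 → ∀ z : P × ℝ,
      B (mfderiv (𝓘(ℝ, P).prod 𝓘(ℝ, ℝ)) 𝓘(ℝ, E) Y (p, q.2) ((0 : P), (1 : ℝ)) : E)
        (mfderiv (𝓘(ℝ, P).prod 𝓘(ℝ, ℝ)) 𝓘(ℝ, E) Y (p, q.2) z : E) = z.2)}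

omit [FiniteDimensional ℝ E] [T2Space M] [SigmaCompactSpace M] [IsManifold 𝓘(ℝ, E) ∞ M]
  [CompactSpace S] [FiniteDimensional ℝ P] [IsManifold 𝓘(ℝ, P) ∞ S] in
lemma convex_extensionConstraint (T J : Set ℝ)
    (h : ℝ → ∀ x : M, TangentSpace 𝓘(ℝ, E) x →L[ℝ] TangentSpace 𝓘(ℝ, E) x →L[ℝ] ℝ)
    (Y : S × ℝ → M) (q : M × ℝ) : Convex ℝ (extensionConstraint P T J h Y q) := by
  rintro B ⟨h1, h2, h3, h4⟩ B' ⟨h1', h2', h3', h4'⟩ α β hα hβ hαβ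
  refine ⟨fun v w => ?_, fun hq v hv => ?_, fun hq => ?_, fun hq p hp z => ?_⟩
  · simp only [_root_.add_apply, _root_.smul_apply, h1 v w, h1' v w]
  · simp only [_root_.add_apply, _root_.smul_apply, smul_eq_mul]
    have e1 := h2 hq v hv
    have e2 := h2' hq v hv
    rcases hα.eq_or_lt with rfl | hα'
    · have : β = 1 := by linarith
      subst this
      linarith
    · linarith [mul_pos hα' e1, mul_nonneg hβ e2.le]
  · rw [h3 hq, h3' hq, ← add_smul, hαβ, one_smul]
  · have e : α * z.2 + β * z.2 = z.2 := by rw [← add_mul, hαβ, one_mul]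
    refine Eq.trans ?_ e
    exact congrArg₂ (fun a b : ℝ => α * a + β * b) (h4 hq p hp z) (h4' hq p hp z)

/-- A smooth family of metrics given for the times in `[-δ, 0] ∪ [1, 1 + δ]` extends to the times
in `[-δ, 1 + δ]` in such a way that an embedding `Y` of `S × [0, 1]`, which satisfies the eikonal
condition near the ends of `[0, 1]`, satisfies it on all of `[0, 1]`. -/
lemma exists_metricFamily_of_eikonalAt {δ κ : ℝ} (hδ : 0 < δ) (hκ : 0 < κ)
    {h : ℝ → ∀ x : M, TangentSpace 𝓘(ℝ, E) x →L[ℝ] TangentSpace 𝓘(ℝ, E) x →L[ℝ] ℝ}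
    (hsm : ContMDiff (𝓘(ℝ, E).prod 𝓘(ℝ, ℝ)) (𝓘(ℝ, E).prod 𝓘(ℝ, E →L[ℝ] E →L[ℝ] ℝ)) ∞
      (formSection h))
    (hsymm : ∀ (t : ℝ) (x : M) (v w : TangentSpace 𝓘(ℝ, E) x), h t x v w = h t x w v)
    (hpos : ∀ t ∈ Icc (-δ) 0 ∪ Icc 1 (1 + δ), ∀ (x : M) (v : TangentSpace 𝓘(ℝ, E) x), v ≠ 0 →
      0 < h t x v v)
    {Y : S × ℝ → M}
    (hY : ∀ z : S × ℝ, z.2 ∈ Ioo (0 : ℝ) 1 →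
      ContMDiffAt (𝓘(ℝ, P).prod 𝓘(ℝ, ℝ)) 𝓘(ℝ, E) ∞ Y z ∧
      Function.Bijective (mfderiv (𝓘(ℝ, P).prod 𝓘(ℝ, ℝ)) 𝓘(ℝ, E) Y z))
    (hYc : ContinuousOn Y (univ ×ˢ Icc 0 1)) (hYi : InjOn Y (univ ×ˢ Icc 0 1))
    (hYe : ∀ z : S × ℝ, z.2 ∈ Icc (0 : ℝ) 1 → z.2 < κ ∨ 1 - κ < z.2 → EikonalAt (P := P) h Y z) :
    ∃ k : ℝ → ∀ x : M, TangentSpace 𝓘(ℝ, E) x →L[ℝ] TangentSpace 𝓘(ℝ, E) x →L[ℝ] ℝ,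
      ContMDiff (𝓘(ℝ, E).prod 𝓘(ℝ, ℝ)) (𝓘(ℝ, E).prod 𝓘(ℝ, E →L[ℝ] E →L[ℝ] ℝ)) ∞
        (formSection k) ∧
      (∀ (t : ℝ) (x : M) (v w : TangentSpace 𝓘(ℝ, E) x), k t x v w = k t x w v) ∧
      (∀ t ∈ Icc (-δ) (1 + δ), ∀ (x : M) (v : TangentSpace 𝓘(ℝ, E) x), v ≠ 0 → 0 < k t x v v) ∧
      (∀ t ∈ Icc (-δ) 0 ∪ Icc 1 (1 + δ), k t = h t) ∧
      ∀ z : S × ℝ, z.2 ∈ Icc (0 : ℝ) 1 → EikonalAt (P := P) k Y z := by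
  set T := Icc (-δ) 0 ∪ Icc 1 (1 + δ) with hT
  set J := Icc (-δ) (1 + δ) with hJ
  obtain ⟨k, hk, hkC⟩ := exists_formFamily_of_local (extensionConstraint P T J h Y)
    (convex_extensionConstraint T J h Y) (by
    rintro ⟨x₀, t₀⟩
    have hsnd : Tendsto (Prod.snd : M × ℝ → ℝ) (𝓝 (x₀, t₀)) (𝓝 t₀) := continuous_snd.tendsto _
    by_cases hJ₀ : t₀ ∈ J
    swap
    -- Outside of `J`, only the symmetry is required.
    · refine ⟨pullbackForm (0 : ℝ →L[ℝ] ℝ →L[ℝ] ℝ) fun _ => 0, ?_⟩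
      filter_upwards [hsnd.eventually (isClosed_Icc.isOpen_compl.mem_nhds hJ₀)] with q hq
      refine ⟨contMDiffAt_pullbackForm _ (Eventually.of_forall fun _ => contMDiffAt_const) _,
        fun v w => rfl, fun h => (hq h).elim, fun h => (hq ?_).elim, fun h => (hq ?_).elim⟩
      · rcases h with h | h
        · exact ⟨h.1, by linarith [h.2]⟩
        · exact ⟨by linarith [h.1], h.2⟩
      · exact ⟨by linarith [h.1], by linarith [h.2]⟩
    by_cases hT₀ : t₀ ∈ T
    -- At the times at which it is given, the family itself can be used.
    · refine ⟨h, ?_⟩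
      have hend : ∀ᶠ t in 𝓝 t₀, t < κ ∨ 1 - κ < t := by
        rcases hT₀ with h | h
        · exact (gt_mem_nhds (by linarith [h.2] : t₀ < κ)).mono fun t ht => Or.inl ht
        · exact (lt_mem_nhds (by linarith [h.1] : 1 - κ < t₀)).mono fun t ht => Or.inr ht
      filter_upwards [hsnd.eventually hend, eventually_pos_form (hsm (x₀, t₀))
        (hpos t₀ hT₀ x₀)] with q hq hqpos
      refine ⟨hsm q, hsymm _ _, fun _ => hqpos, fun _ => rfl, ?_⟩
      obtain ⟨x, t⟩ := q
      intro ht p hp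
      dsimp only at hp
      subst hp
      exact hYe (p, t) ht hq
    have ht₀ : t₀ ∈ Ioo (0 : ℝ) 1 := by
      constructor
      · by_contra! h; exact hT₀ (Or.inl ⟨hJ₀.1, h⟩)
      · by_contra! h; exact hT₀ (Or.inr ⟨h, hJ₀.2⟩)
    have hTne : ∀ t ∈ Ioo (0 : ℝ) 1, t ∉ T := by
      rintro t ht (h | h)
      · exact absurd ht.1 (not_lt.2 h.2)
      · exact absurd ht.2 (not_lt.2 h.1)
    have hIoo := hsnd.eventually (isOpen_Ioo.mem_nhds ht₀)
    by_cases hG : ∃ p, Y (p, t₀) = x₀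
    -- On the graph of `Y`, a flat cylinder metric can be used.
    · obtain ⟨p₀, rfl⟩ := hG
      have hYn : ∀ᶠ z in 𝓝 (p₀, t₀), ContMDiffAt (𝓘(ℝ, P).prod 𝓘(ℝ, ℝ)) 𝓘(ℝ, E) ∞ Y z :=
        ((continuous_snd.tendsto (p₀, t₀)).eventually (isOpen_Ioo.mem_nhds ht₀)).mono
          fun z hz => (hY z hz).1
      obtain ⟨k, g, hk1, hk2, hk3, hgY, hgt, hke⟩ :=
        exists_local_eikonal_metric hYn (hY (p₀, t₀) ht₀).2
      have hfst : Tendsto (Prod.fst : M × ℝ → M) (𝓝 (Y (p₀, t₀), t₀)) (𝓝 (Y (p₀, t₀))) :=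
        continuous_fst.tendsto _
      have hgI : ∀ᶠ x in 𝓝 (Y (p₀, t₀)), (g x).2 ∈ Icc (0 : ℝ) 1 :=
        ((continuous_snd.tendsto (p₀, t₀)).comp hgt).eventually (Icc_mem_nhds ht₀.1 ht₀.2)
      refine ⟨k, ?_⟩
      filter_upwards [hIoo, hfst.eventually hk1, hfst.eventually hgY, hfst.eventually hgI,
        hfst.eventually (hgt.eventually hke),
        eventually_pos_form (hk1.self_of_nhds t₀) (hk3 t₀)] with q hqt hqs hqY hqI hqe hqpos
      refine ⟨hqs _, hk2 _ _, fun _ => hqpos, fun h => (hTne _ hqt h).elim, ?_⟩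
      obtain ⟨x, t⟩ := q
      intro ht p hp
      dsimp only at hp
      subst hp
      have e : g (Y (p, t)) = (p, t) := hYi ⟨mem_univ _, hqI⟩ ⟨mem_univ _, ht⟩ hqY
      rw [e] at hqe
      exact hqe
    -- Off the graph of `Y`, any metric can be used.
    · have hGc : IsClosed ((fun z : S × ℝ => (Y z, z.2)) '' (univ ×ˢ Icc (0 : ℝ) 1)) :=
        ((isCompact_univ.prod isCompact_Icc).image_of_continuousOn
          (hYc.prodMk continuousOn_snd)).isClosed
      have hq₀ : (x₀, t₀) ∉ (fun z : S × ℝ => (Y z, z.2)) '' (univ ×ˢ Icc (0 : ℝ) 1) := by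
        rintro ⟨⟨p, t⟩, -, h⟩
        obtain ⟨h1, h2⟩ := Prod.ext_iff.1 h
        dsimp only at h1 h2
        exact hG ⟨p, by rw [← h2, h1]⟩
      have hch : ∀ᶠ x in 𝓝 x₀, ContMDiffAt 𝓘(ℝ, E) 𝓘(ℝ, E) ∞ (extChartAt 𝓘(ℝ, E) x₀) x :=
        Filter.mem_of_superset ((chartAt E x₀).open_source.mem_nhds (mem_chart_source E x₀))
          fun x hx => contMDiffAt_extChartAt' hx
      have hks : ∀ᶠ x in 𝓝 x₀, ∀ t, ContMDiffAt (𝓘(ℝ, E).prod 𝓘(ℝ, ℝ))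
          (𝓘(ℝ, E).prod 𝓘(ℝ, E →L[ℝ] E →L[ℝ] ℝ)) ∞
          (formSection (pullbackForm (innerSL ℝ : E →L[ℝ] E →L[ℝ] ℝ) (extChartAt 𝓘(ℝ, E) x₀)))
          (x, t) :=
        hch.eventually_nhds.mono fun x hx t => contMDiffAt_pullbackForm _ hx t
      have hpos₀ : ∀ v : TangentSpace 𝓘(ℝ, E) x₀, v ≠ 0 →
          0 < pullbackForm (innerSL ℝ : E →L[ℝ] E →L[ℝ] ℝ) (extChartAt 𝓘(ℝ, E) x₀) t₀ x₀ v v := by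
        intro v hv
        have key : ∀ w : E, w ≠ 0 → 0 < innerSL ℝ w w := fun w hw => real_inner_self_pos.2 hw
        refine key (mfderiv 𝓘(ℝ, E) 𝓘(ℝ, E) (extChartAt 𝓘(ℝ, E) x₀) x₀ v) fun h0 => hv ?_
        exact (bijective_mfderiv_extChartAt (mem_chart_source E x₀)).1
          (h0.trans (map_zero (mfderiv 𝓘(ℝ, E) 𝓘(ℝ, E) (extChartAt 𝓘(ℝ, E) x₀) x₀)).symm)
      refine ⟨pullbackForm (innerSL ℝ) (extChartAt 𝓘(ℝ, E) x₀), ?_⟩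
      filter_upwards [hIoo, (continuous_fst.tendsto (x₀, t₀)).eventually hks,
        hGc.isOpen_compl.mem_nhds hq₀,
        eventually_pos_form (hks.self_of_nhds t₀) hpos₀] with q hqt hqs hqG hqpos
      refine ⟨hqs _, fun v w => real_inner_comm _ _, fun _ => hqpos,
        fun h => (hTne _ hqt h).elim, fun ht p hp => (hqG ?_).elim⟩
      exact ⟨(p, q.2), ⟨mem_univ _, ht⟩, Prod.ext hp rfl⟩)
  refine ⟨k, hk, fun t x => (hkC (x, t)).1, fun t ht x => (hkC (x, t)).2.1 ht,
    fun t ht => funext fun x => (hkC (x, t)).2.2.1 ht, ?_⟩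
  rintro ⟨p, t⟩ ht
  exact (hkC (Y (p, t), t)).2.2.2 ht p rfl

end MetricGluing

/-! ### Velocities in charts -/

section Velocity

variable {E : Type*} [NormedAddCommGroup E] [NormedSpace ℝ E]
  {H : Type*} [TopologicalSpace H] {I : ModelWithCorners ℝ E H}
  {X : Type*} [TopologicalSpace X] [ChartedSpace H X]

/-- The velocity is computed in the preferred chart, because the fibres of the tangent bundle are
identified with the model space by that chart. -/
lemma velocity_snd_eq_derivWithin {γ : ℝ → X} {s : Set ℝ} {t : ℝ}
    (h : MDifferentiableWithinAt 𝓘(ℝ, ℝ) I γ s t) :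
    (velocity I γ s t).2 = derivWithin (fun r => extChartAt I (γ t) (γ r)) s t := by
  have h1 : mfderivWithin 𝓘(ℝ, ℝ) I γ s t
      = fderivWithin ℝ (fun r => extChartAt I (γ t) (γ r)) s t := by
    have e1 : ((extChartAt 𝓘(ℝ, ℝ) t).symm ⁻¹' s ∩ range 𝓘(ℝ, ℝ) : Set ℝ) = s := by
      rw [ModelWithCorners.range_eq_univ, inter_univ]
      rfl
    have e2 : mfderivWithin 𝓘(ℝ, ℝ) I γ s t
        = fderivWithin ℝ (fun r => extChartAt I (γ t) (γ r))
          ((extChartAt 𝓘(ℝ, ℝ) t).symm ⁻¹' s ∩ range 𝓘(ℝ, ℝ)) t := by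
      unfold mfderivWithin
      exact if_pos h
    exact e2.trans (congrArg (fun s => fderivWithin ℝ (fun r => extChartAt I (γ t) (γ r)) s t) e1)
  exact congrArg (fun L : ℝ →L[ℝ] E => L 1) h1

end Velocity

/-! ### Null generators are null pregeodesics -/

section Christoffel

variable {n : ℕ} {M : Type*} [TopologicalSpace M] [ChartedSpace (EuclideanSpace ℝ (Fin n)) M]
  [IsManifold (𝓡 n) ∞ M]
  {k : ℝ → ∀ x : M, TangentSpace (𝓡 n) x →L[ℝ] TangentSpace (𝓡 n) x →L[ℝ] ℝ}

local notation "𝔼" => EuclideanSpace ℝ (Fin n)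

omit [IsManifold (𝓡 n) ∞ M] in
lemma extChartAt_prod_real (x₀ x : M) (t₀ t : ℝ) :
    extChartAt ((𝓡 n).prod 𝓘(ℝ, ℝ)) (x₀, t₀) (x, t) = (extChartAt (𝓡 n) x₀ x, t) := by
  rw [extChartAt_prod]
  rfl

/-- The preferred charts of `M × ℝ` are products, so that `k - dt²` keeps its shape in them. -/
lemma chartForm_lorentzForm {x₀ : M} {t₀ : ℝ} {y : 𝔼 × ℝ}
    (hy : y.1 ∈ (extChartAt (𝓡 n) x₀).target) (v w : 𝔼 × ℝ) :
    chartForm ((𝓡 n).prod 𝓘(ℝ, ℝ)) (lorentzForm k) (x₀, t₀) y v w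
      = coordForm k x₀ y v.1 w.1 - v.2 * w.2 := by
  set φ := extChartAt (𝓡 n) x₀ with hφ
  have hsm : ContMDiffAt 𝓘(ℝ, 𝔼) (𝓡 n) ∞ φ.symm y.1 :=
    (contMDiffOn_extChartAt_symm x₀).contMDiffAt
      ((isOpen_extChartAt_target (I := 𝓡 n) x₀).mem_nhds hy)
  have h1 : HasMFDerivAt 𝓘(ℝ, 𝔼 × ℝ) (𝓡 n) (fun y : 𝔼 × ℝ => φ.symm y.1) y
      ((mfderiv 𝓘(ℝ, 𝔼) (𝓡 n) φ.symm y.1).comp (ContinuousLinearMap.fst ℝ 𝔼 ℝ)) :=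
    HasMFDerivAt.comp (I' := 𝓘(ℝ, 𝔼)) y (g := φ.symm) (f := Prod.fst)
      (hsm.mdifferentiableAt (by simp)).hasMFDerivAt hasFDerivAt_fst.hasMFDerivAt
  have h2 : HasMFDerivAt 𝓘(ℝ, 𝔼 × ℝ) 𝓘(ℝ, ℝ) (fun y : 𝔼 × ℝ => y.2) y
      (ContinuousLinearMap.snd ℝ 𝔼 ℝ) := hasFDerivAt_snd.hasMFDerivAt
  have he : ((extChartAt ((𝓡 n).prod 𝓘(ℝ, ℝ)) (x₀, t₀)).symm : 𝔼 × ℝ → M × ℝ)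
      = fun y => (φ.symm y.1, y.2) := by
    rw [extChartAt_prod]
    rfl
  have h3 := (h1.prodMk h2).mfderiv
  have key : ∀ (f : 𝔼 × ℝ → M × ℝ), f = (fun y => (φ.symm y.1, y.2)) →
      lorentzForm k (f y) (mfderiv 𝓘(ℝ, 𝔼 × ℝ) ((𝓡 n).prod 𝓘(ℝ, ℝ)) f y v)
        (mfderiv 𝓘(ℝ, 𝔼 × ℝ) ((𝓡 n).prod 𝓘(ℝ, ℝ)) f y w)
      = coordForm k x₀ y v.1 w.1 - v.2 * w.2 := by
    rintro f rfl
    have key2 : ∀ L L' : 𝔼 × ℝ →L[ℝ] 𝔼 × ℝ, L = L' →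
        lorentzForm k (φ.symm y.1, y.2) (L v) (L w)
          = lorentzForm k (φ.symm y.1, y.2) (L' v) (L' w) := by
      rintro L _ rfl; rfl
    refine (key2 _ _ h3).trans ?_
    rw [coordForm_apply hy]
    rfl
  exact key _ he

/-- In coordinates, the equation of null pregeodesics for `k - dt²`, parametrized by the time,
is the equation of motion with the force `eikonalForce`. -/
lemma isChristoffel_lorentzForm {x₀ : M} {t₀ : ℝ} {y : 𝔼 × ℝ}
    (hy : y.1 ∈ (extChartAt (𝓡 n) x₀).target)
    (hK : DifferentiableAt ℝ (coordForm k x₀) y) {v a : 𝔼}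
    (ha : ∀ w, coordForm k x₀ y a w = eikonalForce (coordForm k x₀) y v w) :
    IsChristoffel ((𝓡 n).prod 𝓘(ℝ, ℝ)) (lorentzForm k) (x₀, t₀) y (v, (1 : ℝ)) (v, (1 : ℝ))
      ((1 / 2 * fderiv ℝ (coordForm k x₀) y (0, 1) v v) • (v, (1 : ℝ)) - (a, (0 : ℝ))) := by
  set K := coordForm k x₀ with hKdef
  intro w
  have hd : ∀ v w u : 𝔼 × ℝ, fderiv ℝ (fun z => chartForm ((𝓡 n).prod 𝓘(ℝ, ℝ)) (lorentzForm k)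
      (x₀, t₀) z v w) y u = fderiv ℝ K y u v.1 w.1 := by
    intro v w u
    have h1 : (fun z => chartForm ((𝓡 n).prod 𝓘(ℝ, ℝ)) (lorentzForm k) (x₀, t₀) z v w)
        =ᶠ[𝓝 y] fun z => K z v.1 w.1 - v.2 * w.2 := by
      filter_upwards [continuous_fst.continuousAt.preimage_mem_nhds
        ((isOpen_extChartAt_target (I := 𝓡 n) x₀).mem_nhds hy)] with z hz
      exact chartForm_lorentzForm hz v w
    have h2 : HasFDerivAt (fun z => K z v.1 w.1 - v.2 * w.2)
        ((ContinuousLinearMap.apply ℝ ℝ w.1).comp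
          ((ContinuousLinearMap.apply ℝ (𝔼 →L[ℝ] ℝ) v.1).comp (fderiv ℝ K y))) y :=
      ((ContinuousLinearMap.apply ℝ ℝ w.1).hasFDerivAt.comp y
        ((ContinuousLinearMap.apply ℝ (𝔼 →L[ℝ] ℝ) v.1).hasFDerivAt.comp y
          hK.hasFDerivAt)).sub_const _
    rw [h1.fderiv_eq, h2.fderiv]
    rfl
  rw [hd, hd, chartForm_lorentzForm hy, ← hKdef]
  have e1 := ha w.1
  rw [eikonalForce_apply] at e1
  have e2 : fderiv ℝ K y w v v = fderiv ℝ K y (w.1, 0) v v + w.2 * fderiv ℝ K y (0, 1) v v := by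
    have : w = (w.1, (0 : ℝ)) + w.2 • ((0 : 𝔼), (1 : ℝ)) := by ext <;> simp
    conv_lhs => rw [this]
    simp only [map_add, map_smul, _root_.add_apply, _root_.smul_apply, smul_eq_mul]
  rw [e2]
  simp only [Prod.smul_mk, Prod.mk_sub_mk, map_sub, map_smul, _root_.sub_apply,
    _root_.smul_apply, smul_eq_mul, e1]
  ring

variable {P : Type*} [NormedAddCommGroup P] [NormedSpace ℝ P] {S : Type*} [TopologicalSpace S]
  [ChartedSpace P S] [IsManifold 𝓘(ℝ, P) ∞ S] {X : S × ℝ → M} {p : S} {γ : ℝ → M}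

omit [IsManifold (𝓡 n) ∞ M] [IsManifold 𝓘(ℝ, P) ∞ S] in
lemma hasMFDerivWithinAt_graph {t : ℝ} (ht : t ∈ Icc (0 : ℝ) 1)
    (hX : ContMDiffAt (𝓘(ℝ, P).prod 𝓘(ℝ, ℝ)) (𝓡 n) ∞ X (p, t))
    (hγ : EqOn γ (fun t => X (p, t)) (Icc 0 1)) :
    HasMFDerivWithinAt 𝓘(ℝ, ℝ) (𝓡 n) γ (Icc 0 1) t
      ((mfderiv (𝓘(ℝ, P).prod 𝓘(ℝ, ℝ)) (𝓡 n) X (p, t)).comp (ContinuousLinearMap.inr ℝ P ℝ)) :=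
  ((HasMFDerivAt.comp t (g := X) (f := fun t => (p, t))
    (hX.mdifferentiableAt (by simp)).hasMFDerivAt
    (hasMFDerivAt_prodMk_right (P := P) p t)).hasMFDerivWithinAt).congr_of_eventuallyEq
      (hγ.eventuallyEq_of_mem self_mem_nhdsWithin) (hγ ht)

omit [IsManifold (𝓡 n) ∞ M] [IsManifold 𝓘(ℝ, P) ∞ S] in
lemma velocity_eq_of_eqOn {t : ℝ} (ht : t ∈ Icc (0 : ℝ) 1)
    (hX : ContMDiffAt (𝓘(ℝ, P).prod 𝓘(ℝ, ℝ)) (𝓡 n) ∞ X (p, t))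
    (hγ : EqOn γ (fun t => X (p, t)) (Icc 0 1)) :
    ((velocity (𝓡 n) γ (Icc 0 1) t).2 : 𝔼)
      = mfderiv (𝓘(ℝ, P).prod 𝓘(ℝ, ℝ)) (𝓡 n) X (p, t) ((0 : P), (1 : ℝ)) := by
  have hu : UniqueMDiffWithinAt 𝓘(ℝ, ℝ) (Icc (0 : ℝ) 1) t :=
    ((uniqueDiffOn_Icc zero_lt_one) t ht).uniqueMDiffWithinAt
  exact congrArg (fun A : ℝ →L[ℝ] 𝔼 => A 1)
    ((hasMFDerivWithinAt_graph ht hX hγ).mfderivWithin hu)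

omit [IsManifold (𝓡 n) ∞ M] [IsManifold 𝓘(ℝ, P) ∞ S] in
lemma velocity_graph_eq {t : ℝ} (ht : t ∈ Icc (0 : ℝ) 1)
    (hX : ContMDiffAt (𝓘(ℝ, P).prod 𝓘(ℝ, ℝ)) (𝓡 n) ∞ X (p, t))
    (hγ : EqOn γ (fun t => X (p, t)) (Icc 0 1)) :
    ((velocity ((𝓡 n).prod 𝓘(ℝ, ℝ)) (fun t => (γ t, t)) (Icc 0 1) t).2 : 𝔼 × ℝ)
      = ((mfderiv (𝓘(ℝ, P).prod 𝓘(ℝ, ℝ)) (𝓡 n) X (p, t) ((0 : P), (1 : ℝ)) : 𝔼), (1 : ℝ)) := by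
  have hu : UniqueMDiffWithinAt 𝓘(ℝ, ℝ) (Icc (0 : ℝ) 1) t :=
    ((uniqueDiffOn_Icc zero_lt_one) t ht).uniqueMDiffWithinAt
  exact congrArg (fun A : ℝ →L[ℝ] 𝔼 × ℝ => A 1)
    (((hasMFDerivWithinAt_graph ht hX hγ).prodMk (hasMFDerivWithinAt_id _ t)).mfderivWithin hu)

/-- The generators of a null germ, as graphs over the time axis, are null pregeodesics. -/
lemma isNullPregeodesicOn_of_isNullGermAt
    (hk : ContMDiff ((𝓡 n).prod 𝓘(ℝ, ℝ)) ((𝓡 n).prod 𝓘(ℝ, 𝔼 →L[ℝ] 𝔼 →L[ℝ] ℝ)) ∞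
      (formSection k))
    (hsymm : ∀ (t : ℝ) (x : M) (v w : TangentSpace (𝓡 n) x), k t x v w = k t x w v)
    (hX : ∀ t ∈ Icc (0 : ℝ) 1, IsNullGermAt P k X (p, t))
    (hγ : EqOn γ (fun t => X (p, t)) (Icc 0 1)) :
    IsNullPregeodesicOn ((𝓡 n).prod 𝓘(ℝ, ℝ)) (lorentzForm k) (fun t => (γ t, t)) (Icc 0 1) := by
  have hXs : ∀ t ∈ Icc (0 : ℝ) 1, ContMDiffAt (𝓘(ℝ, P).prod 𝓘(ℝ, ℝ)) (𝓡 n) ∞ X (p, t) :=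
    fun t ht => (hX t ht).self_of_nhds.1
  have hsm : ContMDiffOn 𝓘(ℝ, ℝ) ((𝓡 n).prod 𝓘(ℝ, ℝ)) ∞ (fun t => (γ t, t)) (Icc 0 1) := by
    refine ContMDiffOn.prodMk (fun t ht => ?_) contMDiffOn_id
    refine ContMDiffWithinAt.congr (f := fun t => X (p, t)) ?_ (fun s hs => hγ hs) (hγ ht)
    exact ((hXs t ht).comp t (contMDiffAt_const.prodMk contMDiffAt_id)).contMDiffWithinAt
  have hu := uniqueDiffOn_Icc (zero_lt_one (α := ℝ))
  -- In the chart at `γ t`, the curve `u` has velocity `(v, 1)` and acceleration `(a, 0)`.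
  have hacc : ∀ t ∈ Icc (0 : ℝ) 1, ∃ f : ℝ, IsCovariantAcceleration ((𝓡 n).prod 𝓘(ℝ, ℝ))
      (lorentzForm k) (fun t => (γ t, t)) (Icc 0 1) t
      (f • (velocity ((𝓡 n).prod 𝓘(ℝ, ℝ)) (fun t => (γ t, t)) (Icc 0 1) t).2) := by
    intro t ht
    have hsrc : X (p, t) ∈ (chartAt 𝔼 (γ t)).source := by
      rw [← show γ t = X (p, t) from hγ ht]; exact mem_chart_source _ _
    obtain ⟨v, a, hva⟩ := (hX t ht).exists_accel_eq hk hsymm hsrc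
    set φ := extChartAt (𝓡 n) (γ t) with hφ
    set u : ℝ → 𝔼 × ℝ := fun r =>
      extChartAt ((𝓡 n).prod 𝓘(ℝ, ℝ)) (γ t, t) (γ r, r) with hudef
    have hu1 : ∀ r ∈ Icc (0 : ℝ) 1, u r = (φ (X (p, r)), r) := fun r hr => by
      rw [hudef]
      dsimp only
      rw [extChartAt_prod_real, show γ r = X (p, r) from hγ hr]
    have hd1 : ∀ᶠ s in 𝓝 t, s ∈ Icc (0 : ℝ) 1 → derivWithin u (Icc 0 1) s = (v s, (1 : ℝ)) := by
      filter_upwards [hva] with s hs hsI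
      have h1 : HasDerivWithinAt (fun r => (φ (X (p, r)), r)) (v s, (1 : ℝ)) (Icc 0 1) s :=
        (hs.1.1.prodMk (hasDerivAt_id s)).hasDerivWithinAt
      exact (h1.congr hu1 (hu1 s hsI)).derivWithin (hu s hsI)
    have hd1t := hd1.self_of_nhds ht
    have hd2 : derivWithin (derivWithin u (Icc 0 1)) (Icc 0 1) t = (a t, (0 : ℝ)) := by
      have h1 : HasDerivWithinAt (fun s => (v s, (1 : ℝ))) (a t, (0 : ℝ)) (Icc 0 1) t :=
        (hva.self_of_nhds.1.2.1.prodMk (hasDerivAt_const t (1 : ℝ))).hasDerivWithinAt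
      refine (h1.congr_of_eventuallyEq ?_ hd1t).derivWithin (hu t ht)
      exact eventually_nhdsWithin_iff.2 hd1
    have hvel : ((velocity ((𝓡 n).prod 𝓘(ℝ, ℝ)) (fun t => (γ t, t)) (Icc 0 1) t).2 : 𝔼 × ℝ)
        = (v t, (1 : ℝ)) :=
      (velocity_snd_eq_derivWithin ((hsm t ht).mdifferentiableWithinAt (by simp))).trans hd1t
    have hut : u t = (φ (X (p, t)), t) := hu1 t ht
    have hK : ContDiffAt ℝ ∞ (coordForm k (γ t)) (u t) := by
      rw [hut]; exact contDiffAt_coordForm hsrc hk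
    have htgt : (u t).1 ∈ φ.target := by
      rw [hut]; exact φ.map_source (by rwa [hφ, extChartAt_source])
    have hΓ := isChristoffel_lorentzForm (t₀ := t) htgt (hK.differentiableAt (by simp))
      (v := v t) (a := a t) (by rw [hut]; exact hva.self_of_nhds.1.2.2)
    obtain ⟨f, hf⟩ : ∃ f, f = 1 / 2 * fderiv ℝ (coordForm k (γ t)) (u t) (0, 1) (v t) (v t) :=
      ⟨_, rfl⟩
    rw [← hf] at hΓ
    refine ⟨f, f • (v t, (1 : ℝ)) - (a t, (0 : ℝ)), ?_, ?_⟩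
    · have key : ∀ z : 𝔼 × ℝ, z = (v t, (1 : ℝ)) → IsChristoffel ((𝓡 n).prod 𝓘(ℝ, ℝ))
          (lorentzForm k) (γ t, t) (u t) z z (f • (v t, (1 : ℝ)) - (a t, (0 : ℝ))) := by
        rintro _ rfl; exact hΓ
      exact key _ hd1t
    · have key : ∀ z z' : 𝔼 × ℝ, z = (v t, (1 : ℝ)) → z' = (a t, (0 : ℝ)) →
          f • z = z' + (f • (v t, (1 : ℝ)) - (a t, (0 : ℝ))) := by
        rintro _ _ rfl rfl; rw [add_sub_cancel]
      exact key _ _ hvel hd2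
  choose! f hf using hacc
  refine ⟨⟨hsm, fun t ht h0 => ?_, f, hf⟩, fun t ht => ?_⟩
  · have h1 := congrArg Prod.snd ((velocity_graph_eq ht (hXs t ht) hγ).symm.trans h0)
    exact one_ne_zero (α := ℝ) h1
  · have he := (hX t ht).self_of_nhds.2.1 ((0 : P), (1 : ℝ))
    have hv := velocity_graph_eq ht (hXs t ht) hγ
    have key : ∀ (x x' : M) (b : 𝔼) (z : 𝔼 × ℝ), x = x' → z = (b, (1 : ℝ)) → k t x' b b = 1 →
        lorentzForm k (x, t) z z = 0 := by
      rintro x _ b _ rfl rfl h1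
      show k t x b b - (1 : ℝ) * 1 = 0
      linarith
    exact key _ _ _ _ (hγ ht) hv he

end Christoffel

/-! ### Reversal of time -/

section Reversal

universe u

variable {P : Type*} {E : Type u} [NormedAddCommGroup P] [NormedSpace ℝ P]
  [NormedAddCommGroup E] [NormedSpace ℝ E]
  {S M : Type*} [TopologicalSpace S] [ChartedSpace P S] [IsManifold 𝓘(ℝ, P) ∞ S]
  [TopologicalSpace M] [ChartedSpace E M] [IsManifold 𝓘(ℝ, E) ∞ M]
  {k : ℝ → ∀ x : M, TangentSpace 𝓘(ℝ, E) x →L[ℝ] TangentSpace 𝓘(ℝ, E) x →L[ℝ] ℝ}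

/-- The reversal of time, as a map of the cylinder. -/
def timeReversal (z : S × ℝ) : S × ℝ := (z.1, 1 - z.2)

omit [IsManifold 𝓘(ℝ, P) ∞ S] in
lemma contMDiff_timeReversal : ContMDiff (𝓘(ℝ, P).prod 𝓘(ℝ, ℝ)) (𝓘(ℝ, P).prod 𝓘(ℝ, ℝ)) ∞
    (timeReversal : S × ℝ → S × ℝ) :=
  contMDiff_fst.prodMk (contMDiff_const.sub contMDiff_snd)

omit [IsManifold 𝓘(ℝ, P) ∞ S] in
lemma hasMFDerivAt_timeReversal (z : S × ℝ) :
    HasMFDerivAt (𝓘(ℝ, P).prod 𝓘(ℝ, ℝ)) (𝓘(ℝ, P).prod 𝓘(ℝ, ℝ)) timeReversal z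
      ((ContinuousLinearMap.fst ℝ P ℝ).prod (-ContinuousLinearMap.snd ℝ P ℝ)) := by
  have h1 : HasMFDerivAt (𝓘(ℝ, P).prod 𝓘(ℝ, ℝ)) 𝓘(ℝ, P) (Prod.fst : S × ℝ → S) z
      (ContinuousLinearMap.fst ℝ P ℝ) := hasMFDerivAt_fst _
  have h2 : HasMFDerivAt (𝓘(ℝ, P).prod 𝓘(ℝ, ℝ)) 𝓘(ℝ, ℝ) (fun z : S × ℝ => 1 - z.2) z
      (-ContinuousLinearMap.snd ℝ P ℝ) := by
    have h3 : HasMFDerivAt 𝓘(ℝ, ℝ) 𝓘(ℝ, ℝ) (fun t : ℝ => 1 - t) z.2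
        (-ContinuousLinearMap.id ℝ ℝ) := ((hasFDerivAt_id z.2).const_sub 1).hasMFDerivAt
    have h4 := h3.comp z (hasMFDerivAt_snd (I := 𝓘(ℝ, P)) (I' := 𝓘(ℝ, ℝ)) z)
    exact h4
  exact h1.prodMk h2

omit [IsManifold 𝓘(ℝ, E) ∞ M] [IsManifold 𝓘(ℝ, P) ∞ S] in
lemma mfderiv_comp_timeReversal {X : S × ℝ → M} {z : S × ℝ}
    (hX : MDifferentiableAt (𝓘(ℝ, P).prod 𝓘(ℝ, ℝ)) 𝓘(ℝ, E) X (timeReversal z)) (w : P × ℝ) :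
    (mfderiv (𝓘(ℝ, P).prod 𝓘(ℝ, ℝ)) 𝓘(ℝ, E) (fun z => X (timeReversal z)) z w : E)
      = mfderiv (𝓘(ℝ, P).prod 𝓘(ℝ, ℝ)) 𝓘(ℝ, E) X (timeReversal z) ((w.1, -w.2) : P × ℝ) :=
  congrArg (fun A : P × ℝ →L[ℝ] E => A w)
    (HasMFDerivAt.comp z (g := X) hX.hasMFDerivAt (hasMFDerivAt_timeReversal z)).mfderiv

omit [IsManifold 𝓘(ℝ, P) ∞ S] [IsManifold 𝓘(ℝ, E) ∞ M] in
/-- The reversal of a null germ is a null germ for the reversed family of metrics. -/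
lemma IsNullGermAt.comp_timeReversal {X : S × ℝ → M} {z : S × ℝ}
    (hX : IsNullGermAt P (fun t => k (1 - t)) X (timeReversal z)) :
    IsNullGermAt P k (fun z => X (timeReversal z)) z := by
  have ht : Tendsto (timeReversal : S × ℝ → S × ℝ) (𝓝 z) (𝓝 (timeReversal z)) :=
    (contMDiff_timeReversal (P := P)).continuous.tendsto z
  filter_upwards [ht.eventually hX] with z ⟨h1, h2, h3⟩
  have hd := mfderiv_comp_timeReversal (h1.mdifferentiableAt (by simp))
  refine ⟨h1.comp z (contMDiff_timeReversal z), fun w => ?_, ?_⟩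
  · obtain ⟨D, hD⟩ : ∃ D : P × ℝ →L[ℝ] E,
        D = mfderiv (𝓘(ℝ, P).prod 𝓘(ℝ, ℝ)) 𝓘(ℝ, E) X (timeReversal z) := ⟨_, rfl⟩
    let B : E →L[ℝ] E →L[ℝ] ℝ := k z.2 (X (timeReversal z))
    have h2' : ∀ w : P × ℝ, B (D (0, 1)) (D w) = w.2 := by
      intro w
      have h4 : k (1 - (1 - z.2)) = k z.2 := by rw [sub_sub_cancel]
      rw [hD]
      exact (congrArg (fun K : ∀ x : M, TangentSpace 𝓘(ℝ, E) x →L[ℝ]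
        TangentSpace 𝓘(ℝ, E) x →L[ℝ] ℝ => K (X (timeReversal z))
          (mfderiv (𝓘(ℝ, P).prod 𝓘(ℝ, ℝ)) 𝓘(ℝ, E) X (timeReversal z) ((0 : P), (1 : ℝ)))
          (mfderiv (𝓘(ℝ, P).prod 𝓘(ℝ, ℝ)) 𝓘(ℝ, E) X (timeReversal z) w)) h4).symm.trans (h2 w)
    have key : ∀ a b : E, a = D (0, -1) → b = D (w.1, -w.2) → B a b = w.2 := by
      rintro _ _ rfl rfl
      have e : ((0 : P), (-1 : ℝ)) = -((0 : P), (1 : ℝ)) := by simp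
      rw [e, map_neg, map_neg, _root_.neg_apply, h2', neg_neg]
    refine key _ _ ?_ ?_
    · rw [hD]; exact hd ((0 : P), (1 : ℝ))
    · rw [hD]; exact hd w
  · have ha : Function.Bijective fun w : P × ℝ => (w.1, -w.2) :=
      Function.Involutive.bijective fun w => by simp
    have := h3.comp ha
    exact (funext hd : (mfderiv (𝓘(ℝ, P).prod 𝓘(ℝ, ℝ)) 𝓘(ℝ, E) (fun z => X (timeReversal z)) z :
      P × ℝ → E) = _) ▸ this

omit [IsManifold 𝓘(ℝ, P) ∞ S] in
lemma contMDiff_formSection_reverse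
    (hk : ContMDiff (𝓘(ℝ, E).prod 𝓘(ℝ, ℝ)) (𝓘(ℝ, E).prod 𝓘(ℝ, E →L[ℝ] E →L[ℝ] ℝ)) ∞
      (formSection k)) :
    ContMDiff (𝓘(ℝ, E).prod 𝓘(ℝ, ℝ)) (𝓘(ℝ, E).prod 𝓘(ℝ, E →L[ℝ] E →L[ℝ] ℝ)) ∞
      (formSection fun t => k (1 - t)) :=
  hk.comp (contMDiff_timeReversal (P := E) (S := M))

end Reversal

/-! ### The diffeomorphism of cylinders and its trace -/

section Trace

variable {d : ℕ} {M : Type*} [TopologicalSpace M] [ChartedSpace (EuclideanSpace ℝ (Fin (d + 1))) M]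
  [IsManifold (𝓡 (d + 1)) ∞ M] [T2Space M]
  {S : Type*} [TopologicalSpace S] [CompactSpace S] [ChartedSpace (EuclideanSpace ℝ (Fin d)) S]
  [IsManifold (𝓡 d) ∞ S] {ε : ℝ} [hε : Fact (-ε < ε)] {c : S × Icc (-ε) ε → M}

omit [T2Space M] [CompactSpace S] [IsManifold (𝓡 (d + 1)) ∞ M] in
/-- Inside the cylinder, the trace of a diffeomorphism is a local diffeomorphism. -/
lemma contMDiffAt_trace_and_bijective (hc : IsSmoothEmbedding ((𝓡 d).prod (𝓡∂ 1)) (𝓡 (d + 1)) ∞ c)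
    (Φ : (S × Icc (0 : ℝ) 1) ≃ₘ^∞⟮(𝓡 d).prod (𝓡∂ 1), (𝓡 d).prod (𝓡∂ 1)⟯ (S × Icc (-ε) ε))
    {z : S × ℝ} (hz : z.2 ∈ Ioo (0 : ℝ) 1) :
    ContMDiffAt ((𝓡 d).prod 𝓘(ℝ, ℝ)) (𝓡 (d + 1)) ∞ (fun z : S × ℝ => trace c Φ z.1 z.2) z ∧
    Function.Bijective (mfderiv ((𝓡 d).prod 𝓘(ℝ, ℝ)) (𝓡 (d + 1))
      (fun z : S × ℝ => trace c Φ z.1 z.2) z) := by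
  set pr : ℝ → Icc (0 : ℝ) 1 := projIcc 0 1 zero_le_one with hpr
  have hprs : ContMDiffAt 𝓘(ℝ, ℝ) (𝓡∂ 1) ∞ pr z.2 :=
    (contMDiffOn_projIcc (x := (0 : ℝ)) (y := 1)).contMDiffAt (Icc_mem_nhds hz.1 hz.2)
  have hG : ContMDiffAt ((𝓡 d).prod 𝓘(ℝ, ℝ)) ((𝓡 d).prod (𝓡∂ 1)) ∞
      (fun z : S × ℝ => (z.1, pr z.2)) z :=
    contMDiffAt_fst.prodMk (hprs.comp z contMDiffAt_snd)
  have hcΦ : ContMDiff ((𝓡 d).prod (𝓡∂ 1)) (𝓡 (d + 1)) ∞ (fun q => c (Φ q)) :=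
    hc.contMDiff.comp Φ.contMDiff
  refine ⟨(hcΦ _).comp z hG, ?_⟩
  obtain ⟨L, hL⟩ : ∃ L : ℝ →L[ℝ] EuclideanSpace ℝ (Fin 1),
      HasMFDerivAt 𝓘(ℝ, ℝ) (𝓡∂ 1) pr z.2 L := ⟨_, (hprs.mdifferentiableAt (by simp)).hasMFDerivAt⟩
  obtain ⟨D, hD⟩ : ∃ D : EuclideanSpace ℝ (Fin 1) →L[ℝ] ℝ,
      HasMFDerivAt (𝓡∂ 1) 𝓘(ℝ, ℝ) (Subtype.val : Icc (0 : ℝ) 1 → ℝ) (pr z.2) D :=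
    ⟨_, ((contMDiff_subtypeVal_Icc (n := ∞) _).mdifferentiableAt (by simp)).hasMFDerivAt⟩
  have hDL : ∀ t, D (L t) = t := by
    have h1 : HasFDerivAt (fun t : ℝ => t) (D.comp L) z.2 := by
      refine ((hD.comp z.2 hL).congr_of_eventuallyEq (f₁ := fun t : ℝ => t) ?_).hasFDerivAt
      filter_upwards [Icc_mem_nhds hz.1 hz.2] with t ht
      simp only [Function.comp_apply, hpr, projIcc_of_mem _ ht]
    have h2 := h1.unique (hasFDerivAt_id z.2)
    exact fun t => congrArg (fun A : ℝ →L[ℝ] ℝ => A t) h2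
  obtain ⟨A, hA⟩ : ∃ A : EuclideanSpace ℝ (Fin d) × EuclideanSpace ℝ (Fin 1) →L[ℝ]
      EuclideanSpace ℝ (Fin d) × EuclideanSpace ℝ (Fin 1),
      A = mfderiv ((𝓡 d).prod (𝓡∂ 1)) ((𝓡 d).prod (𝓡∂ 1)) Φ (z.1, pr z.2) := ⟨_, rfl⟩
  obtain ⟨B, hB⟩ : ∃ B : EuclideanSpace ℝ (Fin d) × EuclideanSpace ℝ (Fin 1) →L[ℝ]
      EuclideanSpace ℝ (Fin (d + 1)),
      B = mfderiv ((𝓡 d).prod (𝓡∂ 1)) (𝓡 (d + 1)) c (Φ (z.1, pr z.2)) := ⟨_, rfl⟩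
  have hAi : Function.Injective A := by
    rw [hA]
    exact (Φ.mfderivToContinuousLinearEquiv (by simp) (z.1, pr z.2)).injective
  have hBi : Function.Injective B := by
    rw [hB]
    exact (bijective_mfderiv_cylinder hc _).1
  have hGd : HasMFDerivAt ((𝓡 d).prod 𝓘(ℝ, ℝ)) ((𝓡 d).prod (𝓡∂ 1))
      (fun z : S × ℝ => (z.1, pr z.2)) z
      ((ContinuousLinearMap.id ℝ (EuclideanSpace ℝ (Fin d))).prodMap L) :=
    (hasMFDerivAt_fst z).prodMk (hL.comp z (hasMFDerivAt_snd z))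
  have hd : HasMFDerivAt ((𝓡 d).prod 𝓘(ℝ, ℝ)) (𝓡 (d + 1))
      (fun z : S × ℝ => trace c Φ z.1 z.2) z
      (B.comp (A.comp ((ContinuousLinearMap.id ℝ (EuclideanSpace ℝ (Fin d))).prodMap L))) := by
    have h1 : HasMFDerivAt ((𝓡 d).prod (𝓡∂ 1)) ((𝓡 d).prod (𝓡∂ 1)) Φ (z.1, pr z.2) A := by
      rw [hA]; exact ((Φ.contMDiff _).mdifferentiableAt (by simp)).hasMFDerivAt
    have h2 : HasMFDerivAt ((𝓡 d).prod (𝓡∂ 1)) (𝓡 (d + 1)) c (Φ (z.1, pr z.2)) B := by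
      rw [hB]; exact ((hc.contMDiff _).mdifferentiableAt (by simp)).hasMFDerivAt
    exact HasMFDerivAt.comp z (g := c) (f := fun z : S × ℝ => Φ (z.1, pr z.2)) h2
      (HasMFDerivAt.comp z (g := Φ) (f := fun z : S × ℝ => (z.1, pr z.2)) h1 hGd)
  have key : ∀ A : EuclideanSpace ℝ (Fin d) × ℝ →L[ℝ] EuclideanSpace ℝ (Fin (d + 1)),
      Function.Injective A → Function.Bijective A := fun A hA =>
    ⟨hA, (LinearMap.injective_iff_surjective_of_finrank_eq_finrank (f := A.toLinearMap)
      (by simp)).1 hA⟩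
  have hL' : Function.Injective
      ((ContinuousLinearMap.id ℝ (EuclideanSpace ℝ (Fin d))).prodMap L) := by
    rintro ⟨a, t⟩ ⟨b, s⟩ h
    obtain ⟨h1, h2⟩ := Prod.ext_iff.1 h
    have h2 : L t = L s := h2
    exact Prod.ext h1 (by rw [← hDL t, ← hDL s, h2])
  have hbij := key (B.comp (A.comp ((ContinuousLinearMap.id ℝ (EuclideanSpace ℝ (Fin d))).prodMap
    L)))
    (hBi.comp (hAi.comp hL'))
  exact (congrArg (fun A : EuclideanSpace ℝ (Fin d) × ℝ →L[ℝ] EuclideanSpace ℝ (Fin (d + 1)) =>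
    Function.Bijective A) hd.mfderiv).mpr hbij

omit [CompactSpace S] [IsManifold (𝓡 (d + 1)) ∞ M] [T2Space M] [IsManifold (𝓡 d) ∞ S] in
lemma injOn_trace (hc : IsSmoothEmbedding ((𝓡 d).prod (𝓡∂ 1)) (𝓡 (d + 1)) ∞ c)
    (Φ : (S × Icc (0 : ℝ) 1) ≃ₘ^∞⟮(𝓡 d).prod (𝓡∂ 1), (𝓡 d).prod (𝓡∂ 1)⟯ (S × Icc (-ε) ε)) :
    InjOn (fun z : S × ℝ => trace c Φ z.1 z.2) (univ ×ˢ Icc 0 1) := by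
  rintro ⟨p, t⟩ ⟨-, ht⟩ ⟨p', t'⟩ ⟨-, ht'⟩ h
  obtain ⟨h1, h2⟩ := Prod.ext_iff.1 (Φ.injective (hc.isEmbedding.injective h))
  have h2 : projIcc (0 : ℝ) 1 zero_le_one t = projIcc 0 1 zero_le_one t' := h2
  rw [projIcc_of_mem _ ht, projIcc_of_mem _ ht'] at h2
  exact Prod.ext h1 (congrArg Subtype.val h2)

/-- There is a diffeomorphism `Φ` of cylinders, with a smooth extension `Y` of its trace beyond the
times in `[0, 1]`, that follows the null hypersurfaces emanating from the two ends near the times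
`0` and `1`. -/
lemma exists_diffeo_isNullGermAt (hc : IsSmoothEmbedding ((𝓡 d).prod (𝓡∂ 1)) (𝓡 (d + 1)) ∞ c)
    {k : ℝ → ∀ x : M, TangentSpace (𝓡 (d + 1)) x →L[ℝ] TangentSpace (𝓡 (d + 1)) x →L[ℝ] ℝ}
    (hk : ContMDiff ((𝓡 (d + 1)).prod 𝓘(ℝ, ℝ)) ((𝓡 (d + 1)).prod
      𝓘(ℝ, EuclideanSpace ℝ (Fin (d + 1)) →L[ℝ] EuclideanSpace ℝ (Fin (d + 1)) →L[ℝ] ℝ)) ∞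
      (formSection k))
    (hsymm : ∀ (t : ℝ) (x : M) (v w : TangentSpace (𝓡 (d + 1)) x), k t x v w = k t x w v)
    (hpos₀ : ∀ (x : M) (v : TangentSpace (𝓡 (d + 1)) x), v ≠ 0 → 0 < k 0 x v v)
    (hpos₁ : ∀ (x : M) (v : TangentSpace (𝓡 (d + 1)) x), v ≠ 0 → 0 < k 1 x v v)
    {sm sp : Icc (-ε) ε} (hsm : (sm : ℝ) = -ε) (hsp : (sp : ℝ) = ε)
    {V₀ : ∀ p : S, TangentSpace (𝓡 (d + 1)) (c (p, sm))}
    (hV₀ : ∀ p : S, IsPositiveUnitNormal (k 0) c p sm (V₀ p))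
    {V₁ : ∀ p : S, TangentSpace (𝓡 (d + 1)) (c (p, sp))}
    (hV₁ : ∀ p : S, IsPositiveUnitNormal (k 1) c p sp (V₁ p)) :
    ∃ (Φ : (S × Icc (0 : ℝ) 1) ≃ₘ^∞⟮(𝓡 d).prod (𝓡∂ 1), (𝓡 d).prod (𝓡∂ 1)⟯ (S × Icc (-ε) ε))
      (κ : ℝ) (Y : S × ℝ → M), 0 < κ ∧
      (∀ p : S, Φ (p, 0) = (p, sm) ∧ Φ (p, 1) = (p, sp)) ∧
      (∀ z : S × ℝ, z.2 ∈ Icc (0 : ℝ) 1 → Y z = trace c Φ z.1 z.2) ∧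
      (∀ z : S × ℝ, |z.2| < κ ∨ |1 - z.2| < κ → IsNullGermAt (EuclideanSpace ℝ (Fin d)) k Y z) ∧
      ∀ p : S, (mfderiv ((𝓡 d).prod 𝓘(ℝ, ℝ)) (𝓡 (d + 1)) Y (p, 0)
          ((0 : EuclideanSpace ℝ (Fin d)), (1 : ℝ)) : EuclideanSpace ℝ (Fin (d + 1))) = V₀ p ∧
        (mfderiv ((𝓡 d).prod 𝓘(ℝ, ℝ)) (𝓡 (d + 1)) Y (p, 1)
          ((0 : EuclideanSpace ℝ (Fin d)), (1 : ℝ)) : EuclideanSpace ℝ (Fin (d + 1))) = V₁ p := by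
  have hε' := eps_pos_of_fact hε
  have hsm' : sm = collarParam ε 1 0 := Subtype.ext (by
    rw [hsm, coe_collarParam (Or.inl rfl) ⟨le_rfl, by linarith⟩]; ring)
  have hsp' : sp = collarParam ε (-1) 0 := Subtype.ext (by
    rw [hsp, coe_collarParam (Or.inr rfl) ⟨le_rfl, by linarith⟩]; ring)
  obtain ⟨X₀, η₀, A₀, B₀, ρ₀, hη₀, hX₀, hXV₀, hG₀, hXA₀⟩ :=
    exists_null_end hc (Or.inl rfl) hk hsymm hpos₀ hsm' hV₀
  obtain ⟨X₁, η₁, A₁, B₁, ρ₁, hη₁, hX₁, hXV₁, hG₁, hXA₁⟩ :=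
    exists_null_end (k := fun t => k (1 - t)) hc (Or.inr rfl) (contMDiff_formSection_reverse hk)
      (fun t => hsymm (1 - t)) (by simpa only [sub_zero] using hpos₁) hsp'
      (V := V₁) (by simpa only [sub_zero] using hV₁)
  obtain ⟨Φ, κ, hκ, hκη, hκ1, hΦ⟩ := exists_interpolating_diffeo (ε := ε) (lt_min hη₀ hη₁)
    (hG₀.mono (min_le_left _ _)) (hG₁.mono (min_le_right _ _))
  have hκ₀ : κ < η₀ := hκη.trans_le (min_le_left _ _)
  have hκ₁ : κ < η₁ := hκη.trans_le (min_le_right _ _)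
  -- The trace of `Φ` follows the null hypersurfaces near the ends.
  have ht₀ : ∀ p : S, ∀ t ∈ Icc (0 : ℝ) 1, t ≤ κ → trace c Φ p t = X₀ (p, t) := by
    intro p t ht htκ
    rw [trace, projIcc_of_mem _ ht, (hΦ p ⟨t, ht⟩).1 htκ, hXA₀ p t ⟨ht.1, htκ.trans_lt hκ₀⟩]
    rfl
  have ht₁ : ∀ p : S, ∀ t ∈ Icc (0 : ℝ) 1, 1 - κ ≤ t → trace c Φ p t = X₁ (p, 1 - t) := by
    intro p t ht htκ
    rw [trace, projIcc_of_mem _ ht, (hΦ p ⟨t, ht⟩).2 htκ,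
      hXA₁ p (1 - t) ⟨by linarith [ht.2], by linarith⟩]
    rfl
  -- Beyond the ends, where the trace is constant in time, `Y` follows the null hypersurfaces.
  let Y : S × ℝ → M := fun z => if z.2 < κ then X₀ z else
    if 1 - κ < z.2 then X₁ (timeReversal z) else trace c Φ z.1 z.2
  have hY₀ : ∀ z : S × ℝ, z.2 < κ → Y =ᶠ[𝓝 z] X₀ := fun z hz => by
    filter_upwards [(continuous_snd.tendsto z).eventually (gt_mem_nhds hz)] with z' hz'
    exact if_pos hz'
  have hY₁ : ∀ z : S × ℝ, 1 - κ < z.2 → Y =ᶠ[𝓝 z] fun z => X₁ (timeReversal z) := fun z hz => by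
    filter_upwards [(continuous_snd.tendsto z).eventually (lt_mem_nhds hz)] with z' hz'
    exact (if_neg (not_lt.2 (by linarith))).trans (if_pos hz')
  refine ⟨Φ, κ, Y, hκ, fun p => ⟨?_, ?_⟩, ?_, ?_, fun p => ⟨?_, ?_⟩⟩
  · rw [(hΦ p 0).1 hκ.le, hsm']
    show (A₀ (p, 0), collarParam ε 1 (ρ₀ (A₀ (p, 0), 0))) = _
    rw [hG₀.fst_zero, hG₀.height_zero]
  · rw [(hΦ p 1).2 (by show 1 - κ ≤ 1; linarith), hsp']
    show (A₁ (p, 1 - 1), collarParam ε (-1) (ρ₁ (A₁ (p, 1 - 1), 1 - 1))) = _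
    rw [sub_self, hG₁.fst_zero, hG₁.height_zero]
  · rintro ⟨p, t⟩ ht
    simp only [Y]
    split_ifs with h1 h2
    · exact (ht₀ p t ht h1.le).symm
    · exact (ht₁ p t ht h2.le).symm
    · rfl
  · rintro z (hz | hz)
    · exact (hX₀ z.1 z.2 (hz.trans hκ₀)).congr (hY₀ z (abs_lt.1 hz).2)
    · refine IsNullGermAt.congr ?_ (hY₁ z (by linarith [(abs_lt.1 hz).2]))
      exact (hX₁ z.1 (1 - z.2) (hz.trans hκ₁)).comp_timeReversal
  · have h1 := (hY₀ (p, 0) hκ).mfderiv_eq (I := (𝓡 d).prod 𝓘(ℝ, ℝ)) (I' := 𝓡 (d + 1))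
    refine (congrArg (fun A : EuclideanSpace ℝ (Fin d) × ℝ →L[ℝ] EuclideanSpace ℝ (Fin (d + 1)) =>
      A ((0 : EuclideanSpace ℝ (Fin d)), (1 : ℝ))) h1).trans ?_
    exact (hXV₀ p).trans (one_smul ℝ (V₀ p : EuclideanSpace ℝ (Fin (d + 1))))
  · have h1 := (hY₁ (p, 1) (by show 1 - κ < 1; linarith)).mfderiv_eq
      (I := (𝓡 d).prod 𝓘(ℝ, ℝ)) (I' := 𝓡 (d + 1))
    refine (congrArg (fun A : EuclideanSpace ℝ (Fin d) × ℝ →L[ℝ] EuclideanSpace ℝ (Fin (d + 1)) =>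
      A ((0 : EuclideanSpace ℝ (Fin d)), (1 : ℝ))) h1).trans ?_
    have hr : timeReversal (p, (1 : ℝ)) = (p, (0 : ℝ)) := Prod.ext rfl (sub_self 1)
    have hs : MDifferentiableAt ((𝓡 d).prod 𝓘(ℝ, ℝ)) (𝓡 (d + 1)) X₁ (p, 0) :=
      (hX₁ p 0 (by rwa [abs_zero])).self_of_nhds.1.mdifferentiableAt (by simp)
    refine (mfderiv_comp_timeReversal (by rw [hr]; exact hs) _).trans ?_
    obtain ⟨D, hD⟩ : ∃ D : EuclideanSpace ℝ (Fin d) × ℝ →L[ℝ] EuclideanSpace ℝ (Fin (d + 1)),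
        D = mfderiv ((𝓡 d).prod 𝓘(ℝ, ℝ)) (𝓡 (d + 1)) X₁ (p, 0) := ⟨_, rfl⟩
    have h2 : D (0, 1) = (-1 : ℝ) • (V₁ p : EuclideanSpace ℝ (Fin (d + 1))) := by
      rw [hD]; exact hXV₁ p
    have h3 : (mfderiv ((𝓡 d).prod 𝓘(ℝ, ℝ)) (𝓡 (d + 1)) X₁ (timeReversal (p, 1)) :
        EuclideanSpace ℝ (Fin d) × ℝ →L[ℝ] EuclideanSpace ℝ (Fin (d + 1))) = D := by
      rw [hD, hr]
    refine (congrArg (fun A : EuclideanSpace ℝ (Fin d) × ℝ →L[ℝ] EuclideanSpace ℝ (Fin (d + 1)) =>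
      A ((0 : EuclideanSpace ℝ (Fin d)), (-1 : ℝ))) h3).trans ?_
    have e : ((0 : EuclideanSpace ℝ (Fin d)), (-1 : ℝ)) = -(0, 1) := by simp
    show D ((0 : EuclideanSpace ℝ (Fin d)), (-1 : ℝ)) = V₁ p
    rw [e, map_neg, h2, neg_smul, one_smul]
    exact neg_neg (V₁ p : EuclideanSpace ℝ (Fin (d + 1)))

end Trace

/-! ### The given times -/

section Assembly

/-- The set of times at which the metrics are given satisfies the hypothesis of
`exists_symm_extension`. -/
lemma mem_nhds_or_eventually_mem_iff_of_two_intervals {δ : ℝ} (hδ : 0 < δ) {t₀ : ℝ}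
    (ht₀ : t₀ ∈ Icc (-δ) 0 ∪ Icc 1 (1 + δ)) :
    Icc (-δ) 0 ∪ Icc 1 (1 + δ) ∈ 𝓝 t₀ ∨
      ∃ σ : ℝ, σ * σ = 1 ∧ ∀ᶠ t in 𝓝 t₀, t ∈ Icc (-δ) 0 ∪ Icc 1 (1 + δ) ↔ 0 ≤ σ * (t - t₀) := by
  have hl : ∀ a b : ℝ, a < t₀ → t₀ < b →
      (∀ t ∈ Ioo a b, t ∈ Icc (-δ) 0 ∪ Icc 1 (1 + δ) ↔ t₀ ≤ t) →
      ∃ σ : ℝ, σ * σ = 1 ∧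
        ∀ᶠ t in 𝓝 t₀, t ∈ Icc (-δ) 0 ∪ Icc 1 (1 + δ) ↔ 0 ≤ σ * (t - t₀) := by
    refine fun a b ha hb h => ⟨1, one_mul 1, ?_⟩
    filter_upwards [Ioo_mem_nhds ha hb] with t ht
    rw [h t ht, one_mul, sub_nonneg]
  have hr : ∀ a b : ℝ, a < t₀ → t₀ < b →
      (∀ t ∈ Ioo a b, t ∈ Icc (-δ) 0 ∪ Icc 1 (1 + δ) ↔ t ≤ t₀) →
      ∃ σ : ℝ, σ * σ = 1 ∧
        ∀ᶠ t in 𝓝 t₀, t ∈ Icc (-δ) 0 ∪ Icc 1 (1 + δ) ↔ 0 ≤ σ * (t - t₀) := by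
    refine fun a b ha hb h => ⟨-1, by norm_num, ?_⟩
    filter_upwards [Ioo_mem_nhds ha hb] with t ht
    rw [h t ht, neg_one_mul, neg_sub, sub_nonneg]
  rcases ht₀ with ⟨h1, h2⟩ | ⟨h1, h2⟩
  · rcases h1.eq_or_lt with rfl | h1'
    · refine Or.inr (hl (-δ - 1) 0 (by linarith) (by linarith) fun t ht => ?_)
      exact ⟨fun h => h.elim (fun h => h.1) fun h => by linarith [h.1],
        fun h => Or.inl ⟨h, ht.2.le⟩⟩
    rcases h2.eq_or_lt with rfl | h2'
    · refine Or.inr (hr (-δ) 1 (by linarith) one_pos fun t ht => ?_)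
      exact ⟨fun h => h.elim (fun h => h.2) fun h => by linarith [h.1, ht.2],
        fun h => Or.inl ⟨ht.1.le, h⟩⟩
    · exact Or.inl (mem_of_superset (Icc_mem_nhds h1' h2') subset_union_left)
  · rcases h1.eq_or_lt with rfl | h1'
    · refine Or.inr (hl 0 (1 + δ) one_pos (by linarith) fun t ht => ?_)
      exact ⟨fun h => h.elim (fun h => by linarith [h.2, ht.1]) fun h => h.1,
        fun h => Or.inr ⟨h, ht.2.le⟩⟩
    rcases h2.eq_or_lt with rfl | h2'
    · refine Or.inr (hr 1 (1 + δ + 1) h1' (by linarith) fun t ht => ?_)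
      exact ⟨fun h => h.elim (fun h => by linarith [h.2]) fun h => h.2,
        fun h => Or.inr ⟨ht.1.le, h⟩⟩
    · exact Or.inl (mem_of_superset (Icc_mem_nhds h1' h2') subset_union_right)

end Assembly

end NullScattering

end

theorem mainTheorem7
    {d : ℕ}
    {M : Type*} [TopologicalSpace M] [T2Space M] [SecondCountableTopology M] [ConnectedSpace M]
    [ChartedSpace (EuclideanSpace ℝ (Fin (d + 1))) M] [IsManifold (𝓡 (d + 1)) ∞ M]
    {S : Type*} [TopologicalSpace S] [CompactSpace S]
    [ChartedSpace (EuclideanSpace ℝ (Fin d)) S] [IsManifold (𝓡 d) ∞ S]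
    (ε : ℝ) [Fact (-ε < ε)]
    (c : S × Icc (-ε) ε → M)
    (hc : IsSmoothEmbedding ((𝓡 d).prod (𝓡∂ 1)) (𝓡 (d + 1)) ∞ c)
    (δ : ℝ) (hδ : 0 < δ)
    (h : ℝ → ∀ x : M,
      TangentSpace (𝓡 (d + 1)) x →L[ℝ] TangentSpace (𝓡 (d + 1)) x →L[ℝ] ℝ)
    (hh : NullScattering.IsSmoothMetricFamily (Icc (-δ) 0 ∪ Icc 1 (1 + δ)) h)
    (sm sp : Icc (-ε) ε) (hsm : (sm : ℝ) = -ε) (hsp : (sp : ℝ) = ε)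
    (V₀ : ∀ p : S, TangentSpace (𝓡 (d + 1)) (c (p, sm)))
    (hV₀ : ∀ p : S, NullScattering.IsPositiveUnitNormal (h 0) c p sm (V₀ p))
    (V₁ : ∀ p : S, TangentSpace (𝓡 (d + 1)) (c (p, sp)))
    (hV₁ : ∀ p : S, NullScattering.IsPositiveUnitNormal (h 1) c p sp (V₁ p)) :
    ∃ (Φ : (S × Icc (0 : ℝ) 1) ≃ₘ^∞⟮(𝓡 d).prod (𝓡∂ 1), (𝓡 d).prod (𝓡∂ 1)⟯
        (S × Icc (-ε) ε))
      (k : ℝ → ∀ x : M,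
        TangentSpace (𝓡 (d + 1)) x →L[ℝ] TangentSpace (𝓡 (d + 1)) x →L[ℝ] ℝ),
      NullScattering.IsSmoothMetricFamily (Icc (-δ) (1 + δ)) k ∧
      (∀ t ∈ Icc (-δ) 0 ∪ Icc 1 (1 + δ), k t = h t) ∧
      (∀ p : S, Φ (p, 0) = (p, sm) ∧ Φ (p, 1) = (p, sp)) ∧
      (∀ p : S, NullScattering.IsNullPregeodesicOn ((𝓡 (d + 1)).prod 𝓘(ℝ, ℝ))
        (NullScattering.lorentzForm k)
        (fun t : ℝ => (NullScattering.trace c Φ p t, t)) (Icc 0 1)) ∧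
      (∀ p : S,
        NullScattering.velocity (𝓡 (d + 1)) (NullScattering.trace c Φ p) (Icc 0 1) 0
          = ⟨c (p, sm), V₀ p⟩ ∧
        NullScattering.velocity (𝓡 (d + 1)) (NullScattering.trace c Φ p) (Icc 0 1) 1
          = ⟨c (p, sp), V₁ p⟩) := by
  have hlc : LocallyCompactSpace M :=
    ChartedSpace.locallyCompactSpace (EuclideanSpace ℝ (Fin (d + 1))) M
  have h0T : (0 : ℝ) ∈ Icc (-δ) 0 ∪ Icc 1 (1 + δ) := Or.inl ⟨by linarith, le_rfl⟩
  have h1T : (1 : ℝ) ∈ Icc (-δ) 0 ∪ Icc 1 (1 + δ) := Or.inr ⟨le_rfl, by linarith⟩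
  -- The given metrics are extended to all times, as symmetric forms; only at the given
  -- times they are known to be positive definite.
  obtain ⟨h', hsm', hsymm', hT⟩ := NullScattering.exists_symm_extension
    (isClosed_Icc.union isClosed_Icc)
    (fun t ht => NullScattering.mem_nhds_or_eventually_mem_iff_of_two_intervals hδ ht)
    hh.symm hh.smooth
  have hpos' : ∀ t ∈ Icc (-δ) 0 ∪ Icc 1 (1 + δ), ∀ (x : M) (v : TangentSpace (𝓡 (d + 1)) x),
      v ≠ 0 → 0 < h' t x v v := fun t ht => by rw [hT t ht]; exact hh.pos t ht
  obtain ⟨Φ, κ, Y, hκ, hΦ, hYΦ, hYn, hYV⟩ := NullScattering.exists_diffeo_isNullGermAt hc hsm'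
    hsymm' (hpos' 0 h0T) (hpos' 1 h1T) hsm hsp (by rwa [hT 0 h0T]) (by rwa [hT 1 h1T])
  -- `Y` extends the trace of `Φ`, which is constant in time outside of `[0, 1]`.
  have hYloc : ∀ z : S × ℝ, z.2 ∈ Ioo (0 : ℝ) 1 →
      Y =ᶠ[𝓝 z] fun z => NullScattering.trace c Φ z.1 z.2 := fun z hz => by
    filter_upwards [(continuous_snd.tendsto z).eventually (Icc_mem_nhds hz.1 hz.2)] with z' hz'
    exact hYΦ z' hz'
  have hYsm : ∀ z : S × ℝ, z.2 ∈ Ioo (0 : ℝ) 1 →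
      ContMDiffAt ((𝓡 d).prod 𝓘(ℝ, ℝ)) (𝓡 (d + 1)) ∞ Y z ∧
      Function.Bijective (mfderiv ((𝓡 d).prod 𝓘(ℝ, ℝ)) (𝓡 (d + 1)) Y z) := by
    intro z hz
    obtain ⟨h1, h2⟩ := NullScattering.contMDiffAt_trace_and_bijective hc Φ hz
    refine ⟨h1.congr_of_eventuallyEq (hYloc z hz), ?_⟩
    have h3 := (hYloc z hz).mfderiv_eq (I := (𝓡 d).prod 𝓘(ℝ, ℝ)) (I' := 𝓡 (d + 1))
    exact (congrArg (fun A : EuclideanSpace ℝ (Fin d) × ℝ →L[ℝ] EuclideanSpace ℝ (Fin (d + 1)) =>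
      Function.Bijective A) h3).mpr h2
  have hYc : ContinuousOn Y (univ ×ˢ Icc 0 1) := by
    refine Continuous.continuousOn (f := fun z : S × ℝ => NullScattering.trace c Φ z.1 z.2) ?_
      |>.congr fun z hz => hYΦ z hz.2
    exact hc.contMDiff.continuous.comp (Φ.contMDiff.continuous.comp
      (continuous_fst.prodMk (continuous_projIcc.comp continuous_snd)))
  have hYi : InjOn Y (univ ×ˢ Icc 0 1) :=
    (NullScattering.injOn_trace hc Φ).congr fun z hz => (hYΦ z hz.2).symm
  -- The metrics at the times in `(0, 1)` are chosen such that `Y` satisfies the eikonal condition.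
  obtain ⟨k, hksm, hksymm, hkpos, hkT, hkY⟩ :=
    NullScattering.exists_metricFamily_of_eikonalAt (P := EuclideanSpace ℝ (Fin d))
      hδ hκ hsm' hsymm' hpos' hYsm hYc hYi fun z hz hzκ =>
        (hYn z (hzκ.imp (fun h => by rwa [abs_of_nonneg hz.1])
          fun h => by rw [abs_of_nonneg (by linarith [hz.2])]; linarith)).self_of_nhds.2.1
  -- Beyond the ends of `[0, 1]`, the family of metrics is the given one.
  have hend : ∀ z : S × ℝ, |z.2| < κ ∨ |1 - z.2| < κ →
      (∀ᶠ z' in 𝓝 z, z'.2 ∈ Icc (-δ) (1 + δ)) →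
      NullScattering.IsNullGermAt (EuclideanSpace ℝ (Fin d)) k Y z := by
    intro z hz hzδ
    filter_upwards [hYn z hz, hzδ] with z' hz' hzδ'
    refine ⟨hz'.1, ?_, hz'.2.2⟩
    by_cases hzI : z'.2 ∈ Icc (0 : ℝ) 1
    · exact hkY z' hzI
    · have hzT : z'.2 ∈ Icc (-δ) 0 ∪ Icc 1 (1 + δ) := by
        rcases le_total z'.2 0 with h0 | h0
        · exact Or.inl ⟨hzδ'.1, h0⟩
        · exact Or.inr ⟨(not_le.1 fun h1 => hzI ⟨h0, h1⟩).le, hzδ'.2⟩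
      intro w
      have := hz'.2.1 w
      rw [hkT _ hzT]
      exact this
  have hgerm : ∀ p : S, ∀ t ∈ Icc (0 : ℝ) 1,
      NullScattering.IsNullGermAt (EuclideanSpace ℝ (Fin d)) k Y (p, t) := by
    intro p t ht
    have hnear : ∀ᶠ z' in 𝓝 (p, t), z'.2 ∈ Icc (-δ) (1 + δ) :=
      (continuous_snd.tendsto (p, t)).eventually
        (Icc_mem_nhds (by linarith [ht.1]) (by linarith [ht.2]))
    rcases ht.1.eq_or_lt with rfl | h0
    · exact hend _ (Or.inl (by simpa using hκ)) hnear
    rcases ht.2.eq_or_lt with rfl | h1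
    · exact hend _ (Or.inr (by simpa using hκ)) hnear
    · filter_upwards [(continuous_snd.tendsto (p, t)).eventually (Ioo_mem_nhds h0 h1)] with z hz
      exact ⟨(hYsm z hz).1, hkY z ⟨hz.1.le, hz.2.le⟩, (hYsm z hz).2⟩
  have hYγ : ∀ p, EqOn (NullScattering.trace c Φ p) (fun t => Y (p, t)) (Icc 0 1) :=
    fun p t ht => (hYΦ (p, t) ht).symm
  have hbundle : ∀ (x x' : M) (v v' : EuclideanSpace ℝ (Fin (d + 1))), x = x' → v = v' →
      (⟨x, v⟩ : TangentBundle (𝓡 (d + 1)) M) = ⟨x', v'⟩ := by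
    rintro x _ v _ rfl rfl; rfl
  have h0I : (0 : ℝ) ∈ Icc (0 : ℝ) 1 := ⟨le_rfl, zero_le_one⟩
  have h1I : (1 : ℝ) ∈ Icc (0 : ℝ) 1 := ⟨zero_le_one, le_rfl⟩
  refine ⟨Φ, k, ⟨fun t _ => hksymm t, hkpos, hksm.contMDiffOn⟩,
    fun t ht => (hkT t ht).trans (hT t ht), hΦ, fun p =>
    NullScattering.isNullPregeodesicOn_of_isNullGermAt hksm hksymm (hgerm p) (hYγ p),
    fun p => ⟨hbundle _ _ _ _ ?_ ?_, hbundle _ _ _ _ ?_ ?_⟩⟩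
  · rw [NullScattering.trace, projIcc_left]
    exact congrArg c (hΦ p).1
  · exact (NullScattering.velocity_eq_of_eqOn h0I (hgerm p 0 h0I).self_of_nhds.1 (hYγ p)).trans
      (hYV p).1
  · rw [NullScattering.trace, projIcc_right]
    exact congrArg c (hΦ p).2
  · exact (NullScattering.velocity_eq_of_eqOn h1I (hgerm p 1 h1I).self_of_nhds.1 (hYγ p)).trans
      (hYV p).2
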